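/- **Conventions.** All spaces are paracompact Hausdorff. Let $\mathcal G$ be a topological groupoid with object space $Z$, range $r$ and source $s$, and assume that $\mathcal G$ is *numerably proper*: there is a left-invariant continuous family $(\mu^z)_{z\in Z}$ of Radon probability measures on the fibres $r^{-1}(z)$, supported in a closed subset $S\subseteq\mathcal G$ on which $r$ is proper. A $\mathcal G$-space $Y$ has an anchor map $\varrho\colon Y\to Z$. Let $\mathrm F^*$ be a $\mathcal G$-equivariant multiplicative cohomology theory on pairs $(T,A)$ of a $\mathcal G$-space and a closed invariant subset ($\mathbb Z$-graded, homotopy invariant, with excision, long exact sequences and associative, unital, graded commutative cup products compatible with the boundary maps). For a $\mathcal G$-map $T\to X$, $\mathrm F^*_X(T)$ (cohomology with $X$-compact support) is $\varinjlim_A \mathrm F^*(T,T\setminus A)$, where $A$ runs through the open invariant subsets of $T$ whose closure is proper over $X$. An *$\mathrm F$-oriented* $\mathcal G$-vector bundle $V\to X$ is a real $\mathcal G$-vector bundle with a Thom class $\tau_V\in\mathrm F^{\dim V}_X(V)$: for each base change $f\colon Y\to X$ and each $\mathcal G$-map $Y\to B$, $\xi\mapsto \pi^*\xi\cup f^*\tau_V$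 is an isomorphism $\mathrm F^*_B(Y)\cong\mathrm F^*_B(f^*V)$. Direct sums carry the product of the Thom classes. $V$ is *subtrivial* if it is an oriented direct summand of $E^X:=\varrho^*E$ for some $\mathrm F$-oriented $\mathcal G$-vector bundle $E$ of bounded rank over $Z$. An *$\mathrm F$-oriented normally non-singular map* $X\to Y$ is a triple $(V,E,\hat f)$ with $V$ a subtrivial $\mathrm F$-oriented $\mathcal G$-vector bundle over $X$, $E$ an $\mathrm F$-oriented $\mathcal G$-vector bundle over $Z$, both of bounded rank, and an equivariant open embedding $\hat f\colon V\hookrightarrow E^Y$ of total spaces. Equivalence of such maps is generated by isomorphism, isotopy (a normally non-singular map $X\times[0,1]\to Y\times[0,1]$ with $\hat f$ over $[0,1]$) and lifting $(V,E,\hat f)\mapsto(V\oplus D^X,E\oplus D,\hat f\times\mathrm{id}_D)$ for $\mathrm F$-oriented $D\to Z$. A *correspondence* from $X$ to $Y$ is $(M,b,f,\xi)$ with a $\mathcal G$-space $M$, a $\mathcal G$-map $b\colon M\to X$, an $\mathrm F$-oriented normally non-singular map $f=(V,E,\hat f)$ from $M$ to $Y$, and $\xi\in\mathrm F^*_X(M)$;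 its degree is $\deg\xi+\dim V-\dim E$. Equivalence of correspondences is generated by isomorphism, equivalence of the normally non-singular maps $f$, and * *bordism*: if $b\colon W\to X$, $\xi\in\mathrm F^*_X(W)$ and $f=(V,E,\hat f)$ is a normally non-singular map from $W$ to $Y\times[0,1]$ such that $\hat f^{-1}(E^Y\times\{j\})=V|_{\partial_jW}$ for subsets $\partial_jW\subseteq W$, $j=0,1$, then the restrictions to $\partial_0W$ and $\partial_1W$ are equivalent; * *Thom modification*: $(M,b,f,\xi)$ is equivalent to $(U,b\circ\pi_U,f\circ\pi_U,\pi_U^*\xi\cup\tau_U)$ for every subtrivial $\mathrm F$-oriented $\mathcal G$-vector bundle $\pi_U\colon U\to M$; if $\iota\colon U\oplus U^\perp\cong D^M$ with $D\to Z$ oriented of even rank, then $f\circ\pi_U$ is $(\pi_U^*(U^\perp\oplus V),D\oplus E,(\mathrm{id}_D\times\hat f)\circ(\iota\times\mathrm{id}_V))$. $\hat{\textsc f}^*(X,Y)$ denotes the set of equivalence classes; the sum of correspondences is their disjoint union. **Theorem.** For every $\mathcal G$-space $Y$, any two correspondences from $Z$ to $Y$ have a sum, this sum turns $\hat{\textsc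 f}^*(Z,Y)$ into an Abelian group, and there is a natural isomorphism of graded Abelian groups $$\hat{\textsc f}^*(Z,Y)\;\cong\;\mathrm F^*_Z(Y).$$ Its inverse maps $\eta\in\mathrm F^*_Z(Y)$ to the class of $(Y,\varrho,\mathrm{id}_Y,\eta)$. A class in $\hat{\textsc f}^*(Z,Y)$ has a representative of degree $n$ if and only if its image lies in $\mathrm F^n_Z(Y)$. The isomorphism is natural for proper $\mathcal G$-maps $h\colon Y'\to Y$ (pull-back $h^*\colon\mathrm F^*_Z(Y)\to\mathrm F^*_Z(Y')$ corresponds to replacing a correspondence $(M,b,(0,E,\hat f),\xi)$ by its pull-back with middle space $M\times_YY'$) and for open embeddings $j\colon Y\hookrightarrow Y'$ (the extension map $\mathrm F^*_Z(Y)\to\mathrm F^*_Z(Y')$ corresponds to replacing $\hat f$ by $j\circ\hat f$). -/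

import Mathlib

open Topology MeasureTheory

universe u v

/-! ### Topological groupoids, their spaces and equivariant maps -/

/-- A topological groupoid; object and arrow spaces are paracompact Hausdorff.
`mul g h` is defined when the source of `g` is the range of `h`. -/
structure TopGroupoid where
  Obj : Type u
  Arr : Type u
  [topObj : TopologicalSpace Obj]
  [t2Obj : T2Space Obj]
  [paraObj : ParacompactSpace Obj]
  [topArr : TopologicalSpace Arr]
  [t2Arr : T2Space Arr]
  [paraArr : ParacompactSpace Arr]
  src : Arr → Obj
  rng : Arr → Obj
  one : Obj → Arr
  inv : Arr → Arr
  mul : ∀ g h : Arr, src g = rng h → Arr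
  src_one : ∀ z, src (one z) = z
  rng_one : ∀ z, rng (one z) = z
  src_inv : ∀ g, src (inv g) = rng g
  rng_inv : ∀ g, rng (inv g) = src g
  src_mul : ∀ g h e, src (mul g h e) = src h
  rng_mul : ∀ g h e, rng (mul g h e) = rng g
  one_mul : ∀ g, mul (one (rng g)) g (src_one _) = g
  mul_one : ∀ g, mul g (one (src g)) (rng_one _).symm = g
  mul_assoc : ∀ g h k (e : src g = rng h) (e' : src h = rng k),
    mul (mul g h e) k ((src_mul g h e).trans e') = mul g (mul h k e') (e.trans (rng_mul h k e').symm)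
  inv_mul : ∀ g, mul (inv g) g (src_inv g) = one (src g)
  mul_inv : ∀ g, mul g (inv g) (rng_inv g).symm = one (rng g)
  continuous_src : Continuous src
  continuous_rng : Continuous rng
  continuous_one : Continuous one
  continuous_inv : Continuous inv
  continuous_mul : Continuous fun p : {p : Arr × Arr // src p.1 = rng p.2} => mul p.1.1 p.1.2 p.2

attribute [instance] TopGroupoid.topObj TopGroupoid.t2Obj TopGroupoid.paraObj
  TopGroupoid.topArr TopGroupoid.t2Arr TopGroupoid.paraArr

/-- `G` is numerably proper: there is a left invariant continuous family of Radon probability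
measures `μ z` on the fibres of the range map, with supports in a closed set of arrows on which
the range map is proper. -/
def TopGroupoid.NumerablyProper (G : TopGroupoid.{u}) : Prop :=
  letI : MeasurableSpace G.Arr := borel G.Arr
  ∃ (μ : G.Obj → Measure G.Arr) (S : Set G.Arr),
    (∀ z, IsProbabilityMeasure (μ z)) ∧
    (∀ z, (μ z).Regular) ∧
    IsClosed S ∧
    IsProperMap (fun g : S => G.rng g) ∧
    (∀ z, μ z {g | g ∈ S ∧ G.rng g = z}ᶜ = 0) ∧
    (∀ f : G.Arr → ℝ, Continuous f → Continuous fun z => ∫ g, f g ∂(μ z)) ∧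
    (∀ g : G.Arr, ∀ A : Set G.Arr, MeasurableSet A →
      μ (G.rng g) A = μ (G.src g) {h | ∃ e : G.src g = G.rng h, G.mul g h e ∈ A})

/-- A (paracompact Hausdorff) space with a continuous action of `G`. -/
structure GSpace (G : TopGroupoid.{u}) where
  carrier : Type u
  [top : TopologicalSpace carrier]
  [t2 : T2Space carrier]
  [para : ParacompactSpace carrier]
  anchor : carrier → G.Obj
  continuous_anchor : Continuous anchor
  act : ∀ (g : G.Arr) (x : carrier), G.src g = anchor x → carrier
  anchor_act : ∀ g x h, anchor (act g x h) = G.rng g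
  one_act : ∀ x, act (G.one (anchor x)) x (G.src_one _) = x
  mul_act : ∀ g h x (e : G.src g = G.rng h) (e' : G.src h = anchor x),
    act (G.mul g h e) x ((G.src_mul g h e).trans e') =
      act g (act h x e') (e.trans (anchor_act h x e').symm)
  continuous_act : Continuous fun p : {p : G.Arr × carrier // G.src p.1 = anchor p.2} =>
    act p.1.1 p.1.2 p.2

section

variable {G : TopGroupoid.{u}}

instance : CoeSort (GSpace G) (Type u) := ⟨GSpace.carrier⟩

attribute [instance] GSpace.top GSpace.t2 GSpace.para

/-- Continuous equivariant maps. -/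
@[ext]
structure GMap (X Y : GSpace G) where
  toFun : X → Y
  continuous_toFun : Continuous toFun
  anchor_map : ∀ x, Y.anchor (toFun x) = X.anchor x
  map_act : ∀ g x (h : G.src g = X.anchor x),
    toFun (X.act g x h) = Y.act g (toFun x) (h.trans (anchor_map x).symm)

instance (X Y : GSpace G) : CoeFun (GMap X Y) (fun _ => X → Y) := ⟨GMap.toFun⟩

theorem GSpace.act_congr (X : GSpace G) {g : G.Arr} {x y : X} (e : x = y)
    (h : G.src g = X.anchor x) (h' : G.src g = X.anchor y) : X.act g x h = X.act g y h' := by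
  subst e; rfl

namespace GMap

def id (X : GSpace G) : GMap X X := ⟨fun x => x, continuous_id, fun _ => rfl, fun _ _ _ => rfl⟩

def comp {X Y W : GSpace G} (f : GMap Y W) (g : GMap X Y) : GMap X W where
  toFun x := f (g x)
  continuous_toFun := f.continuous_toFun.comp g.continuous_toFun
  anchor_map x := (f.anchor_map _).trans (g.anchor_map _)
  map_act k x h := by
    have := g.map_act k x h
    rw [W.act_congr rfl _ ((h.trans (g.anchor_map x).symm).trans (f.anchor_map _).symm),
      ← f.map_act k (g x) (h.trans (g.anchor_map x).symm), ← this]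

end GMap

/-- The object space of `G` as a `G`-space. -/
def unitSpace (G : TopGroupoid.{u}) : GSpace G where
  carrier := G.Obj
  anchor z := z
  continuous_anchor := continuous_id
  act g _ _ := G.rng g
  anchor_act _ _ _ := rfl
  one_act z := G.rng_one z
  mul_act g h _ e _ := G.rng_mul g h e
  continuous_act := G.continuous_rng.comp (continuous_fst.comp continuous_subtype_val)

/-- The anchor map as an equivariant map to the object space. -/
def GSpace.anchorMap (X : GSpace G) : GMap X (unitSpace G) where
  toFun := X.anchor
  continuous_toFun := X.continuous_anchor
  anchor_map _ := rfl
  map_act g x h := X.anchor_act g x h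

/-- `X × [0,1]`, with the trivial action on the second factor. -/
def GSpace.prodI (X : GSpace G) : GSpace G where
  carrier := X × unitInterval
  anchor p := X.anchor p.1
  continuous_anchor := X.continuous_anchor.comp continuous_fst
  act g p h := (X.act g p.1 h, p.2)
  anchor_act g p h := X.anchor_act g p.1 h
  one_act p := by rw [X.one_act]
  mul_act g h p e e' := by rw [X.mul_act g h p.1 e e']
  continuous_act := by
    refine Continuous.prodMk ?_ (continuous_snd.comp (continuous_snd.comp continuous_subtype_val))
    exact X.continuous_act.comp (f := fun p : {p : G.Arr × (X × unitInterval) //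
      G.src p.1 = X.anchor p.2.1} =>
        (⟨(p.1.1, p.1.2.1), p.2⟩ : {p : G.Arr × X // G.src p.1 = X.anchor p.2}))
      (by fun_prop)

/-- The inclusion `x ↦ (x, t)`. -/
def GSpace.slice (X : GSpace G) (t : unitInterval) : GMap X X.prodI where
  toFun x := (x, t)
  continuous_toFun := Continuous.prodMk continuous_id continuous_const
  anchor_map _ := rfl
  map_act _ _ _ := rfl

/-! ### Closed invariant subsets -/

/-- A closed `G`-invariant subset. -/
structure ClosedInv (X : GSpace G) where
  carrier : Set X
  isClosed : IsClosed carrier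
  act_mem : ∀ g x (h : G.src g = X.anchor x), x ∈ carrier → X.act g x h ∈ carrier

namespace ClosedInv

variable {X Y : GSpace G}

def empty (X : GSpace G) : ClosedInv X := ⟨∅, isClosed_empty, fun _ _ _ h => h.elim⟩

def univ (X : GSpace G) : ClosedInv X := ⟨Set.univ, isClosed_univ, fun _ _ _ _ => trivial⟩

def union (A B : ClosedInv X) : ClosedInv X :=
  ⟨A.carrier ∪ B.carrier, A.isClosed.union B.isClosed,
    fun g x h hx => hx.imp (A.act_mem g x h) (B.act_mem g x h)⟩

def inter (A B : ClosedInv X) : ClosedInv X :=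
  ⟨A.carrier ∩ B.carrier, A.isClosed.inter B.isClosed,
    fun g x h hx => ⟨A.act_mem g x h hx.1, B.act_mem g x h hx.2⟩⟩

def preimage (f : GMap X Y) (B : ClosedInv Y) : ClosedInv X :=
  ⟨f ⁻¹' B.carrier, B.isClosed.preimage f.continuous_toFun, fun g x h hx => by
    rw [Set.mem_preimage, f.map_act]; exact B.act_mem _ _ _ hx⟩

/-- A closed invariant subset as a `G`-space. -/
def space (A : ClosedInv X) : GSpace G where
  carrier := A.carrier
  para := A.isClosed.isClosedEmbedding_subtypeVal.paracompactSpace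
  anchor x := X.anchor x.1
  continuous_anchor := X.continuous_anchor.comp continuous_subtype_val
  act g x h := ⟨X.act g x.1 h, A.act_mem g x.1 h x.2⟩
  anchor_act g x h := X.anchor_act g x.1 h
  one_act x := Subtype.ext (X.one_act x.1)
  mul_act g h x e e' := Subtype.ext (X.mul_act g h x.1 e e')
  continuous_act := by
    refine Continuous.subtype_mk ?_ _
    exact X.continuous_act.comp (f := fun p : {p : G.Arr × A.carrier //
      G.src p.1 = X.anchor p.2.1} =>
        (⟨(p.1.1, p.1.2.1), p.2⟩ : {p : G.Arr × X // G.src p.1 = X.anchor p.2}))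
      (by fun_prop)

def incl (A : ClosedInv X) : GMap A.space X where
  toFun x := x.1
  continuous_toFun := continuous_subtype_val
  anchor_map _ := rfl
  map_act _ _ _ := rfl

/-- The restriction of a map of pairs `(X, A) → (Y, B)` to `A → B`. -/
def restrict (f : GMap X Y) (A : ClosedInv X) (B : ClosedInv Y)
    (h : A.carrier ⊆ f ⁻¹' B.carrier) : GMap A.space B.space where
  toFun x := ⟨f x.1, h x.2⟩
  continuous_toFun := (f.continuous_toFun.comp continuous_subtype_val).subtype_mk _
  anchor_map x := f.anchor_map x.1
  map_act g x e := Subtype.ext (f.map_act g x.1 e)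

end ClosedInv

/-! ### Equivariant multiplicative cohomology theories -/

/-- A `G`-equivariant multiplicative cohomology theory on pairs `(X, A)` of a `G`-space and a
closed invariant subset. `obj X A` is the total group `⨁ₙ Fⁿ(X, A)` and `deg n` its part of
degree `n`. -/
structure CohTheory (G : TopGroupoid.{u}) where
  obj : ∀ X : GSpace G, ClosedInv X → Type v
  [grp : ∀ X A, AddCommGroup (obj X A)]
  deg : ∀ (X : GSpace G) (A : ClosedInv X), ℤ → AddSubgroup (obj X A)
  internal : ∀ X A, DirectSum.IsInternal (deg X A)
  -- contravariant functoriality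
  map : ∀ {X Y : GSpace G} (f : GMap X Y) (A : ClosedInv X) (B : ClosedInv Y),
    A.carrier ⊆ f ⁻¹' B.carrier → obj Y B →+ obj X A
  map_deg : ∀ {X Y : GSpace G} (f : GMap X Y) (A : ClosedInv X) (B : ClosedInv Y) h n,
    ∀ b ∈ deg Y B n, map f A B h b ∈ deg X A n
  map_id : ∀ {X : GSpace G} (A : ClosedInv X) h a, map (GMap.id X) A A h a = a
  map_comp : ∀ {X Y W : GSpace G} (f : GMap X Y) (g : GMap Y W) (A : ClosedInv X)
    (B : ClosedInv Y) (C : ClosedInv W) hf hg hgf c,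
    map (g.comp f) A C hgf c = map f A B hf (map g B C hg c)
  -- homotopy invariance
  homotopy : ∀ {X Y : GSpace G} (H : GMap X.prodI Y) (A : ClosedInv X) (B : ClosedInv Y)
    (_ : ∀ x ∈ A.carrier, ∀ t, H (x, t) ∈ B.carrier) h₀ h₁ b,
    map (H.comp (X.slice 0)) A B h₀ b = map (H.comp (X.slice 1)) A B h₁ b
  -- excision: the part of `X` outside the range of `i` is removed
  excision : ∀ {X X' : GSpace G} (i : GMap X' X) (A : ClosedInv X), IsEmbedding i →
    closure (Set.range i)ᶜ ⊆ interior A.carrier →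
    Function.Bijective (map i (A.preimage i) A subset_rfl)
  -- long exact sequence
  δ : ∀ {X : GSpace G} (A : ClosedInv X), obj A.space (.empty _) →+ obj X A
  δ_deg : ∀ {X : GSpace G} (A : ClosedInv X) n, ∀ a ∈ deg A.space (.empty _) n,
    δ A a ∈ deg X A (n + 1)
  δ_natural : ∀ {X Y : GSpace G} (f : GMap X Y) (A : ClosedInv X) (B : ClosedInv Y) h b,
    δ A (map (ClosedInv.restrict f A B h) (.empty _) (.empty _) (Set.empty_subset _) b) =
      map f A B h (δ B b)
  exact_space : ∀ {X : GSpace G} (A : ClosedInv X), Function.Exact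
    (map (GMap.id X) (.empty _) A (Set.empty_subset _))
    (map A.incl (.empty _) (.empty _) (Set.empty_subset _))
  exact_sub : ∀ {X : GSpace G} (A : ClosedInv X), Function.Exact
    (map A.incl (.empty _) (.empty _) (Set.empty_subset _)) (δ A)
  exact_pair : ∀ {X : GSpace G} (A : ClosedInv X), Function.Exact
    (δ A) (map (GMap.id X) (.empty _) A (Set.empty_subset _))
  -- cup products
  one : ∀ X : GSpace G, obj X (.empty X)
  one_deg : ∀ X, one X ∈ deg X (.empty X) 0
  map_one : ∀ {X Y : GSpace G} (f : GMap X Y),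
    map f (.empty _) (.empty _) (Set.empty_subset _) (one Y) = one X
  mul : ∀ {X : GSpace G} (A B : ClosedInv X), obj X A →+ obj X B →+ obj X (A.union B)
  mul_deg : ∀ {X : GSpace G} (A B : ClosedInv X) m n, ∀ a ∈ deg X A m, ∀ b ∈ deg X B n,
    mul A B a b ∈ deg X (A.union B) (m + n)
  map_mul : ∀ {X Y : GSpace G} (f : GMap X Y) (A A' : ClosedInv X) (B B' : ClosedInv Y)
    h h' h'' b b', map f (A.union A') (B.union B') h'' (mul B B' b b') =
      mul A A' (map f A B h b) (map f A' B' h' b')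
  one_mul : ∀ {X : GSpace G} (A : ClosedInv X) a h,
    mul (.empty X) A (one X) a = map (GMap.id X) _ A h a
  mul_one : ∀ {X : GSpace G} (A : ClosedInv X) a h,
    mul A (.empty X) a (one X) = map (GMap.id X) _ A h a
  mul_assoc : ∀ {X : GSpace G} (A B C : ClosedInv X) a b c h,
    mul (A.union B) C (mul A B a b) c =
      map (GMap.id X) _ (A.union (B.union C)) h (mul A (B.union C) a (mul B C b c))
  mul_comm : ∀ {X : GSpace G} (A B : ClosedInv X) m n, ∀ a ∈ deg X A m, ∀ b ∈ deg X B n, ∀ h,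
    mul A B a b = (Int.negOnePow (m * n) : ℤ) • map (GMap.id X) _ (B.union A) h (mul B A b a)
  δ_mul : ∀ {X : GSpace G} (A : ClosedInv X) (a : obj A.space (.empty _)) (b : obj X (.empty X))
    h h', mul A (.empty X) (δ A a) b = map (GMap.id X) _ A h
      (δ A (map (GMap.id _) (.empty _) _ h' (mul (.empty _) (.empty _) a
        (map A.incl (.empty _) (.empty _) (Set.empty_subset _) b))))

attribute [instance] CohTheory.grp

/-! ### Cohomology with `X`-compact support -/

/-- `s` is compact over the target of `p`: `p` restricts to a proper map on `s`. -/
def CompactOver {T X : Type*} [TopologicalSpace T] [TopologicalSpace X] (p : T → X) (s : Set T) :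
    Prop :=
  IsProperMap (fun t : s => p t)

theorem compactOver_iff {T X : Type*} [TopologicalSpace T] [TopologicalSpace X] [T2Space X]
    {p : T → X} (hp : Continuous p) {s : Set T} :
    CompactOver p s ↔ ∀ (U : Ultrafilter T) (x : X), s ∈ U → Filter.Tendsto p U (𝓝 x) →
      ∃ t ∈ s, (U : Filter T) ≤ 𝓝 t := by
  rw [CompactOver, isProperMap_iff_ultrafilter_of_t2]
  constructor
  · rintro ⟨-, h⟩ U x hs hU
    have hr : Set.range ((↑) : s → T) ∈ U := by simpa using hs
    obtain ⟨t, ht⟩ := @h (U.comap Subtype.val_injective hr) x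
      (hU.comp (by rw [Ultrafilter.coe_comap]; exact Filter.tendsto_comap))
    refine ⟨t, t.2, ?_⟩
    have h1 : Filter.map ((↑) : s → T) (Filter.comap (↑) (U : Filter T)) = U :=
      Filter.map_comap_of_mem hr
    rw [Ultrafilter.coe_comap] at ht
    rw [← h1]
    exact (Filter.map_mono ht).trans continuous_subtype_val.continuousAt
  · intro h
    refine ⟨hp.comp continuous_subtype_val, fun U x hU => ?_⟩
    obtain ⟨t, ht, hle⟩ := h (U.map ((↑) : s → T)) x
      (Ultrafilter.mem_map.2 (Filter.univ_mem' fun y : s => y.2)) hU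
    refine ⟨⟨t, ht⟩, ?_⟩
    rw [nhds_subtype, ← Filter.map_le_iff_le_comap]
    exact hle

/-- A closed invariant subset `B` of `T` with relatively `X`-compact complement. -/
structure Cosupp {T X : GSpace G} (p : GMap T X) where
  set : ClosedInv T
  compactOver : CompactOver p (closure set.carrierᶜ)

namespace Cosupp

variable {T X T' X' S : GSpace G} {p : GMap T X}

instance : Preorder (Cosupp p) where
  le B B' := B'.set.carrier ⊆ B.set.carrier
  le_refl _ := subset_rfl
  le_trans _ _ _ h h' := h'.trans h

instance : Nonempty (Cosupp p) :=
  ⟨⟨.univ T, (compactOver_iff p.continuous_toFun).2 fun U x hU => by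
    simp [ClosedInv.univ] at hU⟩⟩

def inter (B B' : Cosupp p) : Cosupp p :=
  ⟨B.set.inter B'.set, (compactOver_iff p.continuous_toFun).2 fun U x hU hx => by
    have : closure (B.set.inter B'.set).carrierᶜ
        = closure B.set.carrierᶜ ∪ closure B'.set.carrierᶜ := by
      rw [← closure_union, ← Set.compl_inter]; rfl
    rw [this] at hU ⊢
    rcases Ultrafilter.union_mem_iff.1 hU with h | h
    · obtain ⟨t, ht, hl⟩ := (compactOver_iff p.continuous_toFun).1 B.compactOver U x h hx
      exact ⟨t, .inl ht, hl⟩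
    · obtain ⟨t, ht, hl⟩ := (compactOver_iff p.continuous_toFun).1 B'.compactOver U x h hx
      exact ⟨t, .inr ht, hl⟩⟩

instance : IsDirectedOrder (Cosupp p) :=
  ⟨fun B B' => ⟨B.inter B', fun _ h => h.1, fun _ h => h.2⟩⟩

/-- Pull-back along a map `φ : T' → T` over `f : X' → X` for which `T' → X' × T` is proper. -/
def pull (φ : GMap T' T) (f : GMap X' X) {p' : GMap T' X'} (comm : ∀ t, f (p' t) = p (φ t))
    (hφ : IsProperMap fun t => (p' t, φ t)) (B : Cosupp p) : Cosupp p' :=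
  ⟨B.set.preimage φ, (compactOver_iff p'.continuous_toFun).2 fun U x hU hx => by
    have hsub : closure (B.set.preimage φ).carrierᶜ ⊆ φ ⁻¹' closure B.set.carrierᶜ :=
      φ.continuous_toFun.closure_preimage_subset B.set.carrierᶜ
    have hU' : φ ⁻¹' closure B.set.carrierᶜ ∈ U := Filter.mem_of_superset hU hsub
    obtain ⟨t, -, hl⟩ := (compactOver_iff p.continuous_toFun).1 B.compactOver (U.map φ) (f x)
      hU' (by
        have := (f.continuous_toFun.tendsto x).comp hx
        rw [Ultrafilter.coe_map, Filter.tendsto_map'_iff]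
        exact this.congr comm)
    obtain ⟨t', -, hl'⟩ := hφ.ultrafilter_le_nhds_of_tendsto (𝒰 := U) (y := (x, t))
      (by rw [nhds_prod_eq]; exact hx.prodMk hl)
    exact ⟨t', isClosed_closure.mem_of_frequently_of_tendsto
      (Filter.Eventually.frequently hU) hl', hl'⟩⟩

/-- The co-support of the product of a class on `S` with a class on `T`, for `T → S → X`. -/
def prod {p : GMap S X} {q : GMap T S} (r : GMap T X) (comm : ∀ t, r t = p (q t))
    (B : Cosupp p) (C : Cosupp q) : Cosupp r :=
  ⟨(B.set.preimage q).union C.set, (compactOver_iff r.continuous_toFun).2 fun U x hU hx => by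
    have hsub : closure ((B.set.preimage q).union C.set).carrierᶜ
        ⊆ q ⁻¹' closure B.set.carrierᶜ ∩ closure C.set.carrierᶜ := by
      refine (closure_mono (?_ : _ ⊆ q ⁻¹' B.set.carrierᶜ ∩ C.set.carrierᶜ)).trans
        ((closure_inter_subset_inter_closure _ _).trans (Set.inter_subset_inter_left _
          (q.continuous_toFun.closure_preimage_subset _)))
      intro t ht
      exact ⟨fun h => ht (.inl h), fun h => ht (.inr h)⟩
    have hU' := Filter.mem_of_superset hU hsub
    have hU'' : q ⁻¹' closure B.set.carrierᶜ ∈ U :=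
      Filter.mem_of_superset hU' Set.inter_subset_left
    obtain ⟨s, -, hs⟩ := (compactOver_iff p.continuous_toFun).1 B.compactOver (U.map q) x hU'' (by
        rw [Ultrafilter.coe_map, Filter.tendsto_map'_iff]
        exact hx.congr comm)
    obtain ⟨t, -, ht⟩ := (compactOver_iff q.continuous_toFun).1 C.compactOver U s
      (Filter.mem_of_superset hU' Set.inter_subset_right) hs
    exact ⟨t, isClosed_closure.mem_of_frequently_of_tendsto
      (Filter.Eventually.frequently hU) ht, ht⟩⟩

end Cosupp

namespace CohTheory

variable (F : CohTheory.{u, v} G) {T X T' X' S : GSpace G}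

/-- Restriction of supports `F(X, A) → F(X, B)` for `B ⊆ A`. -/
def res {X : GSpace G} (A B : ClosedInv X) (h : B.carrier ⊆ A.carrier) : F.obj X A →+ F.obj X B :=
  F.map (GMap.id X) B A h

theorem map_res (f : GMap X T) (A A' : ClosedInv X) (B B' : ClosedInv T) (hA : A'.carrier ⊆ A.carrier)
    (hB : B'.carrier ⊆ B.carrier) (h : A.carrier ⊆ f ⁻¹' B.carrier)
    (h' : A'.carrier ⊆ f ⁻¹' B'.carrier) (b : F.obj T B) :
    F.res A A' hA (F.map f A B h b) = F.map f A' B' h' (F.res B B' hB b) := by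
  exact (F.map_comp (GMap.id X) f A' A B hA h (hA.trans h) b).symm.trans
    (F.map_comp f (GMap.id T) A' B' B h' hB (hA.trans h) b)

instance directedSystem (p : GMap T X) :
    DirectedSystem (fun B : Cosupp p => F.obj T B.set)
      (fun B B' (h : B ≤ B') => F.res B.set B'.set h) where
  map_self B x := F.map_id B.set _ x
  map_map _ _ _ hij hjk x := (F.map_comp (GMap.id T) (GMap.id T) _ _ _ hjk hij _ x).symm

/-- `F*_X(T)`, the cohomology of `T` with `X`-compact support for `p : T → X`: the inductive limit
of `F*(T, T ∖ A)` over the open invariant relatively `X`-compact subsets `A` of `T`. -/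
abbrev Supp (p : GMap T X) : Type (max u v) :=
  DirectLimit (fun B : Cosupp p => F.obj T B.set) (fun B B' (h : B ≤ B') => F.res B.set B'.set h)

variable {F}

/-- The class in `F*_X(T)` of a relative class. -/
def Supp.mk {p : GMap T X} (B : Cosupp p) (a : F.obj T B.set) : F.Supp p := ⟦⟨B, a⟩⟧

/-- Membership in `Fⁿ_X(T)`. -/
def Supp.HasDegree {p : GMap T X} (x : F.Supp p) (n : ℤ) : Prop :=
  ∃ (B : Cosupp p) (a : F.obj T B.set), a ∈ F.deg T B.set n ∧ x = Supp.mk B a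

/-- `x` is the unit class (so `p` is proper). -/
def Supp.IsOne {p : GMap T X} (x : F.Supp p) : Prop :=
  ∃ h : CompactOver p (closure (ClosedInv.empty T).carrierᶜ), x = Supp.mk ⟨.empty T, h⟩ (F.one T)

/-- The pull-back `φ* : F*_X(T) → F*_{X'}(T')` along a map `φ : T' → T` over `f : X' → X`
for which the map `T' → X' × T` is proper. -/
def Supp.pull (φ : GMap T' T) (f : GMap X' X) {p : GMap T X} {p' : GMap T' X'}
    (comm : ∀ t, f (p' t) = p (φ t)) (hφ : IsProperMap fun t => (p' t, φ t)) :
    F.Supp p → F.Supp p' :=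
  DirectLimit.lift _
    (fun B a => Supp.mk (B.pull φ f comm hφ) (F.map φ (B.set.preimage φ) B.set subset_rfl a))
    fun B B' h a => by
      have h' : (B'.set.preimage φ).carrier ⊆ (B.set.preimage φ).carrier := fun _ ht => h ht
      refine Quotient.sound ⟨B'.pull φ f comm hφ, h', le_refl (B'.pull φ f comm hφ), ?_⟩
      refine (F.map_res φ (B.set.preimage φ) (B'.set.preimage φ) B.set B'.set h' h
        subset_rfl subset_rfl a).trans ?_
      exact (F.map_id _ _ _).symm

theorem isProperMap_graph {p : GMap T X} {p' : GMap T' X} (i : GMap T' T) (hi : IsProperMap i)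
    (comm : ∀ t, p' t = p (i t)) : IsProperMap fun t => (p' t, i t) := by
  have h : IsClosedEmbedding fun t : T => (p t, t) :=
    .of_continuous_injective_isClosedMap (p.continuous_toFun.prodMk continuous_id)
      (fun _ _ h => (Prod.ext_iff.1 h).2) (by
        refine (isProperMap_of_comp_of_t2 (g := Prod.snd)
          (p.continuous_toFun.prodMk continuous_id) continuous_snd ?_).isClosedMap
        exact isProperMap_id)
  convert h.isProperMap.comp hi using 2
  simp [comm]

/-- The pull-back `i* : F*_X(T) → F*_X(T')` along a proper map `i : T' → T` over `X`. -/
def Supp.restr (i : GMap T' T) (hi : IsProperMap i) {p : GMap T X} {p' : GMap T' X}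
    (comm : ∀ t, p' t = p (i t)) : F.Supp p → F.Supp p' :=
  Supp.pull i (GMap.id X) comm (isProperMap_graph i hi comm)

/-- The product `F*_X(S) × F*_S(T) → F*_X(T)`, `(x, y) ↦ q*(x) ∪ y`, for `q : T → S`
and `p : S → X`. -/
def Supp.mul {p : GMap S X} (q : GMap T S) (r : GMap T X) (comm : ∀ t, r t = p (q t)) :
    F.Supp p → F.Supp q → F.Supp r :=
  Quotient.map₂ (fun x y => ⟨x.1.prod r comm y.1, F.mul (x.1.set.preimage q) y.1.set
      (F.map q (x.1.set.preimage q) x.1.set subset_rfl x.2) y.2⟩) (by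
    rintro ⟨B, a⟩ ⟨B', a'⟩ ⟨B'', h, h', e⟩ ⟨C, c⟩ ⟨C', c'⟩ ⟨C'', k, k', e'⟩
    refine ⟨B''.prod r comm C'', Set.union_subset_union (Set.preimage_mono h) k,
      Set.union_subset_union (Set.preimage_mono h') k', ?_⟩
    have key : ∀ (D : Cosupp p) (E : Cosupp q) (hD : D ≤ B'') (hE : E ≤ C'')
        (d : F.obj S D.set) (x : F.obj T E.set) (hh : D.prod r comm E ≤ B''.prod r comm C''),
        F.res (D.prod r comm E).set (B''.prod r comm C'').set hh
          (F.mul (D.set.preimage q) E.set (F.map q (D.set.preimage q) D.set subset_rfl d) x) =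
        F.mul (B''.set.preimage q) C''.set (F.map q _ B''.set subset_rfl
          (F.res D.set B''.set hD d)) (F.res E.set C''.set hE x) := by
      intro D E hD hE d x hh
      have hD' : (B''.set.preimage q).carrier ⊆ (D.set.preimage q).carrier := fun _ ht => hD ht
      refine (F.map_mul (GMap.id T) (B''.set.preimage q) C''.set (D.set.preimage q) E.set hD' hE
        hh _ _).trans ?_
      exact congrArg (fun s => F.mul (B''.set.preimage q) C''.set s (F.res E.set C''.set hE x))
        (F.map_res q (D.set.preimage q) (B''.set.preimage q) D.set B''.set hD' hD
          subset_rfl subset_rfl d)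
    refine (key B C h k a c _).trans (Eq.trans ?_ (key B' C' h' k' a' c' _).symm)
    exact congrArg₂ (fun s t => F.mul (B''.set.preimage q) C''.set
      (F.map q _ B''.set subset_rfl s) t) e e')

/-- `x` has degree `d` locally: it restricts to a class of degree `k` on every open and closed
invariant piece on which the function `d` is constant with value `k`. -/
def Supp.HasLocalDegree {p : GMap T X} (x : F.Supp p) (d : T → ℤ) : Prop :=
  ∀ (N : GSpace G) (i : GMap N T) (hi : IsClosedEmbedding i), IsOpen (Set.range i) →
    ∀ k : ℤ, (∀ t, d (i t) = k) →
      (Supp.restr i hi.isProperMap (p' := p.comp i) (fun _ => rfl) x).HasDegree k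

/-- `y` is the image of `x` under the extension map `F*_X(T') → F*_X(T)` for an open
embedding `j : T' → T`. -/
def Supp.IsExtension {p : GMap T X} {p' : GMap T' X} (j : GMap T' T) (x : F.Supp p')
    (y : F.Supp p) : Prop :=
  ∃ (B : Cosupp p) (a : F.obj T B.set) (h : CompactOver p' (closure (B.set.preimage j).carrierᶜ)),
    B.set.carrierᶜ ⊆ Set.range j ∧ y = Supp.mk B a ∧
    x = Supp.mk ⟨B.set.preimage j, h⟩ (F.map j (B.set.preimage j) B.set subset_rfl a)

end CohTheory

/-! ### Equivariant vector bundles -/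

/-- A point of the total space of a family of vector spaces. -/
@[ext]
structure TotPt {B : Type u} (fib : B → Type u) where
  pt : B
  vec : fib pt

/-- A real `G`-vector bundle over `X`; the rank is finite but need not be constant. -/
structure GBundle (X : GSpace G) where
  fib : X → Type u
  [grp : ∀ x, AddCommGroup (fib x)]
  [mod : ∀ x, Module ℝ (fib x)]
  [top : TopologicalSpace (TotPt fib)]
  [t2 : T2Space (TotPt fib)]
  [para : ParacompactSpace (TotPt fib)]
  locTriv : ∀ x, ∃ (n : ℕ) (e : Bundle.Trivialization (Fin n → ℝ) (TotPt.pt : TotPt fib → X)),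
    x ∈ e.baseSet ∧ ∀ y ∈ e.baseSet, IsLinearMap ℝ fun v : fib y => (e ⟨y, v⟩).2
  act : ∀ g x (h : G.src g = X.anchor x), fib x →ₗ[ℝ] fib (X.act g x h)
  one_act : ∀ v : TotPt fib,
    (⟨_, act (G.one (X.anchor v.pt)) v.pt (G.src_one _) v.vec⟩ : TotPt fib) = v
  mul_act : ∀ g h (v : TotPt fib) (e : G.src g = G.rng h) (e' : G.src h = X.anchor v.pt),
    (⟨_, act (G.mul g h e) v.pt ((G.src_mul g h e).trans e') v.vec⟩ : TotPt fib) =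
      ⟨_, act g _ (e.trans (X.anchor_act h v.pt e').symm) (act h v.pt e' v.vec)⟩
  continuous_act : Continuous
    fun p : {p : G.Arr × TotPt fib // G.src p.1 = X.anchor p.2.pt} =>
      (⟨_, act p.1.1 p.1.2.pt p.2 p.1.2.vec⟩ : TotPt fib)

attribute [instance] GBundle.grp GBundle.mod GBundle.top GBundle.t2 GBundle.para

namespace GBundle

variable {X X' : GSpace G}

theorem continuous_pt (V : GBundle X) : Continuous (TotPt.pt : TotPt V.fib → X) := by
  rw [continuous_iff_continuousAt]
  intro v
  obtain ⟨n, e, he, -⟩ := V.locTriv v.pt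
  exact e.continuousAt_proj (e.mem_source.2 he)

/-- The total space. -/
def tot (V : GBundle X) : GSpace G where
  carrier := TotPt V.fib
  anchor v := X.anchor v.pt
  continuous_anchor := X.continuous_anchor.comp V.continuous_pt
  act g v h := ⟨X.act g v.pt h, V.act g v.pt h v.vec⟩
  anchor_act g v h := X.anchor_act g v.pt h
  one_act := V.one_act
  mul_act g h v e e' := V.mul_act g h v e e'
  continuous_act := V.continuous_act

/-- The bundle projection. -/
def proj (V : GBundle X) : GMap V.tot X where
  toFun v := v.pt
  continuous_toFun := V.continuous_pt
  anchor_map _ := rfl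
  map_act _ _ _ := rfl

/-- The rank at a point. -/
noncomputable def rank (V : GBundle X) (x : X) : ℕ := Module.finrank ℝ (V.fib x)

def BoundedRank (V : GBundle X) : Prop := ∃ n : ℕ, ∀ x, V.rank x ≤ n

/-- An isomorphism of `G`-vector bundles `V' ≅ f*(V)`. -/
structure Map (V' : GBundle X') (V : GBundle X) (f : GMap X' X) where
  lin : ∀ x, V'.fib x ≃ₗ[ℝ] V.fib (f x)
  toGMap : GMap V'.tot V.tot
  toGMap_eq : ∀ v : V'.tot, toGMap v = (⟨f v.pt, lin v.pt v.vec⟩ : TotPt V.fib)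
  isClosedEmbedding : IsClosedEmbedding fun v : V'.tot => (V'.proj v, toGMap v)

theorem Map.comm {V' : GBundle X'} {V : GBundle X} {f : GMap X' X} (φ : Map V' V f)
    (v : V'.tot) : f (V'.proj v) = V.proj (φ.toGMap v) := by
  rw [φ.toGMap_eq]; rfl

/-- An isomorphism of `G`-vector bundles `U ≅ V ⊕ g*(W)`. -/
structure Sum {Y : GSpace G} (U V : GBundle X) (W : GBundle Y) (g : GMap X Y) where
  lin : ∀ x, U.fib x ≃ₗ[ℝ] V.fib x × W.fib (g x)
  fst : GMap U.tot V.tot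
  snd : GMap U.tot W.tot
  fst_eq : ∀ u : U.tot, fst u = (⟨u.pt, (lin u.pt u.vec).1⟩ : TotPt V.fib)
  snd_eq : ∀ u : U.tot, snd u = (⟨g u.pt, (lin u.pt u.vec).2⟩ : TotPt W.fib)
  isClosedEmbedding : IsClosedEmbedding fun u : U.tot => (fst u, snd u)

theorem Sum.comm_fst {Y : GSpace G} {U V : GBundle X} {W : GBundle Y} {g : GMap X Y}
    (s : Sum U V W g) (u : U.tot) : U.proj u = V.proj (s.fst u) := by
  rw [s.fst_eq]; rfl

theorem Sum.comm_snd {Y : GSpace G} {U V : GBundle X} {W : GBundle Y} {g : GMap X Y}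
    (s : Sum U V W g) (u : U.tot) : g.comp V.proj (s.fst u) = W.proj (s.snd u) := by
  rw [s.fst_eq, s.snd_eq]; rfl

end GBundle

/-! ### Orientations -/

section Orientation

variable {F : CohTheory.{u, v} G} {X X' Y : GSpace G}

open CohTheory

/-- `τ` is a Thom class for `V`: for every base change `f : Y → X` and every support condition
`p : Y → B`, multiplication with the pull-back of `τ` is an isomorphism
`F*_B(Y) ≅ F*_B(f*V)`. -/
def GBundle.IsThom (V : GBundle X) (τ : F.Supp V.proj) : Prop :=
  ∀ (Y : GSpace G) (f : GMap Y X) (V' : GBundle Y) (φ : GBundle.Map V' V f) (B : GSpace G)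
    (p : GMap Y B), Function.Bijective fun ξ : F.Supp p =>
      Supp.mul V'.proj (p.comp V'.proj) (fun _ => rfl) ξ
        (Supp.pull φ.toGMap f φ.comm φ.isClosedEmbedding.isProperMap τ)

variable (F) in
/-- An `F`-oriented `G`-vector bundle: a `G`-vector bundle with a Thom class of degree
equal to the rank. -/
structure OBundle (X : GSpace G) extends GBundle X where
  τ : F.Supp toGBundle.proj
  isThom : toGBundle.IsThom τ
  degree : τ.HasLocalDegree fun v => (toGBundle.rank (toGBundle.proj v) : ℤ)

namespace OBundle

/-- An orientation preserving isomorphism `V' ≅ f*(V)`. -/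
structure Map (V' : OBundle F X') (V : OBundle F X) (f : GMap X' X) extends
    GBundle.Map V'.toGBundle V.toGBundle f where
  map_τ : V'.τ = Supp.pull toGMap f toMap.comm toMap.isClosedEmbedding.isProperMap V.τ

/-- An orientation preserving isomorphism `U ≅ V ⊕ g*(W)`, where the direct sum carries the
product of the Thom classes. -/
structure Sum (U V : OBundle F X) (W : OBundle F Y) (g : GMap X Y) extends
    GBundle.Sum U.toGBundle V.toGBundle W.toGBundle g where
  sum_τ : U.τ = Supp.mul fst U.proj toSum.comm_fst V.τ
    (Supp.pull snd (g.comp V.proj) toSum.comm_snd isClosedEmbedding.isProperMap W.τ)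

/-- A presentation of `V` as an oriented direct summand in a trivial oriented bundle:
`V ⊕ compl ≅ whole ≅ triv^X`, where `triv` is an oriented bundle over the object space. -/
structure Complement (V : OBundle F X) where
  compl : OBundle F X
  triv : OBundle F (unitSpace G)
  whole : OBundle F X
  sum : Sum whole V compl (GMap.id X)
  toTriv : Map whole triv X.anchorMap
  bounded : triv.BoundedRank

/-- `V` is subtrivial. -/
def Subtrivial (V : OBundle F X) : Prop := Nonempty V.Complement

end OBundle

end Orientation

/-! ### Normally non-singular maps -/

section NNM

variable (F : CohTheory.{u, v} G)

/-- An `F`-oriented normally non-singular map `(V, E, f̂)` from `X` to `Y`. The components of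
`f̂ : V → E^Y ⊆ Y × E` are `toBase` and `toFib`. -/
structure NNMap (X Y : GSpace G) where
  V : OBundle F X
  E : OBundle F (unitSpace G)
  subtrivial : V.Subtrivial
  boundedV : V.BoundedRank
  boundedE : E.BoundedRank
  toBase : GMap V.tot Y
  toFib : GMap V.tot E.tot
  isOpenEmbedding : IsOpenEmbedding fun v : V.tot =>
    (⟨(toBase v, toFib v), (toBase.anchor_map v).trans (toFib.anchor_map v).symm⟩ :
      {p : Y × E.tot // Y.anchor p.1 = E.tot.anchor p.2})

variable {F} {X X' Y W : GSpace G}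

namespace NNMap

/-- `f'` is isomorphic to the restriction `(i*V, E, f̂ ∘ i)` of `f` along `i`, followed by a map
`j` between the targets. -/
def IsoAlong {Y' : GSpace G} (f' : NNMap F X' Y') (f : NNMap F X Y) (i : GMap X' X)
    (j : Y → Y') : Prop :=
  ∃ (α : OBundle.Map f'.V f.V i) (β : OBundle.Map f'.E f.E (GMap.id _)),
    ∀ v, f'.toBase v = j (f.toBase (α.toGMap v)) ∧ β.toGMap (f'.toFib v) = f.toFib (α.toGMap v)

/-- `f` is isomorphic to the restriction along `i : X → W` of a normally non-singular map `h`
from `W` to `Y × [0,1]`, and `h` maps this part to `Y × {t}`. -/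
def IsEnd (f : NNMap F X Y) (h : NNMap F W Y.prodI) (i : GMap X W) (t : unitInterval) : Prop :=
  ∃ (α : OBundle.Map f.V h.V i) (β : OBundle.Map f.E h.E (GMap.id _)),
    ∀ v, h.toBase (α.toGMap v) = ((f.toBase v, t) : Y × unitInterval) ∧
      h.toFib (α.toGMap v) = β.toGMap (f.toFib v)

/-- Isotopy: a normally non-singular map from `X × [0,1]` to `Y × [0,1]` over `[0,1]`. -/
def Isotopic (f₀ f₁ : NNMap F X Y) : Prop :=
  ∃ h : NNMap F X.prodI Y.prodI,
    (∀ v : h.V.tot, (h.toBase v : Y × unitInterval).2 = (h.V.proj v : X × unitInterval).2) ∧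
    f₀.IsEnd h (X.slice 0) 0 ∧ f₁.IsEnd h (X.slice 1) 1

/-- `f'` is the lifting `(V ⊕ D^X, E ⊕ D, f̂ × id_D)` of `f = (V, E, f̂)` along an oriented
`G`-vector bundle `D` over the object space. -/
def IsLifting (f' f : NNMap F X Y) : Prop :=
  ∃ (D : OBundle F (unitSpace G)) (a : OBundle.Sum f'.V f.V D X.anchorMap)
    (c : OBundle.Sum f'.E f.E D (GMap.id _)), ∀ v,
      f'.toBase v = f.toBase (a.fst v) ∧
      c.fst (f'.toFib v) = f.toFib (a.fst v) ∧
      c.snd (f'.toFib v) = a.snd v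

/-- Equivalence of normally non-singular maps: generated by isomorphism, isotopy and lifting. -/
def Equivalent (f f' : NNMap F X Y) : Prop :=
  Relation.EqvGen
    (fun f f' : NNMap F X Y => f.IsoAlong f' (GMap.id X) id ∨ f.Isotopic f' ∨ f.IsLifting f') f f'

end NNMap

/-! ### Correspondences -/

open CohTheory

variable (F) in
/-- A correspondence `(M, b, f, ξ)` from `X` to `Y`. -/
structure Corr (X Y : GSpace G) where
  M : GSpace G
  b : GMap M X
  f : NNMap F M Y
  ξ : F.Supp b

namespace Corr

/-- Isomorphism of correspondences. -/
def Iso (Ψ' Ψ : Corr F X Y) : Prop :=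
  ∃ (i : GMap Ψ'.M Ψ.M) (hi : IsHomeomorph i) (hb : ∀ m, Ψ'.b m = Ψ.b (i m)),
    Ψ'.f.IsoAlong Ψ.f i id ∧ Ψ'.ξ = Supp.restr i hi.isProperMap hb Ψ.ξ

/-- `Ψ` is the boundary `∂ₜ` of `(W, b, h, ξ)`, where `h` is a normally non-singular map from `W`
to `Y × [0,1]`: the preimage of the level `t` in the total space of `h.V` is the part over
a subset `D` of `W`, and `Ψ` is the restriction to `D`. -/
def IsBoundary (Ψ : Corr F X Y) (h : NNMap F W Y.prodI) (b : GMap W X) (ξ : F.Supp b)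
    (t : unitInterval) : Prop :=
  ∃ D : Set W,
    (∀ v : h.V.tot, (h.toBase v : Y × unitInterval).2 = t ↔ h.V.proj v ∈ D) ∧
    ∃ (i : GMap Ψ.M W) (hi : IsClosedEmbedding i) (hb : ∀ m, Ψ.b m = b (i m)),
      Set.range i = D ∧ Ψ.f.IsEnd h i t ∧ Ψ.ξ = Supp.restr i hi.isProperMap hb ξ

/-- Bordism of correspondences. -/
def Bordant (Ψ₀ Ψ₁ : Corr F X Y) : Prop :=
  ∃ (W : GSpace G) (b : GMap W X) (h : NNMap F W Y.prodI) (ξ : F.Supp b),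
    Ψ₀.IsBoundary h b ξ 0 ∧ Ψ₁.IsBoundary h b ξ 1

/-- `Ψ'` is the Thom modification of `Ψ = (M, b, (V, E, f̂), ξ)` along a subtrivial oriented
bundle `U` over `M`. The projection of `U` is the normally non-singular map
`(p*(U^⊥), D, ι)` with `ι : U ⊕ U^⊥ ≅ D^M`; its composite with `f` is
`(p*(U^⊥ ⊕ V), D ⊕ E, (id_D × f̂) ∘ (ι × id_V))`. The rank of `D` is taken to be even
(add copies of `D` to `U^⊥` and `D`), so that interchanging `D` with `V` and `E`
produces no sign in the orientation of the composite. -/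
def IsThomModification (Ψ' Ψ : Corr F X Y) : Prop :=
  ∃ (U : OBundle F Ψ.M) (k : U.Complement) (_ : ∀ z, Even (k.triv.rank z))
    (N : OBundle F Ψ.M) (n : OBundle.Sum N k.compl Ψ.f.V (GMap.id _))
    (i : GMap Ψ'.M U.tot) (hi : IsHomeomorph i)
    (hb : ∀ m, Ψ'.b m = (Ψ.b.comp U.proj) (i m))
    (α : OBundle.Map Ψ'.f.V N (U.proj.comp i))
    (c : OBundle.Sum Ψ'.f.E k.triv Ψ.f.E (GMap.id _)),
    (∀ v : Ψ'.f.V.tot,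
      Ψ'.f.toBase v = Ψ.f.toBase (n.snd (α.toGMap v)) ∧
      c.snd (Ψ'.f.toFib v) = Ψ.f.toFib (n.snd (α.toGMap v)) ∧
      ∀ w : k.whole.tot, k.sum.fst w = i (Ψ'.f.V.proj v) → k.sum.snd w = n.fst (α.toGMap v) →
        c.fst (Ψ'.f.toFib v) = k.toTriv.toGMap w) ∧
    Ψ'.ξ = Supp.restr i hi.isProperMap hb
      (Supp.mul U.proj (Ψ.b.comp U.proj) (fun _ => rfl) Ψ.ξ U.τ)

/-- The relations that generate the equivalence of correspondences. -/
inductive Rel : Corr F X Y → Corr F X Y → Prop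
  | iso (Ψ Ψ' : Corr F X Y) : Ψ.Iso Ψ' → Rel Ψ Ψ'
  | normal (M : GSpace G) (b : GMap M X) (f f' : NNMap F M Y) (ξ : F.Supp b) :
      f.Equivalent f' → Rel ⟨M, b, f, ξ⟩ ⟨M, b, f', ξ⟩
  | bordism (Ψ Ψ' : Corr F X Y) : Ψ.Bordant Ψ' → Rel Ψ Ψ'
  | thom (Ψ Ψ' : Corr F X Y) : Ψ'.IsThomModification Ψ → Rel Ψ Ψ'

/-- `Ψ` is the sum of `Ψ₁` and `Ψ₂`, that is, their disjoint union: `M = M₁ ⊔ M₂`, with `b` and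
`ξ` restricting to `bₖ` and `ξₖ` on `Mₖ` and `f` restricting to a normally non-singular map
equivalent to `fₖ`. -/
def IsSum (Ψ Ψ₁ Ψ₂ : Corr F X Y) : Prop :=
  ∃ (i₁ : GMap Ψ₁.M Ψ.M) (i₂ : GMap Ψ₂.M Ψ.M) (h₁ : IsClosedEmbedding i₁)
    (h₂ : IsClosedEmbedding i₂) (b₁ : ∀ m, Ψ₁.b m = Ψ.b (i₁ m)) (b₂ : ∀ m, Ψ₂.b m = Ψ.b (i₂ m)),
    IsCompl (Set.range i₁) (Set.range i₂) ∧
    (∃ f₁, NNMap.IsoAlong f₁ Ψ.f i₁ id ∧ f₁.Equivalent Ψ₁.f) ∧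
    (∃ f₂, NNMap.IsoAlong f₂ Ψ.f i₂ id ∧ f₂.Equivalent Ψ₂.f) ∧
    Ψ₁.ξ = Supp.restr i₁ h₁.isProperMap b₁ Ψ.ξ ∧ Ψ₂.ξ = Supp.restr i₂ h₂.isProperMap b₂ Ψ.ξ

/-- `Ψ` has degree `n`: `deg ξ + rank V - rank E = n`. -/
def HasDegree (Ψ : Corr F X Y) (n : ℤ) : Prop :=
  Ψ.ξ.HasLocalDegree fun m =>
    n - ((Ψ.f.V.rank m : ℤ) - (Ψ.f.E.rank (Ψ.M.anchor m) : ℤ))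

/-- `Ψ` is the correspondence `(Y, ϱ, id_Y, η)` from the object space to `Y`. -/
def IsCanonical (Ψ : Corr F (unitSpace G) Y) (η : F.Supp Y.anchorMap) : Prop :=
  (∀ m, Subsingleton (Ψ.f.V.fib m)) ∧ Ψ.f.V.τ.IsOne ∧
  (∀ z, Subsingleton (Ψ.f.E.fib z)) ∧ Ψ.f.E.τ.IsOne ∧
  ∃ (e : GMap Ψ.M Y) (he : IsHomeomorph e) (hb : ∀ m, Ψ.b m = Y.anchorMap (e m)),
    (∀ v, Ψ.f.toBase v = e (Ψ.f.V.proj v)) ∧ Ψ.ξ = Supp.restr e he.isProperMap hb η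

/-- `Ψ = (M, b, f, ξ)` is special: `f = (V, E, f̂)` with `V = 0`. -/
def Special (Ψ : Corr F X Y) : Prop := ∀ m, Subsingleton (Ψ.f.V.fib m)

/-- `Ψ'` is the composite of the special correspondence `Ψ = (M, b, (0, E, f̂), ξ)` from `X` to `Y`
with the correspondence `h* = (Y', h, id, 1)` of a proper map `h : Y' → Y`; its middle space is
`M ×_Y Y'`. -/
def IsPullback {Y' : GSpace G} (Ψ' : Corr F X Y') (Ψ : Corr F X Y) (h : GMap Y' Y) : Prop :=
  Ψ.Special ∧
  ∃ (c : GMap Ψ'.M Ψ.M) (hc : IsProperMap c) (hb : ∀ m, Ψ'.b m = Ψ.b (c m))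
    (α : OBundle.Map Ψ'.f.V Ψ.f.V c) (β : OBundle.Map Ψ'.f.E Ψ.f.E (GMap.id _)),
    (∀ v, Ψ.f.toBase (α.toGMap v) = h (Ψ'.f.toBase v) ∧
      Ψ.f.toFib (α.toGMap v) = β.toGMap (Ψ'.f.toFib v)) ∧
    (∀ v y', Ψ.f.toBase v = h y' → ∃ v', α.toGMap v' = v ∧ Ψ'.f.toBase v' = y') ∧
    Ψ'.ξ = Supp.restr c hc hb Ψ.ξ

/-- `Ψ'` is the composite `(M, b, (V, E, j ∘ f̂), ξ)` of `Ψ` with an open embedding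
`j : Y → Y'`. -/
def IsPushforward {Y' : GSpace G} (Ψ' : Corr F X Y') (Ψ : Corr F X Y) (j : GMap Y Y') : Prop :=
  ∃ (i : GMap Ψ'.M Ψ.M) (hi : IsHomeomorph i) (hb : ∀ m, Ψ'.b m = Ψ.b (i m)),
    Ψ'.f.IsoAlong Ψ.f i j ∧ Ψ'.ξ = Supp.restr i hi.isProperMap hb Ψ.ξ

end Corr

variable (F) in
/-- The set of equivalence classes of correspondences from `X` to `Y`. -/
def FHat (X Y : GSpace G) : Type (max (u + 1) v) := Quot (Corr.Rel (F := F) (X := X) (Y := Y))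

/-- The class of a correspondence. -/
def Corr.cls (Ψ : Corr F X Y) : FHat F X Y := Quot.mk _ Ψ

end NNM

end

attribute [reducible] ClosedInv.preimage ClosedInv.union ClosedInv.empty ClosedInv.univ
  ClosedInv.inter ClosedInv.space ClosedInv.incl GMap.id GMap.comp Cosupp.pull Cosupp.prod
  GBundle.tot GBundle.proj

section

variable {G : TopGroupoid.{u}}

namespace CohTheory

variable {F : CohTheory.{u, v} G} {T X T' X' S S' T'' X'' R Y : GSpace G}

/-! ### Calculus of relative classes -/

theorem map_congr {f f' : GMap X Y} (hf : ∀ x, f x = f' x) (A : ClosedInv X) (B : ClosedInv Y)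
    (h : A.carrier ⊆ f ⁻¹' B.carrier) (h' : A.carrier ⊆ f' ⁻¹' B.carrier) (b : F.obj Y B) :
    F.map f A B h b = F.map f' A B h' b := by
  have : f = f' := GMap.ext (funext hf)
  subst this; rfl

theorem map_map {f : GMap X Y} {g : GMap Y S} {k : GMap X S} (hk : ∀ x, k x = g (f x))
    (A : ClosedInv X) (B : ClosedInv Y) (C : ClosedInv S) (hf : A.carrier ⊆ f ⁻¹' B.carrier)
    (hg : B.carrier ⊆ g ⁻¹' C.carrier) (h : A.carrier ⊆ k ⁻¹' C.carrier) (c : F.obj S C) :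
    F.map f A B hf (F.map g B C hg c) = F.map k A C h c := by
  rw [← F.map_comp f g A B C hf hg (fun x hx => hg (hf hx))]
  exact map_congr (fun x => (hk x).symm) _ _ _ _ _

theorem map_map_comm {f : GMap X Y} {g : GMap Y S} {f' : GMap X T} {g' : GMap T S}
    (hk : ∀ x, g (f x) = g' (f' x)) (A : ClosedInv X) (B : ClosedInv Y) (B' : ClosedInv T)
    (C : ClosedInv S) (hf : A.carrier ⊆ f ⁻¹' B.carrier) (hg : B.carrier ⊆ g ⁻¹' C.carrier)
    (hf' : A.carrier ⊆ f' ⁻¹' B'.carrier) (hg' : B'.carrier ⊆ g' ⁻¹' C.carrier) (c : F.obj S C) :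
    F.map f A B hf (F.map g B C hg c) = F.map f' A B' hf' (F.map g' B' C hg' c) :=
  (map_map (k := g.comp f) (fun _ => rfl) _ _ _ _ _ (fun _ hx => hg (hf hx)) _).trans
    (map_map (fun x => hk x) _ _ _ _ _ _ _).symm

theorem res_map {f : GMap X Y} {A A' : ClosedInv X} {B : ClosedInv Y}
    (h : A.carrier ⊆ f ⁻¹' B.carrier) (hA : A'.carrier ⊆ A.carrier) (b : F.obj Y B) :
    F.res A A' hA (F.map f A B h b) = F.map f A' B (hA.trans h) b :=
  map_map (fun _ => rfl) _ _ _ _ _ _ _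

theorem map_of_res {f : GMap X Y} {A : ClosedInv X} {B B' : ClosedInv Y}
    (h : A.carrier ⊆ f ⁻¹' B'.carrier) (hB : B'.carrier ⊆ B.carrier) (b : F.obj Y B) :
    F.map f A B' h (F.res B B' hB b) = F.map f A B (fun _ hx => hB (h hx)) b :=
  map_map (fun _ => rfl) _ _ _ _ _ _ _

theorem res_res {A B C : ClosedInv X} (h : B.carrier ⊆ A.carrier) (h' : C.carrier ⊆ B.carrier)
    (a : F.obj X A) : F.res B C h' (F.res A B h a) = F.res A C (h'.trans h) a :=
  map_map (fun _ => rfl) _ _ _ _ _ _ _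

theorem res_self {A : ClosedInv X} (h : A.carrier ⊆ A.carrier) (a : F.obj X A) :
    F.res A A h a = a := F.map_id A h a

theorem res_mul {A A' B B' : ClosedInv X} (h : A'.carrier ⊆ A.carrier) (h' : B'.carrier ⊆ B.carrier)
    (hu : (A'.union B').carrier ⊆ (A.union B).carrier) (a : F.obj X A) (b : F.obj X B) :
    F.res (A.union B) (A'.union B') hu (F.mul A B a b) =
      F.mul A' B' (F.res A A' h a) (F.res B B' h' b) :=
  F.map_mul (GMap.id X) A' B' A B h h' hu a b

/-! ### Classes with compact support -/

namespace Supp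

theorem ind {p : GMap T X} {P : F.Supp p → Prop} (h : ∀ B a, P (mk B a)) (x : F.Supp p) : P x :=
  DirectLimit.induction _ h x

theorem ind₂ {p : GMap T X} {P : F.Supp p → F.Supp p → Prop}
    (h : ∀ B a b, P (mk B a) (mk B b)) (x y : F.Supp p) : P x y :=
  DirectLimit.induction₂ _ h x y

theorem mk_eq_iff {p : GMap T X} {B B' : Cosupp p} {a : F.obj T B.set} {a' : F.obj T B'.set} :
    mk B a = mk B' a' ↔ ∃ (C : Cosupp p) (h : C.set.carrier ⊆ B.set.carrier)
      (h' : C.set.carrier ⊆ B'.set.carrier), F.res _ _ h a = F.res _ _ h' a' :=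
  Quotient.eq

theorem mk_res {p : GMap T X} {B C : Cosupp p} (h : C.set.carrier ⊆ B.set.carrier)
    (a : F.obj T B.set) : mk C (F.res B.set C.set h a) = mk B a :=
  mk_eq_iff.2 ⟨C, subset_rfl, h, res_self _ _⟩

theorem mk_eq_of_res {p : GMap T X} {B C : Cosupp p} (h : C.set.carrier ⊆ B.set.carrier)
    {a : F.obj T B.set} {c : F.obj T C.set} (e : F.res B.set C.set h a = c) : mk B a = mk C c := by
  rw [← e, mk_res]

theorem mk_add {p : GMap T X} (B : Cosupp p) (a b : F.obj T B.set) :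
    mk B (a + b) = mk B a + mk B b :=
  (DirectLimit.add_def (G := fun B : Cosupp p => F.obj T B.set) B a b).symm

theorem mk_zero {p : GMap T X} (B : Cosupp p) : mk B (0 : F.obj T B.set) = 0 :=
  (DirectLimit.zero_def (G := fun B : Cosupp p => F.obj T B.set) B).symm

theorem mk_eq_zero {p : GMap T X} {B : Cosupp p} {a : F.obj T B.set} (h : mk B a = 0) :
    ∃ (C : Cosupp p) (h : C.set.carrier ⊆ B.set.carrier), F.res _ _ h a = 0 := by
  rw [← mk_zero B, mk_eq_iff] at h
  obtain ⟨C, h, h', e⟩ := h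
  exact ⟨C, h, by rw [e, map_zero]⟩

theorem pull_mk (φ : GMap T' T) (f : GMap X' X) {p : GMap T X} {p' : GMap T' X'}
    (comm : ∀ t, f (p' t) = p (φ t)) (hφ : IsProperMap fun t => (p' t, φ t)) (B : Cosupp p)
    (a : F.obj T B.set) : pull φ f comm hφ (mk B a) =
      mk (B.pull φ f comm hφ) (F.map φ (B.set.preimage φ) B.set subset_rfl a) := rfl

theorem mul_mk {p : GMap S X} (q : GMap T S) (r : GMap T X) (comm : ∀ t, r t = p (q t))
    (B : Cosupp p) (a : F.obj S B.set) (C : Cosupp q) (c : F.obj T C.set) :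
    mul q r comm (mk B a) (mk C c) = mk (B.prod r comm C) (F.mul (B.set.preimage q) C.set
      (F.map q (B.set.preimage q) B.set subset_rfl a) c) := rfl

theorem pull_add (φ : GMap T' T) (f : GMap X' X) {p : GMap T X} {p' : GMap T' X'}
    (comm : ∀ t, f (p' t) = p (φ t)) (hφ : IsProperMap fun t => (p' t, φ t)) (x y : F.Supp p) :
    pull φ f comm hφ (x + y) = pull φ f comm hφ x + pull φ f comm hφ y := by
  induction x, y using ind₂ with | h B a b => ?_
  rw [← mk_add, pull_mk, map_add, mk_add]; rfl

theorem restr_add (i : GMap T' T) (hi : IsProperMap i) {p : GMap T X} {p' : GMap T' X}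
    (comm : ∀ t, p' t = p (i t)) (x y : F.Supp p) :
    restr i hi comm (x + y) = restr i hi comm x + restr i hi comm y := pull_add _ _ _ _ _ _

theorem add_mul {p : GMap S X} (q : GMap T S) (r : GMap T X) (comm : ∀ t, r t = p (q t))
    (x x' : F.Supp p) (y : F.Supp q) :
    mul q r comm (x + x') y = mul q r comm x y + mul q r comm x' y := by
  induction y using ind with | h C c => ?_
  induction x, x' using ind₂ with | h B a a' => ?_
  rw [← mk_add, mul_mk, map_add, map_add, AddMonoidHom.add_apply, mk_add]; rfl

theorem pull_pull {φ : GMap T' T} {f : GMap X' X} {ψ : GMap T'' T'} {g : GMap X'' X'}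
    {χ : GMap T'' T} {k : GMap X'' X} {p : GMap T X} {p' : GMap T' X'} {p'' : GMap T'' X''}
    {comm : ∀ t, f (p' t) = p (φ t)} {hφ : IsProperMap fun t => (p' t, φ t)}
    {comm' : ∀ t, g (p'' t) = p' (ψ t)} {hψ : IsProperMap fun t => (p'' t, ψ t)}
    {comm'' : ∀ t, k (p'' t) = p (χ t)} {hχ : IsProperMap fun t => (p'' t, χ t)}
    (h : ∀ t, φ (ψ t) = χ t) (x : F.Supp p) :
    pull ψ g comm' hψ (pull φ f comm hφ x) = pull χ k comm'' hχ x := by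
  have : χ = φ.comp ψ := GMap.ext (funext fun t => (h t).symm)
  subst this
  induction x using ind with | h B a => ?_
  exact congrArg (mk _) (map_map (fun _ => rfl) _ _ _ _ _ _ _)

theorem pull_congr {φ φ' : GMap T' T} {f f' : GMap X' X} {p : GMap T X} {p' : GMap T' X'}
    {comm : ∀ t, f (p' t) = p (φ t)} {hφ : IsProperMap fun t => (p' t, φ t)}
    {comm' : ∀ t, f' (p' t) = p (φ' t)} {hφ' : IsProperMap fun t => (p' t, φ' t)}
    (h : ∀ t, φ t = φ' t) (x : F.Supp p) : pull φ f comm hφ x = pull φ' f' comm' hφ' x := by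
  have : φ = φ' := GMap.ext (funext h)
  subst this; rfl

theorem pull_eq_self {φ : GMap T T} {f : GMap X X} {p : GMap T X}
    {comm : ∀ t, f (p t) = p (φ t)} {hφ : IsProperMap fun t => (p t, φ t)}
    (h : ∀ t, φ t = t) (x : F.Supp p) : pull φ f comm hφ x = x := by
  have : φ = GMap.id T := GMap.ext (funext h)
  subst this
  induction x using ind with | h B a => ?_
  exact congrArg (mk _) (F.map_id _ _ _)

theorem pull_mul {p : GMap S X} {q : GMap T S} {r : GMap T X} {comm : ∀ t, r t = p (q t)}
    {p' : GMap S' X'} {q' : GMap T' S'} {r' : GMap T' X'} (comm' : ∀ t, r' t = p' (q' t))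
    {φ : GMap T' T} {ψ : GMap S' S} {f : GMap X' X}
    {c₁ : ∀ t, f (r' t) = r (φ t)} {h₁ : IsProperMap fun t => (r' t, φ t)}
    (c₂ : ∀ t, f (p' t) = p (ψ t)) (h₂ : IsProperMap fun t => (p' t, ψ t))
    (c₃ : ∀ t, ψ (q' t) = q (φ t)) (h₃ : IsProperMap fun t => (q' t, φ t))
    (x : F.Supp p) (y : F.Supp q) :
    pull φ f c₁ h₁ (mul q r comm x y) =
      mul q' r' comm' (pull ψ f c₂ h₂ x) (pull φ ψ c₃ h₃ y) := by
  induction x using ind with | h B a => ?_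
  induction y using ind with | h C c => ?_
  rw [mul_mk, pull_mk, pull_mk, pull_mk, mul_mk]
  have hs : ∀ t, φ t ∈ q ⁻¹' B.set.carrier ↔ q' t ∈ ψ ⁻¹' B.set.carrier := fun t => by
    rw [Set.mem_preimage, Set.mem_preimage, c₃]
  fapply mk_eq_of_res
  · exact fun t ht => ht.imp (fun h => (hs t).2 h) (fun h => h)
  refine (res_map _ _ _).trans ?_
  refine (F.map_mul φ (((B.pull ψ f c₂ h₂).set.preimage q')) (C.set.preimage φ) (B.set.preimage q)
    C.set (fun t ht => (hs t).2 ht) subset_rfl _ _ _).trans ?_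
  congr 2
  exact map_map_comm (fun t => (c₃ t).symm) _ _ _ _ _ _ _ _ _

theorem mul_assoc {p : GMap S X} {q : GMap T S} {r : GMap T X} {comm : ∀ t, r t = p (q t)}
    {q' : GMap R T} {r' : GMap R X} {comm' : ∀ t, r' t = r (q' t)}
    (q'' : GMap R S) (c₁ : ∀ t, q'' t = q (q' t)) (c₂ : ∀ t, r' t = p (q'' t))
    (x : F.Supp p) (y : F.Supp q) (z : F.Supp q') :
    mul q' r' comm' (mul q r comm x y) z = mul q'' r' c₂ x (mul q' q'' c₁ y z) := by
  have : q'' = q.comp q' := GMap.ext (funext c₁)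
  subst this
  induction x using ind with | h B a => ?_
  induction y using ind with | h C c => ?_
  induction z using ind with | h D d => ?_
  rw [mul_mk, mul_mk, mul_mk, mul_mk]
  symm
  fapply mk_eq_of_res
  · exact fun t ht => or_assoc.1 ht
  refine Eq.trans ?_ (congrArg (fun s => F.mul ((B.prod r comm C).set.preimage q') D.set s d)
    (F.map_mul q' ((B.set.preimage q).preimage q') (C.set.preimage q') (B.set.preimage q) C.set
      subset_rfl subset_rfl subset_rfl _ _).symm)
  refine Eq.trans ?_ (F.mul_assoc ((B.set.preimage q).preimage q') (C.set.preimage q') D.set _ _ _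
    (fun t ht => or_assoc.1 ht)).symm
  rw [map_map (k := q.comp q') (fun _ => rfl) _ _ _ _ _ subset_rfl]
  rfl

/-- Multiplication with the unit class amounts to pull-back. -/
theorem mul_isOne {p : GMap S X} {q : GMap T S} {r : GMap T X} {comm : ∀ t, r t = p (q t)}
    {y : F.Supp q} (hy : y.IsOne) {f : GMap X X} {c : ∀ t, f (r t) = p (q t)}
    {h : IsProperMap fun t => (r t, q t)} (x : F.Supp p) :
    mul q r comm x y = pull q f c h x := by
  obtain ⟨h', rfl⟩ := hy
  induction x using ind with | h B a => ?_
  rw [mul_mk, pull_mk]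
  symm
  fapply mk_eq_of_res
  · exact fun t ht => ht.elim id fun h => h.elim
  exact (F.mul_one _ _ _).symm

theorem isOne_mul {p : GMap S X} {q : GMap T S} {r : GMap T X} {comm : ∀ t, r t = p (q t)}
    {x : F.Supp p} (hx : x.IsOne) {f : GMap X S} {c : ∀ t, f (r t) = q t}
    {h : IsProperMap fun t => (r t, t)} (y : F.Supp q) :
    mul q r comm x y = pull (GMap.id T) f c h y := by
  obtain ⟨h', rfl⟩ := hx
  induction y using ind with | h B a => ?_
  rw [mul_mk, pull_mk]
  symm
  fapply mk_eq_of_res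
  · exact fun t ht => ht.elim (fun h => h.elim) id
  have hs : ((ClosedInv.empty T).union B.set).carrier ⊆ B.set.carrier :=
    fun t ht => ht.elim (fun h => h.elim) id
  refine Eq.trans ?_ (congrArg (fun s => F.mul (.empty T) B.set s a) (F.map_one q)).symm
  exact (res_map _ _ _).trans (F.one_mul _ _ hs).symm

end Supp

end CohTheory

theorem GSpace.act_congr_left (X : GSpace G) {g g' : G.Arr} {x : X} (e : g = g')
    (h : G.src g = X.anchor x) (h' : G.src g' = X.anchor x) : X.act g x h = X.act g' x h' := by
  subst e; rfl

theorem GSpace.inv_act (X : GSpace G) (g : G.Arr) (x : X) (h : G.src g = X.anchor x) :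
    X.act (G.inv g) (X.act g x h) ((G.src_inv g).trans (X.anchor_act g x h).symm) = x := by
  rw [← X.mul_act (G.inv g) g x (G.src_inv g) h]
  refine (X.act_congr_left ((G.inv_mul g).trans (congrArg G.one h)) _ (G.src_one _)).trans
    (X.one_act x)

theorem CompactOver.isClosed {T X : GSpace G} {p : GMap T X} {s : Set T} (h : CompactOver p s) :
    IsClosed s := by
  rw [isClosed_iff_ultrafilter]
  intro x U hU hs
  obtain ⟨t, ht, hl⟩ := (compactOver_iff p.continuous_toFun).1 h U (p x) hs
    ((p.continuous_toFun.tendsto x).mono_left hU)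
  rwa [tendsto_nhds_unique (f := id) (l := (U : Filter T)) hU hl]

theorem CompactOver.subset {T X : GSpace G} {p : GMap T X} {s t : Set T} (h : CompactOver p t)
    (hs : IsClosed s) (hst : s ⊆ t) : CompactOver p s := by
  rw [compactOver_iff p.continuous_toFun] at h ⊢
  intro U x hU hx
  obtain ⟨a, -, hl⟩ := h U x (Filter.mem_of_superset hU hst) hx
  exact ⟨a, hs.mem_of_frequently_of_tendsto (Filter.Eventually.frequently hU) hl, hl⟩

theorem CompactOver.image {T T' X : GSpace G} {p : GMap T X} {p' : GMap T' X} {j : GMap T' T}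
    (comm : ∀ t, p' t = p (j t)) {s : Set T'} (h : CompactOver p' s) : CompactOver p (j '' s) := by
  rw [compactOver_iff p.continuous_toFun]
  intro U x hU hx
  have : CompactOver p' s := h
  obtain ⟨V, hV, hVU⟩ : ∃ V : Ultrafilter T', s ∈ V ∧ V.map j = U := by
    have hne : (Filter.comap j (U : Filter T) ⊓ Filter.principal s).NeBot := by
      rw [Filter.neBot_iff, Ne, ← Filter.empty_mem_iff_bot, Filter.mem_inf_principal]
      rintro ⟨W, hW, hWs⟩
      obtain ⟨_, ⟨t, ht, rfl⟩, ht'⟩ := (U.neBot.nonempty_of_mem (Filter.inter_mem hU hW))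
      exact hWs ht' ht
    refine ⟨Ultrafilter.of (Filter.comap j (U : Filter T) ⊓ Filter.principal s), ?_, ?_⟩
    · exact le_trans (Ultrafilter.of_le (Filter.comap j (U : Filter T) ⊓ Filter.principal s)) inf_le_right
        (Filter.mem_principal_self s)
    · refine Ultrafilter.coe_injective (U.unique ?_)
      rw [Ultrafilter.coe_map, Filter.map_le_iff_le_comap]
      exact (Ultrafilter.of_le _).trans inf_le_left
  obtain ⟨t, ht, hl⟩ := (compactOver_iff p'.continuous_toFun).1 h V x hV (by
    rw [← hVU, Ultrafilter.coe_map, Filter.tendsto_map'_iff] at hx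
    exact hx.congr fun t => (comm t).symm)
  refine ⟨j t, ⟨t, ht, rfl⟩, ?_⟩
  rw [← hVU, Ultrafilter.coe_map]
  exact (Filter.map_mono hl).trans (j.continuous_toFun.tendsto t)

namespace Cosupp

variable {T T' X : GSpace G} {p' : GMap T' X} {p : GMap T X}

/-- The image of a co-support under an open embedding. -/
def push (j : GMap T' T) (hj : IsOpenEmbedding j) (comm : ∀ t, p' t = p (j t)) (C : Cosupp p') :
    Cosupp p where
  set := ⟨(j '' C.set.carrierᶜ)ᶜ, (hj.isOpenMap _ C.set.isClosed.isOpen_compl).isClosed_compl, by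
    rintro g x h hx ⟨t, ht, e⟩
    have hs : G.src (G.inv g) = T'.anchor t := by
      rw [G.src_inv, ← j.anchor_map, e, T.anchor_act]
    refine hx ⟨T'.act (G.inv g) t hs, fun hm => ht ?_, ?_⟩
    · have h2 : G.src g = T'.anchor (T'.act (G.inv g) t hs) := by rw [T'.anchor_act, G.rng_inv]
      have h3 := C.set.act_mem g _ h2 hm
      have h4 : T'.act g (T'.act (G.inv g) t hs) h2 = t := by
        apply hj.injective
        rw [j.map_act, T.act_congr (j.map_act _ _ _) _ (by rw [T.anchor_act, G.rng_inv])]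
        rw [← T.mul_act g (G.inv g) (j t) (G.rng_inv g).symm]
        refine (T.act_congr_left (G.mul_inv g) _ ?_).trans ?_
        · rw [G.src_one, ← G.src_inv, hs, j.anchor_map]
        · refine (T.act_congr_left (congrArg G.one ?_) _ (G.src_one _)).trans (T.one_act _)
          rw [← G.src_inv, hs, j.anchor_map]
      rwa [h4] at h3
    · rw [j.map_act, T.act_congr e _ (by rw [G.src_inv, T.anchor_act])]
      exact T.inv_act g x h⟩
  compactOver := by
    have h := C.compactOver.image comm
    refine h.subset isClosed_closure (closure_minimal ?_ h.isClosed)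
    rw [compl_compl]
    exact Set.image_mono subset_closure

theorem preimage_push (j : GMap T' T) (hj : IsOpenEmbedding j) (comm : ∀ t, p' t = p (j t))
    (C : Cosupp p') : ((C.push j hj comm).set.preimage j).carrier = C.set.carrier := by
  ext t
  change ¬ _ ↔ _
  rw [hj.injective.mem_set_image, Set.mem_compl_iff, not_not]

theorem compl_push (j : GMap T' T) (hj : IsOpenEmbedding j) (comm : ∀ t, p' t = p (j t))
    (C : Cosupp p') : (C.push j hj comm).set.carrierᶜ = j '' C.set.carrierᶜ := compl_compl _

end Cosupp

namespace CohTheory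

variable {F : CohTheory.{u, v} G} {T X T' X' S S' T'' X'' R Y : GSpace G}

/-! ### Extension along open embeddings -/

namespace Supp

theorem excision_push {p : GMap T X} {p' : GMap T' X} (j : GMap T' T) (hj : IsOpenEmbedding j)
    (comm : ∀ t, p' t = p (j t)) (C : Cosupp p') :
    Function.Bijective (F.map j ((C.push j hj comm).set.preimage j) (C.push j hj comm).set
      subset_rfl) := by
  refine F.excision j _ hj.isEmbedding ?_
  rw [hj.isOpen_range.isClosed_compl.closure_eq]
  have h := (C.compactOver.image comm).isClosed
  refine subset_trans ?_ (interior_maximal (s := (C.push j hj comm).set.carrier)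
    (t := (j '' closure C.set.carrierᶜ)ᶜ) ?_ h.isOpen_compl)
  · exact Set.compl_subset_compl.2 (Set.image_subset_range _ _)
  · exact Set.compl_subset_compl.2 (Set.image_mono subset_closure)

theorem exists_isExtension {p : GMap T X} {p' : GMap T' X} (j : GMap T' T) (hj : IsOpenEmbedding j)
    (comm : ∀ t, p' t = p (j t)) (x : F.Supp p') : ∃ y : F.Supp p, IsExtension j x y := by
  induction x using ind with | h C c => ?_
  have hC := C.preimage_push j hj comm
  obtain ⟨a, ha⟩ := (excision_push j hj comm C).2 (F.res C.set _ hC.le c)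
  refine ⟨mk _ a, C.push j hj comm, a, ?_, ?_, rfl, ?_⟩
  · rw [hC]; exact C.compactOver
  · rw [Cosupp.compl_push]; exact Set.image_subset_range _ _
  · rw [ha]; exact (mk_res _ _).symm

theorem IsExtension.unique {p : GMap T X} {p' : GMap T' X} {j : GMap T' T}
    (hj : IsOpenEmbedding j) (comm : ∀ t, p' t = p (j t)) {x : F.Supp p'} {y y' : F.Supp p}
    (h : IsExtension j x y) (h' : IsExtension j x y') : y = y' := by
  obtain ⟨B, a, hB, hr, rfl, rfl⟩ := h
  obtain ⟨B', a', hB', hr', rfl, e⟩ := h'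
  obtain ⟨C, h, h', e⟩ := mk_eq_iff.1 e
  have hC := C.preimage_push j hj comm
  have key : ∀ D : Cosupp p, D.set.carrierᶜ ⊆ Set.range j →
      C.set.carrier ⊆ (D.set.preimage j).carrier →
      (C.push j hj comm).set.carrier ⊆ D.set.carrier := by
    intro D hD hDC t ht
    by_contra hn
    obtain ⟨s, rfl⟩ := hD hn
    exact ht ⟨s, fun hs => hn (hDC hs), rfl⟩
  have k := key B hr h
  have k' := key B' hr' h'
  refine mk_eq_iff.2 ⟨C.push j hj comm, k, k', (excision_push j hj comm C).1 ?_⟩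
  refine (map_of_res _ _ _).trans (Eq.trans ?_ (map_of_res _ _ _).symm)
  have e' := congrArg (F.res C.set ((C.push j hj comm).set.preimage j) hC.le) e
  exact ((res_res _ _ _).trans (res_map _ _ _)).symm.trans
    (e'.trans ((res_res _ _ _).trans (res_map _ _ _)))

theorem IsExtension.add {p : GMap T X} {p' : GMap T' X} {j : GMap T' T}
    (hj : IsOpenEmbedding j) (comm : ∀ t, p' t = p (j t)) {x x' : F.Supp p'} {y y' : F.Supp p}
    (h : IsExtension j x y) (h' : IsExtension j x' y') : IsExtension j (x + x') (y + y') := by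
  induction x, x' using ind₂ with | h C c c' => ?_
  have hC := C.preimage_push j hj comm
  have hc : CompactOver p' (closure ((C.push j hj comm).set.preimage j).carrierᶜ) := by
    rw [hC]; exact C.compactOver
  have hr : (C.push j hj comm).set.carrierᶜ ⊆ Set.range j := by
    rw [Cosupp.compl_push]; exact Set.image_subset_range _ _
  have key : ∀ c : F.obj T' C.set, ∃ a : F.obj T (C.push j hj comm).set, mk C c =
      mk ⟨_, hc⟩ (F.map j ((C.push j hj comm).set.preimage j) (C.push j hj comm).set
        subset_rfl a) := by
    intro c
    obtain ⟨a, ha⟩ := (excision_push j hj comm C).2 (F.res C.set _ hC.le c)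
    refine ⟨a, ?_⟩
    rw [ha]; exact (mk_res _ _).symm
  obtain ⟨a, ha⟩ := key c
  obtain ⟨a', ha'⟩ := key c'
  rw [h.unique hj comm ⟨_, a, hc, hr, rfl, ha⟩, h'.unique hj comm ⟨_, a', hc, hr, rfl, ha'⟩]
  refine ⟨_, a + a', hc, hr, (mk_add _ _ _).symm, ?_⟩
  rw [ha, ha', ← mk_add, map_add]

theorem IsExtension.pull {p : GMap T X} {p' : GMap T' X} {j : GMap T' T}
    {q : GMap S X'} {q' : GMap S' X'} {k : GMap S' S} {φ : GMap S T} {φ' : GMap S' T'}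
    {f : GMap X' X} (comm : ∀ s, f (q s) = p (φ s)) (hφ : IsProperMap fun s => (q s, φ s))
    (comm' : ∀ s, f (q' s) = p' (φ' s)) (hφ' : IsProperMap fun s => (q' s, φ' s))
    (hk : ∀ s, φ (k s) = j (φ' s)) (hr : ∀ s, φ s ∈ Set.range j → s ∈ Set.range k)
    {x : F.Supp p'} {y : F.Supp p} (h : IsExtension j x y) :
    IsExtension k (Supp.pull φ' f comm' hφ' x) (Supp.pull φ f comm hφ y) := by
  obtain ⟨B, a, hB, hB', rfl, rfl⟩ := h
  have hs : ((B.set.preimage φ).preimage k).carrier = ((B.set.preimage j).preimage φ').carrier := by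
    ext s
    change φ (k s) ∈ B.set.carrier ↔ j (φ' s) ∈ B.set.carrier
    rw [hk]
  have hc : CompactOver q' (closure ((B.set.preimage φ).preimage k).carrierᶜ) := by
    rw [hs]
    exact ((⟨B.set.preimage j, hB⟩ : Cosupp p').pull φ' f comm' hφ').compactOver
  refine ⟨B.pull φ f comm hφ, _, hc, fun s hs => hr s (hB' hs), rfl, ?_⟩
  rw [pull_mk]
  refine mk_eq_of_res hs.le ((res_map _ _ _).trans ?_)
  exact map_map_comm (fun s => (hk s).symm) _ _ _ _ _ _ _ _ _

theorem IsExtension.mul {p : GMap T X} {p' : GMap S X} {j : GMap S T} {q : GMap T' T}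
    {r : GMap T' X} (comm : ∀ t, r t = p (q t)) {q' : GMap S' S} {r' : GMap S' X}
    (comm' : ∀ t, r' t = p' (q' t)) {j' : GMap S' T'} (hj : ∀ s, j (q' s) = q (j' s))
    (h₁ : IsProperMap fun s => (q' s, j' s)) (hr : ∀ t, q t ∈ Set.range j → t ∈ Set.range j')
    {x : F.Supp p'} {w : F.Supp p} (h : IsExtension j x w) (y : F.Supp q) :
    IsExtension j' (mul q' r' comm' x (Supp.pull j' j hj h₁ y)) (mul q r comm w y) := by
  obtain ⟨B, a, hB, hB', rfl, rfl⟩ := h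
  induction y using ind with | h C c => ?_
  have hs : ((B.prod r comm C).set.preimage j').carrier =
      (((⟨B.set.preimage j, hB⟩ : Cosupp p').prod r' comm' (C.pull j' j hj h₁)).set).carrier := by
    ext s
    change q (j' s) ∈ B.set.carrier ∨ j' s ∈ C.set.carrier ↔
      j (q' s) ∈ B.set.carrier ∨ j' s ∈ C.set.carrier
    rw [hj]
  have hc : CompactOver r' (closure ((B.prod r comm C).set.preimage j').carrierᶜ) := by
    rw [hs]; exact Cosupp.compactOver _
  refine ⟨B.prod r comm C, _, hc, fun t ht => hr t (hB' fun h => ht (.inl h)), mul_mk _ _ _ _ _ _ _,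
    ?_⟩
  rw [pull_mk, mul_mk]
  refine mk_eq_of_res hs.le ?_
  refine (res_mul (A' := (B.set.preimage q).preimage j') (B' := C.set.preimage j')
    (fun s (hs : q (j' s) ∈ B.set.carrier) => ?_) subset_rfl _ _ _).trans ?_
  · change j (q' s) ∈ B.set.carrier
    rw [hj]; exact hs
  · refine Eq.trans ?_ (F.map_mul j' ((B.set.preimage q).preimage j') (C.set.preimage j')
      (B.set.preimage q) C.set subset_rfl subset_rfl subset_rfl _ _).symm
    rw [res_self]
    congr 2
    exact (res_map _ _ _).trans (map_map_comm (fun s => hj s) _ _ _ _ _ _ _ _ _)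

theorem IsExtension.comp {p : GMap T X} {p' : GMap T' X} {p'' : GMap T'' X} {k : GMap T' T}
    {j : GMap T'' T'} (hj : IsOpenEmbedding j) (hk : IsOpenEmbedding k)
    (comm : ∀ t, p' t = p (k t)) (comm' : ∀ t, p'' t = p' (j t)) {x : F.Supp p''} {y : F.Supp p'}
    {z : F.Supp p} (h : IsExtension j x y) (h' : IsExtension k y z) :
    IsExtension (k.comp j) x z := by
  have hkj : IsOpenEmbedding (k.comp j) := hk.comp hj
  have c : ∀ t, p'' t = p (k.comp j t) := fun t => (comm' t).trans (comm _)
  obtain ⟨z', hz'⟩ := exists_isExtension (k.comp j) hkj c x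
  obtain ⟨B, a, hB, hr, rfl, e⟩ := id hz'
  have hs : (B.set.preimage k).carrierᶜ =
      j '' ((⟨B.set.preimage (k.comp j), hB⟩ : Cosupp p'').set.carrierᶜ) := by
    ext t
    constructor
    · intro ht
      obtain ⟨s, hs⟩ := hr ht
      have : j s = t := hk.injective hs
      exact ⟨s, fun h => ht (this ▸ h), this⟩
    · rintro ⟨s, hs, rfl⟩ h
      exact hs h
  have hc : CompactOver p' (closure (B.set.preimage k).carrierᶜ) := by
    have := ((⟨B.set.preimage (k.comp j), hB⟩ : Cosupp p'').push j hj comm').compactOver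
    rw [hs]
    rwa [Cosupp.compl_push] at this
  have e₁ : IsExtension k (mk ⟨_, hc⟩ (F.map k (B.set.preimage k) B.set subset_rfl a)) (mk B a) :=
    ⟨B, a, hc, hr.trans (by rintro _ ⟨s, rfl⟩; exact ⟨j s, rfl⟩), rfl, rfl⟩
  have e₂ : IsExtension j x (mk ⟨_, hc⟩ (F.map k (B.set.preimage k) B.set subset_rfl a)) := by
    refine ⟨⟨_, hc⟩, _, hB, ?_, rfl, ?_⟩
    · change (B.set.preimage k).carrierᶜ ⊆ _
      rw [hs]; exact Set.image_subset_range _ _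
    · rw [e]
      exact congrArg (mk _) (map_map (fun _ => rfl) _ _ _ _ _ _ _).symm
  have := h.unique hj comm' e₂
  subst this
  rw [h'.unique hk comm e₁]
  exact hz'

/-- Restriction undoes extension. -/
theorem IsExtension.pull_eq {p : GMap T X} {p' : GMap T' X} {j : GMap T' T} {x : F.Supp p'}
    {y : F.Supp p} (h : IsExtension j x y) {f : GMap X X} {c : ∀ t, f (p' t) = p (j t)}
    {hj : IsProperMap fun t => (p' t, j t)} : Supp.pull j f c hj y = x := by
  obtain ⟨B, a, hB, hr, rfl, rfl⟩ := h
  rfl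

/-- Extension along a homeomorphism. -/
theorem IsExtension.of_homeomorph {p : GMap T X} {p' : GMap T' X} {j : GMap T' T}
    (hj : IsHomeomorph j) (comm : ∀ t, p' t = p (j t)) (y : F.Supp p) :
    IsExtension j (restr j hj.isProperMap comm y) y := by
  induction y using ind with | h B a => ?_
  exact ⟨B, a, (B.pull j (GMap.id X) comm
    (isProperMap_graph j hj.isProperMap comm)).compactOver, by simp [hj.surjective.range_eq], rfl, rfl⟩

end Supp

end CohTheory

namespace CohTheory

variable {F : CohTheory.{u, v} G} {T X T' X' S S' T'' X'' R Y : GSpace G}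

/-! ### The grading -/

theorem homogeneous_induction {A : ClosedInv X} {P : F.obj X A → Prop} (h0 : P 0)
    (hd : ∀ n, ∀ a ∈ F.deg X A n, P a) (hadd : ∀ a b, P a → P b → P (a + b)) (a : F.obj X A) :
    P a := by
  obtain ⟨x, rfl⟩ := (F.internal X A).2 a
  induction x using DirectSum.induction_on with
  | zero => rw [map_zero]; exact h0
  | of i x => rw [DirectSum.coeAddMonoidHom_of]; exact hd i _ x.2
  | add x y hx hy => rw [map_add]; exact hadd _ _ hx hy

/-- The component of degree `n`. -/
noncomputable def part (n : ℤ) (A : ClosedInv X) : F.obj X A →+ F.obj X A :=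
  (F.deg X A n).subtype.comp ((DFinsupp.evalAddMonoidHom n).comp
    (AddEquiv.ofBijective (DirectSum.coeAddMonoidHom (F.deg X A)) (F.internal X A)).symm.toAddMonoidHom)

theorem part_mem (n : ℤ) {A : ClosedInv X} (a : F.obj X A) : part n A a ∈ F.deg X A n :=
  SetLike.coe_mem _

theorem part_of_mem_eq {m : ℤ} (n : ℤ) {A : ClosedInv X} {a : F.obj X A} (h : a ∈ F.deg X A m) :
    part n A a = if m = n then a else 0 := by
  have : (AddEquiv.ofBijective (DirectSum.coeAddMonoidHom (F.deg X A)) (F.internal X A)).symm a =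
      DirectSum.of (fun n => F.deg X A n) m ⟨a, h⟩ := by
    rw [AddEquiv.symm_apply_eq]
    exact (DirectSum.coeAddMonoidHom_of (F.deg X A) m ⟨a, h⟩).symm
  change (((AddEquiv.ofBijective (DirectSum.coeAddMonoidHom (F.deg X A)) (F.internal X A)).symm a) n :
    F.obj X A) = _
  rw [this]
  split_ifs with e
  · subst e; rw [DirectSum.of_eq_same]
  · rw [DirectSum.of_eq_of_ne _ _ _ (Ne.symm e)]; rfl

theorem part_of_mem {n : ℤ} {A : ClosedInv X} {a : F.obj X A} (h : a ∈ F.deg X A n) :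
    part n A a = a := by rw [part_of_mem_eq n h, if_pos rfl]

theorem map_part (n : ℤ) (f : GMap X Y) (A : ClosedInv X) (B : ClosedInv Y)
    (h : A.carrier ⊆ f ⁻¹' B.carrier) (b : F.obj Y B) :
    F.map f A B h (part n B b) = part n A (F.map f A B h b) := by
  induction b using homogeneous_induction with
  | h0 => simp
  | hd m b hb =>
    rw [part_of_mem_eq n hb, part_of_mem_eq n (F.map_deg f A B h m b hb)]
    split_ifs <;> simp
  | hadd a b ha hb => simp only [map_add, ha, hb]

theorem part_mul {k : ℤ} (n : ℤ) (A B : ClosedInv X) (a : F.obj X A) {b : F.obj X B}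
    (hb : b ∈ F.deg X B k) :
    part (n + k) (A.union B) (F.mul A B a b) = F.mul A B (part n A a) b := by
  induction a using homogeneous_induction with
  | h0 => simp
  | hd m a ha =>
    rw [part_of_mem_eq n ha, part_of_mem_eq (n + k) (F.mul_deg A B m k a ha b hb)]
    simp only [add_left_inj]
    split_ifs <;> simp
  | hadd a b ha hb => simp only [map_add, AddMonoidHom.add_apply, ha, hb]

theorem mul_comm_of_even {k : ℤ} (hk : Even k) (A B : ClosedInv X) (a : F.obj X A) {b : F.obj X B}
    (hb : b ∈ F.deg X B k) (h : (A.union B).carrier ⊆ (B.union A).carrier) :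
    F.mul A B a b = F.res (B.union A) (A.union B) h (F.mul B A b a) := by
  induction a using homogeneous_induction with
  | h0 => simp
  | hd m a ha =>
    rw [F.mul_comm A B m k a ha b hb h, Int.negOnePow_even _ (hk.mul_left m)]
    simp [res]
  | hadd a b ha hb => simp only [map_add, AddMonoidHom.add_apply, ha, hb]

namespace Supp

/-- The component of degree `n`. -/
noncomputable def part (n : ℤ) {p : GMap T X} : F.Supp p → F.Supp p :=
  DirectLimit.lift _ (fun B a => mk B (CohTheory.part n B.set a)) fun B C h a => by
    symm
    refine (mk_eq_of_res h ?_).symm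
    exact map_part _ _ _ _ _ _

theorem part_mk (n : ℤ) {p : GMap T X} (B : Cosupp p) (a : F.obj T B.set) :
    part n (mk B a) = mk B (CohTheory.part n B.set a) := rfl

theorem hasDegree_iff {p : GMap T X} {x : F.Supp p} {n : ℤ} : x.HasDegree n ↔ part n x = x := by
  constructor
  · rintro ⟨B, a, ha, rfl⟩
    rw [part_mk, part_of_mem ha]
  · intro h
    induction x using ind with | h B a => ?_
    exact ⟨B, _, part_mem n a, h.symm⟩

theorem part_pull (n : ℤ) {φ : GMap T' T} {f : GMap X' X} {p : GMap T X} {p' : GMap T' X'}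
    {comm : ∀ t, f (p' t) = p (φ t)} {hφ : IsProperMap fun t => (p' t, φ t)} (x : F.Supp p) :
    part n (pull φ f comm hφ x) = pull φ f comm hφ (part n x) := by
  induction x using ind with | h B a => ?_
  exact congrArg (mk _) (map_part _ _ _ _ _ _).symm

theorem HasDegree.pull {n : ℤ} {φ : GMap T' T} {f : GMap X' X} {p : GMap T X} {p' : GMap T' X'}
    {comm : ∀ t, f (p' t) = p (φ t)} {hφ : IsProperMap fun t => (p' t, φ t)} {x : F.Supp p}
    (h : x.HasDegree n) : (pull φ f comm hφ x).HasDegree n := by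
  rw [hasDegree_iff] at h ⊢
  rw [part_pull, h]

theorem part_mul (n : ℤ) {k : ℤ} {p : GMap S X} {q : GMap T S} {r : GMap T X}
    {comm : ∀ t, r t = p (q t)} (x : F.Supp p) {y : F.Supp q} (hy : y.HasDegree k) :
    part (n + k) (mul q r comm x y) = mul q r comm (part n x) y := by
  obtain ⟨C, c, hc, rfl⟩ := hy
  induction x using ind with | h B a => ?_
  rw [mul_mk, part_mk, CohTheory.part_mul n _ _ _ hc, part_mk, mul_mk, map_part]

theorem HasDegree.mul {n k : ℤ} {p : GMap S X} {q : GMap T S} {r : GMap T X}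
    {comm : ∀ t, r t = p (q t)} {x : F.Supp p} {y : F.Supp q} (hx : x.HasDegree n)
    (hy : y.HasDegree k) : (mul q r comm x y).HasDegree (n + k) := by
  rw [hasDegree_iff, part_mul n x hy, hasDegree_iff.1 hx]

theorem IsExtension.part (n : ℤ) {p : GMap T X} {p' : GMap T' X} {j : GMap T' T} {x : F.Supp p'}
    {y : F.Supp p} (h : IsExtension j x y) : IsExtension j (Supp.part n x) (Supp.part n y) := by
  obtain ⟨B, a, hB, hr, rfl, rfl⟩ := h
  refine ⟨B, CohTheory.part n B.set a, hB, hr, rfl, ?_⟩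
  rw [map_part]; rfl

theorem HasDegree.of_isExtension {n : ℤ} {p : GMap T X} {p' : GMap T' X} {j : GMap T' T}
    (hj : IsOpenEmbedding j) (comm : ∀ t, p' t = p (j t)) {x : F.Supp p'} {y : F.Supp p}
    (h : IsExtension j x y) (hx : x.HasDegree n) : y.HasDegree n := by
  rw [hasDegree_iff] at hx ⊢
  have := h.part n
  rw [hx] at this
  exact this.unique hj comm h

end Supp

/-! ### Decomposition into open and closed pieces -/

theorem eq_zero_of_univ {A : ClosedInv X} (hA : ∀ x, x ∈ A.carrier) (a : F.obj X A) : a = 0 := by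
  let g : GMap X A.space :=
    ⟨fun x => ⟨x, hA x⟩, continuous_id.subtype_mk _, fun _ => rfl, fun _ _ _ => rfl⟩
  have hδ : ∀ b, F.δ A b = 0 := fun b => (F.exact_sub A b).2
    ⟨F.map g (.empty _) (.empty _) (Set.empty_subset _) b,
      (map_map (k := GMap.id _) (fun _ => rfl) _ _ _ _ _ subset_rfl _).trans (F.map_id _ _ _)⟩
  have h1 : F.map A.incl (.empty _) (.empty _) (Set.empty_subset _)
      (F.map (GMap.id X) (.empty _) A (Set.empty_subset _) a) = 0 := (F.exact_space A _).2 ⟨a, rfl⟩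
  have h2 : F.map (GMap.id X) (.empty _) A (Set.empty_subset _) a = 0 := by
    have := congrArg (F.map g (.empty _) (.empty _) (Set.empty_subset _)) h1
    rw [map_zero] at this
    exact ((map_map (k := GMap.id _) (fun _ => rfl) _ _ _ _ _ (Set.empty_subset _) _).trans
      (F.map_id _ _ _)).symm.trans this
  obtain ⟨b, rfl⟩ := (F.exact_pair A a).1 h2
  exact hδ b

theorem exists_idempotent (A A' : ClosedInv X) (h : IsCompl A.carrier A'.carrier) :
    ∃ e : F.obj X A', F.map A.incl (.empty _) A' (Set.empty_subset _) e = F.one _ := by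
  have he : (A'.preimage A.incl).carrier ⊆ (ClosedInv.empty A.space).carrier :=
    fun x hx => (Set.disjoint_left.1 h.disjoint x.2 hx).elim
  have hA : A'.carrier = A.carrierᶜ := h.compl_eq.symm
  have hb : Function.Bijective (F.map A.incl (A'.preimage A.incl) A' subset_rfl) := by
    refine F.excision A.incl A' IsEmbedding.subtypeVal ?_
    have : Set.range A.incl = A.carrier := Subtype.range_val
    have ho : IsOpen A'.carrier := by rw [hA]; exact A.isClosed.isOpen_compl
    rw [this, ← hA, A'.isClosed.closure_eq, ho.interior_eq]
  obtain ⟨e, he'⟩ := hb.2 (F.res (.empty _) _ he (F.one _))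
  refine ⟨e, ?_⟩
  have := congrArg (F.res _ (.empty _) (Set.empty_subset _)) he'
  exact (res_map _ _ _).symm.trans (this.trans ((res_res _ _ _).trans (res_self _ _)))

theorem eq_zero_of_excision (A A' B : ClosedInv X) (h : IsCompl A.carrier A'.carrier)
    (hB : A'.carrier ⊆ B.carrier) (a : F.obj X B)
    (ha : F.map A.incl (B.preimage A.incl) B subset_rfl a = 0) : a = 0 := by
  have hA : A'.carrier = A.carrierᶜ := h.compl_eq.symm
  have hb : Function.Bijective (F.map A.incl (B.preimage A.incl) B subset_rfl) := by
    refine F.excision A.incl B IsEmbedding.subtypeVal ?_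
    have : Set.range A.incl = A.carrier := Subtype.range_val
    have ho : IsOpen A'.carrier := by rw [hA]; exact A.isClosed.isOpen_compl
    rw [this, ← hA, A'.isClosed.closure_eq]
    exact interior_maximal hB ho
  exact hb.1 (ha.trans (map_zero _).symm)

theorem map_incl_res_eq_zero (A A' B : ClosedInv X) (h : A.carrier ⊆ A'.carrier)
    (hB : B.carrier ⊆ A'.carrier) (e : F.obj X A') :
    F.map A.incl (B.preimage A.incl) B subset_rfl (F.res A' B hB e) = 0 := by
  have h1 : (B.preimage A.incl).carrier ⊆ (A'.preimage A.incl).carrier := fun x hx => hB hx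
  refine (map_of_res _ _ _).trans ((res_map subset_rfl h1 e).symm.trans ?_)
  rw [eq_zero_of_univ (A := A'.preimage A.incl) (fun x => h x.2) (F.map A.incl _ A' subset_rfl e),
    map_zero]

theorem eq_zero_of_pieces {A A' : ClosedInv X} (h : IsCompl A.carrier A'.carrier) (B : ClosedInv X)
    (a : F.obj X B) (ha : F.map A.incl (B.preimage A.incl) B subset_rfl a = 0)
    (ha' : F.map A'.incl (B.preimage A'.incl) B subset_rfl a = 0) : a = 0 := by
  obtain ⟨e, he⟩ := exists_idempotent (F := F) A A' h
  obtain ⟨e', he'⟩ := exists_idempotent (F := F) A' A h.symm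
  have hE : ∀ C : ClosedInv X, (ClosedInv.empty X).carrier ⊆ C.carrier := fun _ => Set.empty_subset _
  have hone : F.one X = F.res A' (.empty X) (hE _) e + F.res A (.empty X) (hE _) e' := by
    have i1 : F.map A.incl (.empty _) (.empty _) (Set.empty_subset _)
        (F.one X - (F.res A' (.empty X) (hE _) e + F.res A (.empty X) (hE _) e')) = 0 := by
      rw [map_sub, map_add, F.map_one, map_of_res, he]
      have := map_incl_res_eq_zero A A (.empty X) subset_rfl (hE _) e'
      have h3 : F.map A.incl (.empty _) (.empty X) (Set.empty_subset _)
        (F.res A (.empty X) (hE _) e') = 0 := this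
      rw [h3]; abel
    have i2 : F.map A'.incl (.empty _) (.empty _) (Set.empty_subset _)
        (F.one X - (F.res A' (.empty X) (hE _) e + F.res A (.empty X) (hE _) e')) = 0 := by
      rw [map_sub, map_add, F.map_one, map_of_res (B := A), he']
      have := map_incl_res_eq_zero A' A' (.empty X) subset_rfl (hE _) e
      have h3 : F.map A'.incl (.empty _) (.empty X) (Set.empty_subset _)
        (F.res A' (.empty X) (hE _) e) = 0 := this
      rw [h3]; abel
    obtain ⟨d, hd⟩ := (F.exact_space A' _).1 i2
    have hd0 : d = 0 := by
      refine eq_zero_of_excision A A' A' h subset_rfl d ?_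
      have he : (A'.preimage A.incl).carrier ⊆ (ClosedInv.empty A.space).carrier :=
        fun x hx => (Set.disjoint_left.1 h.disjoint x.2 hx).elim
      rw [← hd] at i1
      have := congrArg (F.res _ (A'.preimage A.incl) he) i1
      rw [map_zero] at this
      refine Eq.trans ?_ this
      have hE' : (ClosedInv.empty X).carrier ⊆ (GMap.id X) ⁻¹' A'.carrier := Set.empty_subset _
      refine Eq.trans ?_ (congrArg _ (map_map (k := A.incl) (fun _ => rfl) _ _ _
        (Set.empty_subset _) hE' (Set.empty_subset _) d)).symm
      exact (res_map _ _ _).symm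
    rw [hd0, map_zero] at hd
    exact (sub_eq_zero.1 hd.symm)
  have hs : (B.union (.empty X)).carrier ⊆ B.carrier := fun x hx => hx.elim id fun h => h.elim
  have hs' : B.carrier ⊆ (B.union (.empty X)).carrier := fun x hx => .inl hx
  have key : ∀ (A A' : ClosedInv X) (h : IsCompl A.carrier A'.carrier) (e : F.obj X A')
      (ha : F.map A.incl (B.preimage A.incl) B subset_rfl a = 0),
      F.mul B (.empty X) a (F.res A' (.empty X) (hE _) e) = 0 := by
    intro A A' h e ha
    have h0 : F.mul B A' a e = 0 := by
      refine eq_zero_of_excision A A' _ h Set.subset_union_right _ ?_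
      refine (F.map_mul A.incl (B.preimage A.incl) (A'.preimage A.incl) B A' subset_rfl subset_rfl
        subset_rfl a e).trans ?_
      rw [ha, map_zero]; rfl
    have hu : (B.union (.empty X)).carrier ⊆ (B.union A').carrier :=
      Set.union_subset_union_right _ (hE _)
    have := res_mul (subset_refl B.carrier) (hE A') hu a e
    rw [h0, map_zero, res_self] at this
    exact this.symm
  have h1 : F.res B (B.union (.empty X)) hs a = 0 := by
    refine (F.mul_one B a hs).symm.trans ?_
    rw [hone, map_add, key A A' h e ha, key A' A h.symm e' ha', add_zero]
  have := congrArg (F.res _ B hs') h1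
  rwa [res_res, res_self, map_zero] at this

namespace Supp

theorem eq_zero_of_isEmpty {p : GMap T X} [IsEmpty T] (x : F.Supp p) : x = 0 := by
  induction x using ind with | h B a => ?_
  rw [eq_zero_of_univ (fun t => isEmptyElim t) a, mk_zero]

theorem pull_zero (φ : GMap T' T) (f : GMap X' X) {p : GMap T X} {p' : GMap T' X'}
    (comm : ∀ t, f (p' t) = p (φ t)) (hφ : IsProperMap fun t => (p' t, φ t)) :
    pull φ f comm hφ (0 : F.Supp p) = 0 := by
  have := pull_add φ f comm hφ (0 : F.Supp p) 0
  rwa [add_zero, left_eq_add] at this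

theorem pull_sub (φ : GMap T' T) (f : GMap X' X) {p : GMap T X} {p' : GMap T' X'}
    (comm : ∀ t, f (p' t) = p (φ t)) (hφ : IsProperMap fun t => (p' t, φ t)) (x y : F.Supp p) :
    pull φ f comm hφ (x - y) = pull φ f comm hφ x - pull φ f comm hφ y :=
  map_sub (AddMonoidHom.mk' (pull φ f comm hφ) (pull_add φ f comm hφ)) x y

theorem isClosedEmbedding_incl (A : ClosedInv T) : IsClosedEmbedding A.incl :=
  A.isClosed.isClosedEmbedding_subtypeVal

theorem isOpenEmbedding_incl {A A' : ClosedInv T} (h : IsCompl A.carrier A'.carrier) :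
    IsOpenEmbedding A.incl := by
  refine IsOpen.isOpenEmbedding_subtypeVal ?_
  rw [← h.symm.compl_eq]
  exact A'.isClosed.isOpen_compl

theorem eq_zero_of_two_pieces {p : GMap T X} {A A' : ClosedInv T}
    (h : IsCompl A.carrier A'.carrier) (x : F.Supp p)
    (hx : restr A.incl (isClosedEmbedding_incl A).isProperMap (p' := p.comp A.incl)
      (fun _ => rfl) x = 0)
    (hx' : restr A'.incl (isClosedEmbedding_incl A').isProperMap (p' := p.comp A'.incl)
      (fun _ => rfl) x = 0) : x = 0 := by
  induction x using ind with | h B a => ?_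
  obtain ⟨C, hC, e⟩ := mk_eq_zero hx
  obtain ⟨C', hC', e'⟩ := mk_eq_zero hx'
  let D := C.push A.incl (isOpenEmbedding_incl h) (p := p) (fun _ => rfl)
  let D' := C'.push A'.incl (isOpenEmbedding_incl h.symm) (p := p) (fun _ => rfl)
  have hD : ∀ t : A.carrier, (t : T) ∈ (D.inter D').set.carrier ↔ t ∈ C.set.carrier := by
    intro t
    constructor
    · rintro ⟨h1, -⟩
      by_contra hn
      exact h1 ⟨t, hn, rfl⟩
    · refine fun ht => ⟨?_, ?_⟩
      · rintro ⟨s, hs, e⟩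
        exact hs (by rwa [Subtype.ext e])
      · rintro ⟨s, hs, e⟩
        exact Set.disjoint_left.1 h.disjoint t.2 ((show (s : T) = t from e) ▸ s.2)
  have hD' : ∀ t : A'.carrier, (t : T) ∈ (D.inter D').set.carrier ↔ t ∈ C'.set.carrier := by
    intro t
    constructor
    · rintro ⟨-, h1⟩
      by_contra hn
      exact h1 ⟨t, hn, rfl⟩
    · refine fun ht => ⟨?_, ?_⟩
      · rintro ⟨s, hs, e⟩
        exact Set.disjoint_left.1 h.disjoint s.2 ((show (s : T) = t from e) ▸ t.2)
      · rintro ⟨s, hs, e⟩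
        exact hs (by rwa [Subtype.ext e])
  have hB : (D.inter D').set.carrier ⊆ B.set.carrier := by
    intro t ht
    have : t ∈ A.carrier ⊔ A'.carrier := h.codisjoint.eq_top ▸ trivial
    rcases this with h1 | h1
    · exact hC ((hD ⟨t, h1⟩).1 ht)
    · exact hC' ((hD' ⟨t, h1⟩).1 ht)
  rw [← mk_res hB]
  have k : ((D.inter D').set.preimage A.incl).carrier ⊆ C.set.carrier := fun t ht => (hD t).1 ht
  have k' : ((D.inter D').set.preimage A'.incl).carrier ⊆ C'.set.carrier := fun t ht => (hD' t).1 ht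
  rw [eq_zero_of_pieces h (D.inter D').set (F.res _ _ hB a), mk_zero]
  · have := congrArg (F.res _ ((D.inter D').set.preimage A.incl) k) e
    rw [map_zero] at this
    refine (map_of_res _ _ _).trans (Eq.trans ?_ this)
    exact ((res_res _ _ _).trans (res_map _ _ _)).symm
  · have := congrArg (F.res _ ((D.inter D').set.preimage A'.incl) k') e'
    rw [map_zero] at this
    refine (map_of_res _ _ _).trans (Eq.trans ?_ this)
    exact ((res_res _ _ _).trans (res_map _ _ _)).symm

end Supp

end CohTheory

/-- The piece of a `G`-space where a locally constant invariant function satisfies a condition. -/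
def GSpace.piece {ι : Type*} [TopologicalSpace ι] [DiscreteTopology ι] (T : GSpace G) (r : T → ι)
    (hr : Continuous r) (hi : ∀ g x h, r (T.act g x h) = r x) (s : Set ι) : ClosedInv T :=
  ⟨r ⁻¹' s, (isClosed_discrete s).preimage hr, fun g x h hx => by
    rw [Set.mem_preimage, hi]; exact hx⟩

theorem GSpace.isCompl_piece {ι : Type*} [TopologicalSpace ι] [DiscreteTopology ι] (T : GSpace G)
    (r : T → ι) (hr : Continuous r) (hi : ∀ g x h, r (T.act g x h) = r x) (s : Set ι) :
    IsCompl (T.piece r hr hi s).carrier (T.piece r hr hi sᶜ).carrier :=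
  isCompl_compl

namespace CohTheory

namespace Supp

variable {F : CohTheory.{u, v} G} {T X T' X' S S' T'' X'' R Y : GSpace G}

theorem isOpen_range_piece {ι : Type*} [TopologicalSpace ι] [DiscreteTopology ι] (T : GSpace G)
    (r : T → ι) (hr : Continuous r) (hi : ∀ g x h, r (T.act g x h) = r x) (s : Set ι) :
    IsOpen (Set.range (T.piece r hr hi s).incl) := by
  rw [show Set.range (T.piece r hr hi s).incl = r ⁻¹' s from Subtype.range_val]
  exact (isOpen_discrete s).preimage hr

theorem eq_zero_of_finite_pieces {ι : Type*} [TopologicalSpace ι] [DiscreteTopology ι]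
    (s : Finset ι) : ∀ {T : GSpace G} {p : GMap T X} (r : T → ι) (_ : Continuous r)
    (_ : ∀ g x h, r (T.act g x h) = r x) (_ : ∀ t, r t ∈ s) (x : F.Supp p)
    (_ : ∀ (N : GSpace G) (i : GMap N T) (hi : IsClosedEmbedding i), IsOpen (Set.range i) →
      ∀ k, (∀ t, r (i t) = k) →
        restr i hi.isProperMap (p' := p.comp i) (fun _ => rfl) x = 0), x = 0 := by
  classical
  induction s using Finset.induction_on with
  | empty =>
    intro T p r hr hi hs x hx
    have : IsEmpty T := ⟨fun t => by simpa using hs t⟩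
    exact eq_zero_of_isEmpty x
  | insert k s hk ih =>
    intro T p r hr hi hs x hx
    refine eq_zero_of_two_pieces (T.isCompl_piece r hr hi {k}) x ?_ ?_
    · exact hx _ _ (isClosedEmbedding_incl _) (isOpen_range_piece T r hr hi _) k fun t => t.2
    · refine ih (T := (T.piece r hr hi {k}ᶜ).space) (fun t => r t.1) (hr.comp continuous_subtype_val) (fun g x h => hi _ _ _)
        (fun t => (Finset.mem_insert.1 (hs t.1)).resolve_left t.2) _ ?_
      intro N i hi' ho l hl
      have hc : IsClosedEmbedding ((T.piece r hr hi {k}ᶜ).incl.comp i) :=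
        (isClosedEmbedding_incl _).comp hi'
      refine (pull_pull (fun _ => rfl) x).trans (hx N ((T.piece r hr hi {k}ᶜ).incl.comp i) hc ?_ l hl)
      rw [show Set.range ((T.piece r hr hi {k}ᶜ).incl.comp i) = _ from
        Set.range_comp (T.piece r hr hi {k}ᶜ).incl i]
      exact (isOpenEmbedding_incl (T.isCompl_piece r hr hi {k}).symm).isOpenMap _ ho

theorem ext_of_finite_pieces {ι : Type*} [TopologicalSpace ι] [DiscreteTopology ι]
    (s : Finset ι) {p : GMap T X} (r : T → ι) (hr : Continuous r)
    (hi : ∀ g x h, r (T.act g x h) = r x) (hs : ∀ t, r t ∈ s) (x y : F.Supp p)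
    (h : ∀ (N : GSpace G) (i : GMap N T) (hi : IsClosedEmbedding i), IsOpen (Set.range i) →
      ∀ k, (∀ t, r (i t) = k) →
        restr i hi.isProperMap (p' := p.comp i) (fun _ => rfl) x =
        restr i hi.isProperMap (p' := p.comp i) (fun _ => rfl) y) : x = y := by
  refine sub_eq_zero.1 (eq_zero_of_finite_pieces s r hr hi hs _ fun N i hi ho k hk => ?_)
  rw [restr, pull_sub, sub_eq_zero]
  exact h N i hi ho k hk

theorem HasDegree.of_finite_pieces {ι : Type*} [TopologicalSpace ι] [DiscreteTopology ι]
    (s : Finset ι) {p : GMap T X} (r : T → ι) (hr : Continuous r)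
    (hi : ∀ g x h, r (T.act g x h) = r x) (hs : ∀ t, r t ∈ s) {x : F.Supp p} {n : ℤ}
    (h : ∀ (N : GSpace G) (i : GMap N T) (hi : IsClosedEmbedding i), IsOpen (Set.range i) →
      ∀ k, (∀ t, r (i t) = k) →
        (restr i hi.isProperMap (p' := p.comp i) (fun _ => rfl) x).HasDegree n) :
    x.HasDegree n := by
  rw [hasDegree_iff]
  refine ext_of_finite_pieces s r hr hi hs _ _ fun N i hi ho k hk => ?_
  rw [restr, ← part_pull]
  exact hasDegree_iff.1 (h N i hi ho k hk)

theorem hasDegree_of_isEmpty {p : GMap T X} [IsEmpty T] (x : F.Supp p) (n : ℤ) :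
    x.HasDegree n := by
  rw [hasDegree_iff]
  exact (eq_zero_of_isEmpty _).trans (eq_zero_of_isEmpty _).symm

theorem HasDegree.localDegree {n : ℤ} {p : GMap T X} {x : F.Supp p} (h : x.HasDegree n)
    {d : T → ℤ} (hd : ∀ t, d t = n) : x.HasLocalDegree d := by
  intro N i hi ho k hk
  by_cases hN : Nonempty N
  · obtain ⟨t⟩ := hN
    rw [← hk t, hd]
    exact h.pull
  · rw [not_nonempty_iff] at hN
    exact hasDegree_of_isEmpty _ _

/-- A class of even degree commutes with all classes. -/
theorem mul_comm_of_even {k : ℤ} (hk : Even k) {p₁ : GMap S X} {p₂ : GMap S' X} {q₁ : GMap T S}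
    {q₂ : GMap T S'} {r : GMap T X} {c₁ : ∀ t, r t = p₁ (q₁ t)} {c₂ : ∀ t, r t = p₂ (q₂ t)}
    {d₁ : ∀ t, p₁ (q₁ t) = p₂ (q₂ t)} {h₁ : IsProperMap fun t => (q₁ t, q₂ t)}
    {d₂ : ∀ t, p₂ (q₂ t) = p₁ (q₁ t)} {h₂ : IsProperMap fun t => (q₂ t, q₁ t)}
    (x : F.Supp p₁) {y : F.Supp p₂} (hy : y.HasDegree k) :
    mul q₁ r c₁ x (pull q₂ p₁ d₁ h₁ y) = mul q₂ r c₂ y (pull q₁ p₂ d₂ h₂ x) := by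
  obtain ⟨C, c, hc, rfl⟩ := hy
  induction x using ind with | h B a => ?_
  rw [pull_mk, pull_mk, mul_mk, mul_mk]
  symm
  have hs : ((B.set.preimage q₁).union (C.set.preimage q₂)).carrier ⊆
    ((C.set.preimage q₂).union (B.set.preimage q₁)).carrier := fun t ht => ht.symm
  exact mk_eq_of_res hs (CohTheory.mul_comm_of_even hk _ _ _ (F.map_deg _ _ _ _ _ _ hc) hs).symm

end Supp

end CohTheory

end

section

/-! ### Paracompactness -/

theorem ParacompactSpace.of_exhaustion {X : Type u} [TopologicalSpace X] (ρ : X → ℝ)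
    (hρ : Continuous ρ) (h0 : ∀ x, 0 ≤ ρ x) (h : ∀ n : ℕ, ParacompactSpace {x | ρ x ≤ n}) :
    ParacompactSpace X := by
  refine ⟨fun α s ho hc => ?_⟩
  have hr : ∀ n : ℕ, ∃ v : α → Set {x | ρ x ≤ n}, (∀ a, IsOpen (v a)) ∧ ⋃ a, v a = Set.univ ∧
      LocallyFinite v ∧ ∀ a, v a ⊆ Subtype.val ⁻¹' s a := fun n => by
    have := h n
    refine precise_refinement _ (fun a => (ho a).preimage continuous_subtype_val) ?_
    rw [← Set.preimage_iUnion, hc, Set.preimage_univ]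
  choose v vo vc vf vs using hr
  have hw : ∀ n a, ∃ w : Set X, IsOpen w ∧ Subtype.val ⁻¹' w = v n a := fun n a =>
    isOpen_induced_iff.1 (vo n a)
  choose w wo hw using hw
  refine ⟨ℕ × α, fun b => w b.1 b.2 ∩ {x | ρ x < b.1 ∧ (b.1 : ℝ) < ρ x + 2}, fun b => ?_, ?_, ?_,
    ?_⟩
  · exact (wo _ _).inter ((isOpen_lt hρ continuous_const).inter
      (isOpen_lt continuous_const (hρ.add continuous_const)))
  · refine Set.eq_univ_of_forall fun x => ?_
    have h1 : ρ x < (⌊ρ x⌋₊ + 1 : ℕ) := by exact_mod_cast Nat.lt_floor_add_one (ρ x)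
    have h2 : ((⌊ρ x⌋₊ + 1 : ℕ) : ℝ) < ρ x + 2 := by
      have := Nat.floor_le (h0 x)
      push_cast; linarith
    have h3 : x ∈ {y | ρ y ≤ (⌊ρ x⌋₊ + 1 : ℕ)} := h1.le
    obtain ⟨a, ha⟩ := Set.mem_iUnion.1 ((vc (⌊ρ x⌋₊ + 1)).ge (Set.mem_univ ⟨x, h3⟩))
    rw [← hw] at ha
    exact Set.mem_iUnion.2 ⟨(⌊ρ x⌋₊ + 1, a), ha, h1, h2⟩
  · intro x
    have key : ∀ n : ℕ, ∃ N ∈ 𝓝 x,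
        {a : α | (w n a ∩ {x | ρ x < n} ∩ N).Nonempty}.Finite := by
      intro n
      by_cases hx : ρ x ≤ n
      · obtain ⟨N, hN, hf⟩ := vf n ⟨x, hx⟩
        rw [nhds_subtype, Filter.mem_comap] at hN
        obtain ⟨N', hN', hs⟩ := hN
        refine ⟨N', hN', hf.subset ?_⟩
        rintro a ⟨y, ⟨hy, hy'⟩, hyN⟩
        have hy'' : y ∈ {x | ρ x ≤ n} := (show ρ y < n from hy').le
        refine ⟨⟨y, hy''⟩, ?_, hs hyN⟩
        rw [← hw]; exact hy
      · refine ⟨{y | (n : ℝ) < ρ y}, (isOpen_lt continuous_const hρ).mem_nhds (not_le.1 hx), ?_⟩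
        convert Set.finite_empty
        ext a
        refine ⟨?_, fun h => h.elim⟩
        rintro ⟨y, ⟨-, hy⟩, hy'⟩
        exact lt_asymm (show ρ y < n from hy) (show (n : ℝ) < ρ y from hy')
    choose N hN hf using key
    obtain ⟨m, hm⟩ := exists_nat_gt (ρ x + 3)
    refine ⟨{y | ρ y < ρ x + 1} ∩ ⋂ n ∈ Finset.range m, N n, Filter.inter_mem
      ((isOpen_lt hρ continuous_const).mem_nhds (by simp)) ((Filter.biInter_finset_mem _).2
        fun n _ => hN n), ?_⟩
    refine (Set.Finite.biUnion (Finset.range m).finite_toSet fun n _ =>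
      (hf n).image fun a => (n, a)).subset ?_
    rintro ⟨n, a⟩ ⟨y, ⟨hy1, hy2, hy3⟩, hy4, hy5⟩
    have hn : n ∈ Finset.range m := by
      rw [Finset.mem_range, ← Nat.cast_lt (α := ℝ)]
      have : ρ y < ρ x + 1 := hy4
      simp only at hy3
      linarith
    exact Set.mem_biUnion hn ⟨a, ⟨y, ⟨hy1, hy2⟩, Set.mem_iInter₂.1 hy5 n hn⟩, rfl⟩
  · rintro ⟨n, a⟩
    refine ⟨a, ?_⟩
    rintro x ⟨hx, hx', -⟩
    have h3 : x ∈ {x | ρ x ≤ n} := (show ρ x < n from hx').le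
    have : (⟨x, h3⟩ : {x | ρ x ≤ n}) ∈ v n a := by rw [← hw]; exact hx
    exact vs n a this

theorem IsProperMap.paracompactSpace {X Y : Type u} [TopologicalSpace X] [TopologicalSpace Y]
    [ParacompactSpace Y] [T1Space Y] {f : X → Y} (hf : IsProperMap f) : ParacompactSpace X := by
  refine ⟨fun α s ho hc => ?_⟩
  have h1 : ∀ y, ∃ A : Finset α, f ⁻¹' {y} ⊆ ⋃ a ∈ A, s a := fun y =>
    (hf.isCompact_preimage isCompact_singleton).elim_finite_subcover s ho
      (by rw [hc]; exact Set.subset_univ _)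
  choose A hA using h1
  let O : Y → Set Y := fun y => (f '' (⋃ a ∈ A y, s a)ᶜ)ᶜ
  have hO : ∀ y, IsOpen (O y) := fun y => (hf.isClosedMap _
    (isOpen_biUnion fun a _ => ho a).isClosed_compl).isOpen_compl
  obtain ⟨w, wo, wc, wf, ws⟩ := precise_refinement O hO (Set.eq_univ_of_forall fun y =>
    Set.mem_iUnion.2 ⟨y, by rintro ⟨x, hx, hy⟩; exact hx (hA y hy)⟩)
  refine ⟨{p : Y × α // p.2 ∈ A p.1}, fun b => f ⁻¹' w b.1.1 ∩ s b.1.2, fun b =>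
    ((wo _).preimage hf.continuous).inter (ho _), Set.eq_univ_of_forall fun x => ?_, fun x => ?_,
    fun b => ⟨b.1.2, Set.inter_subset_right⟩⟩
  · obtain ⟨y, hy⟩ := Set.mem_iUnion.1 (wc ▸ Set.mem_univ (f x) : f x ∈ ⋃ y, w y)
    have : x ∈ ⋃ a ∈ A y, s a := by
      by_contra hn
      exact ws y hy ⟨x, hn, rfl⟩
    obtain ⟨a, ha, hx⟩ := Set.mem_iUnion₂.1 this
    exact Set.mem_iUnion.2 ⟨⟨(y, a), ha⟩, hy, hx⟩
  · obtain ⟨N, hN, hfin⟩ := wf (f x)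
    refine ⟨f ⁻¹' N, hf.continuous.continuousAt hN, ?_⟩
    have : (⋃ y ∈ {y | (w y ∩ N).Nonempty}, (fun a => (y, a)) '' (A y : Set α)).Finite :=
      hfin.biUnion fun y _ => (A y).finite_toSet.image _
    refine (this.preimage Subtype.val_injective.injOn).subset ?_
    rintro ⟨⟨y, a⟩, ha⟩ ⟨z, ⟨hz, -⟩, hz'⟩
    exact Set.mem_biUnion (show y ∈ {y | (w y ∩ N).Nonempty} from ⟨f z, hz, hz'⟩) ⟨a, ha, rfl⟩

theorem ParacompactSpace.of_pos {X : Type u} [TopologicalSpace X] [ParacompactSpace X]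
    (χ : X → ℝ) (hχ : Continuous χ) : ParacompactSpace {x | 0 < χ x} := by
  refine ParacompactSpace.of_exhaustion (fun x => (χ x.1)⁻¹)
    ((hχ.comp continuous_subtype_val).inv₀ fun x => x.2.ne') (fun x => (inv_pos.2 x.2).le) fun n => ?_
  have hc : IsClosedEmbedding (fun x : {x : {x | 0 < χ x} | (χ x.1)⁻¹ ≤ n} => (x.1.1 : X)) := by
    refine ⟨IsEmbedding.subtypeVal.comp IsEmbedding.subtypeVal, ?_⟩
    have : Set.range (fun x : {x : {x | 0 < χ x} | (χ x.1)⁻¹ ≤ n} => (x.1.1 : X)) =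
        {x | 1 ≤ n * χ x} := by
      ext x
      constructor
      · rintro ⟨⟨⟨y, hy⟩, hy'⟩, rfl⟩
        have h1 : 0 < χ y := hy
        have h2 : (χ y)⁻¹ ≤ n := hy'
        exact (inv_le_iff_one_le_mul₀ h1).1 h2
      · intro hx
        have h1 : 1 ≤ n * χ x := hx
        have hn : (0 : ℝ) ≤ n := Nat.cast_nonneg n
        have h2 : 0 < χ x := by
          by_contra hneg
          have := mul_nonpos_of_nonneg_of_nonpos hn (not_lt.1 hneg)
          linarith
        exact ⟨⟨⟨x, h2⟩, (inv_le_iff_one_le_mul₀ h2).2 h1⟩, rfl⟩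
    rw [this]
    exact isClosed_le continuous_const (continuous_const.mul hχ)
  exact hc.paracompactSpace

/-! ### Invariant functions -/

variable {G : TopGroupoid.{u}}

theorem GSpace.act_inv (X : GSpace G) (g : G.Arr) (x : X) (h : G.src (G.inv g) = X.anchor x)
    (h' : G.src g = X.anchor (X.act (G.inv g) x h)) :
    X.act g (X.act (G.inv g) x h) h' = x := by
  rw [← X.mul_act g (G.inv g) x (G.rng_inv g).symm h]
  exact (X.act_congr_left ((G.mul_inv g).trans (congrArg G.one ((G.src_inv g).symm.trans h))) _
    (G.src_one _)).trans (X.one_act x)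

section Average

theorem continuous_fibre (Y : GSpace G) {φ : Y → ℝ} (hφ : Continuous φ) :
    Continuous fun p : {p : G.Arr × Y // G.rng p.1 = Y.anchor p.2} =>
      φ (Y.act (G.inv p.1.1) p.1.2 ((G.src_inv _).trans p.2)) := by
  refine hφ.comp ?_
  exact Y.continuous_act.comp (f := fun p : {p : G.Arr × Y // G.rng p.1 = Y.anchor p.2} =>
    (⟨(G.inv p.1.1, p.1.2), (G.src_inv _).trans p.2⟩ : {p : G.Arr × Y // G.src p.1 = Y.anchor p.2}))
    (((G.continuous_inv.comp (continuous_fst.comp continuous_subtype_val)).prodMk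
      (continuous_snd.comp continuous_subtype_val)).subtype_mk _)

theorem exists_fibre_extension (Y : GSpace G) {φ : Y → ℝ} (hφ : Continuous φ) (y : Y) :
    ∃ f : C(G.Arr, ℝ), ∀ g (h : G.rng g = Y.anchor y),
      f g = φ (Y.act (G.inv g) y ((G.src_inv _).trans h)) := by
  have hc : IsClosed {g | G.rng g = Y.anchor y} := isClosed_eq G.continuous_rng continuous_const
  let f₀ : C({g | G.rng g = Y.anchor y}, ℝ) :=
    ⟨fun g => φ (Y.act (G.inv g.1) y ((G.src_inv _).trans g.2)),
      (continuous_fibre Y hφ).comp (f := fun g : {g | G.rng g = Y.anchor y} =>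
        (⟨(g.1, y), g.2⟩ : {p : G.Arr × Y // G.rng p.1 = Y.anchor p.2})) (by fun_prop)⟩
  obtain ⟨f, hf⟩ := ContinuousMap.exists_restrict_eq hc f₀
  exact ⟨f, fun g h => congrArg (fun k : C({g | G.rng g = Y.anchor y}, ℝ) => k ⟨g, h⟩) hf⟩

variable [MeasurableSpace G.Arr] [BorelSpace G.Arr] {μ : G.Obj → Measure G.Arr} {S : Set G.Arr}

theorem integrable_of_fibre [∀ z, IsProbabilityMeasure (μ z)] (hS : CompactOver G.rng S)
    (hμ : ∀ z, μ z {g | g ∈ S ∧ G.rng g = z}ᶜ = 0) (f : C(G.Arr, ℝ)) (z : G.Obj) :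
    Integrable f (μ z) := by
  have hK : IsCompact {g | g ∈ S ∧ G.rng g = z} := by
    have := (hS.isCompact_preimage (isCompact_singleton (x := z))).image continuous_subtype_val
    convert this using 1
    ext g
    simp only [Set.mem_ofPred_eq, Set.mem_image, Set.mem_preimage, Set.mem_singleton_iff,
      Subtype.exists, exists_and_left, exists_prop, exists_eq_right_right]
    tauto
  obtain ⟨C, hC⟩ := hK.exists_bound_of_continuousOn f.continuous.continuousOn
  refine Integrable.of_bound f.continuous.aestronglyMeasurable C ?_
  filter_upwards [mem_ae_iff.2 (hμ z)] with g hg using hC g hg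

theorem integral_le_of_fibre [∀ z, IsProbabilityMeasure (μ z)] (hS : CompactOver G.rng S)
    (hμ : ∀ z, μ z {g | g ∈ S ∧ G.rng g = z}ᶜ = 0) (f f' : C(G.Arr, ℝ)) (z : G.Obj)
    (h : ∀ g ∈ S, G.rng g = z → f g ≤ f' g) : ∫ g, f g ∂(μ z) ≤ ∫ g, f' g ∂(μ z) := by
  refine integral_mono_ae (integrable_of_fibre hS hμ f z) (integrable_of_fibre hS hμ f' z) ?_
  filter_upwards [mem_ae_iff.2 (hμ z)] with g hg using h g hg.1 hg.2

theorem exists_average [∀ z, IsProbabilityMeasure (μ z)] (hS : CompactOver G.rng S)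
    (hμ : ∀ z, μ z {g | g ∈ S ∧ G.rng g = z}ᶜ = 0)
    (hcont : ∀ f : G.Arr → ℝ, Continuous f → Continuous fun z => ∫ g, f g ∂(μ z))
    (hinv : ∀ g : G.Arr, ∀ A : Set G.Arr, MeasurableSet A →
      μ (G.rng g) A = μ (G.src g) {h | ∃ e : G.src g = G.rng h, G.mul g h e ∈ A})
    (Y : GSpace G) {φ : Y → ℝ} (hφ : Continuous φ) :
    ∃ ψ : Y → ℝ, Continuous ψ ∧ (∀ g y h, ψ (Y.act g y h) = ψ y) ∧
      (∀ y c, (∀ g h, c ≤ φ (Y.act g y h)) → c ≤ ψ y) ∧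
      (∀ y c, (∀ g h, φ (Y.act g y h) ≤ c) → ψ y ≤ c) := by
  choose f hf using exists_fibre_extension Y hφ
  refine ⟨fun y => ∫ g, f y g ∂(μ (Y.anchor y)), ?_, ?_, ?_, ?_⟩
  · rw [continuous_iff_continuousAt]
    intro y₀
    rw [Metric.continuousAt_iff']
    intro ε hε
    have h1 : ∀ᶠ y in 𝓝 y₀, ∀ g ∈ S, G.rng g = Y.anchor y → |f y g - f y₀ g| < ε / 2 := by
      rw [Filter.eventually_iff, Filter.mem_iff_ultrafilter]
      intro U hU
      by_contra hn
      have hn' := Ultrafilter.compl_mem_iff_notMem.2 hn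
      let c : Y → G.Arr := fun y => by
        classical
        exact if h : ∃ g ∈ S, G.rng g = Y.anchor y ∧ ¬ |f y g - f y₀ g| < ε / 2 then h.choose
          else G.one (Y.anchor y)
      have hc : ∀ᶠ y in (U : Filter Y), c y ∈ S ∧ G.rng (c y) = Y.anchor y ∧
          ¬ |f y (c y) - f y₀ (c y)| < ε / 2 := by
        refine Filter.mem_of_superset hn' fun y hy => ?_
        have hy' : ∃ g ∈ S, G.rng g = Y.anchor y ∧ ¬ |f y g - f y₀ g| < ε / 2 := by
          simpa only [Set.mem_compl_iff, Set.mem_ofPred_eq, not_forall, exists_prop] using hy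
        have : c y = hy'.choose := dif_pos hy'
        rw [Set.mem_ofPred_eq, this]
        exact hy'.choose_spec
      have ha : Filter.Tendsto Y.anchor U (𝓝 (Y.anchor y₀)) :=
        (Y.continuous_anchor.tendsto y₀).mono_left hU
      obtain ⟨g₀, hg₀, hl⟩ := (compactOver_iff G.continuous_rng).1 hS (U.map c) (Y.anchor y₀)
        (hc.mono fun y hy => hy.1) (by
          rw [Ultrafilter.coe_map, Filter.tendsto_map'_iff]
          exact ha.congr' (hc.mono fun y hy => hy.2.1.symm))
      have hl' : Filter.Tendsto c U (𝓝 g₀) := hl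
      have hr : G.rng g₀ = Y.anchor y₀ := tendsto_nhds_unique
        ((G.continuous_rng.tendsto g₀).comp hl') (ha.congr' (hc.mono fun y hy => hy.2.1.symm))
      have hlim : Filter.Tendsto (fun y => f y (c y) - f y₀ (c y)) U (𝓝 0) := by
        have e1 : Filter.Tendsto (fun y => f y (c y)) U (𝓝 (f y₀ g₀)) := by
          classical
          let m : Y → {p : G.Arr × Y // G.rng p.1 = Y.anchor p.2} := fun y =>
            if h : G.rng (c y) = Y.anchor y then ⟨(c y, y), h⟩ else ⟨(g₀, y₀), hr⟩
          have hm : Filter.Tendsto m U (𝓝 ⟨(g₀, y₀), hr⟩) := by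
            rw [tendsto_subtype_rng]
            refine (hl'.prodMk_nhds (Filter.tendsto_id'.2 hU)).congr' (hc.mono fun y hy => ?_)
            simp only [m, dif_pos hy.2.1, id]
          rw [hf y₀ g₀ hr]
          refine (((continuous_fibre Y hφ).tendsto _).comp hm).congr' (hc.mono fun y hy => ?_)
          simp only [m, Function.comp_apply]
          rw [hf y (c y) hy.2.1, dif_pos hy.2.1]
        have e2 : Filter.Tendsto (fun y => f y₀ (c y)) U (𝓝 (f y₀ g₀)) :=
          ((f y₀).continuous.tendsto g₀).comp hl'
        simpa using e1.sub e2
      have := (hlim.abs.eventually (gt_mem_nhds (by simpa using half_pos hε : |(0 : ℝ)| < ε / 2)))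
      obtain ⟨y, hy1, hy2⟩ := (this.and hc).exists
      exact hy2.2.2 hy1
    have h2 := (hcont (f y₀) (f y₀).continuous).comp Y.continuous_anchor
    have h3 := Metric.continuousAt_iff'.1 (h2.continuousAt (x := y₀)) (ε / 2) (half_pos hε)
    filter_upwards [h1, h3] with y hy1 hy2
    have hle : |∫ g, f y g ∂(μ (Y.anchor y)) - ∫ g, f y₀ g ∂(μ (Y.anchor y))| ≤ ε / 2 := by
      rw [← integral_sub (integrable_of_fibre hS hμ _ _) (integrable_of_fibre hS hμ _ _)]
      refine (norm_integral_le_of_norm_le_const (μ := μ (Y.anchor y)) (C := ε / 2)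
        (f := fun g => f y g - f y₀ g) ?_).trans ?_
      · filter_upwards [mem_ae_iff.2 (hμ (Y.anchor y))] with g hg
        exact (hy1 g hg.1 hg.2).le
      · simp
    rw [Real.dist_eq]
    rw [Function.comp_apply, Function.comp_apply, Real.dist_eq] at hy2
    have := abs_sub_le (∫ g, f y g ∂(μ (Y.anchor y))) (∫ g, f y₀ g ∂(μ (Y.anchor y)))
      (∫ g, f y₀ g ∂(μ (Y.anchor y₀)))
    linarith
  · intro g y h
    classical
    let L : G.Arr → G.Arr := fun k => if e : G.src g = G.rng k then G.mul g k e else g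
    have hR : IsClosed {k | G.src g = G.rng k} := isClosed_eq continuous_const G.continuous_rng
    have hL : Measurable L := by
      refine measurable_of_restrict_of_restrict_compl hR.measurableSet ?_ ?_
      · have : Continuous ({k | G.src g = G.rng k}.domRestrict L) := by
          have h2 : Continuous fun k : {k | G.src g = G.rng k} => G.mul g k.1 k.2 :=
            G.continuous_mul.comp (f := fun k : {k | G.src g = G.rng k} =>
              (⟨(g, k.1), k.2⟩ : {p : G.Arr × G.Arr // G.src p.1 = G.rng p.2})) (by fun_prop)
          convert h2 using 2 with k
          exact dif_pos k.2
        exact this.measurable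
      · have : ({k | G.src g = G.rng k}ᶜ.domRestrict L) = fun _ => g := by
          ext k
          exact dif_neg k.2
        rw [this]; exact measurable_const
    have hmap : (μ (G.src g)).map L = μ (G.rng g) := by
      ext A hA
      rw [Measure.map_apply hL hA, hinv g A hA]
      refine measure_congr ?_
      filter_upwards [mem_ae_iff.2 (hμ (G.src g))] with k hk
      have e : G.src g = G.rng k := hk.2.symm
      change (L k ∈ A) = _
      simp only [L, dif_pos e, eq_iff_iff]
      exact ⟨fun h => ⟨e, h⟩, fun ⟨_, h⟩ => h⟩
    beta_reduce
    rw [Y.anchor_act, ← hmap, integral_map hL.aemeasurable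
      (f (Y.act g y h)).continuous.aestronglyMeasurable, ← h]
    refine integral_congr_ae ?_
    filter_upwards [mem_ae_iff.2 (hμ (G.src g))] with k hk
    have e : G.src g = G.rng k := hk.2.symm
    have e' : G.rng (G.mul g k e) = Y.anchor (Y.act g y h) := by rw [G.rng_mul, Y.anchor_act]
    simp only [L, dif_pos e]
    rw [hf _ _ e', hf y k (e.symm.trans h)]
    congr 1
    have e2 : G.src (G.inv k) = Y.anchor y := (G.src_inv k).trans (e.symm.trans h)
    have e3 : G.src (G.mul g k e) = Y.anchor (Y.act (G.inv k) y e2) := by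
      rw [G.src_mul, Y.anchor_act, G.rng_inv]
    have h4 : Y.act g y h = Y.act (G.mul g k e) (Y.act (G.inv k) y e2) e3 := by
      have e5 : G.src k = Y.anchor (Y.act (G.inv k) y e2) := by rw [Y.anchor_act, G.rng_inv]
      rw [Y.mul_act g k _ e e5]
      exact Y.act_congr (Y.act_inv k y e2 e5).symm _ _
    have h6 := Y.inv_act (G.mul g k e) (Y.act (G.inv k) y e2) e3
    rw [← h6]
    exact Y.act_congr h4 _ _
  · intro y c hc
    refine le_trans (by simp) (integral_le_of_fibre hS hμ (.const _ c) (f y) (Y.anchor y) ?_)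
    intro g _ hg
    rw [hf y g hg]; exact hc _ _
  · intro y c hc
    refine (integral_le_of_fibre hS hμ (f y) (.const _ c) (Y.anchor y) ?_).trans (by simp)
    intro g _ hg
    rw [hf y g hg]; exact hc _ _

end Average

theorem TopGroupoid.NumerablyProper.exists_average (hG : G.NumerablyProper) (Y : GSpace G)
    {φ : Y → ℝ} (hφ : Continuous φ) :
    ∃ ψ : Y → ℝ, Continuous ψ ∧ (∀ g y h, ψ (Y.act g y h) = ψ y) ∧
      (∀ y c, (∀ g h, c ≤ φ (Y.act g y h)) → c ≤ ψ y) ∧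
      (∀ y c, (∀ g h, φ (Y.act g y h) ≤ c) → ψ y ≤ c) := by
  let _ : MeasurableSpace G.Arr := borel G.Arr
  have : BorelSpace G.Arr := ⟨rfl⟩
  obtain ⟨μ, S, h1, -, -, h4, h5, h6, h7⟩ := hG
  have := h1
  exact _root_.exists_average h4 h5 h6 h7 Y hφ

end

section

variable {G : TopGroupoid.{u}}

/-- Linear coordinates for a family of vector spaces on a neighbourhood of `x`. -/
structure FibChart {B : Type u} [TopologicalSpace B] (fib : B → Type u) [∀ x, AddCommGroup (fib x)]
    [∀ x, Module ℝ (fib x)] [TopologicalSpace (TotPt fib)] (x : B) where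
  E : Type
  [grp : NormedAddCommGroup E]
  [mod : NormedSpace ℝ E]
  [fin : FiniteDimensional ℝ E]
  U : Set B
  isOpen : IsOpen U
  mem : x ∈ U
  L : ∀ y, fib y →ₗ[ℝ] E
  bij : ∀ y ∈ U, Function.Bijective (L y)
  nhds_eq : ∀ v : TotPt fib, v.pt ∈ U → 𝓝 v = Filter.comap TotPt.pt (𝓝 v.pt) ⊓
    Filter.comap (fun w : TotPt fib => L w.pt w.vec) (𝓝 (L v.pt v.vec))

attribute [instance] FibChart.grp FibChart.mod FibChart.fin

namespace FibChart

variable {B : Type u} [TopologicalSpace B] {fib : B → Type u} [∀ x, AddCommGroup (fib x)]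
    [∀ x, Module ℝ (fib x)] [TopologicalSpace (TotPt fib)] {x : B}

theorem tendsto_iff (c : FibChart fib x) {v : TotPt fib} (hv : v.pt ∈ c.U) {α : Type*}
    {l : Filter α} {f : α → TotPt fib} : Filter.Tendsto f l (𝓝 v) ↔
      Filter.Tendsto (fun a => (f a).pt) l (𝓝 v.pt) ∧
      Filter.Tendsto (fun a => c.L (f a).pt (f a).vec) l (𝓝 (c.L v.pt v.vec)) := by
  rw [c.nhds_eq v hv, Filter.tendsto_inf, Filter.tendsto_comap_iff, Filter.tendsto_comap_iff]
  rfl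

theorem tendsto_pt (c : FibChart fib x) {v : TotPt fib} (hv : v.pt ∈ c.U) :
    Filter.Tendsto TotPt.pt (𝓝 v) (𝓝 v.pt) :=
  ((c.tendsto_iff hv (f := id)).1 Filter.tendsto_id).1

theorem tendsto_L (c : FibChart fib x) {v : TotPt fib} (hv : v.pt ∈ c.U) :
    Filter.Tendsto (fun w : TotPt fib => c.L w.pt w.vec) (𝓝 v) (𝓝 (c.L v.pt v.vec)) :=
  ((c.tendsto_iff hv (f := id)).1 Filter.tendsto_id).2

open Classical in
/-- The inverse of the coordinates. -/
noncomputable def inv (c : FibChart fib x) (y : B) (a : c.E) : fib y :=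
  if h : y ∈ c.U then (LinearEquiv.ofBijective (c.L y) (c.bij y h)).symm a else 0

theorem L_inv (c : FibChart fib x) {y : B} (hy : y ∈ c.U) (a : c.E) : c.L y (c.inv y a) = a := by
  rw [inv, dif_pos hy]
  exact (LinearEquiv.ofBijective (c.L y) (c.bij y hy)).apply_symm_apply a

theorem inv_L (c : FibChart fib x) {y : B} (hy : y ∈ c.U) (a : fib y) : c.inv y (c.L y a) = a :=
  (c.bij y hy).1 (c.L_inv hy _)

theorem tendsto_inv (c : FibChart fib x) {y : B} (hy : y ∈ c.U) (a : c.E) {α : Type*}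
    {l : Filter α} {f : α → B} {k : α → c.E} (hf : Filter.Tendsto f l (𝓝 y))
    (hk : Filter.Tendsto k l (𝓝 a)) :
    Filter.Tendsto (fun i => (⟨f i, c.inv (f i) (k i)⟩ : TotPt fib)) l (𝓝 ⟨y, c.inv y a⟩) := by
  refine (c.tendsto_iff (v := ⟨y, c.inv y a⟩) hy).2 ⟨hf, ?_⟩
  have he : ∀ᶠ i in l, f i ∈ c.U := hf (c.isOpen.mem_nhds hy)
  change Filter.Tendsto _ l (𝓝 (c.L y (c.inv y a)))
  rw [c.L_inv hy]
  exact hk.congr' (he.mono fun i hi => (c.L_inv hi _).symm)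

theorem exists_trivialization (c : FibChart fib x) (hp : Continuous (TotPt.pt : TotPt fib → B)) :
    ∃ (n : ℕ) (e : Bundle.Trivialization (Fin n → ℝ) (TotPt.pt : TotPt fib → B)),
      x ∈ e.baseSet ∧ ∀ y ∈ e.baseSet, IsLinearMap ℝ fun v : fib y => (e ⟨y, v⟩).2 := by
  let φ : c.E ≃L[ℝ] (Fin (Module.finrank ℝ c.E) → ℝ) :=
    ContinuousLinearEquiv.ofFinrankEq (by simp)
  refine ⟨_, {
    toFun := fun v => (v.pt, φ (c.L v.pt v.vec))
    invFun := fun p => ⟨p.1, c.inv p.1 (φ.symm p.2)⟩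
    source := TotPt.pt ⁻¹' c.U
    target := c.U ×ˢ Set.univ
    map_source' := fun v hv => ⟨hv, trivial⟩
    map_target' := fun p hp => hp.1
    left_inv' := fun v hv => by
      simp only [ContinuousLinearEquiv.symm_apply_apply]
      rw [c.inv_L hv]
    right_inv' := fun p hp => by
      simp only [c.L_inv hp.1, ContinuousLinearEquiv.apply_symm_apply]
    open_source := c.isOpen.preimage hp
    open_target := c.isOpen.prod isOpen_univ
    continuousOn_toFun := fun v hv => ContinuousAt.continuousWithinAt
      ((c.tendsto_pt hv).prodMk_nhds ((φ.continuous.tendsto _).comp (c.tendsto_L hv)))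
    continuousOn_invFun := fun p hp => ContinuousAt.continuousWithinAt
      (c.tendsto_inv hp.1 (φ.symm p.2) (continuous_fst.tendsto _)
        ((φ.symm.continuous.comp continuous_snd).tendsto _))
    baseSet := c.U
    open_baseSet := c.isOpen
    source_eq := rfl
    target_eq := rfl
    proj_toFun := fun _ _ => rfl }, c.mem, fun y hy => ?_⟩
  exact (φ.toLinearMap.comp (c.L y)).isLinear

end FibChart

namespace GBundle

variable {X X' : GSpace G}

open Classical in
theorem nonempty_fibChart (V : GBundle X) (x : X) : Nonempty (FibChart V.fib x) := by
  obtain ⟨n, e, hx, hl⟩ := V.locTriv x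
  refine ⟨{
    E := Fin n → ℝ
    U := e.baseSet
    isOpen := e.open_baseSet
    mem := hx
    L := fun y => if h : y ∈ e.baseSet then (hl y h).mk' _ else 0
    bij := fun y hy => ?_
    nhds_eq := fun v hv => ?_ }⟩
  · rw [dif_pos hy]
    refine ⟨fun a b h => ?_, fun a => ?_⟩
    · have h1 : (⟨y, a⟩ : TotPt V.fib) = ⟨y, b⟩ :=
        e.injOn (e.mem_source.2 hy) (e.mem_source.2 hy) (Prod.ext
          ((e.coe_fst (e.mem_source.2 hy)).trans
            (e.coe_fst (x := ⟨y, b⟩) (e.mem_source.2 hy)).symm) h)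
      simpa using h1
    · obtain ⟨⟨y', v⟩, hw, he⟩ := e.surjOn ((e.mem_target (x := (y, a))).2 hy)
      have hy' : y' = y := (e.coe_fst hw).symm.trans (congrArg Prod.fst he)
      subst hy'
      exact ⟨v, congrArg Prod.snd he⟩
  · rw [e.nhds_eq_inf_comap (e.mem_source.2 hv)]
    have h1 : ∀ w : TotPt V.fib, w.pt ∈ e.baseSet →
        (if h : w.pt ∈ e.baseSet then (hl w.pt h).mk' _ else 0 : V.fib w.pt →ₗ[ℝ] (Fin n → ℝ)) w.vec
          = (e w).2 := fun w hw => by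
      rw [dif_pos hw]; rfl
    refine eq_of_forall_le_iff fun l => ?_
    rw [le_inf_iff, le_inf_iff, ← Filter.tendsto_iff_comap, ← Filter.tendsto_iff_comap,
      ← Filter.tendsto_iff_comap, h1 v hv]
    refine and_congr_right fun h => Filter.tendsto_congr' ?_
    filter_upwards [h (e.open_baseSet.mem_nhds hv)] with w hw using (h1 w hw).symm

noncomputable def fibChart (V : GBundle X) (x : X) : FibChart V.fib x :=
  (V.nonempty_fibChart x).some

instance (V : GBundle X) (x : X) : FiniteDimensional ℝ (V.fib x) :=
  Module.Finite.equiv (LinearEquiv.ofBijective ((V.fibChart x).L x)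
    ((V.fibChart x).bij x (V.fibChart x).mem)).symm

theorem continuous_rank (V : GBundle X) : Continuous V.rank := by
  refine continuous_iff_continuousAt.2 fun x => ?_
  let c := V.fibChart x
  have : ∀ y ∈ c.U, V.rank y = Module.finrank ℝ c.E := fun y hy =>
    (LinearEquiv.ofBijective (c.L y) (c.bij y hy)).finrank_eq
  refine ContinuousAt.congr (f := fun _ => Module.finrank ℝ c.E) continuousAt_const ?_
  filter_upwards [c.isOpen.mem_nhds c.mem] with y hy using (this y hy).symm

/-- Transport between fibres over equal points. -/
def castEquiv (V : GBundle X) {x y : X} (h : x = y) : V.fib x ≃ₗ[ℝ] V.fib y :=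
  h ▸ LinearEquiv.refl ℝ _

theorem mk_castEquiv (V : GBundle X) {x y : X} (h : x = y) (v : V.fib x) :
    (⟨y, V.castEquiv h v⟩ : TotPt V.fib) = ⟨x, v⟩ := by
  subst h; rfl

theorem mk_injective (V : GBundle X) {x : X} {v w : V.fib x}
    (h : (⟨x, v⟩ : TotPt V.fib) = ⟨x, w⟩) : v = w := by simpa using h

theorem act_act_inv (V : GBundle X) (g : G.Arr) (x : X) (h : G.src g = X.anchor x) (v : V.fib x) :
    (⟨_, V.act (G.inv g) _ ((G.src_inv g).trans (X.anchor_act g x h).symm) (V.act g x h v)⟩ :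
      TotPt V.fib) = ⟨x, v⟩ := V.tot.inv_act g ⟨x, v⟩ h

theorem act_injective (V : GBundle X) (g : G.Arr) (x : X) (h : G.src g = X.anchor x) :
    Function.Injective (V.act g x h) := fun v w e => by
  have h1 := V.act_act_inv g x h v
  rw [e, V.act_act_inv g x h w] at h1
  exact (V.mk_injective h1).symm

theorem rank_act (V : GBundle X) (g : G.Arr) (x : X) (h : G.src g = X.anchor x) :
    V.rank (X.act g x h) = V.rank x := by
  refine le_antisymm ?_ (LinearMap.finrank_le_finrank_of_injective (V.act_injective g x h))
  have := LinearMap.finrank_le_finrank_of_injective (V.act_injective (G.inv g) _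
    ((G.src_inv g).trans (X.anchor_act g x h).symm))
  rwa [X.inv_act g x h] at this

theorem tendsto_add (V : GBundle X) {α : Type*} {l : Filter α} {x : α → X} {a b : ∀ i, V.fib (x i)}
    {y : X} {a' b' : V.fib y}
    (ha : Filter.Tendsto (fun i => (⟨x i, a i⟩ : TotPt V.fib)) l (𝓝 ⟨y, a'⟩))
    (hb : Filter.Tendsto (fun i => (⟨x i, b i⟩ : TotPt V.fib)) l (𝓝 ⟨y, b'⟩)) :
    Filter.Tendsto (fun i => (⟨x i, a i + b i⟩ : TotPt V.fib)) l (𝓝 ⟨y, a' + b'⟩) := by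
  let c := V.fibChart y
  have h1 := (c.tendsto_iff (v := ⟨y, a'⟩) c.mem).1 ha
  have h2 := (c.tendsto_iff (v := ⟨y, b'⟩) c.mem).1 hb
  refine (c.tendsto_iff (v := ⟨y, a' + b'⟩) c.mem).2 ⟨h1.1, ?_⟩
  simp only [map_add]
  exact h1.2.add h2.2

theorem tendsto_smul (V : GBundle X) {α : Type*} {l : Filter α} {x : α → X} {a : ∀ i, V.fib (x i)}
    {s : α → ℝ} {y : X} {a' : V.fib y} {s' : ℝ} (hs : Filter.Tendsto s l (𝓝 s'))
    (ha : Filter.Tendsto (fun i => (⟨x i, a i⟩ : TotPt V.fib)) l (𝓝 ⟨y, a'⟩)) :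
    Filter.Tendsto (fun i => (⟨x i, s i • a i⟩ : TotPt V.fib)) l (𝓝 ⟨y, s' • a'⟩) := by
  let c := V.fibChart y
  have h1 := (c.tendsto_iff (v := ⟨y, a'⟩) c.mem).1 ha
  refine (c.tendsto_iff (v := ⟨y, s' • a'⟩) c.mem).2 ⟨h1.1, ?_⟩
  simp only [map_smul]
  exact hs.smul h1.2

theorem continuous_add (V : GBundle X) {α : Type*} [TopologicalSpace α] {x : α → X}
    {a b : ∀ i, V.fib (x i)} (ha : Continuous fun i => (⟨x i, a i⟩ : TotPt V.fib))
    (hb : Continuous fun i => (⟨x i, b i⟩ : TotPt V.fib)) :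
    Continuous fun i => (⟨x i, a i + b i⟩ : TotPt V.fib) :=
  continuous_iff_continuousAt.2 fun i => V.tendsto_add (ha.tendsto i) (hb.tendsto i)

theorem continuous_smul (V : GBundle X) {α : Type*} [TopologicalSpace α] {x : α → X}
    {a : ∀ i, V.fib (x i)} {s : α → ℝ} (hs : Continuous s)
    (ha : Continuous fun i => (⟨x i, a i⟩ : TotPt V.fib)) :
    Continuous fun i => (⟨x i, s i • a i⟩ : TotPt V.fib) :=
  continuous_iff_continuousAt.2 fun i => V.tendsto_smul (hs.tendsto i) (ha.tendsto i)

theorem continuous_zero (V : GBundle X) : Continuous fun x => (⟨x, 0⟩ : TotPt V.fib) := by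
  refine continuous_iff_continuousAt.2 fun x => ?_
  let c := V.fibChart x
  refine (c.tendsto_iff (v := ⟨x, 0⟩) c.mem).2 ⟨Filter.tendsto_id, ?_⟩
  simp only [map_zero]
  exact tendsto_const_nhds

open Classical in
/-- A continuous map between vector bundles that is bijective and linear on the fibres identifies
its source with the pull-back of its target. -/
theorem isClosedEmbedding_of_lin (V' : GBundle X') (V : GBundle X) {f : X' → X} (hf : Continuous f)
    (lin : ∀ x, V'.fib x ≃ₗ[ℝ] V.fib (f x))
    (hc : Continuous fun v : TotPt V'.fib => (⟨f v.pt, lin v.pt v.vec⟩ : TotPt V.fib)) :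
    IsClosedEmbedding fun v : TotPt V'.fib => (v.pt, (⟨f v.pt, lin v.pt v.vec⟩ : TotPt V.fib)) := by
  have hinj : Function.Injective
      fun v : TotPt V'.fib => (v.pt, (⟨f v.pt, lin v.pt v.vec⟩ : TotPt V.fib)) := by
    rintro ⟨x, a⟩ ⟨y, b⟩ h
    obtain ⟨h1, h2⟩ := Prod.ext_iff.1 h
    change x = y at h1
    subst h1
    exact congrArg _ ((lin x).injective (V.mk_injective h2))
  refine ⟨⟨⟨?_⟩, hinj⟩, ?_⟩
  · refine TopologicalSpace.ext_nhds fun v => ?_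
    rw [nhds_induced]
    refine le_antisymm (Filter.tendsto_iff_comap.1 (V'.continuous_pt.prodMk hc).continuousAt) ?_
    let c' := V'.fibChart v.pt
    let c := V.fibChart (f v.pt)
    refine Filter.tendsto_id'.1 ((c'.tendsto_iff (v := v) c'.mem (f := id)).2 ⟨?_, ?_⟩)
    · exact (continuous_fst.tendsto _).comp Filter.tendsto_comap
    let A : X' → (c'.E →L[ℝ] c.E) := fun y => if h : y ∈ c'.U ∧ f y ∈ c.U then
      LinearMap.toContinuousLinearMap ((c.L (f y)).comp ((lin y).toLinearMap.comp
        (LinearEquiv.ofBijective (c'.L y) (c'.bij y h.1)).symm.toLinearMap)) else 0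
    have hA : ∀ y ∈ c'.U, f y ∈ c.U → ∀ a, A y a = c.L (f y) (lin y (c'.inv y a)) := by
      intro y hy hy' a
      simp only [A]
      rw [dif_pos ⟨hy, hy'⟩, FibChart.inv, dif_pos hy]
      rfl
    have hnear : ∀ᶠ y in 𝓝 v.pt, y ∈ c'.U ∧ f y ∈ c.U :=
      Filter.Eventually.and (c'.isOpen.mem_nhds c'.mem) (hf.continuousAt (c.isOpen.mem_nhds c.mem))
    have hAc : ContinuousAt A v.pt := by
      have h1 : ContinuousOn A {y | y ∈ c'.U ∧ f y ∈ c.U} := by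
        refine continuousOn_clm_apply.2 fun a y hy => ContinuousAt.continuousWithinAt ?_
        have h2 : ContinuousAt (fun y => c.L (f y) (lin y (c'.inv y a))) y := by
          have h3 := c'.tendsto_inv hy.1 a Filter.tendsto_id (tendsto_const_nhds (f := 𝓝 y))
          exact (c.tendsto_L (v := ⟨f y, lin y (c'.inv y a)⟩) hy.2).comp
            ((hc.tendsto ⟨y, c'.inv y a⟩).comp h3)
        refine h2.congr ?_
        filter_upwards [c'.isOpen.mem_nhds hy.1, hf.continuousAt (c.isOpen.mem_nhds hy.2)]
          with z hz hz' using (hA z hz hz' a).symm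
      exact h1.continuousAt hnear
    have hbij : ∀ y ∈ c'.U, f y ∈ c.U → Function.Bijective (A y) := by
      intro y hy hy'
      have : ⇑(A y) = c.L (f y) ∘ lin y ∘ c'.inv y := funext (hA y hy hy')
      rw [this]
      refine (c.bij _ hy').comp ((lin y).bijective.comp ?_)
      exact ⟨fun a b h => by rw [← c'.L_inv hy a, h, c'.L_inv hy], fun a => ⟨_, c'.inv_L hy a⟩⟩
    let e : ∀ y, y ∈ c'.U → f y ∈ c.U → (c'.E ≃L[ℝ] c.E) := fun y hy hy' =>
      (LinearEquiv.ofBijective (A y).toLinearMap (hbij y hy hy')).toContinuousLinearEquiv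
    have he : ∀ y hy hy', ((e y hy hy' : c'.E ≃L[ℝ] c.E) : c'.E →L[ℝ] c.E) = A y := fun y hy hy' => by
      ext a; rfl
    have hBc : ContinuousAt (fun y => (A y).inverse) v.pt := by
      refine ContinuousAt.comp (g := ContinuousLinearMap.inverse) ?_ hAc
      rw [← he v.pt c'.mem c.mem]
      exact (contDiffAt_map_inverse (n := 0) (e v.pt c'.mem c.mem)).continuousAt
    have hB : ∀ w : TotPt V'.fib, w.pt ∈ c'.U → f w.pt ∈ c.U →
        (A w.pt).inverse (c.L (f w.pt) (lin w.pt w.vec)) = c'.L w.pt w.vec := by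
      intro w hw hw'
      have h1 : c.L (f w.pt) (lin w.pt w.vec) = e w.pt hw hw' (c'.L w.pt w.vec) := by
        refine Eq.trans ?_ (hA w.pt hw hw' _).symm
        rw [c'.inv_L hw]
      rw [← he w.pt hw hw', ContinuousLinearMap.inverse_equiv, h1]
      exact (e w.pt hw hw').symm_apply_apply _
    rw [← hB v c'.mem c.mem]
    have hl1 : Filter.Tendsto (fun w : TotPt V'.fib => w.pt) (Filter.comap (fun v : TotPt V'.fib =>
        (v.pt, (⟨f v.pt, lin v.pt v.vec⟩ : TotPt V.fib))) (𝓝 (v.pt, ⟨f v.pt, lin v.pt v.vec⟩)))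
        (𝓝 v.pt) := (continuous_fst.tendsto _).comp Filter.tendsto_comap
    have hl2 := (c.tendsto_L (v := ⟨f v.pt, lin v.pt v.vec⟩) c.mem).comp
      ((continuous_snd.tendsto (v.pt, (⟨f v.pt, lin v.pt v.vec⟩ : TotPt V.fib))).comp
        (Filter.tendsto_comap (f := fun v : TotPt V'.fib =>
          (v.pt, (⟨f v.pt, lin v.pt v.vec⟩ : TotPt V.fib)))))
    refine Filter.Tendsto.congr' (f₁ := fun w : TotPt V'.fib =>
      (A w.pt).inverse (c.L (f w.pt) (lin w.pt w.vec))) ?_ ?_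
    · filter_upwards [hl1 hnear] with w hw using hB w hw.1 hw.2
    · exact (isBoundedBilinearMap_apply.continuous.tendsto
        ((A v.pt).inverse, c.L (f v.pt) (lin v.pt v.vec))).comp
          ((hBc.tendsto.comp hl1).prodMk_nhds hl2)
  · have : Set.range (fun v : TotPt V'.fib => (v.pt, (⟨f v.pt, lin v.pt v.vec⟩ : TotPt V.fib))) =
        {p | f p.1 = p.2.pt} := by
      ext ⟨x, ⟨y, b⟩⟩
      constructor
      · rintro ⟨v, hv⟩
        obtain ⟨rfl, h2⟩ := Prod.ext_iff.1 hv
        exact congrArg TotPt.pt h2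
      · intro h
        change f x = y at h
        subst h
        exact ⟨⟨x, (lin x).symm b⟩, by simp⟩
    rw [this]
    exact isClosed_eq (hf.comp continuous_fst) (V.continuous_pt.comp continuous_snd)

end GBundle

namespace GBundle

variable {X X' Y T : GSpace G}

theorem exists_exhaustion (V : GBundle X) : ∃ ρ : TotPt V.fib → ℝ, Continuous ρ ∧ (∀ v, 0 ≤ ρ v) ∧
    ∀ c, CompactOver V.proj {v | ρ v ≤ c} := by
  obtain ⟨f, hf⟩ := PartitionOfUnity.exists_isSubordinate (X := X) isClosed_univ
    (fun x => (V.fibChart x).U) (fun x => (V.fibChart x).isOpen)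
    (fun x _ => Set.mem_iUnion.2 ⟨x, (V.fibChart x).mem⟩)
  let r : X → TotPt V.fib → ℝ := fun i v => f i v.pt * ‖(V.fibChart i).L v.pt v.vec‖
  have hr0 : ∀ i v, 0 ≤ r i v := fun i v => mul_nonneg (f.nonneg i _) (norm_nonneg _)
  have hrc : ∀ i, Continuous (r i) := fun i => by
    refine continuous_iff_continuousAt.2 fun v => ?_
    by_cases hv : v.pt ∈ tsupport (f i)
    · exact (((f i).continuous.comp V.continuous_pt).continuousAt).mul
        ((V.fibChart i).tendsto_L (hf i hv)).norm
    · refine (continuousAt_const (y := (0 : ℝ))).congr ?_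
      have : ∀ᶠ x in 𝓝 v.pt, f i x = 0 := by
        filter_upwards [(isClosed_tsupport (f i)).isOpen_compl.mem_nhds hv] with x hx
        exact image_eq_zero_of_notMem_tsupport hx
      filter_upwards [V.continuous_pt.continuousAt this] with w hw
      have hw' : f i w.pt = 0 := hw
      simp only [r, hw', zero_mul]
  have hlf : LocallyFinite fun i => Function.support (r i) := by
    refine (f.locallyFinite.preimage_continuous V.continuous_pt).subset fun i v hv => ?_
    simp only [r, Function.mem_support, ne_eq, mul_eq_zero, not_or] at hv
    exact hv.1
  have hρ : Continuous fun v => ∑ᶠ i, r i v := continuous_finsum hrc hlf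
  refine ⟨_, hρ, fun v => finsum_nonneg fun i => hr0 i v, fun c => ?_⟩
  refine (compactOver_iff V.proj.continuous_toFun).2 fun U x hU hx => ?_
  obtain ⟨i, hi⟩ := f.exists_pos (Set.mem_univ x)
  have hxi : x ∈ (V.fibChart i).U := hf i (subset_tsupport _ hi.ne')
  have h1 : ∀ᶠ v in (U : Filter (TotPt V.fib)),
      (V.fibChart i).L v.pt v.vec ∈ Metric.closedBall 0 (c / (f i x / 2)) := by
    have h2 : ∀ᶠ v in (U : Filter (TotPt V.fib)), f i x / 2 < f i v.pt :=
      (((f i).continuous.tendsto x).comp hx).eventually_const_lt (half_lt_self hi)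
    filter_upwards [h2, hU] with v hv hvc
    have h3 : r i v ≤ ∑ᶠ i, r i v :=
      single_le_finsum i (hlf.point_finite v) fun j => hr0 j v
    have h4 : f i v.pt * ‖(V.fibChart i).L v.pt v.vec‖ ≤ c := h3.trans hvc
    rw [mem_closedBall_zero_iff, le_div_iff₀ (half_pos hi)]
    nlinarith [norm_nonneg ((V.fibChart i).L v.pt v.vec)]
  obtain ⟨a, -, ha⟩ := (isCompact_closedBall (0 : (V.fibChart i).E) (c / (f i x / 2))).ultrafilter_le_nhds
    (U.map fun v : TotPt V.fib => (V.fibChart i).L v.pt v.vec) (Filter.le_principal_iff.2 h1)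
  have hlim : (U : Filter (TotPt V.fib)) ≤ 𝓝 ⟨x, (V.fibChart i).inv x a⟩ := by
    refine Filter.tendsto_id'.1 (((V.fibChart i).tendsto_iff
      (v := ⟨x, (V.fibChart i).inv x a⟩) hxi).2 ⟨hx, ?_⟩)
    change Filter.Tendsto _ _ (𝓝 ((V.fibChart i).L x ((V.fibChart i).inv x a)))
    rw [(V.fibChart i).L_inv hxi]
    exact ha
  exact ⟨_, (isClosed_le hρ continuous_const).mem_of_frequently_of_tendsto
    (Filter.Eventually.frequently hU) hlim, hlim⟩

theorem paracompact_of_exhaustion {B T : Type u} [TopologicalSpace B] [T2Space B]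
    [ParacompactSpace B] [TopologicalSpace T] {p : T → B} {ρ : T → ℝ}
    (hρ : Continuous ρ) (h0 : ∀ v, 0 ≤ ρ v) (h : ∀ c, CompactOver p {v | ρ v ≤ c}) :
    ParacompactSpace T :=
  ParacompactSpace.of_exhaustion ρ hρ h0 fun n => (h n).paracompactSpace

/-! ### Pull-backs -/

section Pullback

variable (V : GBundle X) (f : GMap X' X)

def pullbackFun (v : TotPt fun x => V.fib (f x)) : TotPt V.fib := ⟨f v.pt, v.vec⟩

instance pullbackTop : TopologicalSpace (TotPt fun x => V.fib (f x)) :=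
  .induced (fun v => (v.pt, V.pullbackFun f v)) inferInstance

theorem pullback_injective :
    Function.Injective fun v : TotPt fun x => V.fib (f x) => (v.pt, V.pullbackFun f v) := by
  rintro ⟨x, a⟩ ⟨y, b⟩ h
  obtain ⟨h1, h2⟩ := Prod.ext_iff.1 h
  change x = y at h1
  subst h1
  exact congrArg _ (V.mk_injective h2)

theorem pullback_isEmbedding :
    IsEmbedding fun v : TotPt fun x => V.fib (f x) => (v.pt, V.pullbackFun f v) :=
  ⟨⟨rfl⟩, V.pullback_injective f⟩

theorem pullback_isClosedEmbedding :
    IsClosedEmbedding fun v : TotPt fun x => V.fib (f x) => (v.pt, V.pullbackFun f v) := by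
  refine ⟨V.pullback_isEmbedding f, ?_⟩
  have : Set.range (fun v : TotPt fun x => V.fib (f x) => (v.pt, V.pullbackFun f v)) =
      {p | f p.1 = p.2.pt} := by
    ext ⟨x, ⟨y, b⟩⟩
    constructor
    · rintro ⟨v, hv⟩
      obtain ⟨rfl, h2⟩ := Prod.ext_iff.1 hv
      exact congrArg TotPt.pt h2
    · intro h
      change f x = y at h
      subst h
      exact ⟨⟨x, b⟩, rfl⟩
  rw [this]
  exact isClosed_eq (f.continuous_toFun.comp continuous_fst) (V.continuous_pt.comp continuous_snd)

theorem pullback_continuous_pt : Continuous (TotPt.pt : (TotPt fun x => V.fib (f x)) → X') :=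
  continuous_fst.comp (V.pullback_isEmbedding f).continuous

theorem pullback_continuous_fun : Continuous (V.pullbackFun f) :=
  continuous_snd.comp (V.pullback_isEmbedding f).continuous

/-- The pull-back bundle. -/
def pullback : GBundle X' where
  fib x := V.fib (f x)
  t2 := .of_injective_continuous (V.pullback_injective f) (V.pullback_isEmbedding f).continuous
  para := by
    obtain ⟨ρ, hρ, h0, hc⟩ := V.exists_exhaustion
    refine paracompact_of_exhaustion (p := TotPt.pt) (ρ := fun v => ρ (V.pullbackFun f v))
      (hρ.comp (V.pullback_continuous_fun f)) (fun v => h0 _) fun c => ?_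
    refine (compactOver_iff (V.pullback_continuous_pt f)).2 fun U x hU hx => ?_
    obtain ⟨w, hw, hlw⟩ := (compactOver_iff V.proj.continuous_toFun).1 (hc c)
      (U.map (V.pullbackFun f)) (f x) hU ((f.continuous_toFun.tendsto x).comp hx)
    obtain ⟨v, -, hv⟩ := (V.pullback_isClosedEmbedding f).isProperMap.ultrafilter_le_nhds_of_tendsto
      (𝒰 := U) (y := (x, w)) (hx.prodMk_nhds hlw)
    exact ⟨v, (isClosed_le (hρ.comp (V.pullback_continuous_fun f)) continuous_const
      ).mem_of_frequently_of_tendsto (Filter.Eventually.frequently hU) hv, hv⟩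
  locTriv x := by
    let c := V.fibChart (f x)
    let c' : FibChart (fun x => V.fib (f x)) x :=
      { E := c.E
        U := f ⁻¹' c.U
        isOpen := c.isOpen.preimage f.continuous_toFun
        mem := c.mem
        L := fun y => c.L (f y)
        bij := fun y hy => c.bij _ hy
        nhds_eq := fun v hv => by
          refine eq_of_forall_le_iff fun l => ?_
          rw [le_inf_iff, ← Filter.tendsto_iff_comap, ← Filter.tendsto_iff_comap,
            (V.pullback_isEmbedding f).nhds_eq_comap, ← Filter.tendsto_iff_comap,
            nhds_prod_eq, Filter.tendsto_prod_iff',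
            c.tendsto_iff (v := V.pullbackFun f v) hv]
          refine and_congr_right fun h => and_iff_right ?_
          exact (f.continuous_toFun.tendsto _).comp h }
    exact c'.exists_trivialization (V.pullback_continuous_pt f)
  act g x h := (V.castEquiv (f.map_act g x h).symm).toLinearMap.comp
    (V.act g (f x) (h.trans (f.anchor_map x).symm))
  one_act v := V.pullback_injective f (Prod.ext (X'.one_act v.pt) (by
    refine (V.mk_castEquiv _ _).trans ?_
    have := V.tot.one_act (V.pullbackFun f v)
    refine Eq.trans ?_ this
    exact V.tot.act_congr_left (x := V.pullbackFun f v) (congrArg G.one (f.anchor_map v.pt).symm) _ _))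
  mul_act g h v e e' := V.pullback_injective f (Prod.ext (X'.mul_act g h v.pt e e') (by
    refine (V.mk_castEquiv _ _).trans ?_
    refine Eq.trans ?_ (V.mk_castEquiv _ _).symm
    refine (V.tot.mul_act g h (V.pullbackFun f v) e (e'.trans (f.anchor_map _).symm)).trans ?_
    exact V.tot.act_congr (V.mk_castEquiv (f.map_act h v.pt e').symm _).symm _ _))
  continuous_act := by
    refine (V.pullback_isEmbedding f).continuous_iff.2 (Continuous.prodMk ?_ ?_)
    · exact X'.continuous_act.comp (f := fun p : {p : G.Arr × (TotPt fun x => V.fib (f x)) //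
        G.src p.1 = X'.anchor p.2.pt} => (⟨(p.1.1, p.1.2.pt), p.2⟩ :
          {p : G.Arr × X' // G.src p.1 = X'.anchor p.2})) (((continuous_fst.comp
            continuous_subtype_val).prodMk ((V.pullback_continuous_pt f).comp
            (continuous_snd.comp continuous_subtype_val))).subtype_mk _)
    · refine Continuous.congr (V.continuous_act.comp (f := fun p : {p : G.Arr × (TotPt fun x =>
        V.fib (f x)) // G.src p.1 = X'.anchor p.2.pt} => (⟨(p.1.1, V.pullbackFun f p.1.2),
          p.2.trans (f.anchor_map _).symm⟩ :
          {p : G.Arr × TotPt V.fib // G.src p.1 = X.anchor p.2.pt})) (((continuous_fst.comp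
            continuous_subtype_val).prodMk ((V.pullback_continuous_fun f).comp
            (continuous_snd.comp continuous_subtype_val))).subtype_mk _)) fun p => ?_
      exact (V.mk_castEquiv _ _).symm

/-- The pull-back bundle is isomorphic to the pull-back. -/
def pullbackMap : Map (V.pullback f) V f where
  lin _ := LinearEquiv.refl ℝ _
  toGMap :=
    { toFun := V.pullbackFun f
      continuous_toFun := V.pullback_continuous_fun f
      anchor_map := fun v => f.anchor_map v.pt
      map_act := fun _ _ _ => V.mk_castEquiv _ _ }
  toGMap_eq _ := rfl
  isClosedEmbedding := V.pullback_isClosedEmbedding f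

variable {V f}

end Pullback

/-! ### Direct sums -/

section Sum

variable (V : GBundle X) (W : GBundle Y) (g : GMap X Y)

def sumFst (v : TotPt fun x => V.fib x × W.fib (g x)) : TotPt V.fib := ⟨v.pt, v.vec.1⟩

def sumSnd (v : TotPt fun x => V.fib x × W.fib (g x)) : TotPt W.fib := ⟨g v.pt, v.vec.2⟩

instance sumTop : TopologicalSpace (TotPt fun x => V.fib x × W.fib (g x)) :=
  .induced (fun v => (V.sumFst W g v, V.sumSnd W g v)) inferInstance

theorem sum_injective : Function.Injective fun v : TotPt fun x => V.fib x × W.fib (g x) =>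
    (V.sumFst W g v, V.sumSnd W g v) := by
  rintro ⟨x, a⟩ ⟨y, b⟩ h
  obtain ⟨h1, h2⟩ := Prod.ext_iff.1 h
  have h3 : x = y := congrArg TotPt.pt h1
  subst h3
  exact congrArg _ (Prod.ext (V.mk_injective h1) (W.mk_injective h2))

theorem sum_isEmbedding : IsEmbedding fun v : TotPt fun x => V.fib x × W.fib (g x) =>
    (V.sumFst W g v, V.sumSnd W g v) :=
  ⟨⟨rfl⟩, V.sum_injective W g⟩

theorem sum_isClosedEmbedding : IsClosedEmbedding fun v : TotPt fun x => V.fib x × W.fib (g x) =>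
    (V.sumFst W g v, V.sumSnd W g v) := by
  refine ⟨V.sum_isEmbedding W g, ?_⟩
  have : Set.range (fun v : TotPt fun x => V.fib x × W.fib (g x) =>
      (V.sumFst W g v, V.sumSnd W g v)) = {p | g p.1.pt = p.2.pt} := by
    ext ⟨⟨x, a⟩, ⟨y, b⟩⟩
    constructor
    · rintro ⟨v, hv⟩
      obtain ⟨h1, h2⟩ := Prod.ext_iff.1 hv
      exact (congrArg (fun p : TotPt V.fib => g p.pt) h1).symm.trans (congrArg TotPt.pt h2)
    · intro h
      change g x = y at h
      subst h
      exact ⟨⟨x, (a, b)⟩, rfl⟩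
  rw [this]
  exact isClosed_eq (g.continuous_toFun.comp (V.continuous_pt.comp continuous_fst))
    (W.continuous_pt.comp continuous_snd)

theorem sum_continuous_fst : Continuous (V.sumFst W g) :=
  continuous_fst.comp (V.sum_isEmbedding W g).continuous

theorem sum_continuous_snd : Continuous (V.sumSnd W g) :=
  continuous_snd.comp (V.sum_isEmbedding W g).continuous

/-- The direct sum `V ⊕ g*(W)`. -/
def sum : GBundle X where
  fib x := V.fib x × W.fib (g x)
  t2 := .of_injective_continuous (V.sum_injective W g) (V.sum_isEmbedding W g).continuous
  para := by
    obtain ⟨ρ, hρ, h0, hc⟩ := V.exists_exhaustion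
    obtain ⟨ρ', hρ', h0', hc'⟩ := W.exists_exhaustion
    have hcont : Continuous fun v => ρ (V.sumFst W g v) + ρ' (V.sumSnd W g v) :=
      (hρ.comp (V.sum_continuous_fst W g)).add (hρ'.comp (V.sum_continuous_snd W g))
    have hpt : Continuous (TotPt.pt : (TotPt fun x => V.fib x × W.fib (g x)) → X) :=
      V.continuous_pt.comp (V.sum_continuous_fst W g)
    refine paracompact_of_exhaustion (p := TotPt.pt) hcont
      (fun v => add_nonneg (h0 _) (h0' _)) fun c => (compactOver_iff hpt).2 fun U x hU hx => ?_
    have m1 : V.sumFst W g ⁻¹' {v | ρ v ≤ c} ∈ U := Filter.mem_of_superset hU fun v hv =>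
      show ρ (V.sumFst W g v) ≤ c from le_trans (le_add_of_nonneg_right (h0' _))
        (show ρ (V.sumFst W g v) + ρ' (V.sumSnd W g v) ≤ c from hv)
    have m2 : V.sumSnd W g ⁻¹' {v | ρ' v ≤ c} ∈ U := Filter.mem_of_superset hU fun v hv =>
      show ρ' (V.sumSnd W g v) ≤ c from le_trans (le_add_of_nonneg_left (h0 _))
        (show ρ (V.sumFst W g v) + ρ' (V.sumSnd W g v) ≤ c from hv)
    obtain ⟨w, hw, hlw⟩ := (compactOver_iff V.proj.continuous_toFun).1 (hc c)
      (U.map (V.sumFst W g)) x m1 hx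
    obtain ⟨w', hw', hlw'⟩ := (compactOver_iff W.proj.continuous_toFun).1 (hc' c)
      (U.map (V.sumSnd W g)) (g x) m2 ((g.continuous_toFun.tendsto x).comp hx)
    obtain ⟨v, -, hv⟩ := (V.sum_isClosedEmbedding W g).isProperMap.ultrafilter_le_nhds_of_tendsto
      (𝒰 := U) (y := (w, w')) (Filter.Tendsto.prodMk_nhds hlw hlw')
    exact ⟨v, (isClosed_le hcont continuous_const).mem_of_frequently_of_tendsto
      (Filter.Eventually.frequently hU) hv, hv⟩
  locTriv x := by
    let c := V.fibChart x
    let d := W.fibChart (g x)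
    let c' : FibChart (fun x => V.fib x × W.fib (g x)) x :=
      { E := c.E × d.E
        U := c.U ∩ g ⁻¹' d.U
        isOpen := c.isOpen.inter (d.isOpen.preimage g.continuous_toFun)
        mem := ⟨c.mem, d.mem⟩
        L := fun y => (c.L y).prodMap (d.L (g y))
        bij := fun y hy => (c.bij _ hy.1).prodMap (d.bij _ hy.2)
        nhds_eq := fun v hv => by
          refine eq_of_forall_le_iff fun l => ?_
          rw [le_inf_iff, ← Filter.tendsto_iff_comap, ← Filter.tendsto_iff_comap,
            (V.sum_isEmbedding W g).nhds_eq_comap, ← Filter.tendsto_iff_comap,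
            nhds_prod_eq, Filter.tendsto_prod_iff',
            c.tendsto_iff (v := V.sumFst W g v) hv.1, d.tendsto_iff (v := V.sumSnd W g v) hv.2]
          refine ⟨fun h => ⟨h.1.1, h.1.2.prodMk_nhds h.2.2⟩, fun h => ⟨⟨h.1, ?_⟩, ?_, ?_⟩⟩
          · exact (continuous_fst.tendsto _).comp h.2
          · exact (g.continuous_toFun.tendsto _).comp h.1
          · exact (continuous_snd.tendsto _).comp h.2 }
    exact c'.exists_trivialization (V.continuous_pt.comp (V.sum_continuous_fst W g))
  act k x h := (V.act k x h).prodMap ((W.castEquiv (g.map_act k x h).symm).toLinearMap.comp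
    (W.act k (g x) (h.trans (g.anchor_map x).symm)))
  one_act v := V.sum_injective W g (Prod.ext (V.one_act (V.sumFst W g v)) (by
    refine (W.mk_castEquiv _ _).trans (Eq.trans ?_ (W.tot.one_act (V.sumSnd W g v)))
    exact W.tot.act_congr_left (x := V.sumSnd W g v) (congrArg G.one (g.anchor_map v.pt).symm) _ _))
  mul_act k h v e e' := V.sum_injective W g (Prod.ext (V.mul_act k h (V.sumFst W g v) e e') (by
    refine (W.mk_castEquiv _ _).trans (Eq.trans ?_ (W.mk_castEquiv _ _).symm)
    refine (W.tot.mul_act k h (V.sumSnd W g v) e (e'.trans (g.anchor_map _).symm)).trans ?_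
    exact W.tot.act_congr (W.mk_castEquiv (g.map_act h v.pt e').symm _).symm _ _))
  continuous_act := by
    refine (V.sum_isEmbedding W g).continuous_iff.2 (Continuous.prodMk ?_ ?_)
    · exact V.continuous_act.comp (f := fun p : {p : G.Arr × (TotPt fun x => V.fib x × W.fib (g x)) //
        G.src p.1 = X.anchor p.2.pt} => (⟨(p.1.1, V.sumFst W g p.1.2), p.2⟩ :
          {p : G.Arr × TotPt V.fib // G.src p.1 = X.anchor p.2.pt})) (((continuous_fst.comp
            continuous_subtype_val).prodMk ((V.sum_continuous_fst W g).comp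
            (continuous_snd.comp continuous_subtype_val))).subtype_mk _)
    · refine Continuous.congr (W.continuous_act.comp (f := fun p : {p : G.Arr × (TotPt fun x =>
        V.fib x × W.fib (g x)) // G.src p.1 = X.anchor p.2.pt} => (⟨(p.1.1, V.sumSnd W g p.1.2),
          p.2.trans (g.anchor_map _).symm⟩ :
          {p : G.Arr × TotPt W.fib // G.src p.1 = Y.anchor p.2.pt})) (((continuous_fst.comp
            continuous_subtype_val).prodMk ((V.sum_continuous_snd W g).comp
            (continuous_snd.comp continuous_subtype_val))).subtype_mk _)) fun p => ?_
      exact (W.mk_castEquiv _ _).symm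

/-- The projections of the direct sum. -/
def isSum : Sum (V.sum W g) V W g where
  lin _ := LinearEquiv.refl ℝ _
  fst :=
    { toFun := V.sumFst W g
      continuous_toFun := V.sum_continuous_fst W g
      anchor_map := fun _ => rfl
      map_act := fun _ _ _ => rfl }
  snd :=
    { toFun := V.sumSnd W g
      continuous_toFun := V.sum_continuous_snd W g
      anchor_map := fun v => g.anchor_map v.pt
      map_act := fun _ _ _ => W.mk_castEquiv _ _ }
  fst_eq _ := rfl
  snd_eq _ := rfl
  isClosedEmbedding := V.sum_isClosedEmbedding W g

end Sum

section Constructors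

variable {V' : GBundle X'} {f : GMap X' X} {V : GBundle X}

/-- An isomorphism onto a pull-back from its effect on the fibres. -/
def Map.of (lin : ∀ x, V'.fib x ≃ₗ[ℝ] V.fib (f x)) (Φ : GMap V'.tot V.tot)
    (h : ∀ v : V'.tot, Φ v = (⟨f v.pt, lin v.pt v.vec⟩ : TotPt V.fib)) : Map V' V f where
  lin := lin
  toGMap := Φ
  toGMap_eq := h
  isClosedEmbedding := by
    have := V'.isClosedEmbedding_of_lin V f.continuous_toFun lin (Φ.continuous_toFun.congr h)
    convert this using 2 with v
    exact Prod.ext rfl (h v)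

/-- Direct sum decompositions from their effect on the fibres. -/
def Sum.of {U V : GBundle X} {W : GBundle Y} {g : GMap X Y}
    (lin : ∀ x, U.fib x ≃ₗ[ℝ] V.fib x × W.fib (g x)) (a : GMap U.tot V.tot) (b : GMap U.tot W.tot)
    (ha : ∀ u : U.tot, a u = (⟨u.pt, (lin u.pt u.vec).1⟩ : TotPt V.fib))
    (hb : ∀ u : U.tot, b u = (⟨g u.pt, (lin u.pt u.vec).2⟩ : TotPt W.fib)) : Sum U V W g where
  lin := lin
  fst := a
  snd := b
  fst_eq := ha
  snd_eq := hb
  isClosedEmbedding := by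
    have hc : Continuous fun u : TotPt U.fib =>
        (⟨u.pt, lin u.pt u.vec⟩ : TotPt fun x => V.fib x × W.fib (g x)) := by
      refine (V.sum_isEmbedding W g).continuous_iff.2 (Continuous.prodMk ?_ ?_)
      · exact a.continuous_toFun.congr ha
      · exact b.continuous_toFun.congr hb
    have h1 := U.isClosedEmbedding_of_lin (V.sum W g) (f := id) continuous_id lin hc
    have h2 : IsClosedEmbedding fun u : TotPt U.fib =>
        (⟨u.pt, lin u.pt u.vec⟩ : TotPt fun x => V.fib x × W.fib (g x)) := by
      have h4 : IsClosedEmbedding fun w : TotPt (V.sum W g).fib => (w, w.pt) :=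
        .of_continuous_injective_isClosedMap (continuous_id.prodMk (V.sum W g).continuous_pt)
          (fun _ _ h => (Prod.ext_iff.1 h).1) (isProperMap_of_comp_of_t2 (g := Prod.fst)
            (continuous_id.prodMk (V.sum W g).continuous_pt) continuous_fst isProperMap_id).isClosedMap
      have h5 : IsClosedEmbedding fun u : TotPt U.fib =>
          ((⟨u.pt, lin u.pt u.vec⟩ : TotPt fun x => V.fib x × W.fib (g x)), u.pt) :=
        (Homeomorph.prodComm _ _).isClosedEmbedding.comp h1
      exact (h4.of_comp_iff (f := fun u : TotPt U.fib =>
        (⟨u.pt, lin u.pt u.vec⟩ : TotPt fun x => V.fib x × W.fib (g x)))).1 h5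
    convert (V.sum_isClosedEmbedding W g).comp h2 using 2 with u
    exact Prod.ext (ha u) (hb u)

end Constructors

end GBundle

/-- The inverse of a bijective equivariant homeomorphism. -/
noncomputable def GMap.symm {T T' : GSpace G} (i : GMap T' T) (hi : IsHomeomorph i) : GMap T T' where
  toFun := hi.homeomorph.symm
  continuous_toFun := hi.homeomorph.symm.continuous
  anchor_map t := by
    obtain ⟨t', rfl⟩ := hi.surjective t
    rw [i.anchor_map]
    exact congrArg T'.anchor (hi.homeomorph.symm_apply_apply t')
  map_act g t h := by
    obtain ⟨t', rfl⟩ := hi.surjective t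
    have h1 : ∀ s, hi.homeomorph.symm (i s) = s := hi.homeomorph.symm_apply_apply
    have h2 := h.trans (i.anchor_map t')
    refine (congrArg hi.homeomorph.symm (i.map_act g t' h2).symm).trans ((h1 _).trans ?_)
    exact T'.act_congr (h1 t').symm _ _

theorem GMap.symm_apply {T T' : GSpace G} (i : GMap T' T) (hi : IsHomeomorph i) (t : T') :
    i.symm hi (i t) = t := hi.homeomorph.symm_apply_apply t

theorem GMap.apply_symm {T T' : GSpace G} (i : GMap T' T) (hi : IsHomeomorph i) (t : T) :
    i (i.symm hi t) = t := hi.homeomorph.apply_symm_apply t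

theorem GMap.isHomeomorph_symm {T T' : GSpace G} (i : GMap T' T) (hi : IsHomeomorph i) :
    IsHomeomorph (i.symm hi) := hi.homeomorph.symm.isHomeomorph

/-- Corestriction to a closed invariant subset. -/
def ClosedInv.lift {T N : GSpace G} (A : ClosedInv T) (j : GMap N T) (h : ∀ n, j n ∈ A.carrier) :
    GMap N A.space where
  toFun n := ⟨j n, h n⟩
  continuous_toFun := j.continuous_toFun.subtype_mk _
  anchor_map n := j.anchor_map n
  map_act g n e := Subtype.ext (j.map_act g n e)

theorem IsProperMap.prod_of_comp {A B C D : Type*} [TopologicalSpace A] [TopologicalSpace B]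
    [TopologicalSpace C] [TopologicalSpace D] [T2Space B] [T2Space C] {a : A → B} {c : A → C}
    {i : C → D} (ha : Continuous a) (hc : Continuous c) (hi : Continuous i)
    (h : IsProperMap fun t => (a t, i (c t))) : IsProperMap fun t => (a t, c t) :=
  isProperMap_of_comp_of_t2 (g := Prod.map id i) (ha.prodMk hc) (continuous_id.prodMap hi) h

/-- A cartesian square: `T'` is the fibre product of `X'` and `T` over `X`. -/
structure Cart {T X T' X' : GSpace G} (q : GMap T' X') (φ : GMap T' T) (f : GMap X' X)
    (p : GMap T X) : Prop where
  comm : ∀ t, f (q t) = p (φ t)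
  emb : IsClosedEmbedding fun t => (q t, φ t)
  surj : ∀ x t, f x = p t → ∃ t', q t' = x ∧ φ t' = t

namespace Cart

variable {T X T' X' T'' X'' S : GSpace G} {q : GMap T' X'} {φ : GMap T' T} {f : GMap X' X}
    {p : GMap T X}

theorem proper (c : Cart q φ f p) : IsProperMap fun t => (q t, φ t) := c.emb.isProperMap

theorem ext (c : Cart q φ f p) {s t : T'} (h : q s = q t) (h' : φ s = φ t) : s = t :=
  c.emb.injective (Prod.ext h h')

theorem symm (c : Cart q φ f p) : Cart φ q p f where
  comm t := (c.comm t).symm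
  emb := (Homeomorph.prodComm _ _).isClosedEmbedding.comp c.emb
  surj x t h := (c.surj t x h.symm).imp fun _ h => h.symm

/-- The universal property of a fibre product. -/
noncomputable def lift (c : Cart q φ f p) (a : GMap S X') (b : GMap S T) (h : ∀ s, f (a s) = p (b s)) :
    GMap S T' where
  toFun s := (c.surj (a s) (b s) (h s)).choose
  continuous_toFun := by
    refine c.emb.isEmbedding.continuous_iff.2
      ((a.continuous_toFun.prodMk b.continuous_toFun).congr fun s => ?_)
    have := (c.surj (a s) (b s) (h s)).choose_spec
    exact (Prod.ext this.1 this.2).symm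
  anchor_map s := by
    rw [← q.anchor_map, (c.surj (a s) (b s) (h s)).choose_spec.1, a.anchor_map]
  map_act g s e := by
    refine c.ext ?_ ?_
    · rw [(c.surj _ _ (h (S.act g s e))).choose_spec.1, q.map_act, a.map_act]
      exact X'.act_congr (c.surj _ _ (h s)).choose_spec.1.symm _ _
    · rw [(c.surj _ _ (h (S.act g s e))).choose_spec.2, φ.map_act, b.map_act]
      exact T.act_congr (c.surj _ _ (h s)).choose_spec.2.symm _ _

theorem fst_lift (c : Cart q φ f p) (a : GMap S X') (b : GMap S T) (h : ∀ s, f (a s) = p (b s)) (s : S) :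
    q (c.lift a b h s) = a s := (c.surj (a s) (b s) (h s)).choose_spec.1

theorem snd_lift (c : Cart q φ f p) (a : GMap S X') (b : GMap S T) (h : ∀ s, f (a s) = p (b s)) (s : S) :
    φ (c.lift a b h s) = b s := (c.surj (a s) (b s) (h s)).choose_spec.2

/-- Two fibre products of the same maps are homeomorphic. -/
theorem isHomeomorph {q' : GMap S X'} {φ' : GMap S T} (c' : Cart q' φ' f p) (c : Cart q φ f p)
    {k : GMap S T'} (h₁ : ∀ s, q (k s) = q' s) (h₂ : ∀ s, φ (k s) = φ' s) : IsHomeomorph k := by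
  let m := c'.lift q φ c.comm
  refine isHomeomorph_iff_exists_inverse.2 ⟨k.continuous_toFun, m, fun s => ?_, fun s => ?_,
    m.continuous_toFun⟩
  · exact c'.ext ((c'.fst_lift _ _ _ _).trans (h₁ s)) ((c'.snd_lift _ _ _ _).trans (h₂ s))
  · exact c.ext ((h₁ _).trans (c'.fst_lift _ _ _ _)) ((h₂ _).trans (c'.snd_lift _ _ _ _))

theorem of_lift {r : GMap S X'} {ψ : GMap S T} (comm : ∀ s, f (r s) = p (ψ s)) (c : Cart q φ f p)
    {k : GMap S T'} (hk : IsHomeomorph k) (h₁ : ∀ s, q (k s) = r s) (h₂ : ∀ s, φ (k s) = ψ s) :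
    Cart r ψ f p where
  comm := comm
  emb := by
    convert c.emb.comp hk.isClosedEmbedding using 2 with s
    exact Prod.ext (h₁ s).symm (h₂ s).symm
  surj x t h := by
    obtain ⟨t', h', h''⟩ := c.surj x t h
    obtain ⟨s, rfl⟩ := hk.surjective t'
    exact ⟨s, (h₁ s).symm.trans h', (h₂ s).symm.trans h''⟩

theorem comp {q' : GMap T'' X''} {φ' : GMap T'' T'} {f' : GMap X'' X'} (c' : Cart q' φ' f' q)
    (c : Cart q φ f p) : Cart q' (φ.comp φ') (f.comp f') p where
  comm t := (congrArg f (c'.comm t)).trans (c.comm _)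
  emb := by
    have h1 : IsProperMap fun t => (q' t, φ (φ' t)) := by
      have h2 : IsProperMap fun t => (q' t, (q (φ' t), φ (φ' t))) :=
        (isProperMap_id.prodMap c.proper).comp c'.proper
      have h3 : IsClosedEmbedding fun s : X'' × T => (s.1, ((f' s.1 : X'), s.2)) := by
        refine .of_continuous_injective_isClosedMap (by
          have := f'.continuous_toFun; fun_prop) (fun a b h => ?_) ?_
        · obtain ⟨h1, h2⟩ := Prod.ext_iff.1 h
          exact Prod.ext h1 (Prod.ext_iff.1 h2).2
        · refine (isProperMap_of_comp_of_t2 (g := fun s : X'' × (X' × T) => (s.1, s.2.2)) (by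
            have := f'.continuous_toFun; fun_prop) (by fun_prop) ?_).isClosedMap
          exact isProperMap_id
      have h4 : IsProperMap fun t => ((fun s : X'' × T => (s.1, ((f' s.1 : X'), s.2))) ((q' t), φ (φ' t))) := by
        convert h2 using 2 with t
        simp only [c'.comm]
      exact isProperMap_of_comp_of_t2 (g := fun s : X'' × T => (s.1, ((f' s.1 : X'), s.2)))
        (q'.continuous_toFun.prodMk (φ.continuous_toFun.comp φ'.continuous_toFun))
        h3.continuous h4
    refine .of_continuous_injective_isClosedMap h1.continuous (fun a b h => ?_) h1.isClosedMap
    obtain ⟨h1, h2⟩ := Prod.ext_iff.1 h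
    change q' a = q' b at h1
    refine c'.ext h1 (c.ext ?_ h2)
    rw [← c'.comm, ← c'.comm, h1]
  surj x t h := by
    obtain ⟨t', h1, h2⟩ := c.surj (f' x) t h
    obtain ⟨t'', h3, h4⟩ := c'.surj x t' h1.symm
    exact ⟨t'', h3, (congrArg φ h4).trans h2⟩

theorem isOpenEmbedding (c : Cart q φ f p) (hf : IsOpenEmbedding f) : IsOpenEmbedding φ := by
  have hr : Set.range φ = p ⁻¹' Set.range f := by
    ext t
    constructor
    · rintro ⟨t', rfl⟩
      exact ⟨q t', c.comm t'⟩
    · rintro ⟨x, hx⟩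
      obtain ⟨t', -, h⟩ := c.surj x t hx
      exact ⟨t', h⟩
  refine ⟨⟨?_, fun a b h => c.ext (hf.injective ?_) h⟩, ?_⟩
  · refine ⟨TopologicalSpace.ext_nhds fun t => le_antisymm ?_ ?_⟩
    · rw [nhds_induced]
      exact Filter.tendsto_iff_comap.1 φ.continuous_toFun.continuousAt
    · rw [nhds_induced, c.emb.isEmbedding.nhds_eq_comap, nhds_prod_eq, ← Filter.tendsto_iff_comap]
      refine Filter.Tendsto.prodMk ?_ Filter.tendsto_comap
      rw [hf.isInducing.tendsto_nhds_iff]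
      refine Filter.Tendsto.congr (fun s => (c.comm s).symm) ?_
      rw [c.comm]
      exact (p.continuous_toFun.tendsto _).comp Filter.tendsto_comap
  · rw [c.comm, c.comm, h]
  · rw [hr]
    exact hf.isOpen_range.preimage p.continuous_toFun

end Cart

namespace GBundle

variable {X X' Y : GSpace G}

theorem Map.cart {V' : GBundle X'} {V : GBundle X} {f : GMap X' X} (φ : Map V' V f) :
    Cart V'.proj φ.toGMap f V.proj where
  comm := φ.comm
  emb := φ.isClosedEmbedding
  surj x v h := by
    obtain ⟨y, v⟩ := v
    change f x = y at h
    subst h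
    exact ⟨⟨x, (φ.lin x).symm v⟩, rfl, by simp [φ.toGMap_eq]⟩

theorem Sum.cart {U V : GBundle X} {W : GBundle Y} {g : GMap X Y} (s : Sum U V W g) :
    Cart s.fst s.snd (g.comp V.proj) W.proj where
  comm := s.comm_snd
  emb := s.isClosedEmbedding
  surj v w h := by
    obtain ⟨x, v⟩ := v
    obtain ⟨y, w⟩ := w
    change g x = y at h
    subst h
    exact ⟨⟨x, (s.lin x).symm (v, w)⟩, by simp [s.fst_eq], by simp [s.snd_eq]⟩

end GBundle

namespace CohTheory

variable {F : CohTheory.{u, v} G} {T X T' X' T'' S S' R B : GSpace G}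

namespace Supp

theorem restr_bijective {i : GMap T' T} (hi : IsHomeomorph i) {p : GMap T X} {p' : GMap T' X}
    {comm : ∀ t, p' t = p (i t)} :
    Function.Bijective (restr (F := F) i hi.isProperMap comm) := by
  have hc : ∀ t, p t = p' (i.symm hi t) := fun t => by rw [comm, i.apply_symm]
  refine Function.bijective_iff_has_inverse.2
    ⟨restr (i.symm hi) (i.isHomeomorph_symm hi).isProperMap hc, fun x => ?_, fun x => ?_⟩
  · refine (pull_pull (χ := GMap.id T) (k := GMap.id X) (comm'' := fun _ => rfl)
      (hχ := isProperMap_graph _ isProperMap_id fun _ => rfl) (i.apply_symm hi) x).trans ?_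
    exact pull_eq_self (fun _ => rfl) x
  · refine (pull_pull (χ := GMap.id T') (k := GMap.id X) (comm'' := fun _ => rfl)
      (hχ := isProperMap_graph _ isProperMap_id fun _ => rfl) (i.symm_apply hi) x).trans ?_
    exact pull_eq_self (fun _ => rfl) x

/-- A class whose multiples describe the cohomology with support of the total space. -/
def IsThomClass {q : GMap T S} (y : F.Supp q) : Prop :=
  ∀ (B : GSpace G) (p : GMap S B) (r : GMap T B) (comm : ∀ t, r t = p (q t)),
    Function.Bijective fun ξ : F.Supp p => mul q r comm ξ y

theorem IsThomClass.mul {q : GMap T S} {y : F.Supp q} (hy : y.IsThomClass) {q' : GMap R T}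
    {z : F.Supp q'} (hz : z.IsThomClass) {r : GMap R S} (comm : ∀ t, r t = q (q' t)) :
    (mul q' r comm y z).IsThomClass := by
  intro B p r' comm'
  have h1 := (hz B (p.comp q) r' (fun t => (comm' t).trans (congrArg p (comm t)))).comp
    (hy B p (p.comp q) fun _ => rfl)
  convert h1 using 1
  funext ξ
  exact (mul_assoc (comm := fun _ => rfl) r comm comm' ξ y z).symm

theorem IsThomClass.restr {q : GMap T S} {y : F.Supp q} (hy : y.IsThomClass) {q' : GMap T' S}
    {i : GMap T' T} (hi : IsHomeomorph i) (comm : ∀ t, q' t = q (i t)) :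
    (restr i hi.isProperMap comm y).IsThomClass := by
  intro B p r comm'
  have hc : ∀ t, r t = (p.comp q) (i t) := fun t => (comm' t).trans (congrArg p (comm t))
  have h1 := (restr_bijective (F := F) hi (comm := hc)).comp (hy B p (p.comp q) fun _ => rfl)
  convert h1 using 1
  funext ξ
  refine Eq.trans ?_ (pull_mul (ψ := GMap.id S) comm' (fun _ => rfl)
    (isProperMap_graph _ isProperMap_id fun _ => rfl) comm (isProperMap_graph i hi.isProperMap comm)
    ξ y).symm
  rw [pull_eq_self (fun _ => rfl) ξ]
  rfl

end Supp

open Supp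

theorem _root_.GBundle.IsThom.of_cart {E : GBundle X} {τ : F.Supp E.proj} (hτ : E.IsThom τ)
    {q : GMap T S} {φ : GMap T E.tot} {f : GMap S X} (c : Cart q φ f E.proj)
    {comm : ∀ t, f (q t) = E.proj (φ t)} {h : IsProperMap fun t => (q t, φ t)} :
    (pull φ f comm h τ).IsThomClass := by
  let c' := (E.pullbackMap f).cart
  let k := c'.lift q φ comm
  have hk : IsHomeomorph k := c.isHomeomorph c' (c'.fst_lift _ _ _) (c'.snd_lift _ _ _)
  have h1 : (pull (E.pullbackMap f).toGMap f c'.comm c'.proper τ).IsThomClass := by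
    intro B p r hr
    have : r = p.comp (E.pullback f).proj := GMap.ext (funext hr)
    subst this
    exact hτ S f _ (E.pullbackMap f) B p
  have h2 := h1.restr hk (q' := q) (fun t => (c'.fst_lift _ _ _ t).symm)
  convert h2 using 1
  exact (pull_pull (c'.snd_lift _ _ _) τ).symm

namespace Supp

/-- A locally constant invariant function with integral values. -/
structure _root_.IsRank (d : T → ℤ) : Prop where
  continuous : Continuous d
  act : ∀ g x h, d (T.act g x h) = d x

theorem _root_.IsRank.comp {d : T → ℤ} (hd : IsRank d) (φ : GMap T' T) :
    IsRank fun t => d (φ t) where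
  continuous := hd.continuous.comp φ.continuous_toFun
  act g x h := by rw [φ.map_act, hd.act]

/-- The part of `T` where the function `d` takes the value `k`. -/
abbrev _root_.IsRank.level {d : T → ℤ} (hd : IsRank d) (k : ℤ) : ClosedInv T :=
  T.piece d hd.continuous hd.act {k}

theorem HasLocalDegree.level {p : GMap T X} {x : F.Supp p} {d : T → ℤ} (hd : IsRank d)
    (hx : x.HasLocalDegree d) (k : ℤ) :
    (Supp.restr (hd.level k).incl (isClosedEmbedding_incl _).isProperMap
      (p' := p.comp (hd.level k).incl) (fun _ => rfl) x).HasDegree k :=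
  hx _ _ (isClosedEmbedding_incl _) (isOpen_range_piece T d hd.continuous hd.act {k}) k
    fun t => t.2

theorem HasLocalDegree.pull_hasDegree {p : GMap T X} {x : F.Supp p} {d : T → ℤ} (hd : IsRank d)
    (hx : x.HasLocalDegree d) {φ : GMap T' T} {f : GMap X' X} {p' : GMap T' X'}
    {comm : ∀ t, f (p' t) = p (φ t)} {hφ : IsProperMap fun t => (p' t, φ t)} {k : ℤ}
    (hk : ∀ t, d (φ t) = k) : (Supp.pull φ f comm hφ x).HasDegree k := by
  let j := (hd.level k).lift φ hk
  have h1 : IsProperMap fun t => (p' t, j t) := IsProperMap.prod_of_comp (i := Subtype.val)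
    p'.continuous_toFun j.continuous_toFun continuous_subtype_val hφ
  rw [← pull_pull (φ := (hd.level k).incl) (ψ := j) (f := GMap.id X) (g := f) (hψ := h1)
    (comm := fun _ => rfl) (comm' := comm) (p' := p.comp (hd.level k).incl)
    (hφ := isProperMap_graph _ (isClosedEmbedding_incl _).isProperMap fun _ => rfl) (fun _ => rfl)]
  exact (hx.level hd k).pull

theorem HasLocalDegree.pull {p : GMap T X} {x : F.Supp p} {d : T → ℤ} (hd : IsRank d)
    (hx : x.HasLocalDegree d) {φ : GMap T' T} {f : GMap X' X} {p' : GMap T' X'}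
    {comm : ∀ t, f (p' t) = p (φ t)} {hφ : IsProperMap fun t => (p' t, φ t)} {e : T' → ℤ}
    (he : ∀ t, e t = d (φ t)) : (Supp.pull φ f comm hφ x).HasLocalDegree e := by
  intro N i hi ho k hk
  have hc : ∀ t, f ((p'.comp i) t) = p ((φ.comp i) t) := fun t => comm (i t)
  have hp : IsProperMap fun t => ((p'.comp i) t, (φ.comp i) t) := hφ.comp hi.isProperMap
  rw [restr, pull_pull (χ := φ.comp i) (k := f) (comm'' := hc) (hχ := hp) (fun _ => rfl)]
  exact hx.pull_hasDegree hd fun t => (he (i t)).symm.trans (hk t)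

theorem HasLocalDegree.congr {p : GMap T X} {x : F.Supp p} {d e : T → ℤ} (hx : x.HasLocalDegree d)
    (h : ∀ t, e t = d t) : x.HasLocalDegree e := by
  rwa [show e = d from funext h]

theorem HasLocalDegree.mul {p : GMap S X} {q : GMap T S} {r : GMap T X} {comm : ∀ t, r t = p (q t)}
    {x : F.Supp p} {y : F.Supp q} {d : S → ℤ} {e : T → ℤ} (hd : IsRank d) (he : IsRank e)
    (hx : x.HasLocalDegree d) (hy : y.HasLocalDegree e)
    (hfin : ∀ k, ∃ s : Finset ℤ, ∀ t, d (q t) + e t = k → d (q t) ∈ s) :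
    (mul q r comm x y).HasLocalDegree fun t => d (q t) + e t := by
  intro N i hi ho k hk
  have hk' : ∀ n, d (q (i n)) + e (i n) = k := hk
  obtain ⟨s, hs⟩ := hfin k
  have hr : IsRank fun n => d (q (i n)) := (hd.comp q).comp i
  refine HasDegree.of_finite_pieces s _ hr.continuous hr.act (fun n => hs _ (hk' n))
    fun N' i' hi' _ a ha => ?_
  have hs : ∀ n, d (q (i (i' n))) = a := ha
  let j := (hd.level a).lift ((q.comp i).comp i') hs
  have hci : IsClosedEmbedding (i.comp i') := hi.comp hi'
  have h3 : IsProperMap fun t => (j t, (i.comp i') t) := by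
    refine isProperMap_of_comp_of_t2 (g := Prod.map Subtype.val id)
      (j.continuous_toFun.prodMk (i.comp i').continuous_toFun)
      (continuous_subtype_val.prodMap continuous_id) ?_
    exact isProperMap_graph (p := q) (p' := (q.comp i).comp i') (i.comp i') hci.isProperMap fun _ => rfl
  rw [restr, restr, pull_pull (χ := i.comp i') (k := GMap.id X) (comm'' := fun _ => rfl)
    (hχ := isProperMap_graph (i.comp i') hci.isProperMap fun _ => rfl) (fun _ => rfl),
    pull_mul (φ := i.comp i') (S' := (hd.level a).space) (p' := p.comp (hd.level a).incl) (q' := j)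
    (ψ := (hd.level a).incl) (fun t => comm _) (fun _ => rfl)
    (isProperMap_graph _ (isClosedEmbedding_incl _).isProperMap fun _ => rfl) (fun _ => rfl) h3]
  rw [← add_sub_cancel a k]
  refine (hx.level hd a).mul (hy.pull_hasDegree he fun t => ?_)
  have := hk' (i' t); have := hs t
  change e (i (i' t)) = _
  omega

/-- A class whose local degrees are even and bounded commutes with all classes. -/
theorem mul_comm_of_even_local {p₁ : GMap S X} {p₂ : GMap S' X} {q₁ : GMap T S}
    {q₂ : GMap T S'} {r : GMap T X} {c₁ : ∀ t, r t = p₁ (q₁ t)} {c₂ : ∀ t, r t = p₂ (q₂ t)}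
    {d₁ : ∀ t, p₁ (q₁ t) = p₂ (q₂ t)} {h₁ : IsProperMap fun t => (q₁ t, q₂ t)}
    {d₂ : ∀ t, p₂ (q₂ t) = p₁ (q₁ t)} {h₂ : IsProperMap fun t => (q₂ t, q₁ t)}
    (x : F.Supp p₁) {y : F.Supp p₂} {d : S' → ℤ} (hd : IsRank d)
    (hy : y.HasLocalDegree d) (he : ∀ s, Even (d s))
    {s : Finset ℤ} (hs : ∀ t, d t ∈ s) :
    mul q₁ r c₁ x (Supp.pull q₂ p₁ d₁ h₁ y) = mul q₂ r c₂ y (Supp.pull q₁ p₂ d₂ h₂ x) := by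
  have hr := hd.comp q₂
  refine ext_of_finite_pieces s _ hr.continuous hr.act (fun n => hs (q₂ n)) _ _ fun N i hi _ k hk => ?_
  let j := (hd.level k).lift (q₂.comp i) hk
  have hi' : IsProperMap fun t => (q₁ (i t), q₂ (i t)) := h₁.comp hi.isProperMap
  have e1 : IsProperMap fun t => (q₁ (i t), j t) :=
    IsProperMap.prod_of_comp (i := Subtype.val) (q₁.comp i).continuous_toFun j.continuous_toFun
      continuous_subtype_val hi'
  have e2 : IsProperMap fun t => (j t, q₁ (i t)) :=
    (Homeomorph.prodComm _ _).isClosedEmbedding.isProperMap.comp e1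
  have g1 : IsProperMap fun t => ((q₁.comp i) t, i t) :=
    isProperMap_graph (p := q₁) (p' := q₁.comp i) i hi.isProperMap fun _ => rfl
  have g2 : IsProperMap fun t => (j t, i t) := by
    refine isProperMap_of_comp_of_t2 (g := Prod.map Subtype.val id)
      (j.continuous_toFun.prodMk i.continuous_toFun)
      (continuous_subtype_val.prodMap continuous_id) ?_
    exact isProperMap_graph (p := q₂) (p' := q₂.comp i) i hi.isProperMap fun _ => rfl
  have g3 : IsProperMap fun t => ((p₂.comp (hd.level k).incl) t, (hd.level k).incl t) :=
    isProperMap_graph _ (isClosedEmbedding_incl _).isProperMap fun _ => rfl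
  unfold Supp.restr
  rw [pull_mul (φ := i) (p' := p₁) (q' := q₁.comp i) (ψ := GMap.id S) (fun t => c₁ _)
    (fun _ => rfl) (isProperMap_graph _ isProperMap_id fun _ => rfl) (fun _ => rfl) g1,
    pull_mul (φ := i) (p' := p₂.comp (hd.level k).incl) (q' := j) (ψ := (hd.level k).incl) (fun t => c₂ _)
    (fun _ => rfl) g3 (fun _ => rfl) g2, pull_eq_self (fun _ => rfl) x]
  have hy' := hy.level hd k
  obtain hE | ⟨⟨n⟩⟩ := isEmpty_or_nonempty N
  · exact (eq_zero_of_isEmpty _).trans (eq_zero_of_isEmpty _).symm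
  have hke : Even k := by
    have h := he (q₂ (i n))
    rwa [show d (q₂ (i n)) = k from hk n] at h
  have key := mul_comm_of_even hke (q₁ := q₁.comp i) (q₂ := j) (r := r.comp i) (c₁ := fun t => c₁ _)
    (c₂ := fun t => c₂ (i t)) (d₁ := fun t => d₁ (i t)) (h₁ := e1) (d₂ := fun t => d₂ (i t)) (h₂ := e2)
    x hy'
  refine Eq.trans ?_ (key.trans ?_)
  · congr 1
    refine (pull_pull (p'' := q₁.comp i) (χ := q₂.comp i) (k := p₁) (comm'' := fun t => d₁ (i t)) (hχ := hi')
      (fun _ => rfl) y).trans ?_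
    exact (pull_pull (φ := (hd.level k).incl) (ψ := j) (p'' := q₁.comp i) (χ := q₂.comp i) (k := p₁) (comm'' := fun t => d₁ (i t)) (hχ := hi')
      (fun _ => rfl) y).symm
  · congr 1
    symm
    exact pull_pull (fun _ => rfl) x

end Supp

end CohTheory

namespace GBundle

variable {X X' X'' Y Y' : GSpace G}

theorem isRank (V : GBundle X) : IsRank fun x => (V.rank x : ℤ) :=
  ⟨continuous_of_discreteTopology.comp V.continuous_rank, fun g x h => by rw [V.rank_act g x h]⟩

theorem isRank_tot (V : GBundle X) : IsRank fun v : V.tot => (V.rank (V.proj v) : ℤ) := V.isRank.comp V.proj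

theorem Map.rank_eq {V' : GBundle X'} {V : GBundle X} {f : GMap X' X} (φ : Map V' V f) (x : X') :
    V'.rank x = V.rank (f x) := (φ.lin x).finrank_eq

theorem Sum.rank_eq {U V : GBundle X} {W : GBundle Y} {g : GMap X Y} (s : Sum U V W g) (x : X) :
    U.rank x = V.rank x + W.rank (g x) :=
  (s.lin x).finrank_eq.trans (Module.finrank_prod)

theorem BoundedRank.of_map {V' : GBundle X'} {V : GBundle X} {f : GMap X' X} (h : V.BoundedRank)
    (φ : Map V' V f) : V'.BoundedRank :=
  h.imp fun _ h x => (φ.rank_eq x).trans_le (h _)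

theorem BoundedRank.of_sum {U V : GBundle X} {W : GBundle Y} {g : GMap X Y} (hV : V.BoundedRank)
    (hW : W.BoundedRank) (s : Sum U V W g) : U.BoundedRank := by
  obtain ⟨m, hm⟩ := hV
  obtain ⟨n, hn⟩ := hW
  exact ⟨m + n, fun x => (s.rank_eq x).trans_le (add_le_add (hm _) (hn _))⟩

/-- Isomorphisms of bundles over the same base. -/
def Map.iso {V W : GBundle X} (lin : ∀ x, V.fib x ≃ₗ[ℝ] W.fib x)
    (hc : Continuous fun v : TotPt V.fib => (⟨v.pt, lin v.pt v.vec⟩ : TotPt W.fib))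
    (he : ∀ g x h v, lin _ (V.act g x h v) = W.act g x h (lin x v)) : Map V W (GMap.id X) :=
  Map.of lin ⟨fun v => ⟨v.pt, lin v.pt v.vec⟩, hc, fun _ => rfl,
    fun g v h => congrArg (TotPt.mk _) (he g v.pt h v.vec)⟩ fun _ => rfl

/-- The identical isomorphism. -/
def Map.refl (V : GBundle X) : Map V V (GMap.id X) :=
  Map.iso (fun _ => LinearEquiv.refl ℝ _) continuous_id fun _ _ _ _ => rfl

/-- Composition of isomorphisms. -/
def Map.comp {V'' : GBundle X''} {V' : GBundle X'} {V : GBundle X} {f : GMap X' X} {f' : GMap X'' X'}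
    (φ : Map V' V f) (φ' : Map V'' V' f') : Map V'' V (f.comp f') :=
  Map.of (fun x => (φ'.lin x).trans (φ.lin (f' x))) (φ.toGMap.comp φ'.toGMap) fun v => by
    change φ.toGMap (φ'.toGMap v) = _
    rw [φ'.toGMap_eq, φ.toGMap_eq]; rfl

/-- Replacing the map between the bases by an equal one. -/
def Map.congr {V' : GBundle X'} {V : GBundle X} {f f' : GMap X' X} (φ : Map V' V f)
    (h : ∀ x, f x = f' x) : Map V' V f' :=
  Map.of (fun x => (φ.lin x).trans (V.castEquiv (h x))) φ.toGMap fun v => by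
    rw [φ.toGMap_eq]; exact (V.mk_castEquiv _ _).symm

/-- Factorisation of an isomorphism through a pull-back. -/
noncomputable def Map.lift {V'' : GBundle X''} {V' : GBundle X'} {V : GBundle X} {f : GMap X' X}
    {f'' : GMap X'' X} (φ : Map V' V f) (ψ : Map V'' V f'') (f' : GMap X'' X')
    (h : ∀ x, f (f' x) = f'' x) : Map V'' V' f' :=
  Map.of (fun x => (ψ.lin x).trans ((V.castEquiv (h x).symm).trans (φ.lin (f' x)).symm))
    (φ.cart.lift (f'.comp V''.proj) ψ.toGMap fun v => (h v.pt).trans (ψ.comm v)) fun v => by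
    refine φ.cart.ext (φ.cart.fst_lift _ _ _ _) ((φ.cart.snd_lift _ _ _ _).trans ?_)
    rw [φ.toGMap_eq, ψ.toGMap_eq]
    simp [V.mk_castEquiv]

theorem Map.toGMap_lift {V'' : GBundle X''} {V' : GBundle X'} {V : GBundle X} {f : GMap X' X}
    {f'' : GMap X'' X} (φ : Map V' V f) (ψ : Map V'' V f'') (f' : GMap X'' X')
    (h : ∀ x, f (f' x) = f'' x) (v : V''.tot) :
    φ.toGMap ((φ.lift ψ f' h).toGMap v) = ψ.toGMap v :=
  φ.cart.snd_lift _ _ (fun v : V''.tot => (h v.pt).trans (ψ.comm v)) _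

theorem Sum.map_comm {U' V' : GBundle X'} {W' : GBundle Y'} {g' : GMap X' Y'} {V : GBundle X}
    {W : GBundle Y} {g : GMap X Y} {f : GMap X' X} {k : GMap Y' Y} (s' : Sum U' V' W' g')
    (a : Map V' V f) (b : Map W' W k) (h : ∀ x, k (g' x) = g (f x)) (v : U'.tot) :
    (g.comp V.proj) ((a.toGMap.comp s'.fst) v) = W.proj ((b.toGMap.comp s'.snd) v) := by
  change g (V.proj (a.toGMap _)) = W.proj (b.toGMap _)
  rw [← a.comm, ← b.comm, ← h, s'.fst_eq, s'.snd_eq]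

/-- The map between direct sums induced by maps between the summands. -/
noncomputable def Sum.map {U' V' : GBundle X'} {W' : GBundle Y'} {g' : GMap X' Y'} {U V : GBundle X}
    {W : GBundle Y} {g : GMap X Y} {f : GMap X' X} {k : GMap Y' Y} (s' : Sum U' V' W' g')
    (s : Sum U V W g) (a : Map V' V f) (b : Map W' W k) (h : ∀ x, k (g' x) = g (f x)) :
    Map U' U f :=
  Map.of (fun x => (s'.lin x).trans (((a.lin x).prodCongr
      ((b.lin (g' x)).trans (W.castEquiv (h x)))).trans (s.lin (f x)).symm))
    (s.cart.lift (a.toGMap.comp s'.fst) (b.toGMap.comp s'.snd)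
      (s'.map_comm a b h)) fun v => by
    refine s.cart.ext ((s.cart.fst_lift _ _ _ _).trans ?_) ((s.cart.snd_lift _ _ _ _).trans ?_)
    · change a.toGMap (s'.fst v) = _
      rw [s.fst_eq, s'.fst_eq, a.toGMap_eq]
      simp
    · change b.toGMap (s'.snd v) = _
      rw [s.snd_eq, s'.snd_eq, b.toGMap_eq]
      simp [W.mk_castEquiv]

section

variable {U' V' : GBundle X'} {W' : GBundle Y'} {g' : GMap X' Y'} {U V : GBundle X}
    {W : GBundle Y} {g : GMap X Y} {f : GMap X' X} {k : GMap Y' Y} (s' : Sum U' V' W' g')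
    (s : Sum U V W g) (a : Map V' V f) (b : Map W' W k) (h : ∀ x, k (g' x) = g (f x))

theorem Sum.fst_map (u : U'.tot) : s.fst ((s'.map s a b h).toGMap u) = a.toGMap (s'.fst u) :=
  s.cart.fst_lift _ _ (s'.map_comm a b h) _

theorem Sum.snd_map (u : U'.tot) : s.snd ((s'.map s a b h).toGMap u) = b.toGMap (s'.snd u) :=
  s.cart.snd_lift _ _ (s'.map_comm a b h) _

end

end GBundle

namespace OBundle

variable {F : CohTheory.{u, v} G} {X X' X'' Y Y' : GSpace G}

open CohTheory

/-- The pull-back of an oriented bundle. -/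
def pullback (V : OBundle F X) (f : GMap X' X) : OBundle F X' where
  toGBundle := V.toGBundle.pullback f
  τ := Supp.pull (V.pullbackMap f).toGMap f (V.pullbackMap f).comm
    (V.pullbackMap f).isClosedEmbedding.isProperMap V.τ
  isThom Y k V' φ B p := by
    have c := φ.cart.comp (V.pullbackMap f).cart
    have := V.isThom.of_cart c (comm := c.comm) (h := c.proper) B p (p.comp V'.proj) fun _ => rfl
    convert this using 3
    exact Supp.pull_pull (fun _ => rfl) _
  degree := V.degree.pull V.isRank_tot fun _ => rfl

/-- The structure map of the pull-back. -/
def pullbackMap (V : OBundle F X) (f : GMap X' X) : Map (V.pullback f) V f where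
  toMap := V.toGBundle.pullbackMap f
  map_τ := rfl

/-- The direct sum `V ⊕ g*(W)` of oriented bundles. -/
def sum (V : OBundle F X) (W : OBundle F Y) (g : GMap X Y) : OBundle F X where
  toGBundle := V.toGBundle.sum W.toGBundle g
  τ := Supp.mul (V.toGBundle.isSum W.toGBundle g).fst (V.toGBundle.sum W.toGBundle g).proj
    (V.toGBundle.isSum W.toGBundle g).comm_fst V.τ
    (Supp.pull (V.toGBundle.isSum W.toGBundle g).snd (g.comp V.proj)
      (V.toGBundle.isSum W.toGBundle g).comm_snd
      (V.toGBundle.isSum W.toGBundle g).isClosedEmbedding.isProperMap W.τ)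
  isThom Y k U' φ B p := by
    let s := V.toGBundle.isSum W.toGBundle g
    let c := (V.toGBundle.pullbackMap k).cart
    let j : GMap U'.tot (V.toGBundle.pullback k).tot :=
      c.lift U'.proj (s.fst.comp φ.toGMap) fun t => (φ.comm t).trans (s.comm_fst _)
    have hj1 : ∀ t, (V.toGBundle.pullback k).proj (j t) = U'.proj t := c.fst_lift _ _ _
    have hj2 : ∀ t, (V.toGBundle.pullbackMap k).toGMap (j t) = s.fst (φ.toGMap t) := c.snd_lift _ _ _
    have c' : Cart j φ.toGMap (V.toGBundle.pullbackMap k).toGMap s.fst :=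
      { comm := hj2
        emb := by
          have h1 : IsClosedEmbedding fun t => (U'.proj t, φ.toGMap t) := φ.cart.emb
          have h2 : IsProperMap fun t => (j t, φ.toGMap t) :=
            isProperMap_of_comp_of_t2 (g := Prod.map (V.toGBundle.pullback k).proj id)
              (j.continuous_toFun.prodMk φ.toGMap.continuous_toFun)
              ((V.toGBundle.pullback k).proj.continuous_toFun.prodMap continuous_id) (by
                convert h1.isProperMap using 2 with t
                exact Prod.ext (hj1 t) rfl)
          refine .of_continuous_injective_isClosedMap h2.continuous (fun a b h => ?_) h2.isClosedMap
          obtain ⟨e1, e2⟩ := Prod.ext_iff.1 h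
          exact φ.cart.ext ((hj1 a).symm.trans ((congrArg _ e1).trans (hj1 b))) e2
        surj := fun w u hwu => by
          obtain ⟨t, h1, h2⟩ := φ.cart.surj ((V.toGBundle.pullback k).proj w) u (by
            rw [c.comm, hwu]; exact (s.comm_fst u).symm)
          exact ⟨t, c.ext ((hj1 t).trans h1) ((hj2 t).trans ((congrArg s.fst h2).trans hwu.symm)), h2⟩ }
    have c'' := c'.comp s.cart
    have t1 := V.isThom.of_cart c (comm := c.comm) (h := c.proper)
    have t2 := W.isThom.of_cart c'' (comm := c''.comm) (h := c''.proper)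
    have := t1.mul t2 (r := U'.proj) (fun t => (hj1 t).symm) B p (p.comp U'.proj) fun _ => rfl
    convert this using 3
    refine (Supp.pull_mul (fun t => (hj1 t).symm) c.comm c.proper hj2 c'.proper _ _).trans ?_
    congr 1
    exact Supp.pull_pull (fun _ => rfl) _
  degree := by
    refine Supp.HasLocalDegree.congr (Supp.HasLocalDegree.mul V.isRank_tot
      (e := fun u : (V.toGBundle.sum W.toGBundle g).tot => (W.rank (g u.pt) : ℤ)) ?_ V.degree
      (W.degree.pull W.isRank_tot fun t => ?_) fun k => ?_) fun t => ?_
    · exact (W.isRank.comp g).comp (V.toGBundle.sum W.toGBundle g).proj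
    · rfl
    · refine ⟨Finset.Icc 0 k, fun t ht => Finset.mem_Icc.2 ?_⟩
      omega
    · exact_mod_cast congrArg (Nat.cast (R := ℤ)) ((V.toGBundle.isSum W.toGBundle g).rank_eq t.pt)

/-- The decomposition of the direct sum. -/
def isSum (V : OBundle F X) (W : OBundle F Y) (g : GMap X Y) : Sum (V.sum W g) V W g where
  toSum := V.toGBundle.isSum W.toGBundle g
  sum_τ := rfl

/-- The identical isomorphism. -/
def Map.refl (V : OBundle F X) : Map V V (GMap.id X) where
  toMap := .refl _
  map_τ := (Supp.pull_eq_self (fun _ => rfl) _).symm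

/-- Composition of isomorphisms. -/
def Map.comp {V'' : OBundle F X''} {V' : OBundle F X'} {V : OBundle F X} {f : GMap X' X}
    {f' : GMap X'' X'} (φ : Map V' V f) (φ' : Map V'' V' f') : Map V'' V (f.comp f') where
  toMap := φ.toMap.comp φ'.toMap
  map_τ := by
    rw [φ'.map_τ, φ.map_τ]
    exact Supp.pull_pull (fun _ => rfl) _

/-- Replacing the map between the bases by an equal one. -/
def Map.congr {V' : OBundle F X'} {V : OBundle F X} {f f' : GMap X' X} (φ : Map V' V f)
    (h : ∀ x, f x = f' x) : Map V' V f' where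
  toMap := φ.toMap.congr h
  map_τ := φ.map_τ.trans (Supp.pull_congr (fun _ => rfl) _)

/-- Factorisation of an isomorphism through a pull-back. -/
noncomputable def Map.lift {V'' : OBundle F X''} {V' : OBundle F X'} {V : OBundle F X} {f : GMap X' X}
    {f'' : GMap X'' X} (φ : Map V' V f) (ψ : Map V'' V f'') (f' : GMap X'' X')
    (h : ∀ x, f (f' x) = f'' x) : Map V'' V' f' where
  toMap := φ.toMap.lift ψ.toMap f' h
  map_τ := by
    rw [ψ.map_τ, φ.map_τ]
    exact (Supp.pull_pull (φ.toMap.toGMap_lift ψ.toMap f' h) _).symm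

/-- The inverse of an isomorphism over the same base. -/
noncomputable def Map.symm {V W : OBundle F X} (φ : Map V W (GMap.id X)) : Map W V (GMap.id X) :=
  φ.lift (Map.refl W) (GMap.id X) fun _ => rfl

theorem Map.apply_symm {V W : OBundle F X} (φ : Map V W (GMap.id X)) (w : W.tot) :
    φ.toGMap (φ.symm.toGMap w) = w := 
  φ.toMap.toGMap_lift (Map.refl W).toMap (GMap.id X) (fun _ => rfl) w

theorem Map.symm_apply {V W : OBundle F X} (φ : Map V W (GMap.id X)) (v : V.tot) :
    φ.symm.toGMap (φ.toGMap v) = v := by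
  refine φ.cart.ext ?_ (φ.apply_symm _)
  have h1 := φ.symm.cart.comm (φ.toGMap v)
  exact h1.symm.trans (φ.cart.comm v).symm

/-- The map between direct sums induced by maps between the summands. -/
noncomputable def Sum.map {U' V' : OBundle F X'} {W' : OBundle F Y'} {g' : GMap X' Y'}
    {U V : OBundle F X} {W : OBundle F Y} {g : GMap X Y} {f : GMap X' X} {k : GMap Y' Y}
    (s' : Sum U' V' W' g') (s : Sum U V W g) (a : Map V' V f) (b : Map W' W k)
    (h : ∀ x, k (g' x) = g (f x)) : Map U' U f where
  toMap := s'.toSum.map s.toSum a.toMap b.toMap h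
  map_τ := by
    have h1 := s'.toSum.fst_map s.toSum a.toMap b.toMap h
    have h2 := s'.toSum.snd_map s.toSum a.toMap b.toMap h
    have hp : IsProperMap fun t => (s'.fst t, (s'.toSum.map s.toSum a.toMap b.toMap h).toGMap t) := by
      refine isProperMap_of_comp_of_t2 (g := Prod.map V'.proj id)
        (s'.fst.continuous_toFun.prodMk (GMap.continuous_toFun _))
        (V'.proj.continuous_toFun.prodMap continuous_id) ?_
      convert (s'.toSum.map s.toSum a.toMap b.toMap h).cart.proper using 2 with t
      exact Prod.ext (s'.comm_fst t).symm rfl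
    rw [s'.sum_τ, s.sum_τ]
    refine Eq.trans ?_ (Supp.pull_mul s'.comm_fst a.cart.comm a.cart.proper (fun t => (h1 t).symm) hp
      _ _).symm
    have hq : IsProperMap fun t => (s'.fst t, b.toGMap (s'.snd t)) := (s'.cart.comp b.cart).proper
    refine congr (congrArg _ a.map_τ) ?_
    rw [b.map_τ]
    refine (Supp.pull_pull (χ := b.toGMap.comp s'.snd) (k := (k.comp g').comp V'.proj)
      (comm'' := (s'.cart.comp b.cart).comm) (hχ := hq) (fun _ => rfl) _).trans ?_
    exact (Supp.pull_pull (fun t => h2 t) _).symm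

section

variable {U' V' : OBundle F X'} {W' : OBundle F Y'} {g' : GMap X' Y'} {U V : OBundle F X}
    {W : OBundle F Y} {g : GMap X Y} {f : GMap X' X} {k : GMap Y' Y} (s' : Sum U' V' W' g')
    (s : Sum U V W g) (a : Map V' V f) (b : Map W' W k) (h : ∀ x, k (g' x) = g (f x))

theorem Sum.fst_map (u : U'.tot) : s.fst ((s'.map s a b h).toGMap u) = a.toGMap (s'.fst u) :=
  s'.toSum.fst_map s.toSum a.toMap b.toMap h u

theorem Sum.snd_map (u : U'.tot) : s.snd ((s'.map s a b h).toGMap u) = b.toGMap (s'.snd u) :=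
  s'.toSum.snd_map s.toSum a.toMap b.toMap h u

end

end OBundle

namespace GBundle

variable {X Y : GSpace G}

/-- The direct sum of two bundles over the same base. -/
abbrev add (V W : GBundle X) : GBundle X := V.sum W (GMap.id X)

theorem continuous_addMk {α : Type*} [TopologicalSpace α] {V W : GBundle X} {x : α → X}
    {a : ∀ i, V.fib (x i)} {b : ∀ i, W.fib (x i)}
    (ha : Continuous fun i => (⟨x i, a i⟩ : TotPt V.fib))
    (hb : Continuous fun i => (⟨x i, b i⟩ : TotPt W.fib)) :
    Continuous fun i => (⟨x i, (a i, b i)⟩ : TotPt (V.add W).fib) :=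
  (V.sum_isEmbedding W (GMap.id X)).continuous_iff.2 (ha.prodMk hb)

theorem continuous_addFst (V W : GBundle X) :
    Continuous fun v : TotPt (V.add W).fib => (⟨v.pt, v.vec.1⟩ : TotPt V.fib) :=
  V.sum_continuous_fst W (GMap.id X)

theorem continuous_addSnd (V W : GBundle X) :
    Continuous fun v : TotPt (V.add W).fib => (⟨v.pt, v.vec.2⟩ : TotPt W.fib) :=
  V.sum_continuous_snd W (GMap.id X)

/-- Associativity of direct sums. -/
def assoc (A B C : GBundle X) : Map ((A.add B).add C) (A.add (B.add C)) (GMap.id X) :=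
  Map.iso (fun x => LinearEquiv.prodAssoc ℝ (A.fib x) (B.fib x) (C.fib x))
    (continuous_addMk (V := A) (W := B.add C) (x := fun v : TotPt ((A.add B).add C).fib => v.pt)
      (a := fun v => v.vec.1.1) (b := fun v => (v.vec.1.2, v.vec.2))
      ((A.continuous_addFst B).comp ((A.add B).continuous_addFst C))
      (continuous_addMk (x := fun v : TotPt ((A.add B).add C).fib => v.pt) (a := fun v => v.vec.1.2)
        ((A.continuous_addSnd B).comp ((A.add B).continuous_addFst C))
        ((A.add B).continuous_addSnd C)))
    fun _ _ _ _ => rfl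

/-- Commutativity of direct sums. -/
def swap (A B : GBundle X) : Map (A.add B) (B.add A) (GMap.id X) :=
  Map.iso (fun x => LinearEquiv.prodComm ℝ (A.fib x) (B.fib x))
    (continuous_addMk (A.continuous_addSnd B) (A.continuous_addFst B)) fun _ _ _ _ => rfl

/-! ### The zero bundle -/

instance zeroTop (X : GSpace G) : TopologicalSpace (TotPt fun _ : X => PUnit.{u + 1}) :=
  .induced TotPt.pt inferInstance

/-- The total space of the zero bundle. -/
def zeroHomeo (X : GSpace G) : (TotPt fun _ : X => PUnit.{u + 1}) ≃ₜ X where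
  toFun := TotPt.pt
  invFun x := ⟨x, ⟨⟩⟩
  left_inv _ := rfl
  right_inv _ := rfl
  continuous_toFun := continuous_induced_dom
  continuous_invFun := continuous_induced_rng.2 continuous_id

/-- The zero bundle. -/
def zero (X : GSpace G) : GBundle X where
  fib _ := PUnit
  t2 := (zeroHomeo X).isEmbedding.t2Space
  para := (zeroHomeo X).isClosedEmbedding.paracompactSpace
  locTriv x := by
    let c : FibChart (fun _ : X => PUnit.{u + 1}) x :=
      { E := PUnit
        U := Set.univ
        isOpen := isOpen_univ
        mem := trivial
        L := fun _ => 0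
        bij := fun _ _ => ⟨fun _ _ _ => rfl, fun _ => ⟨⟨⟩, rfl⟩⟩
        nhds_eq := fun v _ => by
          rw [(zeroHomeo X).isEmbedding.nhds_eq_comap]
          symm
          refine inf_eq_left.2 ?_
          refine Filter.tendsto_iff_comap.1 ?_
          exact tendsto_const_nhds }
    exact c.exists_trivialization (zeroHomeo X).continuous
  act _ _ _ := 0
  one_act v := TotPt.ext (X.one_act v.pt) (Subsingleton.helim rfl _ _)
  mul_act g h v e e' := TotPt.ext (X.mul_act g h v.pt e e') (Subsingleton.helim rfl _ _)
  continuous_act := continuous_induced_rng.2 (X.continuous_act.comp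
    (f := fun p : {p : G.Arr × TotPt (fun _ : X => PUnit.{u + 1}) // G.src p.1 = X.anchor p.2.pt} =>
      (⟨(p.1.1, p.1.2.pt), p.2⟩ : {p : G.Arr × X // G.src p.1 = X.anchor p.2}))
    (((continuous_fst.comp continuous_subtype_val).prodMk ((zeroHomeo X).continuous.comp
      (continuous_snd.comp continuous_subtype_val))).subtype_mk _))

theorem isHomeomorph_zero (X : GSpace G) : IsHomeomorph (zero X).proj := (zeroHomeo X).isHomeomorph

theorem isHomeomorph_proj (V : GBundle X) (h : ∀ x, Subsingleton (V.fib x)) : IsHomeomorph V.proj :=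
  isHomeomorph_iff_exists_inverse.2 ⟨V.proj.continuous_toFun, fun x => ⟨x, 0⟩,
    fun _ => congrArg (TotPt.mk _) (Subsingleton.elim _ _), fun _ => rfl, V.continuous_zero⟩

/-- Neutrality of the zero bundle. -/
noncomputable def addZero (V : GBundle X) : Map (V.add (zero X)) V (GMap.id X) :=
  Map.iso (fun x => LinearEquiv.prodUnique (R := ℝ) (M := V.fib x) (M₂ := PUnit.{u + 1}))
    (V.continuous_addFst (zero X)) fun _ _ _ _ => rfl

end GBundle

namespace OBundle

variable {F : CohTheory.{u, v} G} {X X' X'' Y Y' : GSpace G}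

open CohTheory

/-- The direct sum of two oriented bundles over the same base. -/
abbrev add (V W : OBundle F X) : OBundle F X := V.sum W (GMap.id X)

/-- The decomposition of a direct sum. -/
abbrev addSum (V W : OBundle F X) : Sum (V.add W) V W (GMap.id X) := V.isSum W (GMap.id X)

/-- Associativity of direct sums. -/
def assoc (A B C : OBundle F X) : Map ((A.add B).add C) (A.add (B.add C)) (GMap.id X) where
  toMap := A.toGBundle.assoc B.toGBundle C.toGBundle
  map_τ := by
    let Φ := (A.toGBundle.assoc B.toGBundle C.toGBundle).toGMap
    let s := A.addSum B
    let s' := (A.add B).addSum C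
    let t := B.addSum C
    let t' := A.addSum (B.add C)
    let q : GMap ((A.add B).add C).tot A.tot := s.fst.comp s'.fst
    have hΦ : IsProperMap Φ := by
      refine IsHomeomorph.isProperMap (isHomeomorph_iff_exists_inverse.2 ⟨Φ.continuous_toFun,
        fun v : TotPt (A.add (B.add C)).fib =>
          (⟨v.pt, ((v.vec.1, v.vec.2.1), v.vec.2.2)⟩ : TotPt ((A.add B).add C).fib), fun _ => rfl, fun _ => rfl, ?_⟩)
      exact GBundle.continuous_addMk (V := A.toGBundle.add B.toGBundle) (W := C.toGBundle)
        (x := fun v : TotPt (A.add (B.add C)).fib => v.pt) (a := fun v => (v.vec.1, v.vec.2.1))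
        (b := fun v => v.vec.2.2)
        (GBundle.continuous_addMk (x := fun v : TotPt (A.add (B.add C)).fib => v.pt)
          (a := fun v => v.vec.1) (b := fun v => v.vec.2.1) (GBundle.continuous_addFst _ _)
        ((GBundle.continuous_addFst _ _).comp (GBundle.continuous_addSnd _ _)))
        ((GBundle.continuous_addSnd _ _).comp (GBundle.continuous_addSnd _ _))
    have g1 : IsProperMap fun v => (q v, Φ v) := isProperMap_graph (p := t'.fst) Φ hΦ fun _ => rfl
    let χ : GMap ((A.add B).add C).tot (B.add C).tot := t'.snd.comp Φ
    have hχ : IsProperMap fun v => (q v, χ v) := t'.cart.proper.comp hΦ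
    have hχ' : IsProperMap fun v => (s'.fst v, χ v) :=
      isProperMap_of_comp_of_t2 (g := Prod.map s.fst id)
        (s'.fst.continuous_toFun.prodMk χ.continuous_toFun)
        (s.fst.continuous_toFun.prodMap continuous_id) hχ
    rw [(A.addSum (B.add C)).sum_τ]
    refine (Supp.mul_assoc (q := s.fst) (q' := s'.fst) (r := (A.add B).proj)
      (r' := ((A.add B).add C).proj) q (fun _ => rfl) (fun _ => rfl) A.τ _ _).trans ?_
    refine Eq.trans ?_ (Supp.pull_mul (q := t'.fst) (q' := q) (φ := Φ) (ψ := GMap.id A.tot) (f := GMap.id X)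
      (fun _ => rfl) (fun _ => rfl) (isProperMap_graph _ isProperMap_id fun _ => rfl) (fun _ => rfl) g1
      A.τ _).symm
    rw [Supp.pull_eq_self (fun _ => rfl) A.τ]
    congr 1
    refine Eq.trans ?_ (Supp.pull_pull (χ := χ) (k := A.proj) (comm'' := fun _ => rfl) (hχ := hχ)
      (fun _ => rfl) _).symm
    symm
    refine (Supp.pull_mul (q := t.fst) (q' := s'.fst) (φ := χ) (ψ := s.snd)
      (fun _ => rfl) s.cart.comm s.cart.proper (fun _ => rfl) hχ' B.τ _).trans ?_
    congr 1
    exact Supp.pull_pull (fun _ => rfl) _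

/-- Commutativity of direct sums, if one summand has even rank. -/
def swap (A B : OBundle F X) (hB : ∀ x, Even (B.rank x)) (hb : B.BoundedRank) :
    Map (A.add B) (B.add A) (GMap.id X) where
  toMap := A.toGBundle.swap B.toGBundle
  map_τ := by
    obtain ⟨m, hm⟩ := hb
    let Φ := (A.toGBundle.swap B.toGBundle).toGMap
    let s := A.addSum B
    let t := B.addSum A
    have hΦ : IsProperMap Φ :=
      IsHomeomorph.isProperMap (isHomeomorph_iff_exists_inverse.2 ⟨Φ.continuous_toFun,
        (B.toGBundle.swap A.toGBundle).toGMap, fun _ => rfl, fun _ => rfl,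
        (B.toGBundle.swap A.toGBundle).toGMap.continuous_toFun⟩)
    have g1 : IsProperMap fun v => (s.snd v, Φ v) := isProperMap_graph (p := t.fst) Φ hΦ fun _ => rfl
    have g2 : IsProperMap fun v => (s.snd v, s.fst v) := s.cart.symm.proper
    rw [(B.addSum A).sum_τ]
    refine (Supp.mul_comm_of_even_local (q₁ := s.fst) (q₂ := s.snd) (c₂ := fun _ => rfl)
      (d₂ := fun _ => rfl) (h₂ := g2) A.τ B.isRank_tot B.degree
      (s := Finset.Icc 0 m) (fun v => (Int.even_coe_nat _).2 (hB v.pt))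
      (fun v => Finset.mem_Icc.2 ⟨Int.natCast_nonneg _, Int.ofNat_le.2 (hm v.pt)⟩)).trans ?_
    refine Eq.trans ?_ (Supp.pull_mul (q := t.fst) (q' := s.snd) (φ := Φ) (ψ := GMap.id B.tot) (f := GMap.id X)
      (fun _ => rfl) (fun _ => rfl) (isProperMap_graph _ isProperMap_id fun _ => rfl) (fun _ => rfl) g1
      B.τ _).symm
    rw [Supp.pull_eq_self (fun _ => rfl) B.τ]
    congr 1
    exact (Supp.pull_pull (fun _ => rfl) _).symm

/-- Functoriality of direct sums. -/
noncomputable def addCongr {A A' B B' : OBundle F X} (a : Map A A' (GMap.id X))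
    (b : Map B B' (GMap.id X)) : Map (A.add B) (A'.add B') (GMap.id X) :=
  (A.addSum B).map (A'.addSum B') a b fun _ => rfl

theorem isOne_of_eq_one {T S : GSpace G} {q : GMap T S} (hq : IsProperMap q) :
    ∃ y : F.Supp q, y.IsOne := by
  have h : CompactOver q (closure (ClosedInv.empty T).carrierᶜ) :=
    (compactOver_iff q.continuous_toFun).2 fun U x _ hx => by
      obtain ⟨t, -, ht⟩ := hq.ultrafilter_le_nhds_of_tendsto (𝒰 := U) (y := x) hx
      exact ⟨t, subset_closure fun h => h, ht⟩
  exact ⟨_, h, rfl⟩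

end OBundle

namespace CohTheory.Supp

variable {F : CohTheory.{u, v} G} {T X T' X' S : GSpace G}

theorem IsOne.pull {p : GMap T X} {x : F.Supp p} (hx : x.IsOne) {φ : GMap T' T} {f : GMap X' X}
    {p' : GMap T' X'} {comm : ∀ t, f (p' t) = p (φ t)} {hφ : IsProperMap fun t => (p' t, φ t)} :
    (Supp.pull φ f comm hφ x).IsOne := by
  obtain ⟨h, rfl⟩ := hx
  exact ⟨(Cosupp.pull φ f comm hφ ⟨.empty T, h⟩).compactOver, congrArg (mk _) (F.map_one φ)⟩

theorem IsOne.hasDegree {p : GMap T X} {x : F.Supp p} (hx : x.IsOne) : x.HasDegree 0 := by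
  obtain ⟨h, rfl⟩ := hx
  exact ⟨_, _, F.one_deg T, rfl⟩

theorem IsOne.eq {p : GMap T X} {x y : F.Supp p} (hx : x.IsOne) (hy : y.IsOne) : x = y := by
  obtain ⟨h, rfl⟩ := hx
  obtain ⟨h', rfl⟩ := hy
  rfl

theorem IsOne.isThomClass {q : GMap T S} {y : F.Supp q} (hy : y.IsOne) (hq : IsHomeomorph q) :
    y.IsThomClass := fun B p r comm => by
  convert restr_bijective (F := F) hq (p := p) (comm := comm) using 1
  funext ξ
  exact mul_isOne hy ξ

end CohTheory.Supp

namespace OBundle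

variable {F : CohTheory.{u, v} G} {X X' X'' Y Y' : GSpace G}

open CohTheory

variable (F) in
/-- The zero bundle with its canonical orientation. -/
noncomputable def zero (X : GSpace G) : OBundle F X where
  toGBundle := .zero X
  τ := (isOne_of_eq_one (F := F) (GBundle.isHomeomorph_zero X).isProperMap).choose
  isThom := fun Y f V' φ B p => by
    have hy := (isOne_of_eq_one (F := F) (GBundle.isHomeomorph_zero X).isProperMap).choose_spec
    exact (hy.pull (φ := φ.toGMap) (f := f)).isThomClass (V'.isHomeomorph_proj fun x =>
      (φ.lin x).toEquiv.subsingleton_congr.2 (inferInstanceAs (Subsingleton PUnit.{u + 1}))) B p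
      (p.comp V'.proj) fun _ => rfl
  degree := by
    have hy := (isOne_of_eq_one (F := F) (GBundle.isHomeomorph_zero X).isProperMap).choose_spec
    exact hy.hasDegree.localDegree fun v => congrArg Nat.cast (Module.finrank_zero_of_subsingleton
      (R := ℝ) (M := PUnit.{u + 1}))

theorem isOne_zero (X : GSpace G) : (zero F X).τ.IsOne :=
  (isOne_of_eq_one (F := F) (GBundle.isHomeomorph_zero X).isProperMap).choose_spec

instance subsingleton_zero (X : GSpace G) (x : X) : Subsingleton ((zero F X).fib x) :=
  inferInstanceAs (Subsingleton PUnit.{u + 1})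

theorem rank_zero (X : GSpace G) (x : X) : (zero F X).rank x = 0 :=
  Module.finrank_zero_of_subsingleton

/-- Neutrality of the zero bundle. -/
noncomputable def addZero (V : OBundle F X) : Map (V.add (zero F X)) V (GMap.id X) where
  toMap := V.toGBundle.addZero
  map_τ := (V.addSum (zero F X)).sum_τ.trans (Supp.mul_isOne (isOne_zero X).pull V.τ)

end OBundle

theorem GMap.toUnit_eq {T : GSpace G} (b : GMap T (unitSpace G)) (t : T) : b t = T.anchor t :=
  b.anchor_map t

theorem GMap.toUnit_congr {T T' : GSpace G} (b : GMap T (unitSpace G)) (b' : GMap T' (unitSpace G))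
    (j : GMap T' T) (t : T') : b' t = b (j t) := by
  rw [b.toUnit_eq, b'.toUnit_eq, j.anchor_map]

variable {F : CohTheory.{u, v} G} {X X' Y Y' Z M M' : GSpace G}

open CohTheory

namespace NNMap

/-- The bundle `E^Y`. -/
abbrev EY (f : NNMap F X Y) : OBundle F Y := f.E.pullback Y.anchorMap

theorem hat_comm (f : NNMap F X Y) (v : f.V.tot) : Y.anchorMap (f.toBase v) = f.E.proj (f.toFib v) :=
  (f.toBase.anchor_map v).trans (f.toFib.anchor_map v).symm

/-- The open embedding of total spaces. -/
noncomputable def hat (f : NNMap F X Y) : GMap f.V.tot f.EY.tot :=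
  (f.E.pullbackMap Y.anchorMap).cart.lift f.toBase f.toFib f.hat_comm

theorem proj_hat (f : NNMap F X Y) (v : f.V.tot) : f.EY.proj (f.hat v) = f.toBase v :=
  (f.E.pullbackMap Y.anchorMap).cart.fst_lift _ _ f.hat_comm v

theorem fib_hat (f : NNMap F X Y) (v : f.V.tot) :
    (f.E.pullbackMap Y.anchorMap).toGMap (f.hat v) = f.toFib v :=
  (f.E.pullbackMap Y.anchorMap).cart.snd_lift _ _ f.hat_comm v

theorem _root_.Cart.isOpenEmbedding_iff {T X T' X' S : GSpace G} {q : GMap T' X'} {φ : GMap T' T}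
    {f : GMap X' X} {p : GMap T X} (c : Cart q φ f p) {j : GMap S T'} {a : GMap S X'} {b : GMap S T}
    (ha : ∀ s, q (j s) = a s) (hb : ∀ s, φ (j s) = b s) (h : ∀ s, f (a s) = p (b s)) :
    IsOpenEmbedding j ↔
      IsOpenEmbedding fun s : S => (⟨(a s, b s), h s⟩ : {x : X' × T // f x.1 = p x.2}) := by
  let H : T' → {x : X' × T // f x.1 = p x.2} := fun t => ⟨(q t, φ t), c.comm t⟩
  have hH : IsHomeomorph H := by
    have h1 : IsEmbedding H := .of_comp (Continuous.subtype_mk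
      (q.continuous_toFun.prodMk φ.continuous_toFun) _) continuous_subtype_val c.emb.isEmbedding
    rw [isHomeomorph_iff_isEmbedding_surjective]
    refine ⟨h1, ?_⟩
    rintro ⟨⟨x, t⟩, h⟩
    obtain ⟨t', h', h''⟩ := c.surj x t h
    exact ⟨t', Subtype.ext (Prod.ext h' h'')⟩
  have : (fun s : S => (⟨(a s, b s), h s⟩ : {x : X' × T // f x.1 = p x.2})) = H ∘ j := by
    funext s
    exact Subtype.ext (Prod.ext (ha s).symm (hb s).symm)
  rw [this]
  exact (hH.isOpenEmbedding.of_comp_iff j).symm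

theorem isOpenEmbedding_hat (f : NNMap F X Y) : IsOpenEmbedding f.hat :=
  ((f.E.pullbackMap Y.anchorMap).cart.isOpenEmbedding_iff f.proj_hat f.fib_hat f.hat_comm).2
    f.isOpenEmbedding

end NNMap

namespace Corr

/-- `η` is the image of the class of `Ψ` in `F*_Z(Y)`: the product `η τ_E` is the extension of `ξ τ_V`. -/
def IsValue (Ψ : Corr F (unitSpace G) Y) (η : F.Supp Y.anchorMap) : Prop :=
  Supp.IsExtension Ψ.f.hat (Supp.mul Ψ.f.V.proj (Ψ.b.comp Ψ.f.V.proj) (fun _ => rfl) Ψ.ξ Ψ.f.V.τ)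
    (Supp.mul Ψ.f.EY.proj (Y.anchorMap.comp Ψ.f.EY.proj) (fun _ => rfl) η Ψ.f.EY.τ)

theorem bijective_EY (Ψ : Corr F (unitSpace G) Y) : Function.Bijective fun η : F.Supp Y.anchorMap =>
    Supp.mul Ψ.f.EY.proj (Y.anchorMap.comp Ψ.f.EY.proj) (fun _ => rfl) η Ψ.f.EY.τ :=
  (Ψ.f.E.isThom.of_cart (Ψ.f.E.pullbackMap Y.anchorMap).cart) _ _ _ _

theorem exists_value (Ψ : Corr F (unitSpace G) Y) : ∃ η, Ψ.IsValue η := by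
  obtain ⟨y, hy⟩ := Supp.exists_isExtension Ψ.f.hat Ψ.f.isOpenEmbedding_hat
    (p := Y.anchorMap.comp Ψ.f.EY.proj) (fun t => GMap.toUnit_congr _ _ Ψ.f.hat t)
    (Supp.mul Ψ.f.V.proj (Ψ.b.comp Ψ.f.V.proj) (fun _ => rfl) Ψ.ξ Ψ.f.V.τ)
  obtain ⟨η, rfl⟩ := Ψ.bijective_EY.2 y
  exact ⟨η, hy⟩

theorem IsValue.unique {Ψ : Corr F (unitSpace G) Y} {η η' : F.Supp Y.anchorMap} (h : Ψ.IsValue η)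
    (hη' : Ψ.IsValue η') : η = η' :=
  Ψ.bijective_EY.1 (Supp.IsExtension.unique Ψ.f.isOpenEmbedding_hat
    (fun t => GMap.toUnit_congr _ _ Ψ.f.hat t) h hη')

/-- Values are compatible with pull-back along proper maps, for cartesian squares. -/
theorem IsValue.pull {Ψ : Corr F (unitSpace G) Y} {η : F.Supp Y.anchorMap} (hη : Ψ.IsValue η)
    (Ψ' : Corr F (unitSpace G) Y') (h : GMap Y' Y) (hh : IsProperMap h) (c : GMap Ψ'.M Ψ.M)
    (hc : IsProperMap c) (hb : ∀ m, Ψ'.b m = Ψ.b (c m))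
    (α : OBundle.Map Ψ'.f.V Ψ.f.V c) (β : OBundle.Map Ψ'.f.E Ψ.f.E (GMap.id _))
    (h₁ : ∀ v, Ψ.f.toBase (α.toGMap v) = h (Ψ'.f.toBase v))
    (h₂ : ∀ v, Ψ.f.toFib (α.toGMap v) = β.toGMap (Ψ'.f.toFib v))
    (h₃ : ∀ v y', Ψ.f.toBase v = h y' → ∃ v', α.toGMap v' = v ∧ Ψ'.f.toBase v' = y')
    (hξ : Ψ'.ξ = Supp.restr c hc hb Ψ.ξ) :
    Ψ'.IsValue (Supp.restr h hh (p := Y.anchorMap) (fun y => (h.anchor_map y).symm) η) := by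
  let e := Ψ.f.E.pullbackMap Y.anchorMap
  let e' := Ψ'.f.E.pullbackMap Y'.anchorMap
  have hH : ∀ t : Ψ'.f.EY.tot, Y.anchorMap ((h.comp Ψ'.f.EY.proj) t) =
      Ψ.f.E.proj ((β.toGMap.comp e'.toGMap) t) := fun t => by
    refine (h.anchor_map _).trans ((e'.cart.comm t).trans ?_)
    exact β.cart.comm (e'.toGMap t)
  let H : GMap Ψ'.f.EY.tot Ψ.f.EY.tot := e.cart.lift (h.comp Ψ'.f.EY.proj) (β.toGMap.comp e'.toGMap) hH
  have H1 : ∀ t, Ψ.f.EY.proj (H t) = h (Ψ'.f.EY.proj t) := e.cart.fst_lift _ _ hH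
  have H2 : ∀ t, e.toGMap (H t) = β.toGMap (e'.toGMap t) := e.cart.snd_lift _ _ hH
  have gβ := (e'.cart.comp β.cart).proper
  have hp2 : IsProperMap fun t => (Ψ'.f.EY.proj t, H t) :=
    isProperMap_of_comp_of_t2 (g := Prod.map id e.toGMap)
      (Ψ'.f.EY.proj.continuous_toFun.prodMk H.continuous_toFun)
      (continuous_id.prodMap e.toGMap.continuous_toFun) (by
        convert gβ using 2 with t
        exact Prod.ext rfl (H2 t))
  have hp1 : IsProperMap H := by
    have k1 : IsProperMap fun t => (h (Ψ'.f.EY.proj t), β.toGMap (e'.toGMap t)) :=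
      (hh.prodMap isProperMap_id).comp gβ
    refine isProperMap_of_comp_of_t2 (g := fun t => (Ψ.f.EY.proj t, e.toGMap t)) H.continuous_toFun
      (Ψ.f.EY.proj.continuous_toFun.prodMk e.toGMap.continuous_toFun) ?_
    convert k1 using 2 with t
    exact Prod.ext (H1 t) (H2 t)
  have hα : IsProperMap α.toGMap := by
    have k1 : IsProperMap fun t => (c (Ψ'.f.V.proj t), α.toGMap t) :=
      (hc.prodMap isProperMap_id).comp α.cart.proper
    refine isProperMap_of_comp_of_t2 (g := fun t => (Ψ.f.V.proj t, t)) α.toGMap.continuous_toFun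
      (Ψ.f.V.proj.continuous_toFun.prodMk continuous_id) ?_
    convert k1 using 2 with t
    exact Prod.ext (α.cart.comm t).symm rfl
  have c1 : ∀ t, (GMap.id (unitSpace G)) ((Y'.anchorMap.comp Ψ'.f.EY.proj) t) =
      (Y.anchorMap.comp Ψ.f.EY.proj) (H t) := fun t =>
    GMap.toUnit_congr (Y.anchorMap.comp Ψ.f.EY.proj) (Y'.anchorMap.comp Ψ'.f.EY.proj) H t
  have c2 : ∀ t, (GMap.id (unitSpace G)) ((Ψ'.b.comp Ψ'.f.V.proj) t) =
      (Ψ.b.comp Ψ.f.V.proj) (α.toGMap t) := fun t =>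
    GMap.toUnit_congr (Ψ.b.comp Ψ.f.V.proj) (Ψ'.b.comp Ψ'.f.V.proj) α.toGMap t
  have key := Supp.IsExtension.pull c1 (isProperMap_graph H hp1 c1) c2
    (isProperMap_graph α.toGMap hα c2) (k := Ψ'.f.hat) (fun s => by
      refine e.cart.ext ?_ ?_
      · rw [H1, Ψ'.f.proj_hat, Ψ.f.proj_hat, h₁]
      · rw [H2, Ψ'.f.fib_hat, Ψ.f.fib_hat, h₂]) (fun s hs => by
      obtain ⟨v, hv⟩ := hs
      obtain ⟨v', rfl, hv'⟩ := h₃ v (Ψ'.f.EY.proj s) (by rw [← Ψ.f.proj_hat, hv, H1])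
      refine ⟨v', e'.cart.ext ((Ψ'.f.proj_hat v').trans hv') ((Ψ'.f.fib_hat v').trans ?_)⟩
      refine β.cart.ext ?_ ?_
      · have k1 := Ψ'.f.hat_comm v'
        have k2 := e'.cart.comm s
        exact k1.symm.trans ((congrArg Y'.anchorMap hv').trans k2)
      · rw [← h₂, ← Ψ.f.fib_hat, hv, H2]) hη
  have x1 := Supp.pull_mul (p := Ψ.b) (q := Ψ.f.V.proj) (r := Ψ.b.comp Ψ.f.V.proj)
    (comm := fun _ => rfl) (p' := Ψ'.b) (q' := Ψ'.f.V.proj) (r' := Ψ'.b.comp Ψ'.f.V.proj) (fun _ => rfl)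
    (φ := α.toGMap) (ψ := c) (f := GMap.id (unitSpace G)) (c₁ := c2)
    (h₁ := isProperMap_graph α.toGMap hα c2) hb (isProperMap_graph c hc hb) α.cart.comm α.cart.proper
    Ψ.ξ Ψ.f.V.τ
  have x2 := Supp.pull_mul (p := Y.anchorMap) (q := Ψ.f.EY.proj) (r := Y.anchorMap.comp Ψ.f.EY.proj)
    (comm := fun _ => rfl) (p' := Y'.anchorMap) (q' := Ψ'.f.EY.proj)
    (r' := Y'.anchorMap.comp Ψ'.f.EY.proj) (fun _ => rfl)
    (φ := H) (ψ := h) (f := GMap.id (unitSpace G)) (c₁ := c1)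
    (h₁ := isProperMap_graph H hp1 c1) (fun y => (h.anchor_map y).symm)
    (isProperMap_graph (p := Y.anchorMap) (p' := Y'.anchorMap) h hh
      fun y => (h.anchor_map y).symm) (fun t => (H1 t).symm) hp2
    η Ψ.f.EY.τ
  have x3 : Supp.pull H h (fun t => (H1 t).symm) hp2 Ψ.f.EY.τ = Ψ'.f.EY.τ := by
    refine (Supp.pull_pull (χ := β.toGMap.comp e'.toGMap) (k := Y'.anchorMap)
      (comm'' := fun t => (e'.cart.comp β.cart).comm t) (hχ := gβ) (fun t => H2 t) Ψ.f.E.τ).trans ?_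
    refine Eq.trans ?_ (congrArg (Supp.pull e'.toGMap Y'.anchorMap e'.cart.comm e'.cart.proper)
      β.map_τ).symm
    exact (Supp.pull_pull (fun _ => rfl) Ψ.f.E.τ).symm
  rw [IsValue, hξ]
  convert key using 1
  · exact Eq.trans (congrArg _ α.map_τ) x1.symm
  · exact Eq.trans (congrArg _ x3.symm) x2.symm

theorem IsValue.iso {Ψ Ψ' : Corr F (unitSpace G) Y} {η : F.Supp Y.anchorMap} (hη : Ψ.IsValue η)
    (h : Ψ'.Iso Ψ) : Ψ'.IsValue η := by
  obtain ⟨i, hi, hb, ⟨α, β, hf⟩, hξ⟩ := h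
  have := hη.pull Ψ' (GMap.id Y) isProperMap_id i hi.isProperMap hb α β (fun v => (hf v).1.symm)
    (fun v => (hf v).2.symm) (fun v y' hv => by
      obtain ⟨m, hm⟩ := hi.surjective (Ψ.f.V.proj v)
      obtain ⟨v', -, hv'⟩ := α.cart.surj m v hm
      exact ⟨v', hv', (hf v').1.trans ((congrArg Ψ.f.toBase hv').trans hv)⟩) hξ
  exact Eq.mp (congrArg Ψ'.IsValue (Supp.pull_eq_self (fun _ => rfl) η)) this

theorem isClosedEmbedding_slice (Y : GSpace G) (t : unitInterval) : IsClosedEmbedding (Y.slice t) :=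
  .of_continuous_injective_isClosedMap (Y.slice t).continuous_toFun
    (fun _ _ h => congrArg Prod.fst h)
    (isProperMap_of_comp_of_t2 (Y := Y.prodI) (g := fun p => p.1) (Y.slice t).continuous_toFun continuous_fst
      isProperMap_id).isClosedMap

theorem _root_.CohTheory.Supp.restr_slice (Y : GSpace G) (η : F.Supp Y.prodI.anchorMap) :
    Supp.restr (Y.slice 0) (isClosedEmbedding_slice Y 0).isProperMap (p' := Y.anchorMap) (fun _ => rfl) η =
    Supp.restr (Y.slice 1) (isClosedEmbedding_slice Y 1).isProperMap (p' := Y.anchorMap) (fun _ => rfl) η := by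
  induction η using Supp.ind with | h B a => ?_
  let pr : GMap Y.prodI Y := ⟨Prod.fst, continuous_fst, fun _ => rfl, fun _ _ _ => rfl⟩
  have hop : IsOpen (pr '' B.set.carrierᶜ) := isOpenMap_fst _ B.set.isClosed.isOpen_compl
  let C : ClosedInv Y := ⟨(pr '' B.set.carrierᶜ)ᶜ, hop.isClosed_compl, by
    rintro g y h hy ⟨⟨y', t⟩, hp, he⟩
    change y' = Y.act g y h at he
    subst he
    refine hy ⟨(y, t), fun hm => hp ?_, rfl⟩
    exact B.set.act_mem g (y, t) h hm⟩
  have hC : CompactOver Y.anchorMap (closure C.carrierᶜ) := by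
    have h1 := B.compactOver.image (j := pr) (p := Y.anchorMap) (fun _ => rfl)
    refine h1.subset isClosed_closure (closure_minimal ?_ h1.isClosed)
    rw [compl_compl]
    exact Set.image_mono subset_closure
  have hmem : ∀ y ∈ C.carrier, ∀ t, ((y, t) : Y × unitInterval) ∈ B.set.carrier := fun y hy t => by
    by_contra h
    exact hy ⟨(y, t), h, rfl⟩
  have key := F.homotopy (GMap.id Y.prodI) C B.set hmem (fun y hy => hmem y hy 0)
    (fun y hy => hmem y hy 1) a
  have h2 : ∀ t, Supp.restr (Y.slice t) (isClosedEmbedding_slice Y t).isProperMap (p' := Y.anchorMap)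
      (fun _ => rfl) (Supp.mk B a) = Supp.mk ⟨C, hC⟩ (F.map ((GMap.id Y.prodI).comp (Y.slice t)) C B.set
        (fun y hy => hmem y hy t) a) := fun t => by
    refine Supp.mk_eq_of_res (fun y hy => hmem y hy t) ?_
    exact CohTheory.res_map _ _ _
  rw [h2, h2, key]

theorem IsBoundary.isValue {W : GSpace G} {h : NNMap F W Y.prodI} {b : GMap W (unitSpace G)}
    {ξ : F.Supp b} {t : unitInterval} {Ψ : Corr F (unitSpace G) Y} (hΨ : Ψ.IsBoundary h b ξ t)
    {η : F.Supp Y.prodI.anchorMap} (hη : (⟨W, b, h, ξ⟩ : Corr F (unitSpace G) Y.prodI).IsValue η) :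
    Ψ.IsValue (Supp.restr (Y.slice t) (isClosedEmbedding_slice Y t).isProperMap (fun _ => rfl) η) := by
  obtain ⟨D, hD, i, hi, hb, hr, ⟨α, β, hf⟩, hξ⟩ := hΨ
  refine hη.pull Ψ (Y.slice t) (isClosedEmbedding_slice Y t).isProperMap i hi.isProperMap hb α β
    (fun v => (hf v).1) (fun v => (hf v).2) (fun v y' hv => ?_) hξ
  have h1 : h.V.proj v ∈ Set.range i := hr ▸ (hD v).1 (congrArg Prod.snd hv)
  obtain ⟨m, hm⟩ := h1
  obtain ⟨v', -, hv'⟩ := α.cart.surj m v hm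
  refine ⟨v', hv', ?_⟩
  have h2 := (hf v').1
  rw [hv'] at h2
  exact congrArg Prod.fst (h2.symm.trans hv)

theorem Bordant.isValue_iff {Ψ₀ Ψ₁ : Corr F (unitSpace G) Y} (h : Ψ₀.Bordant Ψ₁)
    (η : F.Supp Y.anchorMap) : Ψ₀.IsValue η ↔ Ψ₁.IsValue η := by
  obtain ⟨W, b, f, ξ, h₀, h₁⟩ := h
  obtain ⟨ζ, hζ⟩ := (⟨W, b, f, ξ⟩ : Corr F (unitSpace G) Y.prodI).exists_value
  have e₀ := h₀.isValue hζ
  have e₁ := h₁.isValue hζ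
  have := Supp.restr_slice Y ζ
  constructor
  · intro h
    rw [h.unique e₀, this]
    exact e₁
  · intro h
    rw [h.unique e₁, ← this]
    exact e₀

theorem _root_.NNMap.Isotopic.bordant {M : GSpace G} {f₀ f₁ : NNMap F M Y} (h : f₀.Isotopic f₁)
    (b : GMap M X) (ξ : F.Supp b) : (⟨M, b, f₀, ξ⟩ : Corr F X Y).Bordant ⟨M, b, f₁, ξ⟩ := by
  obtain ⟨h, hl, h₀, h₁⟩ := h
  let pr : GMap M.prodI M := ⟨Prod.fst, continuous_fst, fun _ => rfl, fun _ _ _ => rfl⟩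
  have hpr : IsProperMap pr := isProperMap_fst_of_compactSpace
  have hs : ∀ t, Supp.restr (M.slice t) (isClosedEmbedding_slice M t).isProperMap (p' := b)
      (fun _ => rfl) (Supp.restr pr hpr (p' := b.comp pr) (fun _ => rfl) ξ) = ξ := fun t => by
    refine (Supp.pull_pull (χ := GMap.id M) (k := GMap.id X) (comm'' := fun _ => rfl)
      (hχ := isProperMap_graph _ isProperMap_id fun _ => rfl) (fun _ => rfl) ξ).trans ?_
    exact Supp.pull_eq_self (fun _ => rfl) ξ
  have hb : ∀ (f : NNMap F M Y) t, f.IsEnd h (M.slice t) t →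
      (⟨M, b, f, ξ⟩ : Corr F X Y).IsBoundary h (b.comp pr) (Supp.restr pr hpr (fun _ => rfl) ξ) t := by
    intro f t hf
    refine ⟨{w | (w : M × unitInterval).2 = t}, fun v => ?_, M.slice t, isClosedEmbedding_slice M t,
      fun _ => rfl, ?_, hf, (hs t).symm⟩
    · rw [hl]; rfl
    · ext ⟨m, s⟩
      exact ⟨by rintro ⟨m', h⟩; exact (congrArg Prod.snd h).symm, fun h => ⟨m, Prod.ext rfl h.symm⟩⟩
  exact ⟨M.prodI, b.comp pr, h, _, hb f₀ 0 h₀, hb f₁ 1 h₁⟩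

end Corr

end

section

variable {G : TopGroupoid.{u}}

variable {F : CohTheory.{u, v} G} {X X' Y Y' Z M M' : GSpace G}

open CohTheory

theorem Cart.cancel {T X T' X' S S' : GSpace G} {q : GMap T' X'} {φ : GMap T' T} {f : GMap X' X}
    {p : GMap T X} (c : Cart q φ f p) {q₁ : GMap S' X'} {φ₁ : GMap S' S} {p₁ : GMap S X}
    (c₁ : Cart q₁ φ₁ f p₁) {p₂ : GMap T S} (hp : ∀ t, p t = p₁ (p₂ t)) {k : GMap T' S'}
    (h₁ : ∀ t, q₁ (k t) = q t) (h₂ : ∀ t, φ₁ (k t) = p₂ (φ t)) : Cart k φ φ₁ p₂ where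
  comm := h₂
  emb := by
    have h3 : IsProperMap fun t => (k t, φ t) :=
      isProperMap_of_comp_of_t2 (g := Prod.map q₁ id)
        (k.continuous_toFun.prodMk φ.continuous_toFun)
        (q₁.continuous_toFun.prodMap continuous_id) (by
          convert c.proper using 2 with t
          exact Prod.ext (h₁ t) rfl)
    refine .of_continuous_injective_isClosedMap h3.continuous (fun a b h => ?_) h3.isClosedMap
    obtain ⟨e1, e2⟩ := Prod.ext_iff.1 h
    exact c.ext ((h₁ a).symm.trans ((congrArg _ e1).trans (h₁ b))) e2
  surj w u hwu := by
    obtain ⟨t, e1, e2⟩ := c.surj (q₁ w) u (by rw [c₁.comm, hwu, hp])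
    exact ⟨t, c₁.ext ((h₁ t).trans e1) ((h₂ t).trans ((congrArg p₂ e2).trans hwu.symm)), e2⟩

/-- Interchanging the summands, if the first one has even rank. -/
def OBundle.Sum.swap {U V W : OBundle F X} (s : Sum U V W (GMap.id X)) (hV : ∀ x, Even (V.rank x))
    (hb : V.BoundedRank) : Sum U W V (GMap.id X) where
  toSum := .of (fun x => (s.lin x).trans (LinearEquiv.prodComm ℝ _ _)) s.snd s.fst s.snd_eq s.fst_eq
  sum_τ := by
    obtain ⟨m, hm⟩ := hb
    rw [s.sum_τ]
    exact (Supp.mul_comm_of_even_local (r := U.proj) (q₁ := s.snd) (q₂ := s.fst)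
      (c₁ := fun u => (s.comm_fst u).trans (s.comm_snd u))
      (d₁ := fun u => (s.comm_snd u).symm) (h₁ := s.cart.symm.proper)
      W.τ V.isRank_tot V.degree (s := Finset.Icc 0 m) (fun v => (Int.even_coe_nat _).2 (hV v.pt))
      (fun v => Finset.mem_Icc.2 ⟨Int.natCast_nonneg _, Int.ofNat_le.2 (hm v.pt)⟩)).symm

/-- For `V' ≅ π*(U^⊥ ⊕ V)` over the total space of `U`, the total space of `V'` is the fibre product
of `U ⊕ U^⊥` and `V`. -/
theorem OBundle.Complement.exists_cart {U V N : OBundle F M} (k : U.Complement)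
    (n : Sum N k.compl V (GMap.id M)) {V' : OBundle F M'} {i : GMap M' U.tot} (hi : IsHomeomorph i)
    (α : Map V' N (U.proj.comp i)) : ∃ w : GMap V'.tot k.whole.tot,
      (∀ t, k.sum.fst (w t) = i (V'.proj t)) ∧ (∀ t, k.sum.snd (w t) = n.fst (α.toGMap t)) ∧
      Cart w α.toGMap k.sum.snd n.fst ∧ Cart (n.snd.comp α.toGMap) w V.proj k.whole.proj := by
  let uQ : GMap V'.tot U.tot := i.comp V'.proj
  let vQ : GMap V'.tot V.tot := n.snd.comp α.toGMap
  let cQ : GMap V'.tot k.compl.tot := n.fst.comp α.toGMap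
  have αc : ∀ t, U.proj (uQ t) = N.proj (α.toGMap t) := α.cart.comm
  have hw : ∀ t, ((GMap.id _).comp U.proj) (uQ t) = k.compl.proj (cQ t) := fun t =>
    (αc t).trans (n.comm_fst _)
  let w : GMap V'.tot k.whole.tot := k.sum.cart.lift uQ cQ hw
  have w1 : ∀ t, k.sum.fst (w t) = uQ t := k.sum.cart.fst_lift _ _ hw
  have w2 : ∀ t, k.sum.snd (w t) = cQ t := k.sum.cart.snd_lift _ _ hw
  have hWM : ∀ t, k.whole.proj (w t) = V.proj (vQ t) := fun t => by
    refine (k.sum.comm_fst _).trans ?_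
    rw [w1]
    exact (αc t).trans ((n.comm_fst _).trans (n.comm_snd _))
  have cα : Cart uQ α.toGMap U.proj N.proj :=
    { comm := αc
      emb := hi.isClosedEmbedding.prodMap .id |>.comp α.cart.emb
      surj := fun x t h => by
        obtain ⟨m, rfl⟩ := hi.surjective x
        obtain ⟨t', rfl, h'⟩ := α.cart.surj m t h
        exact ⟨t', rfl, h'⟩ }
  have cw : Cart w α.toGMap k.sum.snd n.fst :=
    cα.cancel (p₁ := k.compl.proj) ⟨k.sum.cart.comm, k.sum.cart.emb, k.sum.cart.surj⟩ n.comm_fst w1 w2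
  have cv : Cart w vQ (k.compl.proj.comp k.sum.snd) V.proj := cw.comp n.cart
  refine ⟨w, w1, w2, cw, ?_⟩
  exact
    { comm := fun t => (hWM t).symm
      emb := cv.symm.emb
      surj := fun x t h => cv.symm.surj x t (h.trans ((k.sum.comm_fst t).trans (k.sum.comm_snd t))) }

namespace Corr

/-- Adding the same summand to both bundles does not change the value. -/
theorem IsValue.lift {Ψ : Corr F (unitSpace G) Y} {η : F.Supp Y.anchorMap} (hη : Ψ.IsValue η)
    (Ψ' : Corr F (unitSpace G) Y) {D : OBundle F (unitSpace G)}
    (c : OBundle.Sum Ψ'.f.E Ψ.f.E D (GMap.id _)) {v : GMap Ψ'.f.V.tot Ψ.f.V.tot}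
    {d : GMap Ψ'.f.V.tot D.tot} {k : GMap Ψ.f.V.tot (unitSpace G)} (hc : Cart v d k D.proj)
    (h₁ : ∀ w, Ψ'.f.toBase w = Ψ.f.toBase (v w)) (h₂ : ∀ w, c.fst (Ψ'.f.toFib w) = Ψ.f.toFib (v w))
    (h₃ : ∀ w, c.snd (Ψ'.f.toFib w) = d w)
    (hL : Supp.mul Ψ'.f.V.proj (Ψ'.b.comp Ψ'.f.V.proj) (fun _ => rfl) Ψ'.ξ Ψ'.f.V.τ =
      Supp.mul v (Ψ'.b.comp Ψ'.f.V.proj) (fun t => GMap.toUnit_congr (Ψ.b.comp Ψ.f.V.proj)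
        (Ψ'.b.comp Ψ'.f.V.proj) v t) (Supp.mul Ψ.f.V.proj (Ψ.b.comp Ψ.f.V.proj) (fun _ => rfl) Ψ.ξ Ψ.f.V.τ)
        (Supp.pull d k hc.comm hc.proper D.τ)) : Ψ'.IsValue η := by
  let e := Ψ.f.E.pullbackMap Y.anchorMap
  let e' := Ψ'.f.E.pullbackMap Y.anchorMap
  have hK : ∀ t : Ψ'.f.EY.tot, Y.anchorMap (Ψ'.f.EY.proj t) = Ψ.f.E.proj ((c.fst.comp e'.toGMap) t) :=
    fun t => (e'.cart.comm t).trans (c.comm_fst (e'.toGMap t))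
  let K : GMap Ψ'.f.EY.tot Ψ.f.EY.tot := e.cart.lift Ψ'.f.EY.proj (c.fst.comp e'.toGMap) hK
  have K1 : ∀ t, Ψ.f.EY.proj (K t) = Ψ'.f.EY.proj t := e.cart.fst_lift _ _ hK
  have K2 : ∀ t, e.toGMap (K t) = c.fst (e'.toGMap t) := e.cart.snd_lift _ _ hK
  have cK : Cart K e'.toGMap e.toGMap c.fst := e'.cart.cancel e.cart c.comm_fst K1 K2
  have cD := cK.comp c.cart
  have hj : ∀ s, Ψ.f.hat (v s) = K (Ψ'.f.hat s) := fun s => e.cart.ext (by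
    rw [K1, Ψ'.f.proj_hat, Ψ.f.proj_hat, h₁]) (by rw [K2, Ψ'.f.fib_hat, Ψ.f.fib_hat, h₂])
  have hd : ∀ s, (c.snd.comp e'.toGMap) (Ψ'.f.hat s) = d s := fun s => by
    rw [← h₃, ← Ψ'.f.fib_hat]
  have hp : IsProperMap fun s => (v s, Ψ'.f.hat s) :=
    IsProperMap.prod_of_comp (i := c.snd.comp e'.toGMap) v.continuous_toFun Ψ'.f.hat.continuous_toFun
      (GMap.continuous_toFun _) (by
        convert hc.proper using 2 with s
        exact Prod.ext rfl (hd s))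
  have key := Supp.IsExtension.mul (q := K) (r := Y.anchorMap.comp Ψ'.f.EY.proj)
    (fun t => GMap.toUnit_congr (Y.anchorMap.comp Ψ.f.EY.proj) (Y.anchorMap.comp Ψ'.f.EY.proj) K t)
    (q' := v) (r' := Ψ'.b.comp Ψ'.f.V.proj) (fun t => GMap.toUnit_congr (Ψ.b.comp Ψ.f.V.proj)
        (Ψ'.b.comp Ψ'.f.V.proj) v t) hj hp (fun t ht => by
      obtain ⟨u, hu⟩ := ht
      obtain ⟨s, rfl, hs⟩ := hc.surj u ((c.snd.comp e'.toGMap) t) (by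
        refine Eq.trans ?_ (cD.comm t)
        rw [← hu]
        exact (GMap.toUnit_congr (((GMap.id (unitSpace G)).comp Ψ.f.E.proj).comp e.toGMap) k Ψ.f.hat u))
      exact ⟨s, cD.ext ((hj s).symm.trans hu) ((hd s).trans hs)⟩) hη
      (Supp.pull (c.snd.comp e'.toGMap) _ cD.comm cD.proper D.τ)
  rw [IsValue, hL]
  convert key using 1
  · congr 1
    exact (Supp.pull_pull hd D.τ).symm
  · refine Eq.trans ?_ (Supp.mul_assoc (q := Ψ.f.EY.proj) (q' := K) (r' := Y.anchorMap.comp Ψ'.f.EY.proj)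
      (comm := fun _ => rfl) Ψ'.f.EY.proj (fun t => (K1 t).symm) (fun _ => rfl) η Ψ.f.EY.τ _).symm
    congr 1
    refine (congrArg (Supp.pull e'.toGMap Y.anchorMap e'.cart.comm e'.cart.proper) c.sum_τ).trans ?_
    refine (Supp.pull_mul (q' := K) (ψ := e.toGMap) (fun t => (K1 t).symm) e.cart.comm e.cart.proper
      (fun t => K2 t) cK.proper Ψ.f.E.τ _).trans ?_
    congr 1
    exact Supp.pull_pull (fun _ => rfl) D.τ

theorem IsValue.isLifting {f f' : NNMap F M Y} {b : GMap M (unitSpace G)} {ξ : F.Supp b}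
    {η : F.Supp Y.anchorMap} (hη : (⟨M, b, f, ξ⟩ : Corr F (unitSpace G) Y).IsValue η)
    (h : f'.IsLifting f) : (⟨M, b, f', ξ⟩ : Corr F (unitSpace G) Y).IsValue η := by
  obtain ⟨D, a, c, h⟩ := h
  refine hη.lift ⟨M, b, f', ξ⟩ c a.cart (fun w => (h w).1) (fun w => (h w).2.1) (fun w => (h w).2.2) ?_
  refine Eq.trans (congrArg _ a.sum_τ) ?_
  exact (Supp.mul_assoc (comm := fun _ => rfl) f'.V.proj a.comm_fst (fun _ => rfl) ξ f.V.τ _).symm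

theorem IsValue.isThomModification {Ψ Ψ' : Corr F (unitSpace G) Y} {η : F.Supp Y.anchorMap}
    (hη : Ψ.IsValue η) (h : Ψ'.IsThomModification Ψ) : Ψ'.IsValue η := by
  obtain ⟨U, k, heven, N, n, i, hi, hb, α, c, hf, hξ⟩ := h
  let vQ : GMap Ψ'.f.V.tot Ψ.f.V.tot := n.snd.comp α.toGMap
  obtain ⟨w, w1, w2, cw, cv'⟩ := k.exists_cart n hi α
  have hd : ∀ t, c.fst (Ψ'.f.toFib t) = k.toTriv.toGMap (w t) := fun t =>
    (hf t).2.2 (w t) (w1 t) (w2 t)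
  have hWM : ∀ t, k.whole.proj (w t) = Ψ.f.V.proj (vQ t) := fun t => (cv'.comm t).symm
  have cv : Cart w vQ (k.compl.proj.comp k.sum.snd) Ψ.f.V.proj := cw.comp n.cart
  have ct := cv'.comp k.toTriv.cart
  obtain ⟨bd, hbd⟩ := k.bounded
  refine hη.lift Ψ' (c.swap heven k.bounded) ct (fun t => (hf t).1) (fun t => (hf t).2.1) hd ?_
  -- the class on the total space as a product over `k.whole.tot`
  let q₀ : GMap k.whole.tot Ψ'.M := (i.symm hi).comp k.sum.fst
  have hq₀ : ∀ t, i (q₀ t) = k.sum.fst t := fun t => i.apply_symm hi _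
  have hq₁ : ∀ t, Ψ'.f.V.proj t = q₀ (w t) := fun t => by
    change _ = i.symm hi (k.sum.fst (w t))
    rw [w1]
    exact (i.symm_apply hi _).symm
  let r₁ : GMap k.whole.tot (unitSpace G) := Ψ.b.comp k.whole.proj
  let r : GMap Ψ'.f.V.tot (unitSpace G) := Ψ'.b.comp Ψ'.f.V.proj
  have p1 : IsProperMap fun t => (q₀ t, k.sum.snd t) :=
    ((i.isHomeomorph_symm hi).isProperMap.prodMap isProperMap_id).comp k.sum.cart.proper
  have hcc : ∀ t, (U.proj.comp i) (q₀ t) = k.compl.proj (k.sum.snd t) := fun t => by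
    change U.proj (i (q₀ t)) = _
    rw [hq₀]
    exact k.sum.cart.comm t
  have s1 : Ψ'.f.V.τ = Supp.mul w Ψ'.f.V.proj hq₁
      (Supp.pull k.sum.snd (U.proj.comp i) hcc p1 k.compl.τ)
      (Supp.pull vQ (k.compl.proj.comp k.sum.snd) cv.comm cv.proper Ψ.f.V.τ) := by
    rw [α.map_τ, n.sum_τ]
    refine (Supp.pull_mul (q' := w) (ψ := k.sum.snd) hq₁ hcc p1 cw.comm cw.proper k.compl.τ _).trans ?_
    congr 1
    exact Supp.pull_pull (fun _ => rfl) _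
  have s2 : Supp.mul q₀ r₁ (fun t => GMap.toUnit_congr Ψ'.b r₁ q₀ t) Ψ'.ξ
      (Supp.pull k.sum.snd (U.proj.comp i) hcc p1 k.compl.τ) =
      Supp.mul k.whole.proj r₁ (fun _ => rfl) Ψ.ξ k.whole.τ := by
    have a1 := Supp.mul_assoc (q := U.proj) (q' := k.sum.fst) (r' := r₁) (r := Ψ.b.comp U.proj)
      (comm := fun _ => rfl) (comm' := fun t => GMap.toUnit_congr (Ψ.b.comp U.proj) r₁ k.sum.fst t)
      k.whole.proj k.sum.comm_fst (fun _ => rfl) Ψ.ξ U.τ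
      (Supp.pull k.sum.snd _ k.sum.cart.comm k.sum.cart.proper k.compl.τ)
    rw [← k.sum.sum_τ] at a1
    refine Eq.trans ?_ a1
    rw [hξ]
    have a2 := Supp.pull_mul (p := Ψ.b.comp U.proj) (q := k.sum.fst) (r := r₁)
      (comm := fun t => GMap.toUnit_congr (Ψ.b.comp U.proj) r₁ k.sum.fst t)
      (p' := Ψ'.b) (q' := q₀) (r' := r₁)
      (fun t => GMap.toUnit_congr Ψ'.b r₁ q₀ t) (φ := GMap.id _) (ψ := i) (f := GMap.id _)
      (c₁ := fun _ => rfl) (h₁ := isProperMap_graph _ isProperMap_id fun _ => rfl) hb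
      (isProperMap_graph i hi.isProperMap hb) hq₀
      (isProperMap_of_comp_of_t2 (g := Prod.snd) (q₀.continuous_toFun.prodMk continuous_id)
        continuous_snd isProperMap_id)
      (Supp.mul U.proj (Ψ.b.comp U.proj) (fun _ => rfl) Ψ.ξ U.τ)
      (Supp.pull k.sum.snd _ k.sum.cart.comm k.sum.cart.proper k.compl.τ)
    rw [Supp.pull_eq_self (fun _ => rfl)] at a2
    refine Eq.trans ?_ a2.symm
    refine congrArg (Supp.mul q₀ r₁ _ _) ?_
    exact (Supp.pull_pull (fun _ => rfl) k.compl.τ).symm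
  rw [s1]
  refine (Supp.mul_assoc (q := q₀) (q' := w) (r' := r)
    (comm := fun t => GMap.toUnit_congr Ψ'.b r₁ q₀ t)
    (comm' := fun t => GMap.toUnit_congr r₁ r w t) Ψ'.f.V.proj hq₁ (fun _ => rfl) Ψ'.ξ _ _).symm.trans ?_
  rw [s2]
  -- interchange the factors
  have s3 := Supp.mul_assoc (q := k.whole.proj) (q' := w) (r' := r) (comm := fun _ => rfl)
    (comm' := fun t => GMap.toUnit_congr r₁ r w t) (k.whole.proj.comp w) (fun _ => rfl)
    (fun t => GMap.toUnit_congr Ψ.b r (k.whole.proj.comp w) t) Ψ.ξ k.whole.τ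
    (Supp.pull vQ (k.compl.proj.comp k.sum.snd) cv.comm cv.proper Ψ.f.V.τ)
  have s4 := Supp.mul_assoc (q := Ψ.f.V.proj) (q' := vQ) (r' := r) (r := Ψ.b.comp Ψ.f.V.proj)
    (comm := fun _ => rfl)
    (comm' := fun t => GMap.toUnit_congr (Ψ.b.comp Ψ.f.V.proj) r vQ t) (k.whole.proj.comp w)
    hWM (fun t => GMap.toUnit_congr Ψ.b r (k.whole.proj.comp w) t) Ψ.ξ Ψ.f.V.τ
    (Supp.pull (k.toTriv.toGMap.comp w) _ ct.comm ct.proper k.triv.τ)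
  refine s3.trans (Eq.trans ?_ s4.symm)
  congr 1
  have s5 := Supp.mul_comm_of_even_local (q₁ := vQ) (q₂ := w) (r := k.whole.proj.comp w)
    (c₁ := hWM) (c₂ := fun _ => rfl) (d₁ := cv'.comm) (h₁ := cv'.proper) (d₂ := cv'.symm.comm)
    (h₂ := cv'.symm.proper) Ψ.f.V.τ k.whole.isRank_tot k.whole.degree (s := Finset.Icc 0 bd)
    (fun v => (Int.even_coe_nat _).2 (by
      have := heven (Ψ.M.anchorMap v.pt)
      rwa [← k.toTriv.rank_eq] at this))
    (fun v => Finset.mem_Icc.2 ⟨Int.natCast_nonneg _, Int.ofNat_le.2 (by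
      rw [k.toTriv.rank_eq]; exact hbd _)⟩)
  refine Eq.trans ?_ (s5.symm.trans ?_)
  · congr 1
  · congr 1
    rw [k.toTriv.map_τ]
    exact Supp.pull_pull (fun _ => rfl) _

end Corr

namespace CohTheory.Supp

variable {T T' T₁ T₂ S : GSpace G}

theorem restr_zero (i : GMap T' T) (hi : IsProperMap i) {p : GMap T X} {p' : GMap T' X}
    (comm : ∀ t, p' t = p (i t)) : restr (F := F) i hi comm 0 = 0 := pull_zero _ _ _ _

theorem eq_zero_of_restr {p : GMap T X} {j₁ : GMap T₁ T} {j₂ : GMap T₂ T} (h₁ : IsClosedEmbedding j₁)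
    (h₂ : IsClosedEmbedding j₂) (h : IsCompl (Set.range j₁) (Set.range j₂)) (x : F.Supp p)
    (hx₁ : restr j₁ h₁.isProperMap (p' := p.comp j₁) (fun _ => rfl) x = 0)
    (hx₂ : restr j₂ h₂.isProperMap (p' := p.comp j₂) (fun _ => rfl) x = 0) : x = 0 := by
  have key : ∀ {N : GSpace G} {j : GMap N T} (hj : IsClosedEmbedding j)
      (_ : restr j hj.isProperMap (p' := p.comp j) (fun _ => rfl) x = 0) (A : ClosedInv T)
      (_ : A.carrier = Set.range j), restr A.incl (isClosedEmbedding_incl A).isProperMap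
        (p' := p.comp A.incl) (fun _ => rfl) x = 0 := by
    intro N j hj hx A hA
    let k : GMap N A.space := A.lift j fun n => hA ▸ ⟨n, rfl⟩
    have hk : IsHomeomorph k := by
      have h1 : IsEmbedding k := .of_comp k.continuous_toFun A.incl.continuous_toFun hj.isEmbedding
      rw [isHomeomorph_iff_isEmbedding_surjective]
      refine ⟨h1, ?_⟩
      rintro ⟨t, ht⟩
      obtain ⟨n, rfl⟩ := hA ▸ ht
      exact ⟨n, rfl⟩
    refine (restr_bijective hk (p := p.comp A.incl) (p' := p.comp j) (comm := fun _ => rfl)).1 ?_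
    refine Eq.trans ?_ (restr_zero _ _ _).symm
    refine Eq.trans ?_ hx
    exact pull_pull (fun _ => rfl) x
  have hinv : ∀ {N : GSpace G} (j : GMap N T) g t h, t ∈ Set.range j → T.act g t h ∈ Set.range j := by
    rintro N j g t h ⟨n, rfl⟩
    exact ⟨N.act g n (h.trans (j.anchor_map n)), j.map_act _ _ _⟩
  exact eq_zero_of_two_pieces (A := ⟨Set.range j₁, h₁.isClosed_range, hinv j₁⟩)
    (A' := ⟨Set.range j₂, h₂.isClosed_range, hinv j₂⟩) h x (key h₁ hx₁ _ rfl) (key h₂ hx₂ _ rfl)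

theorem IsExtension.restr_eq_zero {p : GMap T X} {p₂ : GMap T₂ X} {j₁ : GMap T₁ T} {j₂ : GMap T₂ T}
    (h₁ : IsClosedEmbedding j₁) (h : Disjoint (Set.range j₁) (Set.range j₂)) {x : F.Supp p₂}
    {y : F.Supp p} (hy : IsExtension j₂ x y) :
    restr j₁ h₁.isProperMap (p' := p.comp j₁) (fun _ => rfl) y = 0 := by
  obtain ⟨B, a, -, hB, rfl, -⟩ := hy
  refine Eq.trans (congrArg (mk _) ?_) (mk_zero _)
  refine eq_zero_of_univ (fun t => ?_) _
  by_contra ht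
  exact Set.disjoint_left.1 h ⟨t, rfl⟩ (hB ht)

/-- A class is the sum of the extensions of its restrictions to two complementary pieces. -/
theorem eq_add_of_pieces {p : GMap T X} {p₁ : GMap T₁ X} {p₂ : GMap T₂ X} {j₁ : GMap T₁ T}
    {j₂ : GMap T₂ T} (h₁ : IsClosedEmbedding j₁) (h₂ : IsClosedEmbedding j₂)
    (h : IsCompl (Set.range j₁) (Set.range j₂)) (c₁ : ∀ t, p₁ t = p (j₁ t))
    (c₂ : ∀ t, p₂ t = p (j₂ t)) (x y₁ y₂ : F.Supp p)
    (hy₁ : IsExtension j₁ (restr j₁ h₁.isProperMap c₁ x) y₁)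
    (hy₂ : IsExtension j₂ (restr j₂ h₂.isProperMap c₂ x) y₂) :
    x = y₁ + y₂ := by
  obtain rfl : p₁ = p.comp j₁ := GMap.ext (funext c₁)
  obtain rfl : p₂ = p.comp j₂ := GMap.ext (funext c₂)
  refine sub_eq_zero.1 (eq_zero_of_restr h₁ h₂ h _ ?_ ?_)
  · refine (pull_sub _ _ _ _ _ _).trans (sub_eq_zero.2 ?_)
    refine Eq.trans ?_ (pull_add _ _ _ _ _ _).symm
    have e1 := hy₁.pull_eq (f := GMap.id X) (c := fun _ => rfl)
      (hj := isProperMap_graph j₁ h₁.isProperMap fun _ => rfl)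
    have e2 := hy₂.restr_eq_zero h₁ h.disjoint
    refine (congrArg₂ (· + ·) e1 e2).trans (add_zero _) |>.symm
  · refine (pull_sub _ _ _ _ _ _).trans (sub_eq_zero.2 ?_)
    refine Eq.trans ?_ (pull_add _ _ _ _ _ _).symm
    have e1 := hy₂.pull_eq (f := GMap.id X) (c := fun _ => rfl)
      (hj := isProperMap_graph j₂ h₂.isProperMap fun _ => rfl)
    have e2 := hy₁.restr_eq_zero h₂ h.disjoint.symm
    refine (congrArg₂ (· + ·) e2 e1).trans (zero_add _) |>.symm

theorem HasLocalDegree.of_level {p : GMap T X} {x : F.Supp p} {d : T → ℤ} (hd : IsRank d)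
    (h : ∀ k, (restr (hd.level k).incl (isClosedEmbedding_incl _).isProperMap
      (p' := p.comp (hd.level k).incl) (fun _ => rfl) x).HasDegree k) : x.HasLocalDegree d := by
  intro N i hi _ k hk
  have hp : IsProperMap ((hd.level k).lift i hk) :=
    isProperMap_of_comp_of_t2 (g := (hd.level k).incl) (GMap.continuous_toFun _)
        (GMap.continuous_toFun _) hi.isProperMap
  have hg := isProperMap_graph (p := p.comp (hd.level k).incl) (p' := p.comp i) _ hp fun _ => rfl
  have h1 := (h k).pull (φ := (hd.level k).lift i hk) (f := GMap.id X) (p' := p.comp i)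
    (comm := fun _ => rfl) (hφ := hg)
  have h2 := pull_pull (χ := i) (k := GMap.id X) (comm'' := fun _ => rfl)
    (hχ := isProperMap_graph (p := p) (p' := p.comp i) i hi.isProperMap fun _ => rfl)
    (φ := (hd.level k).incl)
    (ψ := (hd.level k).lift i hk) (f := GMap.id X) (g := GMap.id X) (comm := fun _ => rfl)
    (hφ := isProperMap_graph (p := p) _ (isClosedEmbedding_incl _).isProperMap fun _ => rfl)
    (comm' := fun _ => rfl) (hψ := hg) (p' := p.comp (hd.level k).incl) (fun _ => rfl) x
  exact Eq.mp (congrArg (HasDegree · k) h2) h1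

theorem HasLocalDegree.of_isExtension {p : GMap T X} {p' : GMap T' X} {j : GMap T' T}
    (hj : IsOpenEmbedding j) (comm : ∀ t, p' t = p (j t)) {x : F.Supp p'} {y : F.Supp p}
    (h : IsExtension j x y) {d : T → ℤ} (hd : IsRank d) (hx : x.HasLocalDegree fun t => d (j t)) :
    y.HasLocalDegree d := by
  refine .of_level hd fun k => ?_
  have hx' := hx.level (hd.comp j) k
  let jk : GMap ((hd.comp j).level k).space (hd.level k).space :=
    ClosedInv.restrict j _ _ fun t ht => ht
  have ho : IsOpenEmbedding jk := by
    have h1 : IsOpenEmbedding (((hd.level k).carrier).restrictPreimage j) := hj.restrictPreimage _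
    exact h1
  have h' := h.pull (k := jk) (φ := (hd.level k).incl) (φ' := ((hd.comp j).level k).incl)
    (f := GMap.id X) (q := p.comp (hd.level k).incl) (q' := p'.comp ((hd.comp j).level k).incl)
    (fun _ => rfl) (isProperMap_graph _ (isClosedEmbedding_incl _).isProperMap fun _ => rfl)
    (fun _ => rfl) (isProperMap_graph _ (isClosedEmbedding_incl _).isProperMap fun _ => rfl)
    (fun _ => rfl) (by
      rintro ⟨_, hs⟩ ⟨t, rfl⟩
      exact ⟨⟨t, hs⟩, rfl⟩)
  exact HasDegree.of_isExtension ho (fun t => comm t.1) h' hx'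

theorem _root_.OBundle.isThomClass (V : OBundle F X) : V.τ.IsThomClass := by
  have := V.isThom.of_cart (GBundle.Map.refl V.toGBundle).cart
    (comm := (GBundle.Map.refl V.toGBundle).comm)
    (h := (GBundle.Map.refl V.toGBundle).isClosedEmbedding.isProperMap)
  rwa [pull_eq_self (fun _ => rfl)] at this

end CohTheory.Supp

namespace Corr

theorem isValue_iff_of_imp {Ψ Ψ' : Corr F (unitSpace G) Y}
    (h : ∀ η, Ψ.IsValue η → Ψ'.IsValue η) (η : F.Supp Y.anchorMap) : Ψ.IsValue η ↔ Ψ'.IsValue η := by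
  refine ⟨h η, fun h' => ?_⟩
  obtain ⟨ζ, hζ⟩ := Ψ.exists_value
  rwa [h'.unique (h ζ hζ)]

theorem isValue_iff_of_equivalent {f f' : NNMap F M Y} (h : f.Equivalent f')
    {b : GMap M (unitSpace G)} {ξ : F.Supp b} (η : F.Supp Y.anchorMap) :
    (⟨M, b, f, ξ⟩ : Corr F (unitSpace G) Y).IsValue η ↔
      (⟨M, b, f', ξ⟩ : Corr F (unitSpace G) Y).IsValue η := by
  induction h with
  | rel f f' h =>
    rcases h with h | h | h
    · refine (isValue_iff_of_imp (fun η hη => hη.iso ?_) η).symm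
      exact ⟨GMap.id M, .id, fun _ => rfl, h, (Supp.pull_eq_self (fun _ => rfl) ξ).symm⟩
    · exact (h.bordant b ξ).isValue_iff η
    · exact (isValue_iff_of_imp (fun η hη => hη.isLifting h) η).symm
  | refl => rfl
  | symm _ _ _ ih => exact ih.symm
  | trans _ _ _ _ _ ih ih' => exact ih.trans ih'

theorem Rel.isValue_iff {Ψ Ψ' : Corr F (unitSpace G) Y} (h : Rel Ψ Ψ') (η : F.Supp Y.anchorMap) :
    Ψ.IsValue η ↔ Ψ'.IsValue η := by
  cases h with
  | iso _ _ h => exact (isValue_iff_of_imp (fun η hη => hη.iso h) η).symm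
  | normal M b f f' ξ h => exact isValue_iff_of_equivalent h η
  | bordism _ _ h => exact h.isValue_iff η
  | thom _ _ h => exact isValue_iff_of_imp (fun η hη => hη.isThomModification h) η

/-- Values are compatible with open embeddings. -/
theorem IsValue.push {Ψ : Corr F (unitSpace G) Y} {η : F.Supp Y.anchorMap} (hη : Ψ.IsValue η)
    (f' : NNMap F M' Y') {b' : GMap f'.V.tot (unitSpace G)} {j : GMap Y Y'} (hj : IsOpenEmbedding j)
    {i : GMap Ψ.M M'} (hi : IsOpenEmbedding i)
    (α : OBundle.Map Ψ.f.V f'.V i) (β : OBundle.Map Ψ.f.E f'.E (GMap.id _))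
    (h₁ : ∀ v, f'.toBase (α.toGMap v) = j (Ψ.f.toBase v))
    (h₂ : ∀ v, f'.toFib (α.toGMap v) = β.toGMap (Ψ.f.toFib v))
    {y : F.Supp b'}
    (hy : Supp.IsExtension α.toGMap
      (Supp.mul Ψ.f.V.proj (Ψ.b.comp Ψ.f.V.proj) (fun _ => rfl) Ψ.ξ Ψ.f.V.τ) y)
    {η' : F.Supp Y'.anchorMap} (hη' : Supp.IsExtension j η η') :
    Supp.IsExtension f'.hat y
      (Supp.mul f'.EY.proj (Y'.anchorMap.comp f'.EY.proj) (fun _ => rfl) η' f'.EY.τ) := by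
  let e := Ψ.f.E.pullbackMap Y.anchorMap
  let e' := f'.E.pullbackMap Y'.anchorMap
  let J' : OBundle.Map Ψ.f.EY f'.EY j := e'.lift ((β.comp e).congr (f' := Y'.anchorMap.comp j)
    fun x => (j.anchor_map x).symm) j (fun _ => rfl)
  let J := J'.toGMap
  have J1 : ∀ t, j (Ψ.f.EY.proj t) = f'.EY.proj (J t) := J'.cart.comm
  have J2 : ∀ t, e'.toGMap (J t) = β.toGMap (e.toGMap t) := fun t =>
    GBundle.Map.toGMap_lift e'.toMap _ j (fun _ => rfl) t
  have hJ : IsOpenEmbedding J := J'.cart.isOpenEmbedding hj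
  have k1 := hη'.mul (q := f'.EY.proj) (r := Y'.anchorMap.comp f'.EY.proj) (fun _ => rfl)
    (q' := Ψ.f.EY.proj) (r' := Y.anchorMap.comp Ψ.f.EY.proj) (fun _ => rfl) (j' := J) J1 J'.cart.proper
    (fun t ht => by
      obtain ⟨y, hy⟩ := ht
      obtain ⟨s, -, hs⟩ := J'.cart.surj y t hy
      exact ⟨s, hs⟩) f'.EY.τ
  rw [← J'.map_τ] at k1
  have k2 := hη.comp Ψ.f.isOpenEmbedding_hat hJ (fun t => GMap.toUnit_congr _ _ J t)
    (fun t => GMap.toUnit_congr _ _ Ψ.f.hat t) k1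
  obtain ⟨w, hw⟩ := Supp.exists_isExtension f'.hat f'.isOpenEmbedding_hat
    (p := Y'.anchorMap.comp f'.EY.proj) (fun t => GMap.toUnit_congr _ _ f'.hat t) y
  have hα := α.cart.isOpenEmbedding hi
  have k3 := hy.comp hα f'.isOpenEmbedding_hat (fun t => GMap.toUnit_congr _ _ f'.hat t)
    (fun t => GMap.toUnit_congr _ _ α.toGMap t) hw
  have hjj : f'.hat.comp α.toGMap = J.comp Ψ.f.hat := GMap.ext (funext fun v => e'.cart.ext (by
      change f'.EY.proj (f'.hat (α.toGMap v)) = f'.EY.proj (J (Ψ.f.hat v))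
      rw [f'.proj_hat, ← J1, Ψ.f.proj_hat, h₁]) (by
      change e'.toGMap (f'.hat (α.toGMap v)) = e'.toGMap (J (Ψ.f.hat v))
      rw [f'.fib_hat, J2, Ψ.f.fib_hat, h₂]))
  rw [hjj] at k3
  have hJo : IsOpenEmbedding (J.comp Ψ.f.hat) := by
    have := hJ.comp Ψ.f.isOpenEmbedding_hat
    exact this
  have := Supp.IsExtension.unique hJo
    (fun t => GMap.toUnit_congr _ _ (J.comp Ψ.f.hat) t) k2 k3
  rwa [this]

theorem mul_τ_restr {b : GMap M X} {b' : GMap M' X} {i : GMap M' M} {hi : IsProperMap i}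
    {hb : ∀ m, b' m = b (i m)} {V' : OBundle F M'} {V : OBundle F M} (α : OBundle.Map V' V i)
    (hα : IsProperMap α.toGMap) {p' : GMap V'.tot X} {hp : ∀ t, p' t = (b.comp V.proj) (α.toGMap t)}
    {hp' : ∀ t, p' t = b' (V'.proj t)}
    (ξ : F.Supp b) :
    Supp.restr α.toGMap hα hp (Supp.mul V.proj (b.comp V.proj) (fun _ => rfl) ξ V.τ) =
      Supp.mul V'.proj p' hp' (Supp.restr i hi hb ξ) V'.τ := by
  rw [α.map_τ]
  exact Supp.pull_mul (q' := V'.proj) (ψ := i) (f := GMap.id X) hp' hb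
    (isProperMap_graph i hi hb) α.cart.comm α.cart.proper ξ V.τ

theorem IsPushforward.isExtension {j : GMap Y Y'} (hj : IsOpenEmbedding j)
    {Ψ : Corr F (unitSpace G) Y} {Ψ' : Corr F (unitSpace G) Y'} (h : Ψ'.IsPushforward Ψ j)
    {η : F.Supp Y.anchorMap} {η' : F.Supp Y'.anchorMap} (hη : Ψ.IsValue η) (hη' : Ψ'.IsValue η') :
    Supp.IsExtension j η η' := by
  obtain ⟨i, hi, hb, ⟨α, β, hf⟩, hξ⟩ := h
  obtain ⟨ζ, hζ⟩ := Supp.exists_isExtension j hj (p := Y'.anchorMap) (p' := Y.anchorMap)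
    (fun t => (j.anchor_map t).symm) η
  let α' : OBundle.Map Ψ.f.V Ψ'.f.V (i.symm hi) :=
    α.lift (OBundle.Map.refl _) (i.symm hi) (i.apply_symm hi)
  have hα' : ∀ v, α.toGMap (α'.toGMap v) = v := fun v =>
    GBundle.Map.toGMap_lift α.toMap _ _ (i.apply_symm hi) v
  have hsi := i.isHomeomorph_symm hi
  have hoα : IsOpenEmbedding α'.toGMap := α'.cart.isOpenEmbedding hsi.isOpenEmbedding
  have hα'h : IsHomeomorph α'.toGMap := by
    rw [isHomeomorph_iff_isEmbedding_surjective]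
    refine ⟨hoα.isEmbedding, fun v => ?_⟩
    obtain ⟨m, hm⟩ := hsi.surjective (Ψ'.f.V.proj v)
    obtain ⟨w, -, hw⟩ := α'.cart.surj m v hm
    exact ⟨w, hw⟩
  have hξ' : Ψ.ξ = Supp.restr (i.symm hi) hsi.isProperMap
      (fun t => GMap.toUnit_congr _ _ (i.symm hi) t) Ψ'.ξ := by
    rw [hξ]
    refine ((Supp.pull_pull (χ := GMap.id _) (k := GMap.id _) (p := Ψ.b) (comm'' := fun _ => rfl)
      (hχ := isProperMap_graph (p := Ψ.b) _ isProperMap_id fun _ => rfl) (i.apply_symm hi)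
      Ψ.ξ).trans ?_).symm
    exact Supp.pull_eq_self (fun _ => rfl) _
  have key := Supp.IsExtension.of_homeomorph (p' := Ψ.b.comp Ψ.f.V.proj) hα'h
    (fun t => GMap.toUnit_congr (Ψ'.b.comp Ψ'.f.V.proj) (Ψ.b.comp Ψ.f.V.proj) α'.toGMap t)
    (Supp.mul Ψ'.f.V.proj (Ψ'.b.comp Ψ'.f.V.proj) (fun _ => rfl) Ψ'.ξ Ψ'.f.V.τ)
  rw [mul_τ_restr (hi := hsi.isProperMap) (hb := fun t => GMap.toUnit_congr _ _ (i.symm hi) t)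
    (hp' := fun _ => rfl) α', ← hξ'] at key
  have h2 := hη.push Ψ'.f hj hsi.isOpenEmbedding α' β.symm (fun v => by
    rw [(hf _).1, hα']) (fun v => by
    have h3 := (hf (α'.toGMap v)).2
    rw [hα'] at h3
    rw [← h3]
    exact (β.symm_apply _).symm) key hζ
  rwa [hη'.unique h2]

theorem IsPullback.isValue {Ψ : Corr F (unitSpace G) Y} {Ψ' : Corr F (unitSpace G) Y'} {h : GMap Y' Y}
    (hΨ : Ψ'.IsPullback Ψ h) (hh : IsProperMap h) {η : F.Supp Y.anchorMap} (hη : Ψ.IsValue η) :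
    Ψ'.IsValue (Supp.restr h hh (p := Y.anchorMap) (fun y => (h.anchor_map y).symm) η) := by
  obtain ⟨-, c, hc, hb, α, β, hf, hs, hξ⟩ := hΨ
  exact hη.pull Ψ' h hh c hc hb α β (fun v => (hf v).1) (fun v => (hf v).2) hs hξ

theorem IsCanonical.isValue {Ψ : Corr F (unitSpace G) Y} {η : F.Supp Y.anchorMap}
    (h : Ψ.IsCanonical η) : Ψ.IsValue η := by
  obtain ⟨hV, oV, hE, oE, e, he, hb, hf, hξ⟩ := h
  have pV := GBundle.isHomeomorph_proj Ψ.f.V.toGBundle hV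
  have pE := GBundle.isHomeomorph_proj Ψ.f.EY.toGBundle fun y => hE _
  have hh : IsHomeomorph Ψ.f.hat := by
    rw [isHomeomorph_iff_isEmbedding_surjective]
    refine ⟨Ψ.f.isOpenEmbedding_hat.isEmbedding, fun t => ?_⟩
    obtain ⟨v, hv⟩ := (he.comp pV).surjective (Ψ.f.EY.proj t)
    refine ⟨v, pE.injective ?_⟩
    rw [Ψ.f.proj_hat, hf]
    exact hv
  have oEY : Ψ.f.EY.τ.IsOne := oE.pull
  have := Supp.IsExtension.of_homeomorph (p' := Ψ.b.comp Ψ.f.V.proj) hh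
    (fun t => GMap.toUnit_congr (Y.anchorMap.comp Ψ.f.EY.proj) (Ψ.b.comp Ψ.f.V.proj) Ψ.f.hat t)
    (Supp.mul Ψ.f.EY.proj (Y.anchorMap.comp Ψ.f.EY.proj) (fun _ => rfl) η Ψ.f.EY.τ)
  rw [IsValue]
  convert this using 1
  refine (Supp.mul_isOne (p := Ψ.b) (r := Ψ.b.comp Ψ.f.V.proj) (comm := fun _ => rfl) oV (f := GMap.id _) (c := fun _ => rfl)
    (h := isProperMap_graph (p := Ψ.b) (p' := Ψ.b.comp Ψ.f.V.proj) _ pV.isProperMap fun _ => rfl)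
    _).trans ?_
  rw [Supp.mul_isOne (p := Y.anchorMap) (r := Y.anchorMap.comp Ψ.f.EY.proj) (comm := fun _ => rfl)
    oEY (f := GMap.id _) (c := fun _ => rfl)
    (h := isProperMap_graph (p := Y.anchorMap) (p' := Y.anchorMap.comp Ψ.f.EY.proj) _
      pE.isProperMap fun _ => rfl), hξ]
  have c1 : ∀ t, (GMap.id (unitSpace G)) ((Ψ.b.comp Ψ.f.V.proj) t) =
    Y.anchorMap ((e.comp Ψ.f.V.proj) t) := fun t => hb _
  refine (Supp.pull_pull (χ := e.comp Ψ.f.V.proj) (k := GMap.id _) (comm'' := c1)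
    (hχ := isProperMap_graph _ (he.comp pV).isProperMap c1) (fun _ => rfl) η).trans ?_
  exact (Supp.pull_pull (fun t => (Ψ.f.proj_hat t).trans (hf t)) η).symm

theorem HasDegree.isValue {Ψ : Corr F (unitSpace G) Y} {n : ℤ} (h : Ψ.HasDegree n)
    {η : F.Supp Y.anchorMap} (hη : Ψ.IsValue η) : η.HasDegree n := by
  have rE : IsRank fun y : Y => (Ψ.f.E.rank (Y.anchor y) : ℤ) := Ψ.f.E.isRank.comp Y.anchorMap
  have rEY : IsRank fun t : Ψ.f.EY.tot => n + (Ψ.f.E.rank (Y.anchor (Ψ.f.EY.proj t)) : ℤ) := by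
    have := (rE.comp Ψ.f.EY.proj)
    exact ⟨continuous_const.add this.1, fun g x h => congrArg (n + ·) (this.2 g x h)⟩
  have rM : IsRank fun m => n - ((Ψ.f.V.rank m : ℤ) - (Ψ.f.E.rank (Ψ.M.anchor m) : ℤ)) := by
    have h1 := Ψ.f.V.isRank
    have h2 := Ψ.f.E.isRank.comp Ψ.M.anchorMap
    refine ⟨continuous_const.sub (h1.1.sub h2.1), fun g x h => ?_⟩
    have e1 := h1.2 g x h
    have e2 := h2.2 g x h
    change n - (_ - _) = n - (_ - _)
    rw [e1]
    exact congrArg (fun a => n - ((Ψ.f.V.rank x : ℤ) - a)) e2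
  obtain ⟨bV, hbV⟩ := Ψ.f.boundedV
  obtain ⟨bE, hbE⟩ := Ψ.f.boundedE
  have h1 := h.mul (q := Ψ.f.V.proj) (r := Ψ.b.comp Ψ.f.V.proj) (comm := fun _ => rfl) rM
    Ψ.f.V.isRank_tot Ψ.f.V.degree fun k => ⟨Finset.Icc (k - bV) k, fun t ht => by
      have := hbV (Ψ.f.V.proj t)
      rw [Finset.mem_Icc]
      omega⟩
  have h2 := Supp.HasLocalDegree.of_isExtension Ψ.f.isOpenEmbedding_hat
    (fun t => GMap.toUnit_congr _ _ Ψ.f.hat t) hη rEY (h1.congr fun t => by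
      have : Y.anchor (Ψ.f.EY.proj (Ψ.f.hat t)) = Ψ.M.anchor (Ψ.f.V.proj t) := by
        rw [Ψ.f.proj_hat, Ψ.f.toBase.anchor_map]
      rw [this]
      ring)
  refine Supp.HasDegree.of_finite_pieces (Finset.Icc (0 : ℤ) bE) _ rE.1 rE.2 (fun y => ?_) ?_
  · rw [Finset.mem_Icc]
    have := hbE (Y.anchor y)
    omega
  intro N i hi _ k hk
  let V' := Ψ.f.EY.pullback i
  let J : OBundle.Map V' Ψ.f.EY i := Ψ.f.EY.pullbackMap i
  have hJ : IsProperMap J.toGMap := by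
    have k1 : IsProperMap fun t => (i (V'.proj t), J.toGMap t) :=
      (hi.isProperMap.prodMap isProperMap_id).comp J.cart.proper
    refine isProperMap_of_comp_of_t2 (g := fun t => (Ψ.f.EY.proj t, t)) J.toGMap.continuous_toFun
      (Ψ.f.EY.proj.continuous_toFun.prodMk continuous_id) ?_
    convert k1 using 2 with t
    exact Prod.ext (J.cart.comm t).symm rfl
  have rJ : ∀ t, (Ψ.f.E.rank (Y.anchor (Ψ.f.EY.proj (J.toGMap t))) : ℤ) = k := fun t => by
    have : Ψ.f.EY.proj (J.toGMap t) = i (V'.proj t) := (J.cart.comm t).symm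
    rw [this]
    exact hk _
  have d1 := h2.pull_hasDegree rEY (φ := J.toGMap) (f := GMap.id _)
    (p' := (Y.anchorMap.comp i).comp V'.proj) (comm := fun t => congrArg Y.anchorMap (J.cart.comm t))
    (hφ := isProperMap_graph (p := Y.anchorMap.comp Ψ.f.EY.proj) J.toGMap hJ
      fun t => congrArg Y.anchorMap (J.cart.comm t))
    (k := n + k) fun t => congrArg (n + ·) (rJ t)
  have e1 := mul_τ_restr (b := Y.anchorMap) (b' := Y.anchorMap.comp i) (hi := hi.isProperMap)
    (hb := fun _ => rfl) J hJ (p' := (Y.anchorMap.comp i).comp V'.proj)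
    (hp := fun t => congrArg Y.anchorMap (J.cart.comm t)) (hp' := fun _ => rfl) η
  have d2 : V'.τ.HasDegree k := by
    rw [J.map_τ]
    refine Ψ.f.EY.degree.pull_hasDegree Ψ.f.EY.isRank_tot fun t => ?_
    exact rJ t
  have d3 := Eq.mp (congrArg (Supp.HasDegree · (n + k)) e1) d1
  rw [Supp.hasDegree_iff, Supp.part_mul n _ d2] at d3
  rw [Supp.hasDegree_iff]
  exact (V'.isThomClass _ _ _ _).1 d3

end Corr

theorem GMap.toUnit_ext {T : GSpace G} (b b' : GMap T (unitSpace G)) (t : T) : b t = b' t :=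
  (b.toUnit_eq t).trans (b'.toUnit_eq t).symm

namespace OBundle

/-- The canonical map between zero bundles. -/
noncomputable def Map.zero (f : GMap X' X) : Map (OBundle.zero F X') (OBundle.zero F X) f where
  toMap := .of (fun _ => LinearEquiv.refl ℝ PUnit.{u + 1})
    { toFun := fun v => (⟨f v.pt, ⟨⟩⟩ : TotPt (OBundle.zero F X).fib)
      continuous_toFun := (OBundle.zero F X).continuous_zero.comp
        (f.continuous_toFun.comp (OBundle.zero F X').continuous_pt)
      anchor_map := fun v => f.anchor_map v.pt
      map_act := fun g v h => TotPt.ext (f.map_act g v.pt h) (Subsingleton.helim rfl _ _) }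
    fun _ => rfl
  map_τ := (isOne_zero X').eq (isOne_zero X).pull

/-- An isomorphism `U ≅ g*(W)` as a decomposition `U ≅ 0 ⊕ g*(W)`. -/
noncomputable def Map.zeroSum {U : OBundle F X} {W : OBundle F Y} {g : GMap X Y} (φ : Map U W g) :
    Sum U (OBundle.zero F X) W g where
  toSum := .of (fun x => (φ.lin x).trans
      (LinearEquiv.uniqueProd (R := ℝ) (M := W.fib (g x)) (M₂ := PUnit.{u + 1})).symm)
    { toFun := fun v => (⟨v.pt, ⟨⟩⟩ : TotPt (OBundle.zero F X).fib)
      continuous_toFun := (OBundle.zero F X).continuous_zero.comp U.continuous_pt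
      anchor_map := fun _ => rfl
      map_act := fun _ _ _ => rfl } φ.toGMap (fun _ => rfl) φ.toGMap_eq
  sum_τ := by
    let i := (OBundle.zero F X).proj.symm (GBundle.isHomeomorph_zero X)
    refine Eq.trans ?_ (Supp.isOne_mul (isOne_zero X) (r := U.proj) (f := i)
      (c := fun t => (OBundle.zero F X).proj.symm_apply (GBundle.isHomeomorph_zero X)
        (⟨t.pt, ⟨⟩⟩ : TotPt (OBundle.zero F X).fib))
      (h := isProperMap_of_comp_of_t2 (g := Prod.snd) (U.proj.continuous_toFun.prodMk continuous_id)
        continuous_snd isProperMap_id) _).symm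
    rw [φ.map_τ]
    exact (Supp.pull_pull (fun _ => rfl) _).symm

/-- Interchanging the summands, if the second one has even rank. -/
def Sum.swap' {U V W : OBundle F X} (s : Sum U V W (GMap.id X)) (hW : ∀ x, Even (W.rank x))
    (hb : W.BoundedRank) : Sum U W V (GMap.id X) where
  toSum := .of (fun x => (s.lin x).trans (LinearEquiv.prodComm ℝ _ _)) s.snd s.fst s.snd_eq s.fst_eq
  sum_τ := by
    obtain ⟨m, hm⟩ := hb
    rw [s.sum_τ]
    exact Supp.mul_comm_of_even_local (r := U.proj) (q₁ := s.fst) (q₂ := s.snd)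
      (c₂ := fun u => (s.comm_fst u).trans (s.comm_snd u))
      (d₂ := fun u => (s.comm_snd u).symm) (h₂ := s.cart.symm.proper)
      V.τ W.isRank_tot W.degree (s := Finset.Icc 0 m) (fun v => (Int.even_coe_nat _).2 (hW v.pt))
      (fun v => Finset.mem_Icc.2 ⟨Int.natCast_nonneg _, Int.ofNat_le.2 (hm v.pt)⟩)

variable {V W A : OBundle F X} {D T : OBundle F (unitSpace G)}

/-- A complement from an isomorphism `V ⊕ W ≅ D^X`. -/
def Complement.of (κ : Map (V.add W) D X.anchorMap) (h : D.BoundedRank) : V.Complement :=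
  ⟨W, D, V.add W, V.addSum W, κ, h⟩

/-- The isomorphism `V ⊕ compl ≅ triv^X`. -/
noncomputable def Complement.iso (k : V.Complement) : Map (V.add k.compl) k.triv X.anchorMap :=
  k.toTriv.comp ((V.addSum k.compl).map k.sum (.refl V) (.refl k.compl) fun _ => rfl)

theorem Map.subtrivial (φ : Map V D X.anchorMap) (h : D.BoundedRank) : V.Subtrivial :=
  ⟨.of (φ.comp V.addZero) h⟩

theorem Subtrivial.of_map {V' : OBundle F X'} {f : GMap X' X} (h : V.Subtrivial) (φ : Map V' V f) :
    V'.Subtrivial := by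
  obtain ⟨k⟩ := h
  let W := k.compl.pullback f
  exact ⟨.of (W := W) ((k.iso.comp ((V'.addSum W).map (V.addSum k.compl) φ (k.compl.pullbackMap f)
    fun _ => rfl)).congr fun x => GMap.toUnit_ext (X.anchorMap.comp f) _ x) k.bounded⟩

theorem boundedRank_add {V W : OBundle F X} (hV : V.BoundedRank) (hW : W.BoundedRank) :
    (V.add W).BoundedRank :=
  hV.of_sum hW (V.addSum W).toSum

theorem even_rank_add_self (V : OBundle F X) (x : X) : Even ((V.add V).rank x) :=
  ⟨V.rank x, (V.addSum V).rank_eq x⟩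

theorem Subtrivial.add (h : V.Subtrivial) (φ : Map A D X.anchorMap) (hD : D.BoundedRank) :
    (V.add A).Subtrivial := by
  obtain ⟨k⟩ := h
  let W := k.compl
  have hA : A.BoundedRank := hD.of_map φ.toMap
  let AA : OBundle F X := A.add A
  let a₁ : Map ((V.add A).add (A.add W)) (V.add (A.add (A.add W))) (GMap.id X) :=
    assoc V A (A.add W)
  let a₂ : Map (V.add (A.add (A.add W))) (V.add (AA.add W)) (GMap.id X) :=
    addCongr (.refl V) (assoc A A W).symm
  let a₃ : Map (V.add (AA.add W)) (V.add (W.add AA)) (GMap.id X) :=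
    addCongr (.refl V) (swap W AA A.even_rank_add_self (boundedRank_add hA hA)).symm
  let a₄ : Map (V.add (W.add AA)) ((V.add W).add AA) (GMap.id X) := (assoc V W AA).symm
  let a₅ : Map AA (D.add D) X.anchorMap := (A.addSum A).map (D.addSum D) φ φ fun _ => rfl
  let a₆ : Map ((V.add W).add AA) (k.triv.add (D.add D)) X.anchorMap :=
    ((V.add W).addSum AA).map (k.triv.addSum (D.add D)) k.iso a₅ fun _ => rfl
  exact ⟨.of (W := A.add W) (a₆.comp (a₄.comp (a₃.comp (a₂.comp a₁))))
    (boundedRank_add k.bounded (boundedRank_add hD hD))⟩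

theorem Subtrivial.sum {U : OBundle F X} (h : V.Subtrivial) (s : Sum U V D X.anchorMap)
    (hD : D.BoundedRank) : U.Subtrivial := by
  let φ : Map (V.add (D.pullback X.anchorMap)) U (GMap.id X) :=
    (V.addSum (D.pullback X.anchorMap)).map s (.refl V) (D.pullbackMap X.anchorMap) fun _ => rfl
  exact (h.add (D.pullbackMap X.anchorMap) hD).of_map φ.symm

theorem subtrivial_zero (X : GSpace G) : (OBundle.zero F X).Subtrivial :=
  Map.subtrivial (D := OBundle.zero F (unitSpace G)) (.zero X.anchorMap)
    ⟨0, fun z => (rank_zero _ z).le⟩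

theorem boundedRank_zero (X : GSpace G) : (OBundle.zero F X).BoundedRank :=
  ⟨0, fun x => (rank_zero X x).le⟩

end OBundle

theorem Cart.paste {T X T' X' T'' X'' : GSpace G} {q : GMap T' X'} {φ : GMap T' T} {f : GMap X' X}
    {p : GMap T X} (c : Cart q φ f p) {q' : GMap T'' X''} {ψ : GMap T'' T} {k : GMap X'' X}
    (c' : Cart q' ψ k p) {f' : GMap X'' X'} (hk : ∀ x, k x = f (f' x)) {φ' : GMap T'' T'}
    (h₁ : ∀ t, φ (φ' t) = ψ t) (h₂ : ∀ t, f' (q' t) = q (φ' t)) : Cart q' φ' f' q where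
  comm := h₂
  emb := by
    have h3 : IsProperMap fun t => (q' t, φ' t) :=
      IsProperMap.prod_of_comp (i := φ) q'.continuous_toFun φ'.continuous_toFun φ.continuous_toFun (by
        convert c'.proper using 2 with t
        exact Prod.ext rfl (h₁ t))
    refine .of_continuous_injective_isClosedMap h3.continuous (fun a b h => ?_) h3.isClosedMap
    obtain ⟨e1, e2⟩ := Prod.ext_iff.1 h
    exact c'.ext e1 ((h₁ a).symm.trans ((congrArg φ e2).trans (h₁ b)))
  surj x t hxt := by
    obtain ⟨s, rfl, hs⟩ := c'.surj x (φ t) (by rw [hk, hxt, c.comm])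
    exact ⟨s, rfl, c.ext ((h₂ s).symm.trans hxt) ((h₁ s).trans hs)⟩

/-- The projection `X × [0,1] → X`. -/
def GSpace.prodFst (X : GSpace G) : GMap X.prodI X :=
  ⟨Prod.fst, continuous_fst, fun _ => rfl, fun _ _ _ => rfl⟩

namespace NNMap

/-- Restriction of `f̂` along an open embedding of total spaces. -/
def precomp (f : NNMap F X Y) (V' : OBundle F X') (hs : V'.Subtrivial) (hb : V'.BoundedRank)
    (a : GMap V'.tot f.V.tot) (ha : IsOpenEmbedding a) : NNMap F X' Y where
  V := V'
  E := f.E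
  subtrivial := hs
  boundedV := hb
  boundedE := f.boundedE
  toBase := f.toBase.comp a
  toFib := f.toFib.comp a
  isOpenEmbedding := f.isOpenEmbedding.comp ha

theorem lift_comm (f : NNMap F X Y) (D : OBundle F (unitSpace G))
    (t : (f.V.sum D X.anchorMap).tot) :
    ((GMap.id _).comp f.E.proj) ((f.toFib.comp (f.V.isSum D X.anchorMap).fst) t) =
      D.proj ((f.V.isSum D X.anchorMap).snd t) :=
  GMap.toUnit_ext (f.E.proj.comp (f.toFib.comp (f.V.isSum D X.anchorMap).fst))
    (D.proj.comp (f.V.isSum D X.anchorMap).snd) t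

/-- The second component of the lifting of `f` along `D`. -/
noncomputable def liftFib (f : NNMap F X Y) (D : OBundle F (unitSpace G)) :
    GMap (f.V.sum D X.anchorMap).tot (f.E.add D).tot :=
  (f.E.addSum D).cart.lift (f.toFib.comp (f.V.isSum D X.anchorMap).fst)
    (f.V.isSum D X.anchorMap).snd (f.lift_comm D)

theorem fst_liftFib (f : NNMap F X Y) (D : OBundle F (unitSpace G)) (t) :
    (f.E.addSum D).fst (f.liftFib D t) = f.toFib ((f.V.isSum D X.anchorMap).fst t) :=
  (f.E.addSum D).cart.fst_lift _ _ (f.lift_comm D) t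

theorem snd_liftFib (f : NNMap F X Y) (D : OBundle F (unitSpace G)) (t) :
    (f.E.addSum D).snd (f.liftFib D t) = (f.V.isSum D X.anchorMap).snd t :=
  (f.E.addSum D).cart.snd_lift _ _ (f.lift_comm D) t

/-- The lifting of `f` along `D`. -/
noncomputable def lift (f : NNMap F X Y) (D : OBundle F (unitSpace G)) (hD : D.BoundedRank) :
    NNMap F X Y where
  V := f.V.sum D X.anchorMap
  E := f.E.add D
  subtrivial := f.subtrivial.sum (f.V.isSum D X.anchorMap) hD
  boundedV := f.boundedV.of_sum hD (f.V.isSum D X.anchorMap).toSum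
  boundedE := OBundle.boundedRank_add f.boundedE hD
  toBase := f.toBase.comp (f.V.isSum D X.anchorMap).fst
  toFib := f.liftFib D
  isOpenEmbedding := by
    let s := f.V.isSum D X.anchorMap
    let c := f.E.addSum D
    let e := f.E.pullbackMap Y.anchorMap
    let e' := (f.E.add D).pullbackMap Y.anchorMap
    let P := ((f.E.add D).pullback Y.anchorMap)
    have hK : ∀ t : P.tot, Y.anchorMap (P.proj t) = f.E.proj ((c.fst.comp e'.toGMap) t) :=
      fun t => (e'.cart.comm t).trans (c.comm_fst (e'.toGMap t))
    let K : GMap P.tot f.EY.tot := e.cart.lift P.proj (c.fst.comp e'.toGMap) hK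
    have K1 : ∀ t, f.EY.proj (K t) = P.proj t := e.cart.fst_lift _ _ hK
    have K2 : ∀ t, e.toGMap (K t) = c.fst (e'.toGMap t) := e.cart.snd_lift _ _ hK
    have cK : Cart K e'.toGMap e.toGMap c.fst := e'.cart.cancel e.cart c.comm_fst K1 K2
    have cD := cK.comp c.cart
    have hc : ∀ t, Y.anchorMap ((f.toBase.comp s.fst) t) = (f.E.add D).proj (f.liftFib D t) :=
      fun t => GMap.toUnit_ext (Y.anchorMap.comp (f.toBase.comp s.fst))
        ((f.E.add D).proj.comp (f.liftFib D)) t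
    let H : GMap (f.V.sum D X.anchorMap).tot P.tot := e'.cart.lift (f.toBase.comp s.fst) (f.liftFib D) hc
    have H1 : ∀ t, P.proj (H t) = f.toBase (s.fst t) := e'.cart.fst_lift _ _ hc
    have H2 : ∀ t, e'.toGMap (H t) = f.liftFib D t := e'.cart.snd_lift _ _ hc
    have hH : Cart s.fst H f.hat K := cD.paste s.cart (fun x =>
      GMap.toUnit_ext (X.anchorMap.comp f.V.proj)
        ((((GMap.id _).comp f.E.proj).comp e.toGMap).comp f.hat) x) (fun t => by
        change c.snd (e'.toGMap (H t)) = _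
        rw [H2]
        exact f.snd_liftFib D t) (fun t => by
        refine e.cart.ext ?_ ?_
        · rw [K1, H1, f.proj_hat]
        · rw [K2, H2, f.fib_hat]
          exact (f.fst_liftFib D t).symm)
    exact (e'.cart.isOpenEmbedding_iff H1 H2 hc).1 (hH.isOpenEmbedding f.isOpenEmbedding_hat)

theorem isLifting_lift (f : NNMap F X Y) (D : OBundle F (unitSpace G)) (hD : D.BoundedRank) :
    (f.lift D hD).IsLifting f :=
  ⟨D, f.V.isSum D X.anchorMap, f.E.addSum D, fun v => ⟨rfl, f.fst_liftFib D v, f.snd_liftFib D v⟩⟩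

/-- The total space of `V × [0,1]`. -/
def totProd (V : OBundle F X) : GMap (V.pullback X.prodFst).tot V.tot.prodI where
  toFun v := ((V.pullbackMap X.prodFst).toGMap v, v.pt.2)
  continuous_toFun := (GMap.continuous_toFun _).prodMk
    (continuous_snd.comp (V.pullback X.prodFst).continuous_pt)
  anchor_map v := (V.pullbackMap X.prodFst).toGMap.anchor_map v
  map_act g v h := Prod.ext ((V.pullbackMap X.prodFst).toGMap.map_act g v h) rfl

theorem isHomeomorph_totProd (V : OBundle F X) : IsHomeomorph (totProd V) := by
  let α := V.pullbackMap X.prodFst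
  have h1 : IsProperMap (totProd V) :=
    isProperMap_of_comp_of_t2 (g := fun p : V.tot × unitInterval => (((V.proj p.1, p.2) : X.prodI), p.1))
      (totProd V).continuous_toFun
      (((V.proj.continuous_toFun.comp continuous_fst).prodMk continuous_snd).prodMk continuous_fst)
      α.cart.proper
  have h2 : Function.Injective (totProd V) := fun a b h => by
    obtain ⟨e1, e2⟩ := Prod.ext_iff.1 h
    refine α.cart.ext (Prod.ext ?_ e2) e1
    have := congrArg V.proj e1
    exact (α.cart.comm a).trans (this.trans (α.cart.comm b).symm)
  rw [isHomeomorph_iff_isEmbedding_surjective]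
  refine ⟨(IsClosedEmbedding.of_continuous_injective_isClosedMap h1.continuous h2
    h1.isClosedMap).isEmbedding, ?_⟩
  rintro ⟨v, s⟩
  obtain ⟨w, hw, rfl⟩ := α.cart.surj ((V.proj v, s) : X.prodI) v rfl
  exact ⟨w, Prod.ext rfl (Prod.ext_iff.1 hw).2⟩

/-- The product of `f` with `[0,1]`. -/
def prodI (f : NNMap F X Y) : NNMap F X.prodI Y.prodI where
  V := f.V.pullback X.prodFst
  E := f.E
  subtrivial := f.subtrivial.of_map (f.V.pullbackMap X.prodFst)
  boundedV := f.boundedV.of_map (f.V.pullbackMap X.prodFst).toMap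
  boundedE := f.boundedE
  toBase :=
    { toFun := fun v => (f.toBase (totProd f.V v).1, (totProd f.V v).2)
      continuous_toFun := (f.toBase.continuous_toFun.comp (continuous_fst.comp
        (totProd f.V).continuous_toFun)).prodMk (continuous_snd.comp (totProd f.V).continuous_toFun)
      anchor_map := fun v => (f.toBase.anchor_map _).trans ((totProd f.V).anchor_map v)
      map_act := fun g v h => by
        obtain ⟨h1, h2⟩ := Prod.ext_iff.1 ((totProd f.V).map_act g v h)
        refine Prod.ext ?_ h2
        refine (congrArg f.toBase h1).trans ?_
        exact f.toBase.map_act g _ _ }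
  toFib := f.toFib.comp (f.V.pullbackMap X.prodFst).toGMap
  isOpenEmbedding := by
    have h1 := (f.isOpenEmbedding.prodMap (IsOpenEmbedding.id (X := unitInterval))).comp
      (isHomeomorph_totProd f.V).isOpenEmbedding
    let e : {p : Y × f.E.tot // Y.anchor p.1 = f.E.tot.anchor p.2} × unitInterval ≃ₜ
        {p : Y.prodI × f.E.tot // Y.prodI.anchor p.1 = f.E.tot.anchor p.2} :=
      { toFun := fun p => ⟨((p.1.1.1, p.2), p.1.1.2), p.1.2⟩
        invFun := fun p => (⟨(p.1.1.1, p.1.2), p.2⟩, p.1.1.2)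
        left_inv := fun _ => rfl
        right_inv := fun _ => rfl
        continuous_toFun := by
          refine Continuous.subtype_mk (Continuous.prodMk (Continuous.prodMk ?_ ?_) ?_) _ <;> fun_prop
        continuous_invFun := by
          have h2 : Continuous fun p : {p : Y.prodI × f.E.tot // Y.prodI.anchor p.1 = f.E.tot.anchor p.2} =>
              (p.1.1 : Y × unitInterval) := continuous_fst.comp continuous_subtype_val
          have h3 : Continuous fun p : {p : Y.prodI × f.E.tot // Y.prodI.anchor p.1 = f.E.tot.anchor p.2} =>
              p.1.2 := continuous_snd.comp continuous_subtype_val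
          exact (((continuous_fst.comp h2).prodMk h3).subtype_mk _).prodMk (continuous_snd.comp h2) }
    exact e.isOpenEmbedding.comp h1

/-- Deforming `f̂` by a family of open embeddings of the total space of `V`. -/
theorem isotopic_precomp (f : NNMap F X Y) (A : GMap f.V.tot.prodI f.V.tot)
    (hA : IsOpenEmbedding fun p : f.V.tot × unitInterval => (A p, p.2)) (h0 : ∀ v, A (v, 0) = v)
    {a : GMap f.V.tot f.V.tot} (ha : IsOpenEmbedding a) (h1 : ∀ v, A (v, 1) = a v) :
    f.Isotopic (f.precomp f.V f.subtrivial f.boundedV a ha) := by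
  let A' : GMap f.V.tot.prodI f.V.tot.prodI :=
    ⟨fun p => (A p, p.2), hA.continuous, fun p => A.anchor_map p, fun g p h => Prod.ext (A.map_act g p h) rfl⟩
  let θ := totProd f.V
  have hθ := isHomeomorph_totProd f.V
  let B : GMap f.prodI.V.tot f.prodI.V.tot := (θ.symm hθ).comp (A'.comp θ)
  have hB : IsOpenEmbedding B :=
    (θ.isHomeomorph_symm hθ).isOpenEmbedding.comp (hA.comp hθ.isOpenEmbedding)
  have hB' : ∀ v, θ (B v) = A' (θ v) := fun v => θ.apply_symm hθ _
  let h := f.prodI.precomp f.prodI.V f.prodI.subtrivial f.prodI.boundedV B hB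
  let α (t : unitInterval) : OBundle.Map f.V f.prodI.V (X.slice t) :=
    (f.V.pullbackMap X.prodFst).lift (.refl f.V) (X.slice t) fun _ => rfl
  have hα : ∀ t v, θ ((α t).toGMap v) = ((v, t) : f.V.tot × unitInterval) := fun t v =>
    Prod.ext (GBundle.Map.toGMap_lift (f.V.pullbackMap X.prodFst).toMap _ _ (fun _ => rfl) v)
      (congrArg Prod.snd ((α t).cart.comm v)).symm
  have key : ∀ t (v w : f.V.tot), A (v, t) = w →
      h.toBase ((α t).toGMap v) = ((f.toBase w, t) : Y × unitInterval) ∧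
        h.toFib ((α t).toGMap v) = f.toFib w := by
    rintro t v _ rfl
    obtain ⟨e1, e2⟩ := Prod.ext_iff.1 ((hB' ((α t).toGMap v)).trans (congrArg A' (hα t v)))
    exact ⟨Prod.ext (congrArg f.toBase e1) e2, congrArg f.toFib e1⟩
  exact ⟨h, fun v => (Prod.ext_iff.1 (hB' v)).2, ⟨α 0, .refl _, fun v => key 0 v v (h0 v)⟩,
    α 1, .refl _, fun v => key 1 v (a v) (h1 v)⟩

variable (F) in
/-- The identity of `Y`. -/
noncomputable def refl (Y : GSpace G) : NNMap F Y Y where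
  V := .zero F Y
  E := .zero F _
  subtrivial := OBundle.subtrivial_zero Y
  boundedV := OBundle.boundedRank_zero Y
  boundedE := OBundle.boundedRank_zero _
  toBase := (OBundle.zero F Y).proj
  toFib := (OBundle.Map.zero (F := F) Y.anchorMap).toGMap
  isOpenEmbedding := ((OBundle.Map.zero (F := F) Y.anchorMap).cart.isOpenEmbedding_iff
    (j := GMap.id _) (fun _ => rfl) (fun _ => rfl) (fun _ => rfl)).1 .id

end NNMap

/-- The correspondence `(Y, ϱ, id, η)`. -/
noncomputable def Corr.canonical {Y : GSpace G} (η : F.Supp Y.anchorMap) : Corr F (unitSpace G) Y :=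
  ⟨Y, Y.anchorMap, .refl F Y, η⟩

theorem Corr.isCanonical_canonical {Y : GSpace G} (η : F.Supp Y.anchorMap) :
    (canonical η).IsCanonical η :=
  ⟨fun _ => OBundle.subsingleton_zero Y _, OBundle.isOne_zero Y,
    fun _ => OBundle.subsingleton_zero _ _, OBundle.isOne_zero _, GMap.id Y, .id, fun _ => rfl,
    fun _ => rfl, (Supp.pull_eq_self (fun _ => rfl) η).symm⟩

theorem Corr.hasDegree_canonical {Y : GSpace G} {η : F.Supp Y.anchorMap} {n : ℤ}
    (h : η.HasDegree n) : (canonical η).HasDegree n :=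
  h.localDegree fun m => by
    have h1 := OBundle.rank_zero (F := F) Y m
    have h2 := OBundle.rank_zero (F := F) (unitSpace G) (Y.anchor m)
    change n - (((OBundle.zero F Y).rank m : ℤ) -
      ((OBundle.zero F (unitSpace G)).rank (Y.anchor m) : ℤ)) = n
    rw [h1, h2]
    simp

/-- The open subspace on which an invariant function is positive. -/
def GSpace.pos (M : GSpace G) (χ : M → ℝ) (hχ : Continuous χ)
    (hi : ∀ g x h, χ (M.act g x h) = χ x) : GSpace G where
  carrier := {x | 0 < χ x}
  para := .of_pos χ hχ
  anchor x := M.anchor x.1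
  continuous_anchor := M.continuous_anchor.comp continuous_subtype_val
  act g x h := ⟨M.act g x.1 h, (x.2 : 0 < χ x.1).trans_eq (hi g x.1 h).symm⟩
  anchor_act g x h := M.anchor_act g x.1 h
  one_act x := Subtype.ext (M.one_act x.1)
  mul_act g h x e e' := Subtype.ext (M.mul_act g h x.1 e e')
  continuous_act := by
    refine Continuous.subtype_mk ?_ _
    exact M.continuous_act.comp (f := fun p : {p : G.Arr × {x | 0 < χ x} //
      G.src p.1 = M.anchor p.2.1} =>
        (⟨(p.1.1, p.1.2.1), p.2⟩ : {p : G.Arr × M // G.src p.1 = M.anchor p.2}))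
      (by fun_prop)

/-- The inclusion of the open subspace. -/
def GSpace.posIncl (M : GSpace G) (χ : M → ℝ) (hχ : Continuous χ)
    (hi : ∀ g x h, χ (M.act g x h) = χ x) : GMap (M.pos χ hχ hi) M :=
  ⟨Subtype.val, continuous_subtype_val, fun _ => rfl, fun _ _ _ => rfl⟩

theorem GSpace.isOpenEmbedding_posIncl (M : GSpace G) (χ : M → ℝ) (hχ : Continuous χ)
    (hi : ∀ g x h, χ (M.act g x h) = χ x) : IsOpenEmbedding (M.posIncl χ hχ hi) :=
  (isOpen_lt continuous_const hχ).isOpenEmbedding_subtypeVal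

/-- Factorization through an embedding. -/
noncomputable def GMap.factor {N T P : GSpace G} (j : GMap T P) (hj : IsEmbedding j) (i : GMap N P)
    (h : ∀ n, i n ∈ Set.range j) : GMap N T where
  toFun n := (h n).choose
  continuous_toFun := hj.continuous_iff.2 (by
    convert i.continuous_toFun using 1
    funext n
    exact (h n).choose_spec)
  anchor_map n := by rw [← j.anchor_map, (h n).choose_spec, i.anchor_map]
  map_act g n e := hj.injective (by
    rw [(h _).choose_spec, i.map_act, j.map_act]
    exact P.act_congr (h n).choose_spec.symm _ _)

theorem GMap.apply_factor {N T P : GSpace G} (j : GMap T P) (hj : IsEmbedding j) (i : GMap N P)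
    (h : ∀ n, i n ∈ Set.range j) (n : N) : j (j.factor hj i h n) = i n := (h n).choose_spec

/-- The restriction of `f` along an open embedding. -/
def NNMap.restrict (f : NNMap F X Y) (i : GMap X' X) (hi : IsOpenEmbedding i) : NNMap F X' Y :=
  f.precomp (f.V.pullback i) (f.subtrivial.of_map (f.V.pullbackMap i))
    (f.boundedV.of_map (f.V.pullbackMap i).toMap) (f.V.pullbackMap i).toGMap
    ((f.V.pullbackMap i).cart.isOpenEmbedding hi)

theorem NNMap.isoAlong_restrict (f : NNMap F X Y) (i : GMap X' X) (hi : IsOpenEmbedding i) :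
    (f.restrict i hi).IsoAlong f i id :=
  ⟨f.V.pullbackMap i, .refl _, fun _ => ⟨rfl, rfl⟩⟩

namespace Corr

/-- A correspondence is bordant to its restriction to an open subset `{χ > 0}` that supports `ξ`. -/
theorem bordant_of_pos {f : NNMap F M Y} {b : GMap M X} {ξ : F.Supp b} {f' : NNMap F M' Y}
    {b' : GMap M' X} {ξ' : F.Supp b'} (i : GMap M' M) (hi : IsOpenEmbedding i) (χ : M → ℝ)
    (hχ : Continuous χ) (hinv : ∀ g x h, χ (M.act g x h) = χ x) (h0 : ∀ x, 0 ≤ χ x)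
    (hr : ∀ x, x ∈ Set.range i ↔ 0 < χ x) (hb : ∀ m, b' m = b (i m)) (hf : f'.IsoAlong f i id)
    (hξ : Supp.IsExtension i ξ' ξ) :
    (⟨M, b, f, ξ⟩ : Corr F X Y).Bordant ⟨M', b', f', ξ'⟩ := by
  let χ' : M.prodI → ℝ := fun p => χ p.1 + (1 - (p.2 : ℝ))
  have hχ' : Continuous χ' := (hχ.comp continuous_fst).add
    (continuous_const.sub (continuous_subtype_val.comp continuous_snd))
  have hinv' : ∀ g x h, χ' (M.prodI.act g x h) = χ' x := fun g x h =>
    congrArg (· + (1 - (x.2 : ℝ))) (hinv g x.1 h)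
  let W := M.prodI.pos χ' hχ' hinv'
  let ι : GMap W M.prodI := M.prodI.posIncl χ' hχ' hinv'
  have hι : IsOpenEmbedding ι := M.prodI.isOpenEmbedding_posIncl χ' hχ' hinv'
  let bW : GMap W X := b.comp (M.prodFst.comp ι)
  let h := f.prodI.restrict ι hι
  let k : GMap M'.prodI W :=
    { toFun := fun p => ⟨(i p.1, p.2), add_pos_of_pos_of_nonneg ((hr _).1 ⟨_, rfl⟩)
        (sub_nonneg.2 p.2.2.2)⟩
      continuous_toFun := ((i.continuous_toFun.comp continuous_fst).prodMk continuous_snd).subtype_mk _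
      anchor_map := fun p => i.anchor_map p.1
      map_act := fun g p e => Subtype.ext (Prod.ext (i.map_act g p.1 e) rfl) }
  have hk : IsOpenEmbedding k :=
    (hι.of_comp_iff k).1 (hi.prodMap (IsOpenEmbedding.id (X := unitInterval)))
  have hpr : IsProperMap M'.prodFst := isProperMap_fst_of_compactSpace
  obtain ⟨ξW, hξW⟩ := Supp.exists_isExtension k hk (p := bW) (p' := b'.comp M'.prodFst)
    (fun t => hb t.1) (Supp.restr M'.prodFst hpr (fun _ => rfl) ξ')
  have key : ∀ (t : unitInterval) (N : GSpace G) (iN : GMap N M) (it : GMap N W)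
      (_ : ∀ n, ι (it n) = ((iN n, t) : M × unitInterval)) (hcl : IsClosedEmbedding it)
      (_ : ∀ w, (ι w : M × unitInterval).2 = t → w ∈ Set.range it)
      (fN : NNMap F N Y) (_ : fN.IsoAlong f iN id) (bN : GMap N X) (_ : ∀ n, bN n = b (iN n))
      (ξN : F.Supp bN) (k' : GMap M' N) (_ : ∀ m, iN (k' m) = i m)
      (_ : ∀ n, iN n ∈ Set.range i → n ∈ Set.range k') (_ : IsOpenEmbedding k')
      (_ : Supp.IsExtension k' ξ' ξN),
      (⟨N, bN, fN, ξN⟩ : Corr F X Y).IsBoundary h bW ξW t := by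
    intro t N iN it hit hcl hW fN hiso bN hbN ξN k' hk' hr' hk'o hext
    obtain ⟨α, β, hαβ⟩ := hiso
    have hit1 : ∀ n, (ι (it n) : M × unitInterval).1 = iN n := fun n => (Prod.ext_iff.1 (hit n)).1
    have hit2 : ∀ n, (ι (it n) : M × unitInterval).2 = t := fun n => (Prod.ext_iff.1 (hit n)).2
    let α₁ : OBundle.Map fN.V f.prodI.V (ι.comp it) :=
      (f.V.pullbackMap M.prodFst).lift (f'' := iN) α (ι.comp it) hit1
    let α₂ : OBundle.Map fN.V h.V it := (f.prodI.V.pullbackMap ι).lift α₁ it fun _ => rfl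
    have e1 : ∀ v, (f.V.pullbackMap M.prodFst).toGMap (α₁.toGMap v) = α.toGMap v := fun v =>
      GBundle.Map.toGMap_lift (f.V.pullbackMap M.prodFst).toMap _ _ hit1 v
    have e2 : ∀ v, (f.prodI.V.pullbackMap ι).toGMap (α₂.toGMap v) = α₁.toGMap v := fun v =>
      GBundle.Map.toGMap_lift (f.prodI.V.pullbackMap ι).toMap _ _ (fun _ => rfl) v
    have e3 : ∀ v : h.V.tot, (h.toBase v : Y × unitInterval).2 = (ι (h.V.proj v) : M × unitInterval).2 :=
      fun v => (Prod.ext_iff.1 ((f.prodI.V.pullbackMap ι).cart.comm v)).2.symm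
    have hbN' : ∀ n, bN n = bW (it n) := fun n => by
      rw [hbN]
      exact congrArg b (hit1 n).symm
    refine ⟨{w | (ι w : M × unitInterval).2 = t}, fun v => by rw [e3]; rfl, it, hcl, hbN', ?_,
      ⟨α₂, β, fun v => ⟨Prod.ext ?_ ?_, ?_⟩⟩, ?_⟩
    · exact Set.Subset.antisymm (by rintro _ ⟨n, rfl⟩; exact hit2 n) hW
    · refine Eq.trans ?_ (hαβ v).1.symm
      exact congrArg f.toBase ((congrArg _ (e2 v)).trans (e1 v))
    · refine (e3 _).trans ?_
      refine (congrArg (fun w => (ι w : M × unitInterval).2) (α₂.cart.comm v)).symm.trans ?_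
      exact hit2 _
    · refine Eq.trans ?_ (hαβ v).2.symm
      exact congrArg f.toFib ((congrArg _ (e2 v)).trans (e1 v))
    · have hs := isClosedEmbedding_slice M' t
      have hsl : ∀ t' : M', b' t' = (b'.comp M'.prodFst) (M'.slice t t') := fun _ => rfl
      have h1 := hξW.pull (k := k') (φ := it) (φ' := M'.slice t) (f := GMap.id X) (q := bN) (q' := b')
        hbN' (isProperMap_graph it hcl.isProperMap hbN') hsl (isProperMap_graph _ hs.isProperMap hsl)
        (fun m => hι.injective (by
          rw [hit, hk']
          rfl)) (fun n ⟨p, hp⟩ => hr' n (by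
          have h2 := (Prod.ext_iff.1 (hit n)).1
          rw [← hp] at h2
          exact ⟨p.1, h2⟩))
      have h2 : Supp.pull (M'.slice t) (GMap.id X) hsl (isProperMap_graph _ hs.isProperMap hsl)
          (Supp.restr M'.prodFst hpr (p' := b'.comp M'.prodFst) (fun _ => rfl) ξ') = ξ' := by
        refine (Supp.pull_pull (χ := GMap.id M') (k := GMap.id X) (comm'' := fun _ => rfl)
          (hχ := isProperMap_graph (p := b') _ isProperMap_id fun _ => rfl) (fun _ => rfl) ξ').trans ?_
        exact Supp.pull_eq_self (fun _ => rfl) ξ'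
      rw [h2] at h1
      exact Supp.IsExtension.unique hk'o (fun m => by rw [hbN, hk', hb]) hext h1
  refine ⟨W, bW, h, ξW, ?_, ?_⟩
  · have hm0 : ∀ m, 0 < χ' (m, 0) := fun m => by
      change 0 < χ m + (1 - ((0 : unitInterval) : ℝ))
      have := h0 m
      rw [Set.Icc.coe_zero]
      linarith
    let it : GMap M W :=
      { toFun := fun m => ⟨(m, 0), hm0 m⟩
        continuous_toFun := (continuous_id.prodMk continuous_const).subtype_mk hm0
        anchor_map := fun _ => rfl
        map_act := fun _ _ _ => rfl }
    refine key 0 M (GMap.id M) it (fun _ => rfl) ?_ ?_ f ⟨.refl _, .refl _, fun _ => ⟨rfl, rfl⟩⟩ b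
      (fun _ => rfl) ξ i (fun _ => rfl) (fun _ h => h) hi hξ
    · have h1 : IsProperMap it := isProperMap_of_comp_of_t2 (g := ι) it.continuous_toFun
        ι.continuous_toFun (isClosedEmbedding_slice M 0).isProperMap
      exact .of_continuous_injective_isClosedMap it.continuous_toFun (fun a b h =>
        (isClosedEmbedding_slice M 0).injective (congrArg ι h)) h1.isClosedMap
    · rintro ⟨⟨m, s⟩, hw⟩ (hs : s = 0)
      subst hs
      exact ⟨m, rfl⟩
  · let it : GMap M' W := k.comp (M'.slice 1)
    have hrange : ∀ w, (ι w : M × unitInterval).2 = 1 → w ∈ Set.range it := by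
      rintro ⟨⟨m, s⟩, hw⟩ (hs : s = 1)
      subst hs
      have h1 : 0 < χ m + (1 - ((1 : unitInterval) : ℝ)) := hw
      rw [Set.Icc.coe_one, sub_self, add_zero] at h1
      obtain ⟨m', rfl⟩ := (hr m).2 h1
      exact ⟨m', rfl⟩
    refine key 1 M' i it (fun _ => rfl) ⟨?_, ?_⟩ hrange f' hf b' hb ξ' (GMap.id M') (fun _ => rfl)
      (fun n _ => ⟨n, rfl⟩) .id ?_
    · exact hk.isEmbedding.comp (isClosedEmbedding_slice M' 1).isEmbedding
    · have : Set.range it = {w | (ι w : M × unitInterval).2 = 1} := by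
        refine Set.Subset.antisymm ?_ hrange
        rintro _ ⟨m, rfl⟩
        rfl
      rw [this]
      exact isClosed_eq (continuous_snd.comp ι.continuous_toFun) continuous_const
    · have := Supp.IsExtension.of_homeomorph (F := F) (p := b') (p' := b') (j := GMap.id M') .id
        (fun _ => rfl) ξ'
      rwa [Supp.restr, Supp.pull_eq_self (fun _ => rfl)] at this

/-- An invariant function that is positive only near the support. -/
theorem _root_.TopGroupoid.NumerablyProper.exists_pos (hG : G.NumerablyProper) {P : GSpace G}
    (B : ClosedInv P) (A : ClosedInv P) (h : Disjoint A.carrier (closure B.carrierᶜ)) :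
    ∃ ψ : P → ℝ, Continuous ψ ∧ (∀ g y h, ψ (P.act g y h) = ψ y) ∧
      (∀ y ∈ A.carrier, ψ y = 0) ∧ (∀ y ∈ closure B.carrierᶜ, ψ y = 1) ∧ ∀ y, 0 ≤ ψ y := by
  obtain ⟨φ, hA, hB, h01⟩ := exists_continuous_zero_one_of_isClosed A.isClosed isClosed_closure h
  obtain ⟨ψ, h1, h2, h3, h4⟩ := hG.exists_average P φ.continuous
  refine ⟨ψ, h1, h2, fun y hy => ?_, ?_, fun y => h3 y 0 fun g h => (h01 _).1⟩
  · exact le_antisymm (h4 y 0 fun g h => (hA (A.act_mem g y h hy)).le)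
      (h3 y 0 fun g h => (hA (A.act_mem g y h hy)).ge)
  · refine closure_minimal (fun y hy => ?_) (isClosed_eq h1 continuous_const)
    have hm : ∀ g h, P.act g y h ∈ B.carrierᶜ := fun g h hg => hy (by
      have := B.act_mem (G.inv g) _ ((G.src_inv g).trans (P.anchor_act g y h).symm) hg
      rwa [P.inv_act] at this)
    exact le_antisymm (h4 y 1 fun g h => (h01 _).2)
      (h3 y 1 fun g h => (hB (subset_closure (hm g h))).ge)

/-- Correspondences may be extended along open embeddings of their middle spaces. -/
theorem cls_eq_of_isExtension (hG : G.NumerablyProper) {f : NNMap F M Y} {b : GMap M X}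
    {ξ : F.Supp b} {f' : NNMap F M' Y} {b' : GMap M' X} {ξ' : F.Supp b'} (j : GMap M' M)
    (hj : IsOpenEmbedding j) (hb : ∀ m, b' m = b (j m)) (hf : f'.IsoAlong f j id)
    (hξ : Supp.IsExtension j ξ' ξ) :
    (⟨M', b', f', ξ'⟩ : Corr F X Y).cls = (⟨M, b, f, ξ⟩ : Corr F X Y).cls := by
  obtain ⟨B, a, hB, hBr, rfl, rfl⟩ := hξ
  let A : ClosedInv M := ⟨(Set.range j)ᶜ, hj.isOpen_range.isClosed_compl, by
    rintro g x h hx ⟨m, hm⟩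
    refine hx ⟨M'.act (G.inv g) m ((G.src_inv g).trans ?_), ?_⟩
    · rw [← j.anchor_map, hm, M.anchor_act]
    · rw [j.map_act]
      refine (M.act_congr hm _ ((G.src_inv g).trans (M.anchor_act g x h).symm)).trans ?_
      exact M.inv_act g x h⟩
  have hcl : closure B.set.carrierᶜ ⊆ Set.range j := by
    have h1 : CompactOver b (j '' closure (B.set.preimage j).carrierᶜ) := hB.image hb
    refine (closure_minimal ?_ h1.isClosed).trans (Set.image_subset_range _ _)
    intro x hx
    obtain ⟨m, rfl⟩ := hBr hx
    exact ⟨m, subset_closure hx, rfl⟩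
  obtain ⟨ψ, c1, c2, c3, c4, c5⟩ := hG.exists_pos B.set A
    (Set.disjoint_left.2 fun x hx hx' => hx (hcl hx'))
  let P := M.pos ψ c1 c2
  let ι : GMap P M := M.posIncl ψ c1 c2
  have hιr : ∀ p, ι p ∈ Set.range j := fun p => by
    by_contra h
    exact p.2.ne' (c3 _ h)
  let i' : GMap P M' := j.factor hj.isEmbedding ι hιr
  let i : GMap P M := j.comp i'
  have hii : i = ι := GMap.ext (funext (j.apply_factor hj.isEmbedding ι hιr))
  have hio : IsOpenEmbedding i := by rw [hii]; exact M.isOpenEmbedding_posIncl ψ c1 c2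
  have hio' : IsOpenEmbedding i' := (hj.of_comp_iff i').1 hio
  have hri : ∀ x, x ∈ Set.range i ↔ 0 < ψ x := fun x => by
    rw [hii]
    exact ⟨by rintro ⟨p, rfl⟩; exact p.2, fun h => ⟨⟨x, h⟩, rfl⟩⟩
  have hri' : ∀ x, x ∈ Set.range i' ↔ 0 < ψ (j x) := fun x => by
    rw [← hri]
    exact ⟨by rintro ⟨p, rfl⟩; exact ⟨p, rfl⟩, fun ⟨p, hp⟩ => ⟨p, hj.injective hp⟩⟩
  have hBP : B.set.carrierᶜ ⊆ Set.range i := fun x hx => (hri x).2 (by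
    rw [c4 x (subset_closure hx)]; exact one_pos)
  have hcP : closure B.set.carrierᶜ ⊆ Set.range i := fun x hx => (hri x).2 (by
    rw [c4 x hx]; exact one_pos)
  have hC : CompactOver (b.comp i) (closure (B.set.preimage i).carrierᶜ) := by
    refine (compactOver_iff (b.comp i).continuous_toFun).2 fun U x hU hx => ?_
    have h1 : closure B.set.carrierᶜ ∈ U.map i := by
      refine Ultrafilter.mem_map.2 (Filter.mem_of_superset hU ?_)
      exact i.continuous_toFun.closure_preimage_subset B.set.carrierᶜ
    obtain ⟨m, hm, hle⟩ := (compactOver_iff b.continuous_toFun).1 B.compactOver (U.map i) x h1 hx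
    obtain ⟨p, rfl⟩ := hcP hm
    have hle' : (U : Filter P) ≤ 𝓝 p := by
      rw [hio.isEmbedding.nhds_eq_comap]
      exact Filter.map_le_iff_le_comap.1 hle
    exact ⟨p, isClosed_closure.mem_of_frequently_of_tendsto (Filter.Eventually.frequently hU) hle', hle'⟩
  have hC' : CompactOver (b'.comp i') (closure (B.set.preimage i).carrierᶜ) := by
    have : b'.comp i' = b.comp i := GMap.ext (funext fun p => hb (i' p))
    rw [this]; exact hC
  let ζ : F.Supp (b'.comp i') := Supp.mk ⟨B.set.preimage i, hC'⟩ (F.map i (B.set.preimage i) B.set subset_rfl a)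
  have hζ : Supp.IsExtension i ζ (Supp.mk B a) := ⟨B, a, hC', hBP, rfl, rfl⟩
  have hζ' : Supp.IsExtension i' ζ (Supp.mk ⟨B.set.preimage j, hB⟩
      (F.map j (B.set.preimage j) B.set subset_rfl a)) := by
    refine ⟨⟨B.set.preimage j, hB⟩, _, hC', fun m hm => ?_, rfl, ?_⟩
    · obtain ⟨p, hp⟩ := hBP hm
      exact ⟨p, hj.injective hp⟩
    · exact congrArg (Supp.mk _) (F.map_comp i' j _ _ _ _ _ _ a)
  let f₀ := f.restrict i hio
  have e1 : f₀.IsoAlong f i id := f.isoAlong_restrict i hio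
  have e2 : f₀.IsoAlong f' i' id := by
    obtain ⟨α, β, h⟩ := hf
    let α' : OBundle.Map f₀.V f'.V i' := α.lift (f.V.pullbackMap i) i' fun _ => rfl
    have hα : ∀ v, α.toGMap (α'.toGMap v) = (f.V.pullbackMap i).toGMap v :=
      GBundle.Map.toGMap_lift α.toMap _ _ fun _ => rfl
    refine ⟨α', β.symm, fun v => ⟨?_, ?_⟩⟩
    · refine Eq.trans ?_ (h _).1.symm
      exact congrArg f.toBase (hα v).symm
    · have h1 := (h (α'.toGMap v)).2
      refine Eq.trans ?_ (β.symm_apply _)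
      refine congrArg β.symm.toGMap (Eq.trans ?_ h1.symm)
      exact congrArg f.toFib (hα v).symm
  have r1 := bordant_of_pos i hio ψ c1 c2 c5 hri (fun m => hb (i' m)) e1 hζ
  have r2 := bordant_of_pos i' hio' (fun x => ψ (j x)) (c1.comp j.continuous_toFun)
    (fun g x h => by rw [j.map_act, c2]) (fun x => c5 _) hri' (fun _ => rfl) e2 hζ'
  exact (Quot.sound (.bordism _ _ r2)).trans (Quot.sound (.bordism _ _ r1)).symm

end Corr

namespace GBundle

instance topTot (V : GBundle M) (N : GBundle V.tot) : TopologicalSpace (TotPt N.fib) := N.top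

variable (V W : GBundle M)

/-- The bundle `W ⊕ V ⊕ W ⊕ V` over the total space of `V`. -/
def stab : GBundle V.tot := (((W.add (V.add W)).add V)).pullback V.proj

/-- The point of the total space of `V.stab W` with given components. -/
def stabMk {V W : GBundle M} {m : M} (u v v' : V.fib m) (w w' : W.fib m) : (V.stab W).tot :=
  (⟨(⟨m, u⟩ : TotPt V.fib), ((w, (v, w')), v')⟩ : TotPt (V.stab W).fib)

theorem stabMk_congr {V W : GBundle M} {m : M} {u v v' u₁ v₁ v₁' : V.fib m} {w w' : W.fib m}
    (h : u = u₁) (h' : v = v₁) (h'' : v' = v₁') : stabMk u v v' w w' = stabMk u₁ v₁ v₁' w w' := by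
  rw [h, h', h'']

theorem act_stabMk {V W : GBundle M} {m : M} (u v v' : V.fib m) (w w' : W.fib m) (g : G.Arr)
    (h : G.src g = M.anchor m) : (V.stab W).tot.act g (stabMk u v v' w w') h =
      stabMk (V.act g m h u) (V.act g m h v) (V.act g m h v') (W.act g m h w) (W.act g m h w') :=
  (((W.add (V.add W)).add V).pullbackMap V.proj).isClosedEmbedding.injective
    (Prod.ext rfl ((((W.add (V.add W)).add V).pullbackMap V.proj).toGMap.map_act g
      (stabMk u v v' w w') h))

theorem lin3 {E : Type*} [AddCommGroup E] [Module ℝ E] {p q r p' q' r' : ℝ}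
    (h₁ : p' * p + q' * r + r' * q = 1) (h₂ : p' * q + q' * p + r' * r = 0)
    (h₃ : p' * r + q' * q + r' * p = 0) (a b c : E) :
    p' • (p • a + q • b + r • c) + q' • (p • b + q • c + r • a) + r' • (p • c + q • a + r • b) = a := by
  have : p' • (p • a + q • b + r • c) + q' • (p • b + q • c + r • a) + r' • (p • c + q • a + r • b) =
      (p' * p + q' * r + r' * q) • a + (p' * q + q' * p + r' * r) • b +
        (p' * r + q' * q + r' * p) • c := by module
  rw [this, h₁, h₂, h₃]
  simp

/-- The action of a combination of the powers of a cyclic permutation of three copies of `V`. -/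
def cyc (p q r : C(unitInterval, ℝ)) : GMap (V.stab W).tot.prodI (V.stab W).tot where
  toFun x := stabMk (p x.2 • x.1.pt.vec + q x.2 • x.1.vec.1.2.1 + r x.2 • x.1.vec.2)
    (p x.2 • x.1.vec.1.2.1 + q x.2 • x.1.vec.2 + r x.2 • x.1.pt.vec)
    (p x.2 • x.1.vec.2 + q x.2 • x.1.pt.vec + r x.2 • x.1.vec.1.2.1) x.1.vec.1.1 x.1.vec.1.2.2
  continuous_toFun := by
    let R : GBundle M := V.add W
    let C : GBundle M := W.add R
    let N : GBundle M := C.add V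
    let T := (V.stab W).tot.prodI
    have hp : Continuous fun x : T => p x.2 := p.continuous.comp continuous_snd
    have hq : Continuous fun x : T => q x.2 := q.continuous.comp continuous_snd
    have hr : Continuous fun x : T => r x.2 := r.continuous.comp continuous_snd
    have hu : Continuous fun x : T => (⟨x.1.pt.pt, x.1.pt.vec⟩ : TotPt V.fib) :=
      (V.stab W).continuous_pt.comp continuous_fst
    have hn : Continuous fun x : T => (⟨x.1.pt.pt, x.1.vec⟩ : TotPt N.fib) :=
      (N.pullbackMap V.proj).toGMap.continuous_toFun.comp continuous_fst
    have hv : Continuous fun x : T => (⟨x.1.pt.pt, x.1.vec.2⟩ : TotPt V.fib) :=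
      (C.continuous_addSnd V).comp hn
    have hc : Continuous fun x : T => (⟨x.1.pt.pt, x.1.vec.1⟩ : TotPt C.fib) :=
      (C.continuous_addFst V).comp hn
    have hw : Continuous fun x : T => (⟨x.1.pt.pt, x.1.vec.1.1⟩ : TotPt W.fib) :=
      (W.continuous_addFst R).comp hc
    have hR : Continuous fun x : T => (⟨x.1.pt.pt, x.1.vec.1.2⟩ : TotPt R.fib) :=
      (W.continuous_addSnd R).comp hc
    have hv2 : Continuous fun x : T => (⟨x.1.pt.pt, x.1.vec.1.2.1⟩ : TotPt V.fib) :=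
      (V.continuous_addFst W).comp hR
    have hw' : Continuous fun x : T => (⟨x.1.pt.pt, x.1.vec.1.2.2⟩ : TotPt W.fib) :=
      (V.continuous_addSnd W).comp hR
    have key : ∀ {a b c : ∀ x : T, V.fib x.1.pt.pt},
        Continuous (fun x : T => (⟨x.1.pt.pt, a x⟩ : TotPt V.fib)) →
        Continuous (fun x : T => (⟨x.1.pt.pt, b x⟩ : TotPt V.fib)) →
        Continuous (fun x : T => (⟨x.1.pt.pt, c x⟩ : TotPt V.fib)) →
        Continuous fun x : T => (⟨x.1.pt.pt, p x.2 • a x + q x.2 • b x + r x.2 • c x⟩ : TotPt V.fib) :=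
      fun ha hb hc => V.continuous_add (V.continuous_add (V.continuous_smul hp ha)
        (V.continuous_smul hq hb)) (V.continuous_smul hr hc)
    refine (N.pullbackMap V.proj).isClosedEmbedding.isEmbedding.continuous_iff.2
      (Continuous.prodMk (key hu hv2 hv) ?_)
    refine continuous_addMk (V := C) (W := V) (x := fun x : T => x.1.pt.pt)
      (a := fun x => (x.1.vec.1.1, (p x.2 • x.1.vec.1.2.1 + q x.2 • x.1.vec.2 + r x.2 • x.1.pt.vec,
        x.1.vec.1.2.2)))
      (b := fun x => p x.2 • x.1.vec.2 + q x.2 • x.1.pt.vec + r x.2 • x.1.vec.1.2.1) ?_ (key hv hu hv2)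
    refine continuous_addMk (V := W) (W := R) (x := fun x : T => x.1.pt.pt) (a := fun x => x.1.vec.1.1)
      (b := fun x => (p x.2 • x.1.vec.1.2.1 + q x.2 • x.1.vec.2 + r x.2 • x.1.pt.vec, x.1.vec.1.2.2))
      hw ?_
    exact continuous_addMk (V := V) (W := W) (x := fun x : T => x.1.pt.pt)
      (a := fun x => p x.2 • x.1.vec.1.2.1 + q x.2 • x.1.vec.2 + r x.2 • x.1.pt.vec)
      (b := fun x => x.1.vec.1.2.2) (key hv2 hv hu) hw'
  anchor_map _ := rfl
  map_act g x h := by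
    have key : ∀ a b c : V.fib x.1.pt.pt, V.act g x.1.pt.pt h (p x.2 • a + q x.2 • b + r x.2 • c) =
        p x.2 • V.act g x.1.pt.pt h a + q x.2 • V.act g x.1.pt.pt h b + r x.2 • V.act g x.1.pt.pt h c :=
      fun a b c => by simp only [map_add, map_smul]
    refine Eq.trans ?_ ((act_stabMk (V := V) (W := W) (m := x.1.pt.pt) _ _ _ _ _ g h).trans
      (stabMk_congr (key _ _ _) (key _ _ _) (key _ _ _))).symm
    have h' := act_stabMk x.1.pt.vec x.1.vec.1.2.1 x.1.vec.2 x.1.vec.1.1 x.1.vec.1.2.2 g h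
    exact congrArg (fun y : (V.stab W).tot => stabMk
      (p x.2 • y.pt.vec + q x.2 • y.vec.1.2.1 + r x.2 • y.vec.2)
      (p x.2 • y.vec.1.2.1 + q x.2 • y.vec.2 + r x.2 • y.pt.vec)
      (p x.2 • y.vec.2 + q x.2 • y.pt.vec + r x.2 • y.vec.1.2.1) y.vec.1.1 y.vec.1.2.2) h'

theorem cyc_cyc {p q r p' q' r' : C(unitInterval, ℝ)}
    (h₁ : ∀ s, p' s * p s + q' s * r s + r' s * q s = 1)
    (h₂ : ∀ s, p' s * q s + q' s * p s + r' s * r s = 0)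
    (h₃ : ∀ s, p' s * r s + q' s * q s + r' s * p s = 0) (x : (V.stab W).tot.prodI) :
    V.cyc W p' q' r' (V.cyc W p q r x, x.2) = x.1 := by
  have key := fun a b c : V.fib x.1.pt.pt => lin3 (h₁ x.2) (h₂ x.2) (h₃ x.2) a b c
  exact stabMk_congr (key _ _ _) (key _ _ _) (key _ _ _)

theorem isHomeomorph_cyc {p q r p' q' r' : C(unitInterval, ℝ)}
    (h₁ : ∀ s, p' s * p s + q' s * r s + r' s * q s = 1)
    (h₂ : ∀ s, p' s * q s + q' s * p s + r' s * r s = 0)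
    (h₃ : ∀ s, p' s * r s + q' s * q s + r' s * p s = 0) :
    IsHomeomorph (fun x : (V.stab W).tot × unitInterval => (V.cyc W p q r x, x.2)) :=
  isHomeomorph_iff_exists_inverse.2 ⟨(V.cyc W p q r).continuous_toFun.prodMk continuous_snd,
    fun x => (V.cyc W p' q' r' x, x.2), fun x => Prod.ext (V.cyc_cyc W h₁ h₂ h₃ x) rfl,
    fun x => Prod.ext (V.cyc_cyc W (fun s => by linarith [h₁ s]) (fun s => by linarith [h₂ s])
      (fun s => by linarith [h₃ s]) x) rfl,
    (V.cyc W p' q' r').continuous_toFun.prodMk continuous_snd⟩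

/-- The cyclic permutation of three copies of `V`. -/
def rot : GMap (V.stab W).tot (V.stab W).tot :=
  (V.cyc W 0 1 0).comp ((V.stab W).tot.slice 1)

theorem rot_mk (m : M) (u : V.fib m) (w : W.fib m) (v : V.fib m) (w' : W.fib m) (v' : V.fib m) :
    V.rot W (stabMk u v v' w w') = stabMk v v' u w w' := by
  have key : ∀ a b c : V.fib m, (0 : C(unitInterval, ℝ)) 1 • a + (1 : C(unitInterval, ℝ)) 1 • b +
      (0 : C(unitInterval, ℝ)) 1 • c = b := fun a b c => by simp
  exact stabMk_congr (key _ _ _) (key _ _ _) (key _ _ _)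

theorem isHomeomorph_rot : IsHomeomorph (V.rot W) :=
  isHomeomorph_iff_exists_inverse.2 ⟨(V.rot W).continuous_toFun,
    (V.cyc W 0 0 1).comp ((V.stab W).tot.slice 1),
    fun x => V.cyc_cyc W (p := 0) (q := 1) (r := 0) (p' := 0) (q' := 0) (r' := 1) (by simp) (by simp)
      (by simp) (x, 1),
    fun x => V.cyc_cyc W (p' := 0) (q' := 1) (r' := 0) (p := 0) (q := 0) (r := 1) (by simp) (by simp)
      (by simp) (x, 1),
    GMap.continuous_toFun _⟩

/-- The cyclic permutation of three copies of `V` is isotopic to the identity. -/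
theorem exists_isotopy_rot : ∃ A : GMap (V.stab W).tot.prodI (V.stab W).tot,
    IsOpenEmbedding (fun x : (V.stab W).tot × unitInterval => (A x, x.2)) ∧
    (∀ x, A (x, 0) = x) ∧ ∀ x, A (x, 1) = V.rot W x := by
  let q : C(unitInterval, ℝ) := ⟨Subtype.val, continuous_subtype_val⟩
  let p : C(unitInterval, ℝ) := 1 - q
  have hd : ∀ s, p s ^ 3 + q s ^ 3 ≠ 0 := fun s => by
    have hq : 0 ≤ q s := s.2.1
    have hp : 0 ≤ p s := sub_nonneg.2 s.2.2
    have hpq : p s + q s = 1 := sub_add_cancel _ _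
    intro h
    have h1 : p s ^ 3 = 0 := le_antisymm (by nlinarith [pow_nonneg hq 3]) (pow_nonneg hp 3)
    have h2 : q s ^ 3 = 0 := le_antisymm (by nlinarith [pow_nonneg hp 3]) (pow_nonneg hq 3)
    rw [pow_eq_zero_iff (by norm_num)] at h1 h2
    rw [h1, h2] at hpq
    norm_num at hpq
  let d : C(unitInterval, ℝ) := ⟨fun s => (p s ^ 3 + q s ^ 3)⁻¹,
    ((p.continuous.pow 3).add (q.continuous.pow 3)).inv₀ hd⟩
  have hd' : ∀ s, d s * (p s ^ 3 + q s ^ 3) = 1 := fun s => inv_mul_cancel₀ (hd s)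
  refine ⟨V.cyc W p q 0, (V.isHomeomorph_cyc W (p' := d * p ^ 2) (q' := - (d * p * q)) (r' := d * q ^ 2)
    (fun s => ?_) (fun s => ?_) (fun s => ?_)).isOpenEmbedding, fun x => ?_, fun x => ?_⟩
  · simp only [ContinuousMap.mul_apply, ContinuousMap.pow_apply, ContinuousMap.neg_apply,
      ContinuousMap.zero_apply]
    linear_combination hd' s
  · simp only [ContinuousMap.mul_apply, ContinuousMap.pow_apply, ContinuousMap.neg_apply,
      ContinuousMap.zero_apply]
    ring
  · simp only [ContinuousMap.mul_apply, ContinuousMap.pow_apply, ContinuousMap.neg_apply,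
      ContinuousMap.zero_apply]
    ring
  · have hp0 : p 0 = 1 := by simp [p, q]
    have hq0 : q 0 = 0 := rfl
    have key : ∀ a b c : V.fib x.pt.pt, p 0 • a + q 0 • b + (0 : C(unitInterval, ℝ)) 0 • c = a :=
      fun a b c => by rw [hp0, hq0]; simp
    exact stabMk_congr (key _ _ _) (key _ _ _) (key _ _ _)
  · have hp0 : p 1 = 0 := by simp [p, q]
    have hq0 : q 1 = 1 := rfl
    have key : ∀ a b c : V.fib x.pt.pt, p 1 • a + q 1 • b + (0 : C(unitInterval, ℝ)) 1 • c = b :=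
      fun a b c => by rw [hp0, hq0]; simp
    exact (stabMk_congr (key _ _ _) (key _ _ _) (key _ _ _)).trans
      (V.rot_mk W x.pt.pt x.pt.vec x.vec.1.1 x.vec.1.2.1 x.vec.1.2.2 x.vec.2).symm

end GBundle

namespace OBundle

variable {V W : OBundle F M} {D : OBundle F (unitSpace G)}

theorem addCongr_mk {A A' B B' : OBundle F X} (a : Map A A' (GMap.id X)) (b : Map B B' (GMap.id X))
    {x : X} {p : A.fib x} {q : B.fib x} {p' : A'.fib x} {q' : B'.fib x}
    (h : a.toGMap (⟨x, p⟩ : TotPt A.fib) = (⟨x, p'⟩ : TotPt A'.fib))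
    (h' : b.toGMap (⟨x, q⟩ : TotPt B.fib) = (⟨x, q'⟩ : TotPt B'.fib)) :
    (addCongr a b).toGMap (⟨x, (p, q)⟩ : TotPt (A.add B).fib) =
      (⟨x, (p', q')⟩ : TotPt (A'.add B').fib) :=
  (A'.addSum B').cart.ext
    ((Sum.fst_map (A.addSum B) (A'.addSum B') a b (fun _ => rfl) _).trans h)
    ((Sum.snd_map (A.addSum B) (A'.addSum B') a b (fun _ => rfl) _).trans h')

theorem assoc_symm_mk (A B C : OBundle F X) {x : X} (p : A.fib x) (q : B.fib x) (r : C.fib x) :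
    (assoc A B C).symm.toGMap (⟨x, (p, (q, r))⟩ : TotPt (A.add (B.add C)).fib) =
      (⟨x, ((p, q), r)⟩ : TotPt ((A.add B).add C).fib) :=
  (assoc A B C).symm_apply (⟨x, ((p, q), r)⟩ : TotPt ((A.add B).add C).fib)

/-- Two copies of a trivialisation of `V ⊕ W`. -/
theorem exists_double (κ : Map (V.add W) D M.anchorMap) :
    ∃ κ' : Map (V.add (W.add (V.add W))) (D.add D) M.anchorMap, ∀ (m : M) (u : V.fib m) (w : W.fib m)
      (v : V.fib m) (w' : W.fib m),
      (D.addSum D).fst (κ'.toGMap (⟨m, (u, (w, (v, w')))⟩ : TotPt (V.add (W.add (V.add W))).fib)) =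
        κ.toGMap (⟨m, (u, w)⟩ : TotPt (V.add W).fib) ∧
      (D.addSum D).snd (κ'.toGMap (⟨m, (u, (w, (v, w')))⟩ : TotPt (V.add (W.add (V.add W))).fib)) =
        κ.toGMap (⟨m, (v, w')⟩ : TotPt (V.add W).fib) := by
  let s := (V.add W).addSum (V.add W)
  let δ : Map ((V.add W).add (V.add W)) (D.add D) M.anchorMap := s.map (D.addSum D) κ κ fun _ => rfl
  refine ⟨δ.comp (assoc V W (V.add W)).symm, fun m u w v w' => ?_⟩
  have h := congrArg δ.toGMap (assoc_symm_mk V W (V.add W) u w (v, w'))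
  exact ⟨(congrArg (D.addSum D).fst h).trans (Sum.fst_map s (D.addSum D) κ κ (fun _ => rfl) _),
    (congrArg (D.addSum D).snd h).trans (Sum.snd_map s (D.addSum D) κ κ (fun _ => rfl) _)⟩

/-- A trivialisation of `W ⊕ V ⊕ W ⊕ V` from one of `V ⊕ W`. -/
theorem exists_shuffle (κ : Map (V.add W) D M.anchorMap) (hD : D.BoundedRank)
    (he : ∀ z, Even (D.rank z)) :
    ∃ ψ : Map ((W.add (V.add W)).add V) (D.add D) M.anchorMap, ∀ (m : M) (w : W.fib m)
      (v : V.fib m) (w' : W.fib m) (v' : V.fib m),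
      (D.addSum D).fst (ψ.toGMap (⟨m, ((w, (v, w')), v')⟩ : TotPt ((W.add (V.add W)).add V).fib)) =
        κ.toGMap (⟨m, (v, w)⟩ : TotPt (V.add W).fib) ∧
      (D.addSum D).snd (ψ.toGMap (⟨m, ((w, (v, w')), v')⟩ : TotPt ((W.add (V.add W)).add V).fib)) =
        κ.toGMap (⟨m, (v', w')⟩ : TotPt (V.add W).fib) := by
  let R := V.add W
  have hR : ∀ m, Even (R.rank m) := fun m => by
    rw [κ.toMap.rank_eq m]
    exact he _
  have hb : R.BoundedRank := hD.of_map κ.toMap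
  have hrk : ∀ m, (W.add V).rank m = R.rank m := fun m => by
    rw [(W.addSum V).rank_eq m, (V.addSum W).rank_eq m]
    exact add_comm _ _
  have hR' : ∀ m, Even ((W.add V).rank m) := fun m => by rw [hrk]; exact hR m
  have hb' : (W.add V).BoundedRank := by
    obtain ⟨n, hn⟩ := hb
    exact ⟨n, fun m => (hrk m).le.trans (hn m)⟩
  let s := R.addSum R
  let δ : Map (R.add R) (D.add D) M.anchorMap := s.map (D.addSum D) κ κ fun _ => rfl
  let a₁ : Map ((W.add R).add V) ((R.add W).add V) (GMap.id M) := addCongr (swap W R hR hb) (.refl V)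
  let a₂ : Map ((R.add W).add V) (R.add (W.add V)) (GMap.id M) := assoc R W V
  let a₃ : Map (R.add (W.add V)) (V.add (W.add (W.add V))) (GMap.id M) := assoc V W (W.add V)
  let a₄ : Map (V.add (W.add (W.add V))) (V.add ((W.add V).add W)) (GMap.id M) :=
    addCongr (.refl V) (swap W (W.add V) hR' hb')
  let a₅ : Map (V.add ((W.add V).add W)) (V.add (W.add (V.add W))) (GMap.id M) :=
    addCongr (.refl V) (assoc W V W)
  let a₆ : Map (V.add (W.add (V.add W))) (R.add R) (GMap.id M) := (assoc V W R).symm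
  refine ⟨δ.comp (a₆.comp (a₅.comp (a₄.comp (a₃.comp (a₂.comp a₁))))), fun m w v w' v' => ?_⟩
  have e₁ : a₁.toGMap (⟨m, ((w, (v, w')), v')⟩ : TotPt ((W.add R).add V).fib) =
      (⟨m, (((v, w'), w), v')⟩ : TotPt ((R.add W).add V).fib) := addCongr_mk _ _ rfl rfl
  have e₄ : a₄.toGMap (⟨m, (v, (w', (w, v')))⟩ : TotPt (V.add (W.add (W.add V))).fib) =
      (⟨m, (v, ((w, v'), w'))⟩ : TotPt (V.add ((W.add V).add W)).fib) := addCongr_mk _ _ rfl rfl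
  have e₅ : a₅.toGMap (⟨m, (v, ((w, v'), w'))⟩ : TotPt (V.add ((W.add V).add W)).fib) =
      (⟨m, (v, (w, (v', w')))⟩ : TotPt (V.add (W.add (V.add W))).fib) := addCongr_mk _ _ rfl rfl
  have e₆ : a₆.toGMap (⟨m, (v, (w, (v', w')))⟩ : TotPt (V.add (W.add (V.add W))).fib) =
      (⟨m, ((v, w), (v', w'))⟩ : TotPt (R.add R).fib) := assoc_symm_mk V W R v w (v', w')
  have e : (a₆.comp (a₅.comp (a₄.comp (a₃.comp (a₂.comp a₁))))).toGMap
      (⟨m, ((w, (v, w')), v')⟩ : TotPt ((W.add R).add V).fib) =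
      (⟨m, ((v, w), (v', w'))⟩ : TotPt (R.add R).fib) := by
    refine Eq.trans ?_ e₆
    refine congrArg a₆.toGMap (Eq.trans ?_ e₅)
    refine congrArg a₅.toGMap (Eq.trans ?_ e₄)
    exact congrArg (fun t => a₄.toGMap (a₃.toGMap (a₂.toGMap t))) e₁
  have h := congrArg δ.toGMap e
  exact ⟨(congrArg (D.addSum D).fst h).trans (Sum.fst_map s (D.addSum D) κ κ (fun _ => rfl) _),
    (congrArg (D.addSum D).snd h).trans (Sum.snd_map s (D.addSum D) κ κ (fun _ => rfl) _)⟩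

end OBundle

namespace NNMap

/-- The open embedding `f̂`, as a normally non-singular map from the total space of `V`. -/
noncomputable def total (f : NNMap F M Y) : NNMap F f.V.tot Y :=
  f.precomp (OBundle.zero F f.V.tot) (OBundle.subtrivial_zero _) (OBundle.boundedRank_zero _)
    (OBundle.zero F f.V.tot).proj (GBundle.isHomeomorph_zero _).isOpenEmbedding

end NNMap

/-- The Thom modification along `V` of a correspondence with the normally non-singular map
`(V, E, f̂)`. -/
theorem Corr.cls_eq_total {X : GSpace G} (f : NNMap F M Y) (b : GMap M X) (ξ : F.Supp b) :
    (⟨M, b, f, ξ⟩ : Corr F X Y).cls = (⟨f.V.tot, b.comp f.V.proj, f.total,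
      Supp.mul f.V.proj (b.comp f.V.proj) (fun _ => rfl) ξ f.V.τ⟩ : Corr F X Y).cls := by
  obtain ⟨k₀⟩ := f.subtrivial
  let V := f.V
  let W := k₀.compl.add (V.add k₀.compl)
  let D := k₀.triv.add k₀.triv
  have hD : D.BoundedRank := OBundle.boundedRank_add k₀.bounded k₀.bounded
  have he : ∀ z, Even (D.rank z) := k₀.triv.even_rank_add_self
  obtain ⟨κ, -⟩ := OBundle.exists_double k₀.iso
  obtain ⟨κ', hκ'⟩ := OBundle.exists_double (V := V) (W := W) (D := D) κ
  obtain ⟨ψ, hψ⟩ := OBundle.exists_shuffle (V := V) (W := W) (D := D) κ hD he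
  let Q := D.add D
  have hQ : Q.BoundedRank := OBundle.boundedRank_add hD hD
  have hQe : ∀ z, Even (Q.rank z) := D.even_rank_add_self
  let C := W.add (V.add W)
  let k : V.Complement := .of (W := C) κ' hQ
  let N := C.add V
  let n : OBundle.Sum N C V (GMap.id M) := C.addSum V
  let V₁ : OBundle F V.tot := N.pullback V.proj
  let α : OBundle.Map V₁ N V.proj := N.pullbackMap V.proj
  let ω : OBundle.Map V₁ Q V.tot.anchorMap := (ψ.comp α).congr fun _ => rfl
  have hs : V₁.Subtrivial := ω.subtrivial hQ
  have hb : V₁.BoundedRank := hQ.of_map ω.toMap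
  obtain ⟨w, w1, w2, -, cw⟩ := k.exists_cart n (i := GMap.id V.tot) .id α
  let s := V.isSum Q M.anchorMap
  have cQ := cw.comp κ'.cart
  let a₁ : GMap V₁.tot (V.sum Q M.anchorMap).tot :=
    s.cart.lift (n.snd.comp α.toGMap) (κ'.toGMap.comp w) cQ.comm
  have a1 : ∀ t, s.fst (a₁ t) = n.snd (α.toGMap t) := s.cart.fst_lift _ _ cQ.comm
  have a2 : ∀ t, s.snd (a₁ t) = κ'.toGMap (w t) := s.cart.snd_lift _ _ cQ.comm
  have ha : IsHomeomorph a₁ := cQ.isHomeomorph s.cart a1 a2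
  let f₁ : NNMap F V.tot Y := (f.lift Q hQ).precomp V₁ hs hb a₁ ha.isOpenEmbedding
  have hB : ∀ t, f₁.toBase t = f.toBase (n.snd (α.toGMap t)) := fun t => congrArg f.toBase (a1 t)
  have hE : ∀ t, (f.E.addSum Q).fst (f₁.toFib t) = f.toFib (n.snd (α.toGMap t)) := fun t =>
    (f.fst_liftFib Q _).trans (congrArg f.toFib (a1 t))
  have hQ' : ∀ t, (f.E.addSum Q).snd (f₁.toFib t) = κ'.toGMap (w t) := fun t =>
    (f.snd_liftFib Q _).trans (a2 t)
  let ξ' := Supp.mul V.proj (b.comp V.proj) (fun _ => rfl) ξ V.τ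
  have h₁ : (⟨M, b, f, ξ⟩ : Corr F X Y).cls = (⟨V.tot, b.comp V.proj, f₁, ξ'⟩ : Corr F X Y).cls := by
    refine Quot.sound (.thom _ _ ⟨V, k, hQe, N, n, GMap.id _, .id, fun _ => rfl, α,
      (f.E.addSum Q).swap' hQe hQ, fun t => ⟨hB t, hE t, fun w' e1 e2 => ?_⟩,
      (Supp.pull_eq_self (fun _ => rfl) _).symm⟩)
    refine (hQ' t).trans (congrArg κ'.toGMap ?_)
    exact k.sum.cart.ext ((w1 t).trans e1.symm) ((w2 t).trans e2.symm)
  let ρ : GMap V₁.tot V₁.tot := V.toGBundle.rot W.toGBundle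
  have hρ : IsHomeomorph ρ := V.toGBundle.isHomeomorph_rot W.toGBundle
  let f₂ : NNMap F V.tot Y := f₁.precomp V₁ hs hb ρ hρ.isOpenEmbedding
  have h₂ : f₁.Isotopic f₂ := by
    obtain ⟨A, hA, hA0, hA1⟩ := V.toGBundle.exists_isotopy_rot W.toGBundle
    exact f₁.isotopic_precomp A hA hA0 hρ.isOpenEmbedding hA1
  have h₃ : f₂.IsLifting f.total := by
    refine ⟨Q, ω.zeroSum, f.E.addSum Q, ?_⟩
    rintro ⟨⟨m, u⟩, ⟨⟨w₁, ⟨v, w₂⟩⟩, v'⟩⟩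
    have hr : ρ (GBundle.stabMk u v v' w₁ w₂) = GBundle.stabMk v v' u w₁ w₂ :=
      V.toGBundle.rot_mk W.toGBundle m u w₁ v w₂ v'
    refine ⟨(hB _).trans ?_, (hE _).trans ?_, (hQ' _).trans ?_⟩
    · exact congrArg (fun t => f.toBase (n.snd (α.toGMap t))) hr
    · exact congrArg (fun t => f.toFib (n.snd (α.toGMap t))) hr
    · refine (congrArg (fun t => κ'.toGMap (w t)) hr).trans ?_
      have hw : w (GBundle.stabMk v v' u w₁ w₂) = (⟨m, (v, (w₁, (v', w₂)))⟩ : TotPt (V.add C).fib) :=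
        k.sum.cart.ext (w1 _) (w2 _)
      refine (congrArg κ'.toGMap hw).trans ((D.addSum D).cart.ext ?_ ?_)
      · exact (hκ' m v w₁ v' w₂).1.trans (hψ m w₁ v w₂ v').1.symm
      · exact (hκ' m v w₁ v' w₂).2.trans (hψ m w₁ v w₂ v').2.symm
  refine h₁.trans (Quot.sound (.normal _ _ _ _ _ ?_))
  exact .trans _ _ _ (.rel _ _ (.inr (.inl h₂))) (.rel _ _ (.inr (.inr h₃)))

namespace NNMap

variable (Y) in
/-- The identity of `Y`, lifted along `E`. -/
noncomputable def stableRefl (E : OBundle F (unitSpace G)) (hE : E.BoundedRank) : NNMap F Y Y where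
  V := E.pullback Y.anchorMap
  E := E
  subtrivial := (E.pullbackMap Y.anchorMap).subtrivial hE
  boundedV := hE.of_map (E.pullbackMap Y.anchorMap).toMap
  boundedE := hE
  toBase := (E.pullback Y.anchorMap).proj
  toFib := (E.pullbackMap Y.anchorMap).toGMap
  isOpenEmbedding := ((E.pullbackMap Y.anchorMap).cart.isOpenEmbedding_iff
    (j := GMap.id _) (fun _ => rfl) (fun _ => rfl) (E.pullbackMap Y.anchorMap).cart.comm).1 .id

theorem isLifting_stableRefl (E : OBundle F (unitSpace G)) (hE : E.BoundedRank) :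
    (stableRefl Y E hE).IsLifting (.refl F Y) :=
  ⟨E, (E.pullbackMap Y.anchorMap).zeroSum, (OBundle.Map.refl E).zeroSum,
    fun _ => ⟨rfl, rfl, rfl⟩⟩

end NNMap

namespace Corr

/-- A correspondence from the object space is equivalent to `(Y, ϱ, id, η)`, where `η` is its value. -/
theorem IsValue.cls_eq (hG : G.NumerablyProper) {Ψ : Corr F (unitSpace G) Y} {η : F.Supp Y.anchorMap}
    (h : Ψ.IsValue η) : Ψ.cls = (canonical η).cls := by
  obtain ⟨M, b, f, ξ⟩ := Ψ
  let e := NNMap.stableRefl Y f.E f.boundedE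
  refine (cls_eq_total f b ξ).trans ?_
  have h₁ := cls_eq_of_isExtension (f := e.total) hG f.hat f.isOpenEmbedding_hat
    (b := Y.anchorMap.comp e.V.proj) (b' := b.comp f.V.proj) (f' := f.total)
    (fun t => GMap.toUnit_congr _ _ f.hat t)
    ⟨OBundle.Map.zero f.hat, .refl f.E, fun v => ⟨(f.proj_hat v.pt).symm, (f.fib_hat v.pt).symm⟩⟩ h
  refine h₁.trans ?_
  refine (cls_eq_total e Y.anchorMap η).symm.trans ?_
  exact Quot.sound (.normal _ _ _ _ _ (.rel _ _ (.inr (.inr (NNMap.isLifting_stableRefl f.E f.boundedE)))))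

/-- The value of a correspondence. -/
noncomputable def value (Ψ : Corr F (unitSpace G) Y) : F.Supp Y.anchorMap := Ψ.exists_value.choose

theorem isValue_value (Ψ : Corr F (unitSpace G) Y) : Ψ.IsValue Ψ.value := Ψ.exists_value.choose_spec

theorem IsValue.value_eq {Ψ : Corr F (unitSpace G) Y} {η : F.Supp Y.anchorMap} (h : Ψ.IsValue η) :
    Ψ.value = η := Ψ.isValue_value.unique h

end Corr

/-- The natural isomorphism from equivalence classes of correspondences to cohomology with
compact supports. -/
noncomputable def FHat.equiv (F : CohTheory.{u, v} G) (hG : G.NumerablyProper) (Y : GSpace G) :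
    FHat F (unitSpace G) Y ≃ F.Supp Y.anchorMap where
  toFun := Quot.lift Corr.value fun _ _ h => ((h.isValue_iff _).1 (Corr.isValue_value _)).value_eq.symm
  invFun η := (Corr.canonical η).cls
  left_inv := by
    rintro ⟨Ψ⟩
    exact (Ψ.isValue_value.cls_eq hG).symm
  right_inv η := (Corr.isCanonical_canonical η).isValue.value_eq

end

section

variable {G : TopGroupoid.{u}}

/-! ### The product with the real line -/

/-- `X × ℝ`, with the trivial action on the second factor. -/
@[reducible]
def GSpace.line (X : GSpace G) : GSpace G where
  carrier := X × ℝ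
  para := by
    refine ParacompactSpace.of_exhaustion (fun p : X × ℝ => |p.2|) (by fun_prop)
      (fun _ => abs_nonneg _) fun n => ?_
    have hc : IsClosedEmbedding fun p : {p : X × ℝ | |p.2| ≤ n} =>
        ((p.1.1, ⟨p.1.2, abs_le.1 p.2⟩) : X × Set.Icc (-n : ℝ) n) := by
      refine IsClosedEmbedding.of_continuous_injective_isClosedMap (by fun_prop) ?_ ?_
      · intro p q h
        exact Subtype.ext (Prod.ext (Prod.ext_iff.1 h).1 (Subtype.ext_iff.1 (Prod.ext_iff.1 h).2))
      · let k : X × Set.Icc (-n : ℝ) n → {p : X × ℝ | |p.2| ≤ n} :=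
          fun p => ⟨(p.1, p.2), abs_le.2 p.2.2⟩
        have hk : Continuous k := by fun_prop
        intro s hs
        convert hs.preimage hk using 1
        ext p
        constructor
        · rintro ⟨q, hq, rfl⟩; exact hq
        · intro hp; exact ⟨k p, hp, rfl⟩
    exact hc.paracompactSpace
  anchor p := X.anchor p.1
  continuous_anchor := X.continuous_anchor.comp continuous_fst
  act g p h := (X.act g p.1 h, p.2)
  anchor_act g p h := X.anchor_act g p.1 h
  one_act p := by rw [X.one_act]
  mul_act g h p e e' := by rw [X.mul_act g h p.1 e e']
  continuous_act := by
    refine Continuous.prodMk ?_ (continuous_snd.comp (continuous_snd.comp continuous_subtype_val))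
    exact X.continuous_act.comp (f := fun p : {p : G.Arr × (X × ℝ) //
      G.src p.1 = X.anchor p.2.1} =>
        (⟨(p.1.1, p.1.2.1), p.2⟩ : {p : G.Arr × X // G.src p.1 = X.anchor p.2}))
      (by fun_prop)

/-- The map to `Y × ℝ` with given components. -/
@[reducible]
def GMap.toLine {X Y : GSpace G} (f : GMap X Y) (t : X → ℝ) (ht : Continuous t)
    (hi : ∀ g x h, t (X.act g x h) = t x) : GMap X Y.line where
  toFun x := (f x, t x)
  continuous_toFun := f.continuous_toFun.prodMk ht
  anchor_map x := f.anchor_map x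
  map_act g x h := Prod.ext (f.map_act g x h) (hi g x h)

namespace GSpace

variable (X : GSpace G)

/-- The projection `X × ℝ → X`. -/
@[reducible]
def lineProj : GMap X.line X := ⟨Prod.fst, continuous_fst, fun _ => rfl, fun _ _ _ => rfl⟩

/-- The closed set where the coordinate belongs to a given closed set of real numbers. -/
@[reducible]
def lineSet (s : Set ℝ) (hs : IsClosed s) : ClosedInv X.line :=
  ⟨{p | p.2 ∈ s}, hs.preimage continuous_snd, fun _ _ _ h => h⟩

theorem isClosed_outer : IsClosed {t : ℝ | 1 ≤ |t|} := isClosed_le continuous_const continuous_abs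

/-- The points of `X × ℝ` outside the open unit interval bundle. -/
@[reducible]
def outer : ClosedInv X.line := X.lineSet {t | 1 ≤ |t|} isClosed_outer

/-- The points of `X × ℝ` below the open unit interval bundle. -/
@[reducible]
def lower : ClosedInv X.line := X.lineSet (Set.Iic (-1)) isClosed_Iic

/-- The points of `X × ℝ` outside the open unit interval bundle or over `C`. -/
@[reducible]
def outerOver (C : ClosedInv X) : ClosedInv X.line := X.outer.union (C.preimage X.lineProj)

/-- The points of `X × ℝ` below the open unit interval bundle or over `C`. -/
@[reducible]
def lowerOver (C : ClosedInv X) : ClosedInv X.line := X.lower.union (C.preimage X.lineProj)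

theorem lowerOver_subset (C : ClosedInv X) : (X.lowerOver C).carrier ⊆ (X.outerOver C).carrier := by
  rintro p (hp | hp)
  · refine .inl ?_
    have h1 : p.2 ≤ -1 := hp
    exact (by linarith : (1 : ℝ) ≤ -p.2).trans (neg_le_abs p.2)
  · exact .inr hp

end GSpace

/-- `f × id : X × ℝ → Y × ℝ`. -/
@[reducible]
def GMap.line {X Y : GSpace G} (f : GMap X Y) : GMap X.line Y.line :=
  (f.comp X.lineProj).toLine Prod.snd continuous_snd fun _ _ _ => rfl

namespace CohTheory

variable {F : CohTheory.{u, v} G} {X Y Y' W : GSpace G}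

theorem map_eq_of_homotopy {f g : GMap X Y} (H : GMap X.prodI Y) (h₀ : ∀ x, H (x, 0) = f x)
    (h₁ : ∀ x, H (x, 1) = g x) (A : ClosedInv X) (B : ClosedInv Y)
    (hH : ∀ x ∈ A.carrier, ∀ t, H (x, t) ∈ B.carrier) (hf : A.carrier ⊆ f ⁻¹' B.carrier)
    (hg : A.carrier ⊆ g ⁻¹' B.carrier) (b : F.obj Y B) :
    F.map f A B hf b = F.map g A B hg b :=
  (map_congr (f' := H.comp (X.slice 0)) (fun x => (h₀ x).symm) A B hf (fun x hx => hH x hx 0)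
    b).trans ((F.homotopy H A B hH (fun x hx => hH x hx 0) (fun x hx => hH x hx 1) b).trans
      (map_congr (f := H.comp (X.slice 1)) h₁ A B (fun x hx => hH x hx 1) hg b))

/-- Homotopy invariance for straight line homotopies in a subspace of `Y × ℝ`. -/
theorem map_eq_of_line (j : GMap W Y.line) (hj : IsEmbedding j) {f g : GMap X W}
    (h : ∀ x, (j (f x)).1 = (j (g x)).1)
    (hs : ∀ x, ∀ s : unitInterval, ∃ w, j w =
      ((j (f x)).1, (1 - s : ℝ) * (j (f x)).2 + s * (j (g x)).2))
    (A : ClosedInv X) (B : ClosedInv W)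
    (hB : ∀ x ∈ A.carrier, ∀ s : unitInterval, ∀ w, j w =
      ((j (f x)).1, (1 - s : ℝ) * (j (f x)).2 + s * (j (g x)).2) → w ∈ B.carrier)
    (hf : A.carrier ⊆ f ⁻¹' B.carrier) (hg : A.carrier ⊆ g ⁻¹' B.carrier) (b : F.obj W B) :
    F.map f A B hf b = F.map g A B hg b := by
  have h1 : ∀ k : GMap X W, Continuous fun p : X × unitInterval => (j (k p.1)).2 := fun k =>
    continuous_snd.comp (j.continuous_toFun.comp (k.continuous_toFun.comp continuous_fst))
  have h2 : ∀ (k : GMap X W) (g x h), (j (k (X.act g x h))).2 = (j (k x)).2 := fun k g x h => by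
    rw [k.map_act, j.map_act]
  let K : GMap X.prodI Y.line := GMap.toLine (((Y.lineProj.comp j).comp f).comp X.prodFst)
    (fun p => (1 - p.2 : ℝ) * (j (f p.1)).2 + p.2 * (j (g p.1)).2) (by
      have h3 : Continuous fun p : X × unitInterval => (p.2 : ℝ) := by fun_prop
      exact ((continuous_const.sub h3).mul (h1 f)).add (h3.mul (h1 g)))
    (fun k p e => congrArg₂ (fun a b : ℝ => (1 - p.2 : ℝ) * a + p.2 * b) (h2 f k p.1 e)
      (h2 g k p.1 e))
  have hK : ∀ p, ∃ w, j w = K p := fun p => hs p.1 p.2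
  refine map_eq_of_homotopy (GMap.factor j hj K hK)
    (fun x => hj.injective ((GMap.apply_factor j hj K hK (x, 0)).trans ?_))
    (fun x => hj.injective ((GMap.apply_factor j hj K hK (x, 1)).trans ?_))
    A B (fun x hx t => hB x hx t _ (GMap.apply_factor j hj K hK _)) hf hg b
  · exact Prod.ext rfl (by change (1 - (0 : ℝ)) * _ + 0 * _ = _; ring)
  · exact Prod.ext (h x) (by change (1 - (1 : ℝ)) * _ + 1 * _ = _; ring)

/-! ### The exact sequence of a triple -/

/-- The connecting homomorphism `F(S, C) → F(X, S)` of a triple. -/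
def bd (S C : ClosedInv X) : F.obj S.space (C.preimage S.incl) →+ F.obj X S :=
  (F.δ S).comp (F.res (C.preimage S.incl) (.empty _) (Set.empty_subset _))

theorem bd_natural (f : GMap X Y) (S C : ClosedInv X) (S' C' : ClosedInv Y)
    (hS : S.carrier ⊆ f ⁻¹' S'.carrier)
    (hC : (C.preimage S.incl).carrier ⊆ ClosedInv.restrict f S S' hS ⁻¹' (C'.preimage S'.incl).carrier)
    (y : F.obj S'.space (C'.preimage S'.incl)) :
    bd S C (F.map (ClosedInv.restrict f S S' hS) _ _ hC y) = F.map f S S' hS (bd S' C' y) := by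
  refine (congrArg (F.δ S) ?_).trans (F.δ_natural f S S' hS _)
  exact F.map_res _ _ _ _ _ _ _ _ _ _

theorem bd_bijective (S C : ClosedInv X) (h : C.carrier ⊆ S.carrier)
    (h0 : ∀ x : F.obj X C, x = 0) : Function.Bijective (bd (F := F) S C) := by
  let D := C.preimage S.incl
  let κ : GMap C.space D.space :=
    ⟨fun x => ⟨⟨x.1, h x.2⟩, x.2⟩, by fun_prop, fun _ => rfl, fun _ _ _ => rfl⟩
  let ρ : GMap D.space C.space :=
    ⟨fun x => ⟨x.1.1, x.2⟩, by fun_prop, fun _ => rfl, fun _ _ _ => rfl⟩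
  have hρ : ∀ c : F.obj D.space (.empty _), F.map ρ (.empty _) (.empty _) (Set.empty_subset _)
      (F.map κ (.empty _) (.empty _) (Set.empty_subset _) c) = c := fun c =>
    (map_map (k := GMap.id _) (fun _ => rfl) _ _ _ _ _ subset_rfl _).trans (F.map_id _ _ _)
  have hext : ∀ c : F.obj D.space (.empty _), ∃ z : F.obj X (.empty _),
      c = F.map D.incl (.empty _) (.empty _) (Set.empty_subset _)
        (F.map S.incl (.empty _) (.empty _) (Set.empty_subset _) z) := by
    intro c
    obtain ⟨z, hz⟩ := (F.exact_sub C (F.map κ (.empty _) (.empty _) (Set.empty_subset _) c)).1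
      (h0 _)
    refine ⟨z, ?_⟩
    rw [← hρ c, ← hz]
    exact map_map_comm (f := ρ) (g := C.incl) (f' := D.incl) (g' := S.incl) (fun _ => rfl)
      _ _ _ _ _ _ _ _ _
  constructor
  · rw [injective_iff_map_eq_zero]
    intro y hy
    obtain ⟨z, hz⟩ := (F.exact_sub S _).1 hy
    have hz0 : z = 0 := by
      obtain ⟨w, hw⟩ := (F.exact_space C z).1 (by
        have h1 := (F.exact_space D (F.res D (.empty _) (Set.empty_subset _) y)).2 ⟨y, rfl⟩
        rw [← hz] at h1
        have h2 := congrArg (F.map κ (.empty _) (.empty _) (Set.empty_subset _)) h1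
        rw [map_zero] at h2
        refine Eq.trans ?_ h2
        refine Eq.trans ?_ (congrArg _ (map_map (k := S.incl.comp D.incl) (fun _ => rfl) _ _ _ _ _
          (Set.empty_subset _) _)).symm
        exact (map_map (fun _ => rfl) _ _ _ _ _ _ _).symm)
      rw [← hw, h0 w, map_zero]
    rw [hz0, map_zero] at hz
    obtain ⟨c, rfl⟩ := (F.exact_pair D y).1 hz.symm
    obtain ⟨z, hz⟩ := hext c
    exact (F.exact_sub D c).2 ⟨_, hz.symm⟩
  · intro x
    obtain ⟨a, rfl⟩ := (F.exact_pair S x).1 (by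
      have := congrArg (F.res C (.empty _) (Set.empty_subset _)) (h0 (F.res S C h x))
      rw [res_res, map_zero] at this
      exact this)
    obtain ⟨z, hz⟩ := hext (F.map D.incl (.empty _) (.empty _) (Set.empty_subset _) a)
    obtain ⟨y, hy⟩ := (F.exact_space D
      (a - F.map S.incl (.empty _) (.empty _) (Set.empty_subset _) z)).1
      (by rw [map_sub, ← hz, sub_self])
    refine ⟨y, (congrArg (F.δ S) hy).trans ?_⟩
    rw [map_sub, (F.exact_sub S _).2 ⟨z, rfl⟩, sub_zero]

/-! ### The suspension isomorphism -/

theorem eq_zero_of_lowerOver (C : ClosedInv Y) (x : F.obj Y.line (Y.lowerOver C)) : x = 0 := by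
  let g : GMap Y.line Y.line := Y.lineProj.toLine (fun _ => -1) continuous_const fun _ _ _ => rfl
  have hg : (ClosedInv.univ Y.line).carrier ⊆ g ⁻¹' (Y.lowerOver C).carrier :=
    fun p _ => .inl (le_refl (-1 : ℝ))
  have h1 : (Y.lowerOver C).carrier ⊆ (ClosedInv.univ Y.line).carrier := Set.subset_univ _
  refine (F.map_id _ subset_rfl x).symm.trans ((map_eq_of_line (GMap.id _) .id (f := GMap.id _)
    (g := g)     (fun _ => rfl) (fun _ _ => ⟨_, rfl⟩) _ _ ?_ subset_rfl (fun p hp => hg (h1 hp)) x).trans ?_)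
  · rintro p (hp | hp) s w rfl
    · refine .inl ?_
      have h2 : p.2 ≤ -1 := hp
      have h3 := s.2.1
      have h4 := s.2.2
      change (1 - s : ℝ) * p.2 + s * (-1) ≤ -1
      nlinarith
    · exact .inr hp
  · rw [← res_map hg h1 x, eq_zero_of_univ (A := .univ Y.line) (fun _ => trivial) (F.map g _ _ hg x), map_zero]

/-- The section at height one. -/
@[reducible]
def unitSection (C : ClosedInv Y) : GMap Y (Y.outerOver C).space :=
  (Y.outerOver C).lift ((GMap.id Y).toLine (fun _ => 1) continuous_const fun _ _ _ => rfl)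
    fun _ => .inl (by change (1 : ℝ) ≤ |1|; simp)

theorem unitSection_mem (C : ClosedInv Y) :
    C.carrier ⊆ unitSection C ⁻¹' ((Y.lowerOver C).preimage (Y.outerOver C).incl).carrier :=
  fun _ hy => .inr hy

theorem unitSection_bijective (C : ClosedInv Y) : Function.Bijective
    (F.map (unitSection C) C ((Y.lowerOver C).preimage (Y.outerOver C).incl)
      (unitSection_mem C)) := by
  let S := Y.outerOver C
  let N := (Y.lowerOver C).preimage S.incl
  let U : ClosedInv S.space := (Y.lineSet (Set.Ici 0) isClosed_Ici).preimage S.incl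
  have hex : Function.Bijective (F.map U.incl (N.preimage U.incl) N subset_rfl) := by
    refine F.excision U.incl N IsEmbedding.subtypeVal ?_
    have h1 : (Set.range U.incl)ᶜ ⊆ {p : S.space | p.1.2 ≤ 0} := by
      intro p hp
      by_contra hn
      have hn' : ¬ p.1.2 ≤ 0 := hn
      exact hp ⟨⟨p, (not_le.1 hn').le⟩, rfl⟩
    have hc : Continuous fun p : S.space => p.1.2 := continuous_snd.comp continuous_subtype_val
    refine (closure_minimal h1 (isClosed_le hc continuous_const)).trans ?_
    have h2 : {p : S.space | p.1.2 ≤ 0} ⊆ {p : S.space | p.1.2 < 1} := fun p hp =>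
      lt_of_le_of_lt (show p.1.2 ≤ 0 from hp) (one_pos : (0 : ℝ) < 1)
    refine h2.trans (interior_maximal ?_ (isOpen_lt hc continuous_const))
    intro p hp
    have hp' : p.1.2 < 1 := hp
    rcases p.2 with h | h
    · refine .inl ?_
      have h' : 1 ≤ |p.1.2| := h
      rcases le_abs.1 h' with h' | h'
      · linarith
      · change p.1.2 ≤ -1; linarith
    · exact .inr h
  let s' : GMap Y U.space := U.lift (unitSection C) fun _ => by change (0 : ℝ) ≤ 1; norm_num
  let q : GMap U.space Y := (Y.lineProj.comp S.incl).comp U.incl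
  have hs' : C.carrier ⊆ s' ⁻¹' (N.preimage U.incl).carrier := fun y hy => .inr hy
  have hq : (N.preimage U.incl).carrier ⊆ q ⁻¹' C.carrier := by
    rintro p (hp | hp)
    · have h1 : p.1.1.2 ≤ -1 := hp
      have h2 : 0 ≤ p.1.1.2 := p.2
      linarith
    · exact hp
  have hsq : Function.Bijective (F.map s' C (N.preimage U.incl) hs') := by
    refine Function.bijective_iff_has_inverse.2 ⟨F.map q _ C hq, fun x => ?_, fun b => ?_⟩
    · refine (map_map (k := s'.comp q) (fun _ => rfl) _ _ _ _ _ (fun p hp => hs' (hq hp)) _).trans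
        (Eq.trans ?_ (F.map_id _ subset_rfl x))
      refine map_eq_of_line (f := s'.comp q) (g := GMap.id _) (S.incl.comp U.incl)
        (IsEmbedding.subtypeVal.comp IsEmbedding.subtypeVal) (fun _ => rfl) ?_ _ _ ?_ _ _ _
      · intro p s
        have h2 : 0 ≤ p.1.1.2 := p.2
        have h3 := s.2.1
        have h4 := s.2.2
        have h5 : 0 ≤ (1 - s : ℝ) * 1 + s * p.1.1.2 := by nlinarith
        refine ⟨⟨⟨(p.1.1.1, (1 - s : ℝ) * 1 + s * p.1.1.2), ?_⟩, h5⟩, rfl⟩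
        rcases p.1.2 with h | h
        · refine .inl ?_
          have h' : 1 ≤ |p.1.1.2| := h
          rw [abs_of_nonneg h2] at h'
          change 1 ≤ |(1 - s : ℝ) * 1 + s * p.1.1.2|
          rw [abs_of_nonneg h5]
          nlinarith
        · exact .inr h
      · intro p hp s w hw
        refine .inr ?_
        have h6 : w.1.1.1 = p.1.1.1 := (Prod.ext_iff.1 hw).1
        change w.1.1.1 ∈ C.carrier
        rw [h6]
        exact hq hp
    · exact (map_map (k := GMap.id Y) (fun _ => rfl) _ _ _ _ _ subset_rfl _).trans (F.map_id _ _ _)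
  have := hsq.comp hex
  convert this using 1
  funext y
  exact (map_map (fun _ => rfl) _ _ _ _ _ _ _).symm

end CohTheory

namespace CohTheory

variable {F : CohTheory.{u, v} G} {X Y Y' Z W : GSpace G}

theorem IsSign.isCompl (Z : GSpace G) :
    IsCompl ((Z.lineSet (Set.Ici 0) isClosed_Ici).preimage Z.outer.incl).carrier
      ((Z.lineSet (Set.Iic 0) isClosed_Iic).preimage Z.outer.incl).carrier := by
  constructor
  · rw [Set.disjoint_left]
    intro p h h'
    have h1 : 0 ≤ p.1.2 := h
    have h2 : p.1.2 ≤ 0 := h'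
    have h3 : 1 ≤ |p.1.2| := p.2
    rw [le_antisymm h2 h1, abs_zero] at h3
    linarith
  · rw [codisjoint_iff_le_sup]
    exact fun p _ => le_total (0 : ℝ) p.1.2

/-- A class of degree zero on `Z × (-∞,-1] ∪ Z × [1,∞)` that is one on the positive part and zero
on the negative part. -/
structure IsSign (e : F.obj Z.outer.space (.empty _)) : Prop where
  deg : e ∈ F.deg _ _ 0
  pos : ∀ (W : GSpace G) (k : GMap W Z.outer.space), (∀ w, 0 ≤ (k w).1.2) →
    F.map k (.empty _) (.empty _) (Set.empty_subset _) e = F.one W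
  neg : ∀ (W : GSpace G) (k : GMap W Z.outer.space), (∀ w, (k w).1.2 ≤ 0) →
    F.map k (.empty _) (.empty _) (Set.empty_subset _) e = 0

theorem exists_isSign (Z : GSpace G) : ∃ e : F.obj Z.outer.space (.empty _), IsSign e := by
  let P := (Z.lineSet (Set.Ici 0) isClosed_Ici).preimage Z.outer.incl
  let Q := (Z.lineSet (Set.Iic 0) isClosed_Iic).preimage Z.outer.incl
  obtain ⟨e, he⟩ := exists_idempotent (F := F) P Q (IsSign.isCompl Z)
  have hE : (ClosedInv.empty Z.outer.space).carrier ⊆ Q.carrier := Set.empty_subset _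
  refine ⟨part 0 _ (F.res Q (.empty _) hE e), part_mem 0 _, fun W k hk => ?_, fun W k hk => ?_⟩
  · rw [map_part, map_of_res]
    have h1 : F.map k (.empty _) Q (Set.empty_subset _) e = F.one W := by
      refine (map_map (f := P.lift k hk) (g := P.incl) (fun _ => rfl) _ (.empty _) _ (Set.empty_subset _)
        (Set.empty_subset _) _ e).symm.trans ?_
      rw [he, F.map_one]
    rw [h1, part_of_mem (F.one_deg W)]
  · rw [map_part, map_of_res]
    have hk' : (ClosedInv.univ W).carrier ⊆ k ⁻¹' Q.carrier := fun w _ => hk w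
    rw [← res_map hk' (Set.empty_subset _) e,
      eq_zero_of_univ (A := .univ W) (fun _ => trivial) (F.map k _ _ hk' e), map_zero, map_zero]

theorem IsSign.unique {e e' : F.obj Z.outer.space (.empty _)} (he : IsSign e) (he' : IsSign e') :
    e = e' := by
  let P := (Z.lineSet (Set.Ici 0) isClosed_Ici).preimage Z.outer.incl
  let Q := (Z.lineSet (Set.Iic 0) isClosed_Iic).preimage Z.outer.incl
  refine sub_eq_zero.1 (eq_zero_of_pieces (IsSign.isCompl Z) (.empty _) _ ?_ ?_)
  · rw [map_sub, sub_eq_zero]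
    exact (he.pos _ P.incl fun p => p.2).trans
      (he'.pos _ P.incl fun p => p.2).symm
  · rw [map_sub, sub_eq_zero]
    exact (he.neg _ Q.incl fun p => p.2).trans
      (he'.neg _ Q.incl fun p => p.2).symm

/-- The restriction of `f × id` to the outer parts. -/
@[reducible]
def _root_.GMap.outer (f : GMap Y Z) : GMap Y.outer.space Z.outer.space :=
  ClosedInv.restrict f.line Y.outer Z.outer fun _ h => h

theorem IsSign.comap {e : F.obj Z.outer.space (.empty _)} (he : IsSign e) (f : GMap Y Z) :
    IsSign (F.map f.outer (.empty _) (.empty _) (Set.empty_subset _) e) where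
  deg := F.map_deg _ _ _ _ _ _ he.deg
  pos W k hk := (map_map (k := f.outer.comp k) (fun _ => rfl) _ _ _ _ _ (Set.empty_subset _)
    e).trans (he.pos W _ hk)
  neg W k hk := (map_map (k := f.outer.comp k) (fun _ => rfl) _ _ _ _ _ (Set.empty_subset _)
    e).trans (he.neg W _ hk)

/-- The product with the Thom class `δ e` of the trivial line bundle. -/
def susp (e : F.obj Y.outer.space (.empty _)) (C : ClosedInv Y) :
    F.obj Y C →+ F.obj Y.line (Y.outerOver C) :=
  (F.mul Y.outer (C.preimage Y.lineProj) (F.δ Y.outer e)).comp (F.map Y.lineProj _ C subset_rfl)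

theorem outerOver_mono (f : GMap Y Z) {C : ClosedInv Y} {C' : ClosedInv Z}
    (h : C.carrier ⊆ f ⁻¹' C'.carrier) :
    (Y.outerOver C).carrier ⊆ f.line ⁻¹' (Z.outerOver C').carrier :=
  fun _ hp => hp.imp id fun hC => h hC

theorem map_susp (f : GMap Y Z) {C : ClosedInv Y} {C' : ClosedInv Z}
    (h : C.carrier ⊆ f ⁻¹' C'.carrier) (e : F.obj Z.outer.space (.empty _)) (b : F.obj Z C') :
    F.map f.line _ _ (outerOver_mono f h) (susp e C' b) =
      susp (F.map f.outer (.empty _) (.empty _) (Set.empty_subset _) e) C (F.map f C C' h b) := by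
  refine (F.map_mul f.line Y.outer (C.preimage Y.lineProj) Z.outer (C'.preimage Z.lineProj)
    (fun _ h => h) (fun p hp => h hp) (outerOver_mono f h) _ _).trans ?_
  refine congrArg₂ (fun s t => F.mul Y.outer (C.preimage Y.lineProj) s t)
    (F.δ_natural f.line Y.outer Z.outer (fun _ h => h) e).symm ?_
  exact map_map_comm (f := f.line) (g := Z.lineProj) (f' := Y.lineProj) (g' := f) (fun _ => rfl)
    _ _ _ _ _ _ _ _ _

theorem restrict_mem (f : GMap Y Z) {C : ClosedInv Y} {C' : ClosedInv Z}
    (h : C.carrier ⊆ f ⁻¹' C'.carrier) :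
    ((Y.lowerOver C).preimage (Y.outerOver C).incl).carrier ⊆
      ClosedInv.restrict f.line _ _ (outerOver_mono f h) ⁻¹'
        ((Z.lowerOver C').preimage (Z.outerOver C').incl).carrier :=
  fun _ hp => hp.imp id fun hC => h hC

/-- Restriction to the section at height one. -/
def atOne (C : ClosedInv Y) :
    F.obj (Y.outerOver C).space ((Y.lowerOver C).preimage (Y.outerOver C).incl) →+ F.obj Y C :=
  F.map (unitSection C) C _ (unitSection_mem C)

theorem map_atOne (f : GMap Y Z) {C : ClosedInv Y} {C' : ClosedInv Z}
    (h : C.carrier ⊆ f ⁻¹' C'.carrier)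
    (y : F.obj (Z.outerOver C').space ((Z.lowerOver C').preimage (Z.outerOver C').incl)) :
    F.map f C C' h (atOne C' y) = atOne C (F.map _ _ _ (restrict_mem f h) y) :=
  map_map_comm (f := f) (g := unitSection C') (f' := unitSection C)
    (g' := ClosedInv.restrict f.line _ _ (outerOver_mono f h)) (fun _ => rfl) _ _ _ _ _ _ _ _ _

theorem mul_empty_of_one {a : F.obj X (.empty X)} (b : F.obj X (.empty X)) (ha : a = F.one X)
    (h : (ClosedInv.empty X).carrier ⊆ ((ClosedInv.empty X).union (.empty X)).carrier) :
    F.res _ (.empty X) h (F.mul (.empty X) (.empty X) a b) = b := by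
  have h' : ((ClosedInv.empty X).union (.empty X)).carrier ⊆ (ClosedInv.empty X).carrier :=
    fun _ hx => hx.elim (fun h => h) fun h => h
  rw [ha, F.one_mul _ b h']
  exact (res_res h' h b).trans (res_self _ _)

theorem susp_atOne_empty {e : F.obj Y.outer.space (.empty _)} (he : IsSign e)
    (y : F.obj (Y.outerOver (.empty Y)).space
      ((Y.lowerOver (.empty Y)).preimage (Y.outerOver (.empty Y)).incl)) :
    susp e (.empty Y) (atOne (.empty Y) y) = bd _ _ y := by
  let S := Y.outerOver (.empty Y)
  have hS : S.carrier ⊆ Y.outer.carrier := fun _ hp => hp.elim (fun h => h) fun h => h.elim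
  have hS' : Y.outer.carrier ⊆ S.carrier := fun _ hp => .inl hp
  let ρ : GMap S.space Y.outer.space := ClosedInv.restrict (GMap.id _) S Y.outer hS
  let E (X : GSpace G) := ClosedInv.empty X
  let b := atOne (.empty Y) y
  let c : F.obj Y.outer.space (.empty _) := F.map Y.outer.incl (.empty _) (.empty _)
    (Set.empty_subset _) (F.map Y.lineProj (.empty _) (.empty _) (Set.empty_subset _) b)
  have hE : ∀ X : GSpace G, (E X).carrier ⊆ ((E X).union (E X)).carrier :=
    fun X => Set.empty_subset _
  refine (F.δ_mul Y.outer e _ hS (hE _)).trans ((F.δ_natural (GMap.id _) S Y.outer hS _).symm.trans ?_)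
  refine congrArg (F.δ S) (sub_eq_zero.1 ?_)
  have key : ∀ (P : ClosedInv S.space), F.map P.incl (.empty _) (.empty _) (Set.empty_subset _)
      (F.map ρ (.empty _) (.empty _) (Set.empty_subset _) (F.map (GMap.id _) (.empty _) _ (hE _)
        (F.mul (.empty _) (.empty _) e c))) = F.res _ (.empty _) (hE _) (F.mul (.empty _) (.empty _)
          (F.map (ρ.comp P.incl) (.empty _) (.empty _) (Set.empty_subset _) e)
          (F.map (ρ.comp P.incl) (.empty _) (.empty _) (Set.empty_subset _) c)) := by
    intro P
    have hu : ((E P.space).union (E P.space)).carrier ⊆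
        (ρ.comp P.incl) ⁻¹' ((E Y.outer.space).union (E Y.outer.space)).carrier :=
      fun _ h => h.elim (fun h => h.elim) fun h => h.elim
    refine Eq.trans ?_ (congrArg (F.res _ (.empty _) (hE _)) (F.map_mul (ρ.comp P.incl) (E _) (E _)
      (E _) (E _) (Set.empty_subset _) (Set.empty_subset _) hu e c))
    refine Eq.trans ?_ (res_map hu (hE _) _).symm
    refine (congrArg _ (map_map (k := ρ) (fun _ => rfl) _ _ _ _ _ (Set.empty_subset _) _)).trans ?_
    exact map_map (fun _ => rfl) _ _ _ _ _ _ _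
  let P := (Y.lineSet (Set.Ici 0) isClosed_Ici).preimage S.incl
  let Q := (Y.lineSet (Set.Iic 0) isClosed_Iic).preimage S.incl
  have hPQ : IsCompl P.carrier Q.carrier := by
    have := IsSign.isCompl Y
    constructor
    · rw [Set.disjoint_left]
      intro p h h'
      have h1 := Set.disjoint_left.1 this.disjoint
      exact @h1 (ρ p) h h'
    · rw [codisjoint_iff_le_sup]
      exact fun p _ => le_total (0 : ℝ) p.1.2
  refine eq_zero_of_pieces hPQ (.empty _) _ ?_ ?_
  · rw [map_sub, sub_eq_zero]
    refine (key P).trans ((mul_empty_of_one _ (he.pos P.space (ρ.comp P.incl) fun p => p.2) (hE _)).trans ?_)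
    let k : GMap P.space S.space := (unitSection (.empty Y)).comp
      ((Y.lineProj.comp Y.outer.incl).comp (ρ.comp P.incl))
    have h1 : F.map (ρ.comp P.incl) (.empty _) (.empty _) (Set.empty_subset _) c =
        F.map k (.empty _) ((Y.lowerOver (.empty Y)).preimage S.incl) (Set.empty_subset _) y := by
      refine (congrArg _ (map_map (k := Y.lineProj.comp Y.outer.incl) (fun _ => rfl) _ _ _ _ _
        (Set.empty_subset _) b)).trans ?_
      refine (map_map (k := (Y.lineProj.comp Y.outer.incl).comp (ρ.comp P.incl)) (fun _ => rfl)
        _ _ _ _ _ (Set.empty_subset _) b).trans ?_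
      exact map_map (fun _ => rfl) _ _ _ _ _ _ _
    refine h1.trans (Eq.trans ?_ (map_of_res (f := P.incl) (Set.empty_subset _) (Set.empty_subset _)
      y).symm)
    refine map_eq_of_line (f := k) (g := P.incl) S.incl IsEmbedding.subtypeVal (fun _ => rfl) ?_
      (.empty _) _ (fun x hx => hx.elim) _ _ _
    intro p s
    refine ⟨⟨(p.1.1.1, (1 - s : ℝ) * 1 + s * p.1.1.2), hS' ?_⟩, rfl⟩
    have h2 : 0 ≤ p.1.1.2 := p.2
    have h3 := s.2.1
    have h4 := s.2.2
    have h5 : 1 ≤ |p.1.1.2| := hS p.1.2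
    rw [abs_of_nonneg h2] at h5
    change 1 ≤ |(1 - s : ℝ) * 1 + s * p.1.1.2|
    rw [abs_of_nonneg (by nlinarith)]
    nlinarith
  · rw [map_sub, sub_eq_zero]
    refine (key Q).trans ?_
    rw [he.neg Q.space (ρ.comp Q.incl) fun p => p.2, map_zero, AddMonoidHom.zero_apply, map_zero]
    have h1 : (ClosedInv.univ Q.space).carrier ⊆
        Q.incl ⁻¹' ((Y.lowerOver (.empty Y)).preimage S.incl).carrier := by
      refine fun p _ => .inl ?_
      have h2 : p.1.1.2 ≤ 0 := p.2
      have h5 : 1 ≤ |p.1.1.2| := hS p.1.2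
      rw [abs_of_nonpos h2] at h5
      change p.1.1.2 ≤ -1
      linarith
    refine Eq.trans ?_ (map_of_res (f := Q.incl) (Set.empty_subset _) (Set.empty_subset _) y).symm
    refine Eq.trans ?_ (res_map h1 (Set.empty_subset _) y)
    rw [eq_zero_of_univ (A := .univ Q.space) (fun _ => trivial) (F.map Q.incl _ _ h1 y), map_zero]

/-- Every relative class is pulled back from a pair for which restriction of supports to the empty
set is injective. -/
theorem exists_cylinder (C : ClosedInv Y) (b : F.obj Y C) : ∃ (D : GSpace G) (D' : ClosedInv D)
    (i : GMap Y D) (h : C.carrier ⊆ i ⁻¹' D'.carrier) (b' : F.obj D D'),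
    F.map i C D' h b' = b ∧
      Function.Injective (F.res D' (.empty D) (Set.empty_subset _)) := by
  have hc : Continuous fun p : Y × unitInterval => (p.2 : ℝ) := by fun_prop
  let A : ClosedInv Y.prodI := ⟨{p : Y × unitInterval | (p.2 : ℝ) ≤ 0 ∨ (p.1 ∈ C.carrier ∨ 1 ≤ (p.2 : ℝ))},
    (isClosed_le hc continuous_const).union ((C.isClosed.preimage continuous_fst).union
      (isClosed_le continuous_const hc)), fun g p h hp =>
        hp.imp (fun h => h) fun hp => hp.imp (fun hp => C.act_mem g p.1 h hp) fun h => h⟩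
  let D := A.space
  have hcD : Continuous fun p : D => (p.1.2 : ℝ) := hc.comp continuous_subtype_val
  have hcD' : Continuous fun p : D => p.1.1 := continuous_fst.comp continuous_subtype_val
  let D' : ClosedInv D := ⟨{p : D | p.1.1 ∈ C.carrier ∨ 1 ≤ (p.1.2 : ℝ)},
    (C.isClosed.preimage hcD').union (isClosed_le continuous_const hcD), fun g p h hp =>
      hp.imp (fun hp => C.act_mem g p.1.1 h hp) fun h => h⟩
  let U : ClosedInv D := ⟨{p : D | (p.1.2 : ℝ) ≤ 1 / 2}, isClosed_le hcD continuous_const,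
    fun g p h hp => hp⟩
  have hex : Function.Bijective (F.map U.incl (D'.preimage U.incl) D' subset_rfl) := by
    refine F.excision U.incl D' IsEmbedding.subtypeVal ?_
    have h1 : (Set.range U.incl)ᶜ ⊆ {p : D | 1 / 2 ≤ (p.1.2 : ℝ)} := by
      intro p hp
      by_contra hn
      have hn' : ¬ 1 / 2 ≤ (p.1.2 : ℝ) := hn
      exact hp ⟨⟨p, (not_le.1 hn').le⟩, rfl⟩
    refine (closure_minimal h1 (isClosed_le continuous_const hcD)).trans ?_
    have h2 : {p : D | 1 / 2 ≤ (p.1.2 : ℝ)} ⊆ {p : D | 0 < (p.1.2 : ℝ)} := fun p hp =>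
      lt_of_lt_of_le (by norm_num : (0 : ℝ) < 1 / 2) (show 1 / 2 ≤ (p.1.2 : ℝ) from hp)
    refine h2.trans (interior_maximal ?_ (isOpen_lt continuous_const hcD))
    intro p hp
    exact p.2.resolve_left (not_le.2 hp)
  let i : GMap Y D := A.lift (Y.slice 0) fun y => .inl (le_refl (0 : ℝ))
  let i' : GMap Y U.space := U.lift i fun y => by change (0 : ℝ) ≤ 1 / 2; norm_num
  let q : GMap U.space Y := (Y.prodFst.comp A.incl).comp U.incl
  have hq : (D'.preimage U.incl).carrier ⊆ q ⁻¹' C.carrier := by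
    rintro p (hp | hp)
    · exact hp
    · have h1 : (1 : ℝ) ≤ p.1.1.2 := hp
      have h2 : (p.1.1.2 : ℝ) ≤ 1 / 2 := p.2
      linarith
  obtain ⟨b', hb'⟩ := hex.2 (F.map q _ C hq b)
  have hi : C.carrier ⊆ i ⁻¹' D'.carrier := fun y hy => .inl hy
  refine ⟨D, D', i, hi, b', ?_, ?_⟩
  · have hi' : C.carrier ⊆ i' ⁻¹' (D'.preimage U.incl).carrier := hi
    refine (map_map (f := i') (g := U.incl) (fun _ => rfl) _ (D'.preimage U.incl) _ hi' subset_rfl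
      _ _).symm.trans ?_
    rw [hb']
    exact (map_map (k := GMap.id Y) (fun _ => rfl) _ _ _ _ _ subset_rfl _).trans (F.map_id _ _ _)
  · rw [injective_iff_map_eq_zero]
    intro x hx
    obtain ⟨a, rfl⟩ := (F.exact_pair D' x).1 hx
    let r₀ : GMap D D := A.lift ((Y.slice 1).comp (Y.prodFst.comp A.incl))
      fun p => .inr (.inr (le_refl (1 : ℝ)))
    let r : GMap D D'.space := D'.lift r₀ fun p => .inr (le_refl (1 : ℝ))
    refine (F.exact_sub D' a).2 ⟨F.map r (.empty _) (.empty _) (Set.empty_subset _) a, ?_⟩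
    refine (map_map (k := r.comp D'.incl) (fun _ => rfl) _ _ _ _ _ (Set.empty_subset _) a).trans
      (Eq.trans ?_ (F.map_id _ subset_rfl a))
    let H : GMap D'.space.prodI D'.space :=
      { toFun := fun p => ⟨⟨(p.1.1.1.1, unitInterval.symm (p.2 * unitInterval.symm p.1.1.1.2)),
          p.1.2.elim (fun h => .inr (.inl h)) fun h => .inr (.inr (by
            have h1 : (1 : ℝ) ≤ p.1.1.1.2 := h
            have h2 : p.1.1.1.2 = 1 := le_antisymm p.1.1.1.2.2.2 h1
            simp [h2]))⟩, p.1.2.imp (fun h => h) fun h => by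
            have h1 : (1 : ℝ) ≤ p.1.1.1.2 := h
            have h2 : p.1.1.1.2 = 1 := le_antisymm p.1.1.1.2.2.2 h1
            simp [h2]⟩
        continuous_toFun := by
          refine Continuous.subtype_mk (Continuous.subtype_mk ?_ _) _
          have h0 : Continuous fun p : D'.space.prodI => p.1.1.1 :=
            continuous_subtype_val.comp (continuous_subtype_val.comp continuous_fst)
          refine (continuous_fst.comp h0).prodMk (unitInterval.continuous_symm.comp
            (continuous_snd.mul (unitInterval.continuous_symm.comp (continuous_snd.comp h0))))
        anchor_map := fun _ => rfl
        map_act := fun _ _ _ => rfl }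
    refine map_eq_of_homotopy H (fun p => ?_) (fun p => ?_) (.empty _) _ (fun x hx => hx.elim) _ _ a
    · exact Subtype.ext (Subtype.ext (Prod.ext rfl (by
        change unitInterval.symm (0 * _) = 1; simp)))
    · exact Subtype.ext (Subtype.ext (Prod.ext rfl (by
        change unitInterval.symm (1 * _) = _; simp)))

theorem susp_atOne {e : F.obj Y.outer.space (.empty _)} (he : IsSign e) (C : ClosedInv Y)
    (y : F.obj (Y.outerOver C).space ((Y.lowerOver C).preimage (Y.outerOver C).incl)) :
    susp e C (atOne C y) = bd _ _ y := by
  have hbd : ∀ (Y : GSpace G) (C : ClosedInv Y), Function.Bijective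
      (bd (F := F) (Y.outerOver C) (Y.lowerOver C)) := fun Y C =>
    bd_bijective _ _ (Y.lowerOver_subset C) (eq_zero_of_lowerOver C)
  obtain ⟨D, D', i, hi, b', hb', hinj⟩ := exists_cylinder C (atOne C y)
  obtain ⟨y', rfl⟩ := (unitSection_bijective D').2 b'
  obtain ⟨e', he'⟩ := exists_isSign (F := F) D
  rw [(he'.comap i).unique he |>.symm]
  rw [(unitSection_bijective C).1 ((map_atOne i hi y').symm.trans hb') |>.symm, ← map_atOne i hi,
    bd_natural, ← map_susp]
  refine congrArg (F.map i.line _ _ (outerOver_mono i hi)) (sub_eq_zero.1 ?_)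
  have hE : (ClosedInv.empty D).carrier ⊆ GMap.id D ⁻¹' D'.carrier := Set.empty_subset _
  have h1 : ∀ y, susp (F.map (GMap.id D).outer (.empty _) (.empty _) (Set.empty_subset _) e')
      (.empty D) (F.map (GMap.id D) _ _ hE (atOne D' y)) =
        bd _ _ (F.map _ _ _ (restrict_mem (GMap.id D) hE) y) := fun y => by
    rw [map_atOne]
    exact susp_atOne_empty (he'.comap _) _
  obtain ⟨x, hx⟩ := (hbd D D').2 (susp e' D' (atOne D' y') - bd _ _ y')
  have h2 := congrArg (F.map (GMap.id D).line _ _ (outerOver_mono (GMap.id D) hE)) hx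
  have h0 : ∀ y, F.map (GMap.id D).line _ _ (outerOver_mono (GMap.id D) hE) (bd _ _ y) =
      bd _ _ (F.map _ _ _ (restrict_mem (GMap.id D) hE) y) := fun y =>
    (bd_natural _ _ _ _ _ _ (restrict_mem (GMap.id D) hE) y).symm
  rw [map_sub, map_susp _ hE, h1, h0, h0, sub_self] at h2
  have h3 := (hbd D (.empty D)).1 (h2.trans (map_zero _).symm)
  have h4 := map_atOne (GMap.id D) hE x
  rw [h3, map_zero] at h4
  have h5 : atOne D' x = 0 := hinj (h4.trans (map_zero _).symm)
  have h6 : x = 0 := (unitSection_bijective D').1 (h5.trans (map_zero _).symm)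
  exact hx.symm.trans (by rw [h6, map_zero])

theorem susp_bijective {e : F.obj Y.outer.space (.empty _)} (he : IsSign e) (C : ClosedInv Y) :
    Function.Bijective (susp e C) := by
  have h1 := bd_bijective (F := F) (Y.outerOver C) (Y.lowerOver C) (Y.lowerOver_subset C)
    (eq_zero_of_lowerOver C)
  have h2 : ⇑(bd (F := F) (Y.outerOver C) (Y.lowerOver C)) = susp e C ∘ atOne C :=
    funext fun y => (susp_atOne he C y).symm
  rw [h2] at h1
  exact (Function.Bijective.of_comp_iff _ (unitSection_bijective C)).1 h1

end CohTheory

namespace CohTheory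

variable {F : CohTheory.{u, v} G} {X Y Y' Z W : GSpace G}

theorem eq_zero_of_part {A : ClosedInv X} {a : F.obj X A} (h : ∀ n, part n A a = 0) : a = 0 := by
  have h1 : (AddEquiv.ofBijective (DirectSum.coeAddMonoidHom (F.deg X A)) (F.internal X A)).symm a
      = 0 := DFinsupp.ext fun n => Subtype.ext (h n)
  rwa [AddEquiv.symm_apply_eq, map_zero] at h1

theorem part_shift {A : ClosedInv X} {A' : ClosedInv Y} {L : F.obj X A →+ F.obj Y A'}
    (hL : ∀ m, ∀ a ∈ F.deg X A m, L a ∈ F.deg Y A' (m + 1)) (n : ℤ) (a : F.obj X A) :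
    part (n + 1) A' (L a) = L (part n A a) := by
  induction a using homogeneous_induction with
  | h0 => simp
  | hd m a ha =>
    rw [part_of_mem_eq n ha, part_of_mem_eq (n + 1) (hL m a ha)]
    simp only [add_left_inj]
    split_ifs <;> simp
  | hadd a b ha hb => simp only [map_add, ha, hb]

theorem bijective_of_sign {A : ClosedInv X} {A' : ClosedInv Y} {L L' : F.obj X A →+ F.obj Y A'}
    (hL : ∀ m, ∀ a ∈ F.deg X A m, L a ∈ F.deg Y A' (m + 1))
    (h : ∀ m, ∀ a ∈ F.deg X A m, L' a = (Int.negOnePow m : ℤ) • L a)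
    (hb : Function.Bijective L) : Function.Bijective L' := by
  have hs : ∀ m (x : F.obj Y A'), (Int.negOnePow m : ℤ) • ((Int.negOnePow m : ℤ) • x) = x := by
    intro m x
    rw [smul_smul, ← Units.val_mul, ← Int.negOnePow_add, Int.negOnePow_even _ ⟨m, rfl⟩]
    simp
  have hL' : ∀ m, ∀ a ∈ F.deg X A m, L' a ∈ F.deg Y A' (m + 1) := fun m a ha => by
    rw [h m a ha]; exact AddSubgroup.zsmul_mem _ (hL m a ha) _
  constructor
  · rw [injective_iff_map_eq_zero]
    intro a ha
    refine eq_zero_of_part fun n => hb.1 ?_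
    rw [map_zero, ← hs n (L _), ← h n _ (part_mem n a), ← part_shift hL', ha, map_zero, smul_zero]
  · intro x
    induction x using homogeneous_induction with
    | h0 => exact ⟨0, map_zero _⟩
    | hd k x hx =>
      obtain ⟨a, rfl⟩ := hb.2 x
      refine ⟨(Int.negOnePow (k - 1) : ℤ) • part (k - 1) A a, ?_⟩
      rw [map_zsmul, h _ _ (part_mem _ a), hs, ← part_shift hL, sub_add_cancel, part_of_mem hx]
    | hadd x y hx hy =>
      obtain ⟨a, rfl⟩ := hx
      obtain ⟨b, rfl⟩ := hy
      exact ⟨a + b, map_add _ _ _⟩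

theorem res_bijective_of_eq {A B : ClosedInv X} (h : B.carrier ⊆ A.carrier)
    (h' : A.carrier ⊆ B.carrier) : Function.Bijective (F.res A B h) :=
  Function.bijective_iff_has_inverse.2 ⟨F.res B A h',
    fun a => (res_res _ _ a).trans (res_self _ _), fun a => (res_res _ _ a).trans (res_self _ _)⟩

/-- The product with `δ e` from the right. -/
def rsusp (e : F.obj Y.outer.space (.empty _)) (C : ClosedInv Y) :
    F.obj Y C →+ F.obj Y.line ((C.preimage Y.lineProj).union Y.outer) :=
  ((F.mul (C.preimage Y.lineProj) Y.outer).flip (F.δ Y.outer e)).comp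
    (F.map Y.lineProj _ C subset_rfl)

theorem rsusp_bijective {e : F.obj Y.outer.space (.empty _)} (he : IsSign e) (C : ClosedInv Y) :
    Function.Bijective (rsusp e C) := by
  have h : ((C.preimage Y.lineProj).union Y.outer).carrier ⊆ (Y.outerOver C).carrier :=
    fun _ hp => hp.symm
  have hτ : F.δ Y.outer e ∈ F.deg Y.line Y.outer 1 := F.δ_deg Y.outer 0 e he.deg
  refine bijective_of_sign (L := (F.res _ _ h).comp (susp e C)) ?_ ?_
    ((res_bijective_of_eq h fun _ hp => hp.symm).comp (susp_bijective he C))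
  · intro m a ha
    rw [add_comm]
    exact F.map_deg _ _ _ _ _ _ (F.mul_deg _ _ _ _ _ hτ _ (F.map_deg _ _ _ _ _ _ ha))
  · intro m a ha
    have := F.mul_comm (C.preimage Y.lineProj) Y.outer m 1 _
      (F.map_deg Y.lineProj _ C subset_rfl _ _ ha) _ hτ h
    rw [_root_.mul_one] at this
    exact this

/-! ### The Thom class of the trivial line bundle -/

/-- The points `(y, t)` with `φ y ≤ |t|`. -/
@[reducible]
def cone (φ : Y → ℝ) (hφ : Continuous φ) (hi : ∀ g y h, φ (Y.act g y h) = φ y) :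
    ClosedInv Y.line :=
  ⟨{p | φ p.1 ≤ |p.2|}, isClosed_le (hφ.comp continuous_fst) (continuous_abs.comp continuous_snd),
    fun g p h hp => by change φ (Y.act g p.1 h) ≤ |p.2|; rw [hi]; exact hp⟩

theorem compactOver_cone (φ : Y → ℝ) (hφ : Continuous φ) (hi : ∀ g y h, φ (Y.act g y h) = φ y) :
    CompactOver Y.lineProj (closure (cone φ hφ hi).carrierᶜ) := by
  refine CompactOver.subset (t := {p : Y.line | |p.2| ≤ φ p.1}) ?_ isClosed_closure
    (closure_minimal (fun p hp => (not_le.1 (show ¬ φ p.1 ≤ |p.2| from hp)).le)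
      (isClosed_le (continuous_abs.comp continuous_snd) (hφ.comp continuous_fst)))
  refine (compactOver_iff Y.lineProj.continuous_toFun).2 fun U y hU hy => ?_
  have h1 : ∀ᶠ p in (U : Filter Y.line), φ p.1 < φ y + 1 :=
    ((hφ.tendsto y).comp hy).eventually_lt_const (by linarith)
  have h2 : (Prod.snd : Y.line → ℝ) ⁻¹' Set.Icc (-(φ y + 1)) (φ y + 1) ∈ U := by
    refine Filter.mem_of_superset (Filter.inter_mem hU h1) fun p hp => abs_le.1 ?_
    have h3 : |p.2| ≤ φ p.1 := hp.1
    have h4 : φ p.1 < φ y + 1 := hp.2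
    linarith
  obtain ⟨t, -, ht⟩ := (isCompact_Icc (a := -(φ y + 1)) (b := φ y + 1)).ultrafilter_le_nhds
    (U.map Prod.snd) (Filter.le_principal_iff.2 h2)
  have hl : (U : Filter Y.line) ≤ 𝓝 (y, t) := by
    rw [nhds_prod_eq, Filter.le_prod]
    exact ⟨hy, ht⟩
  exact ⟨(y, t), (isClosed_le (continuous_abs.comp continuous_snd)
    (hφ.comp continuous_fst)).mem_of_frequently_of_tendsto (Filter.Eventually.frequently hU) hl, hl⟩

/-- The complement of `{|t| < φ}` as a co-support. -/
@[reducible]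
def coneCosupp (φ : Y → ℝ) (hφ : Continuous φ) (hi : ∀ g y h, φ (Y.act g y h) = φ y) :
    Cosupp Y.lineProj := ⟨cone φ hφ hi, compactOver_cone φ hφ hi⟩

/-- The co-support of the Thom class of the trivial line bundle. -/
@[reducible]
def outerCosupp (Y : GSpace G) : Cosupp Y.lineProj :=
  ⟨Y.outer, compactOver_cone (fun _ => 1) continuous_const fun _ _ _ => rfl⟩

theorem res_cone_bijective {φ : Y → ℝ} (hφ : Continuous φ) (hi : ∀ g y h, φ (Y.act g y h) = φ y)
    (h1 : ∀ y, 1 ≤ φ y) (C : ClosedInv Y.line)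
    (hC : ∀ p q : Y.line, p.1 = q.1 → p ∈ C.carrier → q ∈ C.carrier)
    (h : (C.union (cone φ hφ hi)).carrier ⊆ (C.union Y.outer).carrier) :
    Function.Bijective (F.res (C.union Y.outer) (C.union (cone φ hφ hi)) h) := by
  have h0 : ∀ y, 0 < φ y := fun y => lt_of_lt_of_le one_pos (h1 y)
  have hφ' : Continuous fun p : Y.line => φ p.1 := hφ.comp continuous_fst
  let f : GMap Y.line Y.line := Y.lineProj.toLine (fun p => p.2 / φ p.1)
    (continuous_snd.div hφ' fun p => (h0 p.1).ne') fun g p e => by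
      change p.2 / φ (Y.act g p.1 e) = _; rw [hi]
  let k : GMap Y.line Y.line := Y.lineProj.toLine (fun p => p.2 * φ p.1)
    (continuous_snd.mul hφ') fun g p e => by
      change p.2 * φ (Y.act g p.1 e) = _; rw [hi]
  have hf : (C.union (cone φ hφ hi)).carrier ⊆ f ⁻¹' (C.union Y.outer).carrier := by
    rintro p (hp | hp)
    · exact .inl (hC p _ rfl hp)
    · refine .inr ?_
      have h2 : φ p.1 ≤ |p.2| := hp
      change 1 ≤ |p.2 / φ p.1|
      rw [abs_div, abs_of_pos (h0 p.1), le_div_iff₀ (h0 p.1), _root_.one_mul]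
      exact h2
  have hk : (C.union Y.outer).carrier ⊆ k ⁻¹' (C.union (cone φ hφ hi)).carrier := by
    rintro p (hp | hp)
    · exact .inl (hC p _ rfl hp)
    · refine .inr ?_
      have h2 : 1 ≤ |p.2| := hp
      change φ p.1 ≤ |p.2 * φ p.1|
      rw [abs_mul, abs_of_pos (h0 p.1)]
      exact le_mul_of_one_le_left (h0 p.1).le h2
  have hb : Function.Bijective (F.map f _ _ hf) := by
    refine Function.bijective_iff_has_inverse.2 ⟨F.map k _ _ hk, fun x => ?_, fun x => ?_⟩
    · refine (map_map (k := GMap.id _) (fun p => ?_) _ _ _ _ _ subset_rfl _).trans (F.map_id _ _ _)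
      exact Prod.ext rfl (mul_div_cancel_right₀ p.2 (h0 p.1).ne').symm
    · refine (map_map (k := GMap.id _) (fun p => ?_) _ _ _ _ _ subset_rfl _).trans (F.map_id _ _ _)
      exact Prod.ext rfl (div_mul_cancel₀ p.2 (h0 p.1).ne').symm
  convert hb using 1
  funext x
  refine map_eq_of_line (f := GMap.id _) (g := f) (GMap.id _) .id (fun _ => rfl)
    (fun _ _ => ⟨_, rfl⟩) _ _ ?_ _ _ x
  rintro p (hp | hp) s w rfl
  · exact .inl (hC p _ rfl hp)
  · refine .inr ?_
    have h2 : φ p.1 ≤ |p.2| := hp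
    have h3 := s.2.1
    have h4 : (0 : ℝ) ≤ 1 - s := sub_nonneg.2 s.2.2
    have h5 : (1 - s : ℝ) * p.2 + s * (p.2 / φ p.1) = p.2 * ((1 - s) + s / φ p.1) := by ring
    change 1 ≤ |(1 - s : ℝ) * p.2 + s * (p.2 / φ p.1)|
    have h6 : 0 ≤ (1 - s : ℝ) + s / φ p.1 := add_nonneg h4 (div_nonneg h3 (h0 _).le)
    rw [h5, abs_mul, abs_of_nonneg h6]
    calc (1 : ℝ) ≤ φ p.1 * (1 - s) + s := by nlinarith [h1 p.1]
      _ = φ p.1 * ((1 - s) + s / φ p.1) := by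
        rw [mul_add, mul_div_cancel₀ _ (h0 p.1).ne']
      _ ≤ _ := mul_le_mul_of_nonneg_right h2 h6

theorem exists_cone (hG : G.NumerablyProper) {B : GSpace G} {p : GMap Y B} {r : GMap Y.line B}
    (comm : ∀ t, r t = p (Y.lineProj t)) (K : Cosupp r) :
    ∃ (C : Cosupp p) (φ : Y → ℝ) (hφ : Continuous φ) (hi : ∀ g y h, φ (Y.act g y h) = φ y),
      (∀ y, 1 ≤ φ y) ∧
        ((C.set.preimage Y.lineProj).union (cone φ hφ hi)).carrier ⊆ K.set.carrier := by
  have hK : ∀ (g : G.Arr) (q : Y.line) (h : G.src g = Y.anchor q.1), q ∈ K.set.carrierᶜ →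
      (Y.act g q.1 h, q.2) ∈ K.set.carrierᶜ := by
    intro g q h hq hn
    apply hq
    have := K.set.act_mem (G.inv g) (Y.line.act g q h)
      ((G.src_inv g).trans (Y.line.anchor_act g q h).symm) hn
    rwa [Y.line.inv_act] at this
  have hcl := K.compactOver
  have himg : CompactOver p (Y.lineProj '' closure K.set.carrierᶜ) := CompactOver.image comm hcl
  let C : ClosedInv Y := ⟨(Y.lineProj '' K.set.carrierᶜ)ᶜ,
    (isOpenMap_fst _ K.set.isClosed.isOpen_compl).isClosed_compl, by
      rintro g y h hy ⟨q, hq, e⟩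
      have e' : q.1 = Y.act g y h := e
      refine hy ⟨_, hK (G.inv g) q ((G.src_inv g).trans (by rw [e', Y.anchor_act])) hq, ?_⟩
      exact (Y.act_congr e' _ ((G.src_inv g).trans (Y.anchor_act g y h).symm)).trans
        (Y.inv_act g y h)⟩
  have hC : CompactOver p (closure C.carrierᶜ) := himg.subset isClosed_closure
    (closure_minimal (by rw [compl_compl]; exact Set.image_mono subset_closure) himg.isClosed)
  have hprop : IsProperMap fun q : closure K.set.carrierᶜ => Y.lineProj q := by
    refine isProperMap_of_comp_of_t2 (g := p)
      (Y.lineProj.continuous_toFun.comp continuous_subtype_val) p.continuous_toFun ?_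
    have h : (fun q : closure K.set.carrierᶜ => r q) = p ∘
        fun q : closure K.set.carrierᶜ => Y.lineProj q :=
      funext fun q => comm q
    rw [← h]
    exact hcl
  obtain ⟨φ₀, hφ₀⟩ := exists_continuous_forall_mem_convex_of_local_const (X := Y) (E := ℝ)
    (t := fun y => {c | 1 ≤ c ∧ ∀ s, (y, s) ∈ K.set.carrierᶜ → |s| + 1 ≤ c}) (fun y => by
      intro a ha b hb u v hu hv huv
      refine ⟨?_, fun s hs => ?_⟩
      · have := ha.1; have := hb.1
        change 1 ≤ u * a + v * b
        nlinarith
      · have := ha.2 s hs; have := hb.2 s hs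
        change _ ≤ u * a + v * b
        have e : (u + v) * (|s| + 1) = |s| + 1 := by rw [huv, _root_.one_mul]
        nlinarith) (fun y => by
      have hcomp : IsCompact ((fun q : closure K.set.carrierᶜ => Y.lineProj q) ⁻¹' {y}) :=
        hprop.isCompact_preimage isCompact_singleton
      have hcont : Continuous fun q : closure K.set.carrierᶜ => |q.1.2| :=
        continuous_abs.comp (continuous_snd.comp continuous_subtype_val)
      obtain ⟨c, hc⟩ := (hcomp.image hcont).bddAbove
      have hclosed : IsClosed {q : closure K.set.carrierᶜ | c + 1 ≤ |q.1.2|} :=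
        isClosed_le continuous_const hcont
      have hO := (hprop.isClosedMap _ hclosed).isOpen_compl
      have hy : y ∈ ((fun q : closure K.set.carrierᶜ => Y.lineProj q) ''
          {q | c + 1 ≤ |q.1.2|})ᶜ := by
        rintro ⟨q, hq, e⟩
        have h1 : |q.1.2| ≤ c := hc ⟨q, e, rfl⟩
        have h2 : c + 1 ≤ |q.1.2| := hq
        linarith
      refine ⟨max 1 (c + 2), Filter.mem_of_superset (hO.mem_nhds hy) fun y' hy' =>
        ⟨le_max_left _ _, fun s hs => le_max_of_le_right ?_⟩⟩
      by_contra hn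
      refine hy' ⟨⟨(y', s), subset_closure hs⟩, ?_, rfl⟩
      change c + 1 ≤ |s|
      linarith [not_le.1 hn])
  obtain ⟨φ, h1, h2, h3, -⟩ := hG.exists_average Y φ₀.continuous
  refine ⟨⟨C, hC⟩, φ, h1, h2, fun y => h3 y 1 fun g h => (hφ₀ _).1, ?_⟩
  rintro q (hq | hq)
  · by_contra hn
    exact hq ⟨q, hn, rfl⟩
  · by_contra hn
    have h4 : φ q.1 ≤ |q.2| := hq
    have h5 : |q.2| + 1 ≤ φ q.1 := h3 q.1 _ fun g h => (hφ₀ _).2 q.2 (hK g q h hn)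
    linarith

/-- The Thom class of the trivial line bundle. -/
def lineClass (e : F.obj Y.outer.space (.empty _)) : F.Supp Y.lineProj :=
  Supp.mk (outerCosupp Y) (F.δ Y.outer e)

theorem IsSign.isThomClass {e : F.obj Y.outer.space (.empty _)} (he : IsSign e)
    (hG : G.NumerablyProper) : (lineClass e).IsThomClass := by
  intro B p r comm
  have hmul : ∀ (C : Cosupp p) (b : F.obj Y C.set), Supp.mul Y.lineProj r comm (Supp.mk C b)
      (lineClass e) = Supp.mk (C.prod r comm (outerCosupp Y)) (rsusp e C.set b) := fun _ _ => rfl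
  have hres : ∀ (C : Cosupp p) (φ : Y → ℝ) (hφ : Continuous φ)
      (hi : ∀ g y h, φ (Y.act g y h) = φ y), (∀ y, 1 ≤ φ y) →
      ∃ h, Function.Bijective (F.res (C.prod r comm (outerCosupp Y)).set
        (C.prod r comm (coneCosupp φ hφ hi)).set h) := by
    intro C φ hφ hi h1
    refine ⟨fun q hq => hq.imp (fun h => h) fun h => (h1 q.1).trans h,
      res_cone_bijective hφ hi h1 (C.set.preimage Y.lineProj) ?_ _⟩
    intro q q' hqq hq
    change q'.1 ∈ C.set.carrier
    rw [← hqq]; exact hq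
  constructor
  · intro x x' hx
    rw [← sub_eq_zero]
    have hx' : Supp.mul Y.lineProj r comm (x - x') (lineClass e) = 0 := by
      have h1 := Supp.add_mul Y.lineProj r comm (x - x') x' (lineClass e)
      rw [sub_add_cancel, show Supp.mul Y.lineProj r comm x (lineClass e) = _ from hx] at h1
      exact (left_eq_add.1 (h1.trans (add_comm _ _)))
    generalize x - x' = z at hx'
    induction z using Supp.ind with | h C b => ?_
    rw [hmul] at hx'
    obtain ⟨K, hK, hK0⟩ := Supp.mk_eq_zero hx'
    obtain ⟨C', φ, hφ, hi, h1, hs⟩ := exists_cone hG comm K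
    let C'' := C.inter C'
    have hCC : C''.set.carrier ⊆ C.set.carrier := fun _ h => h.1
    obtain ⟨hr, hb⟩ := hres C'' φ hφ hi h1
    have hsK : (C''.prod r comm (coneCosupp φ hφ hi)).set.carrier ⊆ K.set.carrier :=
      fun q hq => hs (hq.imp (fun h => h.2) fun h => h)
    have hm : (C''.prod r comm (outerCosupp Y)).set.carrier ⊆
      (C.prod r comm (outerCosupp Y)).set.carrier := fun q hq => hq.imp (fun h => h.1) fun h => h
    have h3 : rsusp e C''.set (F.res _ _ hCC b) = F.res _ _ hm (rsusp e C.set b) := by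
      have hp : (C''.set.preimage Y.lineProj).carrier ⊆ (C.set.preimage Y.lineProj).carrier :=
        fun q hq => hq.1
      refine Eq.trans ?_ (res_mul hp subset_rfl hm _ _).symm
      refine congrArg₂ (fun s t => F.mul (C''.set.preimage Y.lineProj) Y.outer s t) ?_
        (res_self _ _).symm
      exact (F.map_res Y.lineProj _ _ _ _ hp hCC subset_rfl subset_rfl b).symm
    have h4 : F.res _ _ hCC b = 0 := by
      refine (rsusp_bijective he C''.set).1 (hb.1 ?_)
      rw [h3, map_zero, map_zero]
      refine (res_res _ _ _).trans ?_
      have := congrArg (F.res _ _ hsK) hK0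
      rw [map_zero] at this
      exact (res_res _ _ _).symm.trans this
    rw [← Supp.mk_res (B := C) (C := C'') hCC b, h4, Supp.mk_zero]
  · intro x
    induction x using Supp.ind with | h K a => ?_
    obtain ⟨C, φ, hφ, hi, h1, hs⟩ := exists_cone hG comm K
    obtain ⟨hr, hb⟩ := hres C φ hφ hi h1
    have hs' : (C.prod r comm (coneCosupp φ hφ hi)).set.carrier ⊆ K.set.carrier := hs
    obtain ⟨y, hy⟩ := hb.2 (F.res _ _ hs' a)
    obtain ⟨b, rfl⟩ := (rsusp_bijective he C.set).2 y
    refine ⟨Supp.mk C b, ?_⟩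
    refine (hmul C b).trans ?_
    rw [← Supp.mk_res hr, hy, Supp.mk_res]

end CohTheory

theorem GSpace.cart_line {Y Z : GSpace G} (f : GMap Y Z) :
    Cart Y.lineProj f.line f Z.lineProj where
  comm _ := rfl
  emb := by
    have hc : Continuous fun p : Y.line => (p.1, (f p.1, p.2)) := by
      have := f.continuous_toFun
      fun_prop
    refine .of_continuous_injective_isClosedMap hc (fun p q h => ?_) ?_
    · exact Prod.ext (Prod.ext_iff.1 h).1 (Prod.ext_iff.1 (Prod.ext_iff.1 h).2).2
    · refine (isProperMap_of_comp_of_t2 (g := fun q : Y × Z.line => (q.1, q.2.2)) hc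
        (by fun_prop) ?_).isClosedMap
      exact isProperMap_id
  surj y p h := ⟨(y, p.2), rfl, Prod.ext h rfl⟩

namespace GBundle

instance lineTop (X : GSpace G) : TopologicalSpace (TotPt fun _ : X => ULift.{u} ℝ) :=
  .induced (fun v => (v.pt, v.vec.down)) (inferInstanceAs (TopologicalSpace (X × ℝ)))

/-- The total space of the trivial line bundle. -/
def lineHomeo (X : GSpace G) : (TotPt fun _ : X => ULift.{u} ℝ) ≃ₜ X × ℝ where
  toFun v := (v.pt, v.vec.down)
  invFun p := ⟨p.1, ⟨p.2⟩⟩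
  left_inv _ := rfl
  right_inv _ := rfl
  continuous_toFun := continuous_induced_dom
  continuous_invFun := continuous_induced_rng.2 continuous_id

/-- The trivial line bundle. -/
def line (X : GSpace G) : GBundle X where
  fib _ := ULift ℝ
  t2 := (lineHomeo X).isEmbedding.t2Space
  para := by
    have : ParacompactSpace (X × ℝ) := X.line.para
    exact (lineHomeo X).isClosedEmbedding.paracompactSpace
  locTriv x := by
    let c : FibChart (fun _ : X => ULift.{u} ℝ) x :=
      { E := ℝ
        U := Set.univ
        isOpen := isOpen_univ
        mem := trivial
        L := fun _ => (ULift.moduleEquiv (R := ℝ) (M := ℝ)).toLinearMap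
        bij := fun _ _ => (ULift.moduleEquiv (R := ℝ) (M := ℝ)).bijective
        nhds_eq := fun v _ => by
          rw [(lineHomeo X).isEmbedding.nhds_eq_comap]
          change Filter.comap (lineHomeo X) (𝓝 (v.pt, v.vec.down)) = _
          rw [nhds_prod_eq, Filter.comap_prod]
          rfl }
    exact c.exists_trivialization (continuous_fst.comp (lineHomeo X).continuous)
  act _ _ _ := LinearMap.id
  one_act v := TotPt.ext (X.one_act v.pt) HEq.rfl
  mul_act g h v e e' := TotPt.ext (X.mul_act g h v.pt e e') HEq.rfl
  continuous_act := continuous_induced_rng.2 (X.line.continuous_act.comp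
    (f := fun p : {p : G.Arr × TotPt (fun _ : X => ULift.{u} ℝ) // G.src p.1 = X.anchor p.2.pt} =>
      (⟨(p.1.1, lineHomeo X p.1.2), p.2⟩ : {p : G.Arr × X.line // G.src p.1 = X.line.anchor p.2}))
    (((continuous_fst.comp continuous_subtype_val).prodMk ((lineHomeo X).continuous.comp
      (continuous_snd.comp continuous_subtype_val))).subtype_mk _))

/-- The identification of the total space of the trivial line bundle with `X × ℝ`. -/
def toLine (X : GSpace G) : GMap (line X).tot X.line where
  toFun v := (v.pt, ULift.down v.vec)
  continuous_toFun := (lineHomeo X).continuous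
  anchor_map _ := rfl
  map_act _ _ _ := rfl

theorem isHomeomorph_toLine (X : GSpace G) : IsHomeomorph (toLine X) := (lineHomeo X).isHomeomorph

theorem cart_toLine (X : GSpace G) : Cart (line X).proj (toLine X) (GMap.id X) X.lineProj :=
  Cart.of_lift (fun _ => rfl) (GSpace.cart_line (GMap.id X)) (isHomeomorph_toLine X) (fun _ => rfl)
    fun _ => rfl

theorem rank_line (X : GSpace G) (x : X) : (line X).rank x = 1 :=
  ((ULift.moduleEquiv (R := ℝ) (M := ℝ)).finrank_eq).trans (Module.finrank_self ℝ)

end GBundle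

variable {F : CohTheory.{u, v} G} {X X' Y Y' Z M M' : GSpace G}

open CohTheory

variable (F) in
/-- The trivial line bundle over the object space, with its canonical orientation. -/
noncomputable def OBundle.line (hG : G.NumerablyProper) : OBundle F (unitSpace G) where
  toGBundle := .line _
  τ := Supp.restr (GBundle.toLine _) (GBundle.isHomeomorph_toLine _).isProperMap (fun _ => rfl)
    (lineClass (exists_isSign (F := F) (unitSpace G)).choose)
  isThom Y f V' φ B p := by
    let e := (exists_isSign (F := F) (unitSpace G)).choose
    have he : IsSign e := (exists_isSign (F := F) (unitSpace G)).choose_spec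
    have c := φ.cart.comp (GBundle.cart_toLine (unitSpace G))
    let k := (GSpace.cart_line f).lift V'.proj ((GBundle.toLine _).comp φ.toGMap) c.comm
    have hk : IsHomeomorph k := c.isHomeomorph (GSpace.cart_line f)
      ((GSpace.cart_line f).fst_lift _ _ _) ((GSpace.cart_line f).snd_lift _ _ _)
    have hq : ∀ t, V'.proj t = Y.lineProj (k t) := fun t =>
      ((GSpace.cart_line f).fst_lift _ _ _ t).symm
    have h1 := ((he.comap f).isThomClass hG).restr hk hq B p (p.comp V'.proj) fun _ => rfl
    convert h1 using 3
    have h2 : lineClass (F.map f.outer (.empty _) (.empty _) (Set.empty_subset _) e) =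
        Supp.pull f.line f (GSpace.cart_line f).comm (GSpace.cart_line f).proper (lineClass e) :=
      congrArg (Supp.mk (outerCosupp Y)) (F.δ_natural f.line Y.outer
        (unitSpace G).outer (fun _ h => h) e)
    rw [h2]
    refine (Supp.pull_pull (χ := (GBundle.toLine _).comp φ.toGMap) (k := f) (comm'' := c.comm)
      (hχ := c.proper) (fun _ => rfl) _).trans ?_
    exact (Supp.pull_pull (fun t => (GSpace.cart_line f).snd_lift _ _ _ t) _).symm
  degree := by
    have he := (exists_isSign (F := F) (unitSpace G)).choose_spec
    have h1 : (lineClass (exists_isSign (F := F) (unitSpace G)).choose).HasDegree 1 :=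
      ⟨_, _, F.δ_deg _ 0 _ he.deg, rfl⟩
    exact h1.pull.localDegree fun v => congrArg Nat.cast (GBundle.rank_line _ _)

end

section

variable {G : TopGroupoid.{u}}

variable {F : CohTheory.{u, v} G} {X X' Y Z M N T T₁ T₂ S S₁ S₂ : GSpace G}

open CohTheory

/-! ### Disjoint unions -/

theorem CohTheory.Supp.part_add (n : ℤ) {p : GMap T X} (x y : F.Supp p) :
    part n (x + y) = part n x + part n y := by
  induction x, y using ind₂ with | h B a b => ?_
  rw [← mk_add, part_mk, part_mk, part_mk, map_add, mk_add]

/-- `T` is the disjoint union of `T₁` and `T₂`. -/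
structure IsDisjointUnion (j₁ : GMap T₁ T) (j₂ : GMap T₂ T) : Prop where
  left : IsClosedEmbedding j₁
  right : IsClosedEmbedding j₂
  compl : IsCompl (Set.range j₁) (Set.range j₂)

namespace IsDisjointUnion

variable {j₁ : GMap T₁ T} {j₂ : GMap T₂ T}

theorem symm (h : IsDisjointUnion j₁ j₂) : IsDisjointUnion j₂ j₁ := ⟨h.right, h.left, h.compl.symm⟩

theorem isOpenEmbedding (h : IsDisjointUnion j₁ j₂) : IsOpenEmbedding j₁ :=
  ⟨h.left.isEmbedding, by rw [← h.compl.symm.compl_eq]; exact h.right.isClosed_range.isOpen_compl⟩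

theorem ne (h : IsDisjointUnion j₁ j₂) (a : T₁) (b : T₂) : j₁ a ≠ j₂ b := fun e =>
  Set.disjoint_left.1 h.compl.disjoint ⟨a, rfl⟩ ⟨b, e.symm⟩

theorem cases (h : IsDisjointUnion j₁ j₂) {P : T → Prop} (h₁ : ∀ a, P (j₁ a))
    (h₂ : ∀ b, P (j₂ b)) (t : T) : P t := by
  have : t ∈ Set.range j₁ ⊔ Set.range j₂ := h.compl.codisjoint.eq_top ▸ trivial
  rcases this with ⟨a, rfl⟩ | ⟨b, rfl⟩
  exacts [h₁ a, h₂ b]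

/-- Equivariant maps can be defined piecewise. -/
theorem exists_gmap (h : IsDisjointUnion j₁ j₂) (g₁ : GMap T₁ S) (g₂ : GMap T₂ S) :
    ∃ g : GMap T S, (∀ a, g (j₁ a) = g₁ a) ∧ ∀ b, g (j₂ b) = g₂ b := by
  have h0 : ∀ t, ∃ s, (∀ a, j₁ a = t → s = g₁ a) ∧ ∀ b, j₂ b = t → s = g₂ b :=
    h.cases (fun a => ⟨g₁ a, fun a' e => by rw [h.left.injective e],
        fun b e => (h.ne a b e.symm).elim⟩)
      fun b => ⟨g₂ b, fun a e => (h.ne a b e).elim, fun b' e => by rw [h.right.injective e]⟩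
  choose g hg₁ hg₂ using h0
  have e₁ : ∀ a, g (j₁ a) = g₁ a := fun a => hg₁ _ a rfl
  have e₂ : ∀ b, g (j₂ b) = g₂ b := fun b => hg₂ _ b rfl
  have ha : ∀ t, S.anchor (g t) = T.anchor t :=
    h.cases (fun a => by rw [e₁, g₁.anchor_map, j₁.anchor_map])
      fun b => by rw [e₂, g₂.anchor_map, j₂.anchor_map]
  refine ⟨⟨g, continuous_iff_continuousAt.2 (h.cases ?_ ?_), ha, fun k => h.cases ?_ ?_⟩, e₁, e₂⟩
  · exact fun a => h.isOpenEmbedding.continuousAt_iff.1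
      (g₁.continuous_toFun.congr fun a => (e₁ a).symm).continuousAt
  · exact fun b => h.symm.isOpenEmbedding.continuousAt_iff.1
      (g₂.continuous_toFun.congr fun b => (e₂ b).symm).continuousAt
  · intro a e
    rw [← T.act_congr rfl ((e.trans (j₁.anchor_map a)).trans (j₁.anchor_map a).symm) e,
      ← j₁.map_act k a (e.trans (j₁.anchor_map a)), e₁, g₁.map_act]
    exact S.act_congr (e₁ a).symm _ _
  · intro b e
    rw [← T.act_congr rfl ((e.trans (j₂.anchor_map b)).trans (j₂.anchor_map b).symm) e,
      ← j₂.map_act k b (e.trans (j₂.anchor_map b)), e₂, g₂.map_act]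
    exact S.act_congr (e₂ b).symm _ _

theorem isOpenEmbedding_of_pieces (h : IsDisjointUnion j₁ j₂) {R : Type*} [TopologicalSpace R]
    {Q : T → R} (h₁ : IsOpenEmbedding fun a => Q (j₁ a)) (h₂ : IsOpenEmbedding fun b => Q (j₂ b))
    (hd : ∀ a b, Q (j₁ a) ≠ Q (j₂ b)) : IsOpenEmbedding Q := by
  refine .of_continuous_injective_isOpenMap (continuous_iff_continuousAt.2 (h.cases ?_ ?_)) ?_ ?_
  · exact fun a => h.isOpenEmbedding.continuousAt_iff.1 h₁.continuous.continuousAt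
  · exact fun b => h.symm.isOpenEmbedding.continuousAt_iff.1 h₂.continuous.continuousAt
  · refine h.cases (fun a => h.cases (fun a' e => ?_) fun b e => ?_)
      fun b => h.cases (fun a e => ?_) fun b' e => ?_
    exacts [congrArg j₁ (h₁.injective e), (hd a b e).elim, (hd a b e.symm).elim,
      congrArg j₂ (h₂.injective e)]
  · intro O hO
    have : Q '' O = (fun a => Q (j₁ a)) '' (j₁ ⁻¹' O) ∪ (fun b => Q (j₂ b)) '' (j₂ ⁻¹' O) := by
      ext r
      constructor
      · rintro ⟨t, ht, rfl⟩
        revert ht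
        exact h.cases (P := fun t => t ∈ O → Q t ∈ (fun a => Q (j₁ a)) '' (j₁ ⁻¹' O) ∪
          (fun b => Q (j₂ b)) '' (j₂ ⁻¹' O)) (fun a ha => .inl ⟨a, ha, rfl⟩)
          (fun b hb => .inr ⟨b, hb, rfl⟩) t
      · rintro (⟨a, ha, rfl⟩ | ⟨b, hb, rfl⟩)
        exacts [⟨_, ha, rfl⟩, ⟨_, hb, rfl⟩]
    rw [this]
    exact (h₁.isOpenMap _ (hO.preimage j₁.continuous_toFun)).union
      (h₂.isOpenMap _ (hO.preimage j₂.continuous_toFun))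

theorem supp_ext (h : IsDisjointUnion j₁ j₂) {p : GMap T X} {x y : F.Supp p}
    (h₁ : Supp.restr j₁ h.left.isProperMap (p' := p.comp j₁) (fun _ => rfl) x =
      Supp.restr j₁ h.left.isProperMap (p' := p.comp j₁) (fun _ => rfl) y)
    (h₂ : Supp.restr j₂ h.right.isProperMap (p' := p.comp j₂) (fun _ => rfl) x =
      Supp.restr j₂ h.right.isProperMap (p' := p.comp j₂) (fun _ => rfl) y) : x = y :=
  sub_eq_zero.1 (Supp.eq_zero_of_restr h.left h.right h.compl _
    ((Supp.pull_sub _ _ _ _ _ _).trans (sub_eq_zero.2 h₁))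
    ((Supp.pull_sub _ _ _ _ _ _).trans (sub_eq_zero.2 h₂)))

theorem exists_supp (h : IsDisjointUnion j₁ j₂) {p : GMap T X} {p₁ : GMap T₁ X} {p₂ : GMap T₂ X}
    (c₁ : ∀ t, p₁ t = p (j₁ t)) (c₂ : ∀ t, p₂ t = p (j₂ t)) (x₁ : F.Supp p₁) (x₂ : F.Supp p₂) :
    ∃ x : F.Supp p, Supp.restr j₁ h.left.isProperMap c₁ x = x₁ ∧
      Supp.restr j₂ h.right.isProperMap c₂ x = x₂ := by
  obtain rfl : p₁ = p.comp j₁ := GMap.ext (funext c₁)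
  obtain rfl : p₂ = p.comp j₂ := GMap.ext (funext c₂)
  obtain ⟨y₁, hy₁⟩ := Supp.exists_isExtension j₁ h.isOpenEmbedding c₁ x₁
  obtain ⟨y₂, hy₂⟩ := Supp.exists_isExtension j₂ h.symm.isOpenEmbedding c₂ x₂
  refine ⟨y₁ + y₂, ?_, ?_⟩
  · refine (Supp.restr_add _ _ _ _ _).trans ?_
    rw [hy₂.restr_eq_zero h.left h.compl.disjoint, add_zero]
    exact hy₁.pull_eq
  · refine (Supp.restr_add _ _ _ _ _).trans ?_
    rw [hy₁.restr_eq_zero h.right h.compl.disjoint.symm, zero_add]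
    exact hy₂.pull_eq

theorem hasLocalDegree (h : IsDisjointUnion j₁ j₂) {p : GMap T X} {p₁ : GMap T₁ X} {p₂ : GMap T₂ X}
    (c₁ : ∀ t, p₁ t = p (j₁ t)) (c₂ : ∀ t, p₂ t = p (j₂ t)) {x : F.Supp p} {d : T → ℤ}
    (hd : IsRank d) (h₁ : (Supp.restr j₁ h.left.isProperMap c₁ x).HasLocalDegree fun t => d (j₁ t))
    (h₂ : (Supp.restr j₂ h.right.isProperMap c₂ x).HasLocalDegree fun t => d (j₂ t)) :
    x.HasLocalDegree d := by
  obtain ⟨y₁, hy₁⟩ := Supp.exists_isExtension j₁ h.isOpenEmbedding c₁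
    (Supp.restr j₁ h.left.isProperMap c₁ x)
  obtain ⟨y₂, hy₂⟩ := Supp.exists_isExtension j₂ h.symm.isOpenEmbedding c₂
    (Supp.restr j₂ h.right.isProperMap c₂ x)
  rw [Supp.eq_add_of_pieces h.left h.right h.compl c₁ c₂ x y₁ y₂ hy₁ hy₂]
  intro N i hi ho k hk
  refine Supp.hasDegree_iff.2 ?_
  rw [Supp.restr_add, Supp.part_add,
    Supp.hasDegree_iff.1 (Supp.HasLocalDegree.of_isExtension h.isOpenEmbedding c₁ hy₁ hd h₁ N i hi ho k hk),
    Supp.hasDegree_iff.1 (Supp.HasLocalDegree.of_isExtension h.symm.isOpenEmbedding c₂ hy₂ hd h₂ N i hi ho k hk)]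

/-- The Thom isomorphism can be checked on the pieces of a disjoint union. -/
theorem isThomClass (h : IsDisjointUnion j₁ j₂) {i₁ : GMap S₁ S} {i₂ : GMap S₂ S}
    (h' : IsDisjointUnion i₁ i₂) {q : GMap T S} {q₁ : GMap T₁ S₁} {q₂ : GMap T₂ S₂}
    (c₁ : Cart q₁ j₁ i₁ q) (c₂ : Cart q₂ j₂ i₂ q) {y : F.Supp q}
    (h₁ : (Supp.pull j₁ i₁ c₁.comm c₁.proper y).IsThomClass)
    (h₂ : (Supp.pull j₂ i₂ c₂.comm c₂.proper y).IsThomClass) : y.IsThomClass := by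
  intro B p r comm
  have key : ∀ {T₁ S₁ : GSpace G} {j₁ : GMap T₁ T} {i₁ : GMap S₁ S} {q₁ : GMap T₁ S₁}
      (hj : IsClosedEmbedding j₁) (hi : IsClosedEmbedding i₁) (c₁ : Cart q₁ j₁ i₁ q) (z : F.Supp p),
      Supp.restr j₁ hj.isProperMap (p' := r.comp j₁) (fun _ => rfl) (Supp.mul q r comm z y) =
        Supp.mul q₁ (r.comp j₁) (fun t => (comm _).trans (congrArg p (c₁.comm t).symm))
          (Supp.restr i₁ hi.isProperMap (p' := p.comp i₁) (fun _ => rfl) z)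
          (Supp.pull j₁ i₁ c₁.comm c₁.proper y) := fun hj hi c₁ z =>
    Supp.pull_mul _ _ _ _ _ z y
  have b₁ := h₁ B (p.comp i₁) (r.comp j₁) fun t => (comm _).trans (congrArg p (c₁.comm t).symm)
  have b₂ := h₂ B (p.comp i₂) (r.comp j₂) fun t => (comm _).trans (congrArg p (c₂.comm t).symm)
  constructor
  · intro z z' e
    have e' : Supp.mul q r comm z y = Supp.mul q r comm z' y := e
    refine h'.supp_ext (b₁.1 ?_) (b₂.1 ?_)
    · exact (key h.left h'.left c₁ z).symm.trans ((congrArg _ e').trans (key h.left h'.left c₁ z'))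
    · exact (key h.right h'.right c₂ z).symm.trans
        ((congrArg _ e').trans (key h.right h'.right c₂ z'))
  · intro w
    obtain ⟨z₁, hz₁⟩ := b₁.2 (Supp.restr j₁ h.left.isProperMap (fun _ => rfl) w)
    obtain ⟨z₂, hz₂⟩ := b₂.2 (Supp.restr j₂ h.right.isProperMap (fun _ => rfl) w)
    obtain ⟨z, rfl, rfl⟩ := h'.exists_supp (p := p) (fun _ => rfl) (fun _ => rfl) z₁ z₂
    exact ⟨z, h.supp_ext ((key h.left h'.left c₁ z).trans hz₁)
      ((key h.right h'.right c₂ z).trans hz₂)⟩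

/-- The decomposition of a total space over a disjoint union. -/
theorem of_cart {i₁ : GMap S₁ S} {i₂ : GMap S₂ S} (h : IsDisjointUnion i₁ i₂) {q : GMap T S}
    {q₁ : GMap T₁ S₁} {q₂ : GMap T₂ S₂} (c₁ : Cart q₁ j₁ i₁ q) (c₂ : Cart q₂ j₂ i₂ q) :
    IsDisjointUnion j₁ j₂ := by
  have key : ∀ {T₁ S₁ : GSpace G} {j₁ : GMap T₁ T} {i₁ : GMap S₁ S} {q₁ : GMap T₁ S₁}
      (_ : IsClosedEmbedding i₁) (_ : Cart q₁ j₁ i₁ q),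
      IsClosedEmbedding j₁ ∧ Set.range j₁ = q ⁻¹' Set.range i₁ := by
    intro T₁ S₁ j₁ i₁ q₁ hi c
    refine ⟨?_, ?_⟩
    · have h1 : IsClosedEmbedding fun t => (i₁ (q₁ t), j₁ t) :=
        (hi.prodMap IsClosedEmbedding.id).comp c.emb
      have h2 : IsProperMap fun t => (q (j₁ t), j₁ t) := by
        convert h1.isProperMap using 3 with t
        exact (c.comm t).symm
      refine .of_continuous_injective_isClosedMap j₁.continuous_toFun (fun a b e => c.ext (hi.injective ?_) e)
        (isProperMap_of_comp_of_t2 (g := fun t => (q t, t)) j₁.continuous_toFun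
          (q.continuous_toFun.prodMk continuous_id) h2).isClosedMap
      rw [c.comm, c.comm, e]
    · ext t
      constructor
      · rintro ⟨a, rfl⟩; exact ⟨q₁ a, c.comm a⟩
      · rintro ⟨s, hs⟩
        obtain ⟨a, -, ha⟩ := c.surj s t hs
        exact ⟨a, ha⟩
  refine ⟨(key h.left c₁).1, (key h.right c₂).1, ?_⟩
  rw [(key h.left c₁).2, (key h.right c₂).2]
  exact ⟨h.compl.disjoint.preimage _, codisjoint_iff.2
    ((congrArg (q ⁻¹' ·) h.compl.sup_eq_top).trans Set.preimage_univ)⟩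

end IsDisjointUnion

/-- A co-support over a closed subspace of `X` as a co-support over `X`. -/
@[reducible]
def Cosupp.over {i : GMap X' X} (hi : IsClosedEmbedding i) {p : GMap T X'} {p' : GMap T X}
    (c : ∀ t, p' t = i (p t)) (C : Cosupp p) : Cosupp p' :=
  ⟨C.set, by
    have h1 : (fun t : closure C.set.carrierᶜ => p' t) =
        i ∘ fun t : closure C.set.carrierᶜ => p t := funext fun t => c t
    rw [CompactOver, h1]
    exact hi.isProperMap.comp C.compactOver⟩

/-- The class with compact support over `X` given by a class with compact support over a closed
subspace of `X`. -/
def CohTheory.Supp.over {i : GMap X' X} (hi : IsClosedEmbedding i) {p : GMap T X'} {p' : GMap T X}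
    (c : ∀ t, p' t = i (p t)) : F.Supp p → F.Supp p' :=
  Quotient.map (fun x => ⟨x.1.over hi c, x.2⟩) (by
    rintro ⟨B, a⟩ ⟨B', a'⟩ ⟨B'', h, h', e⟩
    exact ⟨B''.over hi c, h, h', e⟩)

theorem CohTheory.Supp.pull_over {i : GMap X' X} (hi : IsClosedEmbedding i) {p : GMap T X'}
    {p' : GMap T X} (c : ∀ t, p' t = i (p t)) {c' : ∀ t, i (p t) = p' (GMap.id T t)}
    {h : IsProperMap fun t => (p t, GMap.id T t)} (x : F.Supp p) :
    Supp.pull (GMap.id T) i c' h (Supp.over hi c x) = x := by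
  induction x using Supp.ind with | h C a => ?_
  exact congrArg (Supp.mk _) (F.map_id _ _ _)

theorem CohTheory.Supp.HasLocalDegree.over {i : GMap X' X} (hi : IsClosedEmbedding i)
    {p : GMap T X'} {p' : GMap T X} (c : ∀ t, p' t = i (p t)) {x : F.Supp p} {d : T → ℤ}
    (hx : x.HasLocalDegree d) : (Supp.over hi c x).HasLocalDegree d := by
  intro N j hj ho k hk
  have h1 := hx N j hj ho k hk
  have h2 : Supp.restr j hj.isProperMap (p' := p'.comp j) (fun _ => rfl) (Supp.over hi c x) =
      Supp.over hi (fun t => c (j t))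
        (Supp.restr j hj.isProperMap (p' := p.comp j) (fun _ => rfl) x) := by
    induction x using Supp.ind with | h C a => ?_
    rfl
  obtain ⟨B, a, ha, e⟩ := h1
  rw [h2, e]
  exact ⟨B.over hi fun t => c (j t), a, ha, rfl⟩

theorem paracompactSpace_sum {A B : Type u} [TopologicalSpace A] [TopologicalSpace B]
    [ParacompactSpace A] [ParacompactSpace B] : ParacompactSpace (A ⊕ B) := by
  refine ⟨fun α s ho hc => ?_⟩
  obtain ⟨v, vo, vc, vf, vs⟩ := precise_refinement (fun a => Sum.inl ⁻¹' s a)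
    (fun a => (ho a).preimage continuous_inl) (by rw [← Set.preimage_iUnion, hc]; rfl)
  obtain ⟨w, wo, wc, wf, ws⟩ := precise_refinement (fun a => Sum.inr ⁻¹' s a)
    (fun a => (ho a).preimage continuous_inr) (by rw [← Set.preimage_iUnion, hc]; rfl)
  refine ⟨α, fun a => Sum.inl '' v a ∪ Sum.inr '' w a, fun a => (isOpenMap_inl _ (vo a)).union
    (isOpenMap_inr _ (wo a)), ?_, ?_, fun a => ⟨a, ?_⟩⟩
  · refine Set.eq_univ_of_forall fun x => Set.mem_iUnion.2 ?_
    rcases x with x | x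
    · obtain ⟨a, ha⟩ := Set.mem_iUnion.1 (vc ▸ Set.mem_univ x)
      exact ⟨a, .inl ⟨x, ha, rfl⟩⟩
    · obtain ⟨a, ha⟩ := Set.mem_iUnion.1 (wc ▸ Set.mem_univ x)
      exact ⟨a, .inr ⟨x, ha, rfl⟩⟩
  · rintro (x | x)
    · obtain ⟨O, hO, hf⟩ := vf x
      refine ⟨Sum.inl '' O, isOpenMap_inl.image_mem_nhds hO, hf.subset ?_⟩
      rintro a ⟨_, ⟨y, hy, rfl⟩ | ⟨y, hy, rfl⟩, ⟨z, hz, e⟩⟩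
      · exact ⟨y, hy, Sum.inl_injective e ▸ hz⟩
      · cases e
    · obtain ⟨O, hO, hf⟩ := wf x
      refine ⟨Sum.inr '' O, isOpenMap_inr.image_mem_nhds hO, hf.subset ?_⟩
      rintro a ⟨_, ⟨y, hy, rfl⟩ | ⟨y, hy, rfl⟩, ⟨z, hz, e⟩⟩
      · cases e
      · exact ⟨y, hy, Sum.inr_injective e ▸ hz⟩
  · rintro _ (⟨x, hx, rfl⟩ | ⟨x, hx, rfl⟩)
    exacts [vs a hx, ws a hx]

theorem continuous_sum_of_pieces {A B D R : Type*} [TopologicalSpace A] [TopologicalSpace B]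
    [TopologicalSpace D] [TopologicalSpace R] {s : Set (D × (A ⊕ B))} {f : s → R}
    (h₁ : Continuous fun p : {p : D × A | (p.1, Sum.inl p.2) ∈ s} => f ⟨(p.1.1, .inl p.1.2), p.2⟩)
    (h₂ : Continuous fun p : {p : D × B | (p.1, Sum.inr p.2) ∈ s} => f ⟨(p.1.1, .inr p.1.2), p.2⟩) :
    Continuous f := by
  have e₁ := (IsOpenEmbedding.id.prodMap (.inl : IsOpenEmbedding (Sum.inl : A → A ⊕ B))
    (f := (id : D → D))).restrictPreimage s
  have e₂ := (IsOpenEmbedding.id.prodMap (.inr : IsOpenEmbedding (Sum.inr : B → A ⊕ B))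
    (f := (id : D → D))).restrictPreimage s
  rw [continuous_iff_continuousAt]
  rintro ⟨⟨d, a | b⟩, h⟩
  · exact e₁.continuousAt_iff (x := ⟨(d, a), h⟩).1 h₁.continuousAt
  · exact e₂.continuousAt_iff (x := ⟨(d, b), h⟩).1 h₂.continuousAt

/-- The disjoint union of two `G`-spaces. -/
@[reducible]
def GSpace.sum (M N : GSpace G) : GSpace G where
  carrier := M ⊕ N
  para := paracompactSpace_sum
  anchor := Sum.elim M.anchor N.anchor
  continuous_anchor := M.continuous_anchor.sumElim N.continuous_anchor
  act g x := match x with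
    | .inl m => fun h => .inl (M.act g m h)
    | .inr n => fun h => .inr (N.act g n h)
  anchor_act g x := match x with
    | .inl m => fun h => M.anchor_act g m h
    | .inr n => fun h => N.anchor_act g n h
  one_act x := match x with
    | .inl m => congrArg Sum.inl (M.one_act m)
    | .inr n => congrArg Sum.inr (N.one_act n)
  mul_act g h x := match x with
    | .inl m => fun e e' => congrArg Sum.inl (M.mul_act g h m e e')
    | .inr n => fun e e' => congrArg Sum.inr (N.mul_act g h n e e')
  continuous_act := continuous_sum_of_pieces (continuous_inl.comp M.continuous_act)
    (continuous_inr.comp N.continuous_act)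

/-- The inclusion of the first summand. -/
@[reducible]
def GSpace.inl (M N : GSpace G) : GMap M (M.sum N) :=
  ⟨Sum.inl, continuous_inl, fun _ => rfl, fun _ _ _ => rfl⟩

/-- The inclusion of the second summand. -/
@[reducible]
def GSpace.inr (M N : GSpace G) : GMap N (M.sum N) :=
  ⟨Sum.inr, continuous_inr, fun _ => rfl, fun _ _ _ => rfl⟩

theorem GSpace.isDisjointUnion_sum (M N : GSpace G) : IsDisjointUnion (M.inl N) (M.inr N) :=
  ⟨.inl, .inr, Set.isCompl_range_inl_range_inr⟩

/-- Transport of linear coordinates along an open embedding. -/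
def FibChart.map {B B' : Type u} [TopologicalSpace B] [TopologicalSpace B'] {fib : B → Type u}
    {fib' : B' → Type u} [∀ x, AddCommGroup (fib x)] [∀ x, Module ℝ (fib x)]
    [TopologicalSpace (TotPt fib)] [∀ x, AddCommGroup (fib' x)] [∀ x, Module ℝ (fib' x)]
    [TopologicalSpace (TotPt fib')] {x : B} (c : FibChart fib x) {i : B → B'}
    (hi : IsOpenEmbedding i) (L : ∀ y, fib' y →ₗ[ℝ] c.E) {l : ∀ y, fib y ≃ₗ[ℝ] fib' (i y)}
    (hl : ∀ y v, L (i y) (l y v) = c.L y v)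
    (hj : IsOpenEmbedding fun v : TotPt fib => (⟨i v.pt, l v.pt v.vec⟩ : TotPt fib')) :
    FibChart fib' (i x) where
  E := c.E
  U := i '' c.U
  isOpen := hi.isOpenMap _ c.isOpen
  mem := ⟨x, c.mem, rfl⟩
  L := L
  bij := by
    rintro _ ⟨y, hy, rfl⟩
    have h1 : ⇑(L (i y)) = c.L y ∘ (l y).symm := by
      funext v
      rw [Function.comp_apply, ← hl, LinearEquiv.apply_symm_apply]
    rw [h1]
    exact (c.bij y hy).comp (l y).symm.bijective
  nhds_eq := by
    rintro ⟨_, w⟩ ⟨y, hy, rfl⟩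
    obtain ⟨v, rfl⟩ := (l y).surjective w
    have hm : Set.range (fun v : TotPt fib => (⟨i v.pt, l v.pt v.vec⟩ : TotPt fib')) ∈
        Filter.comap TotPt.pt (𝓝 (i y)) ⊓
          Filter.comap (fun v : TotPt fib' => L v.pt v.vec) (𝓝 (L (i y) (l y v))) := by
      refine Filter.mem_inf_of_left ⟨Set.range i, hi.isOpen_range.mem_nhds ⟨y, rfl⟩, ?_⟩
      rintro ⟨_, u⟩ ⟨z, rfl⟩
      exact ⟨⟨z, (l z).symm u⟩, congrArg (TotPt.mk (i z)) ((l z).apply_symm_apply u)⟩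
    have h2 := c.nhds_eq ⟨y, v⟩ hy
    rw [← Filter.map_comap_of_mem hm, Filter.comap_inf, Filter.comap_comap, Filter.comap_comap,
      ← hj.map_nhds_eq (⟨y, v⟩ : TotPt fib), h2, hl, hi.isEmbedding.nhds_eq_comap, Filter.comap_comap]
    congr 4
    funext u
    exact (hl u.pt u.vec).symm

namespace GBundle

variable (V : GBundle M) (W : GBundle N)

instance glueGrp (x : M ⊕ N) : AddCommGroup (Sum.elim V.fib W.fib x) := match x with
  | .inl m => V.grp m
  | .inr n => W.grp n

instance glueMod (x : M ⊕ N) : Module ℝ (Sum.elim V.fib W.fib x) := match x with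
  | .inl m => V.mod m
  | .inr n => W.mod n

/-- The total space over a disjoint union. -/
def glueEquiv : TotPt (Sum.elim V.fib W.fib) ≃ V.tot.sum W.tot where
  toFun v := match v with
    | ⟨.inl m, v⟩ => .inl ⟨m, v⟩
    | ⟨.inr n, w⟩ => .inr ⟨n, w⟩
  invFun := Sum.elim (fun v => ⟨.inl v.pt, v.vec⟩) fun w => ⟨.inr w.pt, w.vec⟩
  left_inv v := match v with
    | ⟨.inl _, _⟩ => rfl
    | ⟨.inr _, _⟩ => rfl
  right_inv v := match v with
    | .inl _ => rfl
    | .inr _ => rfl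

instance glueTop : TopologicalSpace (TotPt (Sum.elim V.fib W.fib)) :=
  .induced (V.glueEquiv W) inferInstance

/-- The total space over a disjoint union. -/
def glueHomeo : TotPt (Sum.elim V.fib W.fib) ≃ₜ V.tot.sum W.tot :=
  (V.glueEquiv W).toHomeomorphOfIsInducing ⟨rfl⟩

theorem glue_inl : IsOpenEmbedding fun v : TotPt V.fib =>
    (⟨.inl v.pt, v.vec⟩ : TotPt (Sum.elim V.fib W.fib)) :=
  (V.glueHomeo W).symm.isOpenEmbedding.comp .inl

theorem glue_inr : IsOpenEmbedding fun w : TotPt W.fib =>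
    (⟨.inr w.pt, w.vec⟩ : TotPt (Sum.elim V.fib W.fib)) :=
  (V.glueHomeo W).symm.isOpenEmbedding.comp .inr

/-- The action on the fibres over a disjoint union. -/
def glueAct (g : G.Arr) (x : M ⊕ N) : ∀ h : G.src g = (M.sum N).anchor x,
    Sum.elim V.fib W.fib x →ₗ[ℝ] Sum.elim V.fib W.fib ((M.sum N).act g x h) := match x with
  | .inl m => fun h => V.act g m h
  | .inr n => fun h => W.act g n h

theorem glueEquiv_act (g : G.Arr) (v : TotPt (Sum.elim V.fib W.fib))
    (h : G.src g = (M.sum N).anchor v.pt) (h' : G.src g = (V.tot.sum W.tot).anchor (V.glueEquiv W v)) :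
    V.glueEquiv W ⟨_, V.glueAct W g v.pt h v.vec⟩ = (V.tot.sum W.tot).act g (V.glueEquiv W v) h' :=
  match v with
  | ⟨.inl _, _⟩ => rfl
  | ⟨.inr _, _⟩ => rfl

theorem anchor_glueEquiv (v : TotPt (Sum.elim V.fib W.fib)) :
    (V.tot.sum W.tot).anchor (V.glueEquiv W v) = (M.sum N).anchor v.pt := match v with
  | ⟨.inl _, _⟩ => rfl
  | ⟨.inr _, _⟩ => rfl

/-- The bundle on a disjoint union with given restrictions. -/
def glue : GBundle (M.sum N) where
  fib := Sum.elim V.fib W.fib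
  t2 := (V.glueHomeo W).isEmbedding.t2Space
  para := by
    have := (V.tot.sum W.tot).para
    exact (V.glueHomeo W).isClosedEmbedding.paracompactSpace
  locTriv x := by
    have hp : Continuous (TotPt.pt : TotPt (Sum.elim V.fib W.fib) → M ⊕ N) := by
      have : Continuous (_root_.Sum.map (TotPt.pt : TotPt V.fib → M)
          (TotPt.pt : TotPt W.fib → N) ∘ V.glueHomeo W) :=
        (V.continuous_pt.sumMap W.continuous_pt).comp (V.glueHomeo W).continuous
      convert this using 1
      funext v
      rcases v with ⟨m | n, v⟩ <;> rfl
    rcases x with m | n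
    · exact ((V.fibChart m).map (i := _root_.Sum.inl) .inl (fun y => match y with
        | .inl y => (V.fibChart m).L y
        | .inr _ => 0) (l := fun _ => LinearEquiv.refl ℝ _) (fun _ _ => rfl)
        (V.glue_inl W)).exists_trivialization hp
    · exact ((W.fibChart n).map (i := _root_.Sum.inr) .inr (fun y => match y with
        | .inl _ => 0
        | .inr y => (W.fibChart n).L y) (l := fun _ => LinearEquiv.refl ℝ _) (fun _ _ => rfl)
        (V.glue_inr W)).exists_trivialization hp
  act := V.glueAct W
  one_act v := match v with
    | ⟨.inl m, v⟩ => congrArg (V.glueEquiv W).symm (congrArg Sum.inl (V.one_act ⟨m, v⟩))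
    | ⟨.inr n, w⟩ => congrArg (V.glueEquiv W).symm (congrArg Sum.inr (W.one_act ⟨n, w⟩))
  mul_act g h v := match v with
    | ⟨.inl m, v⟩ => fun e e' => congrArg (V.glueEquiv W).symm
        (congrArg Sum.inl (V.mul_act g h ⟨m, v⟩ e e'))
    | ⟨.inr n, w⟩ => fun e e' => congrArg (V.glueEquiv W).symm
        (congrArg Sum.inr (W.mul_act g h ⟨n, w⟩ e e'))
  continuous_act := by
    refine continuous_induced_rng.2 ?_
    have h1 : Continuous fun p : {p : G.Arr × TotPt (Sum.elim V.fib W.fib) //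
        G.src p.1 = (M.sum N).anchor p.2.pt} => (⟨(p.1.1, V.glueEquiv W p.1.2),
          p.2.trans (V.anchor_glueEquiv W p.1.2).symm⟩ :
          {p : G.Arr × V.tot.sum W.tot // G.src p.1 = (V.tot.sum W.tot).anchor p.2}) :=
      (((continuous_fst.comp continuous_subtype_val).prodMk ((V.glueHomeo W).continuous.comp
        (continuous_snd.comp continuous_subtype_val))).subtype_mk _)
    refine ((V.tot.sum W.tot).continuous_act.comp h1).congr fun p => ?_
    exact (V.glueEquiv_act W _ _ _ _).symm

/-- The inclusion of the first bundle. -/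
def glueInl : Map V (V.glue W) (M.inl N) :=
  .of (fun _ => LinearEquiv.refl ℝ _) ⟨_, (V.glue_inl W).continuous, fun _ => rfl, fun _ _ _ => rfl⟩
    fun _ => rfl

/-- The inclusion of the second bundle. -/
def glueInr : Map W (V.glue W) (M.inr N) :=
  .of (fun _ => LinearEquiv.refl ℝ _) ⟨_, (V.glue_inr W).continuous, fun _ => rfl, fun _ _ _ => rfl⟩
    fun _ => rfl

end GBundle

namespace IsDisjointUnion

variable {i₁ : GMap S₁ S} {i₂ : GMap S₂ S}

/-- Base change of a disjoint union. -/
theorem exists_base_change (h : IsDisjointUnion i₁ i₂) (f : GMap Y S) :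
    ∃ (Y₁ Y₂ : GSpace G) (k₁ : GMap Y₁ Y) (k₂ : GMap Y₂ Y) (f₁ : GMap Y₁ S₁) (f₂ : GMap Y₂ S₂),
      IsDisjointUnion k₁ k₂ ∧ (∀ y, i₁ (f₁ y) = f (k₁ y)) ∧ ∀ y, i₂ (f₂ y) = f (k₂ y) := by
  have hinv : ∀ {R : GSpace G} (j : GMap R S) g t h, t ∈ Set.range j → S.act g t h ∈ Set.range j := by
    rintro R j g t h ⟨n, rfl⟩
    exact ⟨R.act g n (h.trans (j.anchor_map n)), j.map_act _ _ _⟩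
  let A₁ : ClosedInv Y := .preimage f ⟨_, h.left.isClosed_range, hinv i₁⟩
  let A₂ : ClosedInv Y := .preimage f ⟨_, h.right.isClosed_range, hinv i₂⟩
  refine ⟨A₁.space, A₂.space, A₁.incl, A₂.incl,
    i₁.factor h.left.isEmbedding (f.comp A₁.incl) fun y => y.2,
    i₂.factor h.right.isEmbedding (f.comp A₂.incl) fun y => y.2,
    ⟨A₁.isClosed.isClosedEmbedding_subtypeVal, A₂.isClosed.isClosedEmbedding_subtypeVal, ?_⟩,
    i₁.apply_factor _ _ _, i₂.apply_factor _ _ _⟩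
  have e₁ : Set.range A₁.incl = f ⁻¹' Set.range i₁ := Subtype.range_val
  have e₂ : Set.range A₂.incl = f ⁻¹' Set.range i₂ := Subtype.range_val
  rw [e₁, e₂]
  exact ⟨h.compl.disjoint.preimage _, codisjoint_iff.2
    ((congrArg (f ⁻¹' ·) h.compl.sup_eq_top).trans Set.preimage_univ)⟩

/-- Orientations can be defined piecewise. -/
theorem exists_orientation (h : IsDisjointUnion i₁ i₂) {U : GBundle S} {V₁ : OBundle F S₁}
    {V₂ : OBundle F S₂} (α₁ : GBundle.Map V₁.toGBundle U i₁) (α₂ : GBundle.Map V₂.toGBundle U i₂) :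
    ∃ τ : F.Supp U.proj, U.IsThom τ ∧ (τ.HasLocalDegree fun v => (U.rank (U.proj v) : ℤ)) ∧
      V₁.τ = Supp.pull α₁.toGMap i₁ α₁.comm α₁.cart.proper τ ∧
      V₂.τ = Supp.pull α₂.toGMap i₂ α₂.comm α₂.cart.proper τ := by
  have h' : IsDisjointUnion α₁.toGMap α₂.toGMap := h.of_cart α₁.cart α₂.cart
  obtain ⟨τ, h₁, h₂⟩ := h'.exists_supp (p := U.proj) (p₁ := i₁.comp V₁.proj) (p₂ := i₂.comp V₂.proj)
    α₁.comm α₂.comm (Supp.over h.left (fun _ => rfl) V₁.τ) (Supp.over h.right (fun _ => rfl) V₂.τ)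
  have key : ∀ {R : GSpace G} {i : GMap R S} (hi : IsClosedEmbedding i) {V : OBundle F R}
      {α : GBundle.Map V.toGBundle U i} (hα : IsClosedEmbedding α.toGMap),
      Supp.restr (p' := i.comp V.proj) α.toGMap hα.isProperMap α.comm τ =
        Supp.over hi (fun _ => rfl) V.τ →
      V.τ = Supp.pull α.toGMap i α.comm α.cart.proper τ := by
    intro R i hi V α hα e
    have h3 := Supp.pull_over (F := F) hi (p := V.proj) (p' := i.comp V.proj) (fun _ => rfl)
      (c' := fun _ => rfl) (h := isProperMap_graph (GMap.id _) isProperMap_id fun _ => rfl) V.τ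
    rw [← h3, ← e]
    exact Supp.pull_pull (fun _ => rfl) _
  have e₁ := key h.left h'.left h₁
  have e₂ := key h.right h'.right h₂
  refine ⟨τ, ?_, ?_, e₁, e₂⟩
  · intro Y f U' φ B p
    obtain ⟨Y₁, Y₂, k₁, k₂, f₁, f₂, hk, c₁, c₂⟩ := h.exists_base_change f
    have hτ : ∀ {R Y₁ : GSpace G} {i : GMap R S} {V : OBundle F R} {α : GBundle.Map V.toGBundle U i}
        {k : GMap Y₁ Y} {f₁ : GMap Y₁ R} (_ : ∀ y, i (f₁ y) = f (k y))
        (_ : V.τ = Supp.pull α.toGMap i α.comm α.cart.proper τ),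
        (Supp.pull (U'.pullbackMap k).toGMap k (U'.pullbackMap k).comm (U'.pullbackMap k).cart.proper
          (Supp.pull φ.toGMap f φ.comm φ.cart.proper τ)).IsThomClass := by
      intro R Y₁ i V α k f₁ hf e
      let ψ : GBundle.Map (U'.pullback k) V.toGBundle f₁ := α.lift (φ.comp (U'.pullbackMap k)) f₁ hf
      have h3 := V.isThom.of_cart ψ.cart (comm := ψ.comm) (h := ψ.cart.proper)
      rw [e] at h3
      convert h3 using 1
      refine (Supp.pull_pull (χ := (φ.comp (U'.pullbackMap k)).toGMap) (k := f.comp k)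
        (comm'' := (φ.comp (U'.pullbackMap k)).comm)
        (hχ := (φ.comp (U'.pullbackMap k)).cart.proper) (fun _ => rfl) _).trans ?_
      exact (Supp.pull_pull (fun t => α.toGMap_lift _ f₁ hf t) _).symm
    exact (hk.of_cart (U'.pullbackMap k₁).cart (U'.pullbackMap k₂).cart).isThomClass hk
      (U'.pullbackMap k₁).cart (U'.pullbackMap k₂).cart (hτ c₁ e₁) (hτ c₂ e₂) B p
      (p.comp U'.proj) fun _ => rfl
  · have hr : ∀ {R : GSpace G} {i : GMap R S} {V : GBundle R} (α : GBundle.Map V U i) (v : V.tot),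
        (U.rank (U.proj (α.toGMap v)) : ℤ) = V.rank (V.proj v) := fun α v => by
      rw [← α.comm, α.rank_eq]
    refine h'.hasLocalDegree (p₁ := i₁.comp V₁.proj) (p₂ := i₂.comp V₂.proj) α₁.comm α₂.comm
      U.isRank_tot ?_ ?_
    · rw [h₁]
      exact (V₁.degree.over h.left _).congr (hr α₁)
    · rw [h₂]
      exact (V₂.degree.over h.right _).congr (hr α₂)

theorem supp_ext_of_cart (h : IsDisjointUnion i₁ i₂) {j₁ : GMap T₁ T} {j₂ : GMap T₂ T} {q : GMap T S}
    {q₁ : GMap T₁ S₁} {q₂ : GMap T₂ S₂} (c₁ : Cart q₁ j₁ i₁ q) (c₂ : Cart q₂ j₂ i₂ q) {x y : F.Supp q}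
    (h₁ : Supp.pull j₁ i₁ c₁.comm c₁.proper x = Supp.pull j₁ i₁ c₁.comm c₁.proper y)
    (h₂ : Supp.pull j₂ i₂ c₂.comm c₂.proper x = Supp.pull j₂ i₂ c₂.comm c₂.proper y) : x = y := by
  have h' := h.of_cart c₁ c₂
  have key : ∀ {T₁ S₁ : GSpace G} {j : GMap T₁ T} {i : GMap S₁ S} (hi : IsClosedEmbedding i)
      (hj : IsClosedEmbedding j) {q₁ : GMap T₁ S₁} (c : Cart q₁ j i q) (x : F.Supp q),
      Supp.restr j hj.isProperMap (p' := q.comp j) (fun _ => rfl) x =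
        Supp.over hi (fun t => (c.comm t).symm) (Supp.pull j i c.comm c.proper x) := by
    intro T₁ S₁ j i hi hj q₁ c x
    induction x using Supp.ind with | h C a => ?_
    rfl
  refine h'.supp_ext ?_ ?_
  · rw [key h.left h'.left c₁, key h.left h'.left c₁, h₁]
  · rw [key h.right h'.right c₂, key h.right h'.right c₂, h₂]

/-- Maps between bundles can be defined piecewise. -/
theorem exists_map (h : IsDisjointUnion i₁ i₂) {U : OBundle F S} {V₁ : OBundle F S₁}
    {V₂ : OBundle F S₂} (α₁ : OBundle.Map V₁ U i₁) (α₂ : OBundle.Map V₂ U i₂) {W : OBundle F T}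
    {g : GMap S T} {g₁ : GMap S₁ T} {g₂ : GMap S₂ T} (φ₁ : OBundle.Map V₁ W g₁)
    (φ₂ : OBundle.Map V₂ W g₂) (c₁ : ∀ s, g₁ s = g (i₁ s)) (c₂ : ∀ s, g₂ s = g (i₂ s)) :
    Nonempty (OBundle.Map U W g) := by
  have h' : IsDisjointUnion α₁.toGMap α₂.toGMap := h.of_cart α₁.cart α₂.cart
  obtain ⟨ψ, h₁, h₂⟩ := h'.exists_gmap φ₁.toGMap φ₂.toGMap
  have hL : ∀ s, ∃ L : U.fib s ≃ₗ[ℝ] W.fib (g s), ∀ w, ψ (⟨s, w⟩ : TotPt U.fib) =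
      (⟨g s, L w⟩ : TotPt W.fib) := by
    have key : ∀ {R : GSpace G} {i : GMap R S} {V : OBundle F R} (α : OBundle.Map V U i)
        {g' : GMap R T} (φ : OBundle.Map V W g') (_ : ∀ s, g' s = g (i s))
        (_ : ∀ v, ψ (α.toGMap v) = φ.toGMap v) (r : R), ∃ L : U.fib (i r) ≃ₗ[ℝ] W.fib (g (i r)),
        ∀ w, ψ (⟨i r, w⟩ : TotPt U.fib) = (⟨g (i r), L w⟩ : TotPt W.fib) := by
      intro R i V α g' φ c e r
      refine ⟨(α.lin r).symm.trans ((φ.lin r).trans (W.castEquiv (c r))), fun w => ?_⟩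
      have h3 := e (⟨r, (α.lin r).symm w⟩ : TotPt V.fib)
      rw [α.toGMap_eq, φ.toGMap_eq] at h3
      simp only [LinearEquiv.apply_symm_apply] at h3
      refine h3.trans (W.mk_castEquiv (c r) _).symm
    exact h.cases (key α₁ φ₁ c₁ h₁) (key α₂ φ₂ c₂ h₂)
  choose L hL using hL
  let Ψ : GBundle.Map U.toGBundle W.toGBundle g := .of L ψ fun v => hL v.pt v.vec
  refine ⟨⟨Ψ, h.supp_ext_of_cart α₁.cart α₂.cart ?_ ?_⟩⟩
  · exact α₁.map_τ.symm.trans (φ₁.map_τ.trans (Supp.pull_pull h₁ _).symm)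
  · exact α₂.map_τ.symm.trans (φ₂.map_τ.trans (Supp.pull_pull h₂ _).symm)

end IsDisjointUnion

namespace OBundle

variable (V : OBundle F M) (W : OBundle F N)

/-- The oriented bundle on a disjoint union with given restrictions. -/
noncomputable def glue : OBundle F (M.sum N) :=
  have h := (M.isDisjointUnion_sum N).exists_orientation (V.toGBundle.glueInl W.toGBundle)
    (V.toGBundle.glueInr W.toGBundle)
  ⟨V.toGBundle.glue W.toGBundle, h.choose, h.choose_spec.1, h.choose_spec.2.1⟩

/-- The inclusion of the first bundle. -/
noncomputable def glueInl : Map V (V.glue W) (M.inl N) :=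
  have h := (M.isDisjointUnion_sum N).exists_orientation (V.toGBundle.glueInl W.toGBundle)
    (V.toGBundle.glueInr W.toGBundle)
  ⟨V.toGBundle.glueInl W.toGBundle, h.choose_spec.2.2.1⟩

/-- The inclusion of the second bundle. -/
noncomputable def glueInr : Map W (V.glue W) (M.inr N) :=
  have h := (M.isDisjointUnion_sum N).exists_orientation (V.toGBundle.glueInl W.toGBundle)
    (V.toGBundle.glueInr W.toGBundle)
  ⟨V.toGBundle.glueInr W.toGBundle, h.choose_spec.2.2.2⟩

theorem isDisjointUnion_glue : IsDisjointUnion (V.glueInl W).toGMap (V.glueInr W).toGMap :=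
  (M.isDisjointUnion_sum N).of_cart (V.glueInl W).cart (V.glueInr W).cart

variable {V W}

theorem boundedRank_glue (hV : V.BoundedRank) (hW : W.BoundedRank) : (V.glue W).BoundedRank := by
  obtain ⟨m, hm⟩ := hV
  obtain ⟨n, hn⟩ := hW
  refine ⟨max m n, (M.isDisjointUnion_sum N).cases (fun x => ?_) fun x => ?_⟩
  · exact ((V.glueInl W).rank_eq x).symm.le.trans ((hm x).trans (le_max_left m n))
  · exact ((V.glueInr W).rank_eq x).symm.le.trans ((hn x).trans (le_max_right m n))

/-- Enlarging the trivial bundle containing a given bundle. -/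
theorem Complement.exists_add (k : V.Complement) (D : OBundle F (unitSpace G)) :
    ∃ K : OBundle F M, Nonempty (Map (V.add K) (k.triv.add D) M.anchorMap) :=
  let DX := D.pullback M.anchorMap
  ⟨k.compl.add DX, ⟨(((V.add k.compl).addSum DX).map (k.triv.addSum D) k.iso
    (D.pullbackMap M.anchorMap) fun _ => rfl).comp (assoc V k.compl DX).symm⟩⟩

/-- `A` is a direct summand in `(A ⊕ A) ⊕ (B ⊕ B)`. -/
noncomputable def doubleInl (A B : OBundle F X) :
    Map (A.add (A.add (B.add B))) ((A.add A).add (B.add B)) (GMap.id X) :=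
  (assoc A A (B.add B)).symm

/-- `B` is a direct summand in `(A ⊕ A) ⊕ (B ⊕ B)`. -/
noncomputable def doubleInr {A : OBundle F X} (hA : A.BoundedRank) (B : OBundle F X) :
    Map (B.add (B.add (A.add A))) ((A.add A).add (B.add B)) (GMap.id X) :=
  (swap (B.add B) (A.add A) A.even_rank_add_self (boundedRank_add hA hA)).comp (doubleInl B A)

theorem subtrivial_glue (hV : V.Subtrivial) (hW : W.Subtrivial) : (V.glue W).Subtrivial := by
  obtain ⟨k⟩ := hV
  obtain ⟨l⟩ := hW
  let A := k.triv
  let B := l.triv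
  obtain ⟨K, ⟨κ⟩⟩ := k.exists_add (A.add (B.add B))
  obtain ⟨L, ⟨l'⟩⟩ := l.exists_add (B.add (A.add A))
  obtain ⟨ψ⟩ := (M.isDisjointUnion_sum N).exists_map
    ((V.addSum K).map ((V.glue W).addSum (K.glue L)) (V.glueInl W) (K.glueInl L) fun _ => rfl)
    ((W.addSum L).map ((V.glue W).addSum (K.glue L)) (V.glueInr W) (K.glueInr L) fun _ => rfl)
    ((doubleInl A B).comp κ) ((doubleInr k.bounded B).comp l') (g := (M.sum N).anchorMap)
    (fun _ => rfl) (fun _ => rfl)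
  exact ⟨.of ψ (boundedRank_add (boundedRank_add k.bounded k.bounded)
    (boundedRank_add l.bounded l.bounded))⟩

end OBundle

/-- Normally non-singular maps with disjoint images can be combined. -/
theorem NNMap.exists_glue (f₁ : NNMap F M Y) (f₂ : NNMap F N Y) {E : OBundle F (unitSpace G)}
    (hE : E.BoundedRank) (β₁ : OBundle.Map f₁.E E (GMap.id _)) (β₂ : OBundle.Map f₂.E E (GMap.id _))
    (hd : ∀ v w, β₁.toGMap (f₁.toFib v) ≠ β₂.toGMap (f₂.toFib w)) :
    ∃ f : NNMap F (M.sum N) Y, f₁.IsoAlong f (M.inl N) id ∧ f₂.IsoAlong f (M.inr N) id := by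
  have h := f₁.V.isDisjointUnion_glue f₂.V
  obtain ⟨b, b₁, b₂⟩ := h.exists_gmap f₁.toBase f₂.toBase
  obtain ⟨c, c₁, c₂⟩ := h.exists_gmap (β₁.toGMap.comp f₁.toFib) (β₂.toGMap.comp f₂.toFib)
  have key : ∀ {R : GSpace G} (f : NNMap F R Y) (β : OBundle.Map f.E E (GMap.id _))
      {α : GMap f.V.tot (f₁.V.glue f₂.V).tot} (_ : ∀ v, b (α v) = f.toBase v)
      (_ : ∀ v, c (α v) = β.toGMap (f.toFib v)), IsOpenEmbedding fun v : f.V.tot =>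
      (⟨(b (α v), c (α v)), (b.anchor_map _).trans (c.anchor_map _).symm⟩ :
        {p : Y × E.tot // Y.anchor p.1 = E.tot.anchor p.2}) := by
    intro R f β α hb hc
    let e : {p : Y × f.E.tot // Y.anchor p.1 = f.E.tot.anchor p.2} ≃ₜ
        {p : Y × E.tot // Y.anchor p.1 = E.tot.anchor p.2} :=
      { toFun := fun p => ⟨(p.1.1, β.toGMap p.1.2), p.2.trans (β.toGMap.anchor_map _).symm⟩
        invFun := fun p => ⟨(p.1.1, β.symm.toGMap p.1.2), p.2.trans (β.symm.toGMap.anchor_map _).symm⟩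
        left_inv := fun p => Subtype.ext (Prod.ext rfl (β.symm_apply _))
        right_inv := fun p => Subtype.ext (Prod.ext rfl (β.apply_symm _))
        continuous_toFun := ((continuous_fst.comp continuous_subtype_val).prodMk
          (β.toGMap.continuous_toFun.comp (continuous_snd.comp continuous_subtype_val))).subtype_mk _
        continuous_invFun := ((continuous_fst.comp continuous_subtype_val).prodMk
          (β.symm.toGMap.continuous_toFun.comp
            (continuous_snd.comp continuous_subtype_val))).subtype_mk _ }
    convert e.isOpenEmbedding.comp f.isOpenEmbedding using 1
    funext v
    exact Subtype.ext (Prod.ext (hb v) (hc v))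
  refine ⟨⟨f₁.V.glue f₂.V, E, OBundle.subtrivial_glue f₁.subtrivial f₂.subtrivial,
    OBundle.boundedRank_glue f₁.boundedV f₂.boundedV, hE, b, c,
    h.isOpenEmbedding_of_pieces (key f₁ β₁ b₁ c₁) (key f₂ β₂ b₂ c₂) fun v w e => hd v w ?_⟩,
    ⟨f₁.V.glueInl f₂.V, β₁, fun v => ⟨(b₁ v).symm, (c₁ v).symm⟩⟩,
    f₁.V.glueInr f₂.V, β₂, fun v => ⟨(b₂ v).symm, (c₂ v).symm⟩⟩
  exact (c₁ v).symm.trans ((Prod.ext_iff.1 (Subtype.ext_iff.1 e)).2.trans (c₂ w))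

end

section

variable {G : TopGroupoid.{u}}

variable {F : CohTheory.{u, v} G} {X Y M N : GSpace G}

open CohTheory

theorem isOpenEmbedding_of_strictMono {B : Type*} [TopologicalSpace B] {H : B × ℝ → ℝ}
    (hc : Continuous H) (hm : ∀ b, StrictMono fun t => H (b, t)) :
    IsOpenEmbedding fun p : B × ℝ => (p.1, H p) := by
  refine .of_continuous_injective_isOpenMap (continuous_fst.prodMk hc) ?_
    (IsOpenMap.of_nhds_le ?_)
  · rintro ⟨b, t⟩ ⟨b', t'⟩ e
    obtain ⟨rfl, e'⟩ := Prod.ext_iff.1 e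
    exact Prod.ext rfl ((hm b).injective e')
  · rintro ⟨b, t⟩ O hO
    obtain ⟨O₁, h₁, O₂, h₂, hO⟩ := mem_nhds_prod_iff.1 hO
    obtain ⟨ε, hε, h₂⟩ := Metric.nhds_basis_closedBall.mem_iff.1 h₂
    have hl : ∀ᶠ q : B × ℝ in 𝓝 (b, H (b, t)), H (q.1, t - ε) < q.2 :=
      (isOpen_lt (hc.comp (continuous_fst.prodMk continuous_const)) continuous_snd).mem_nhds
        (hm b (sub_lt_self t hε))
    have hr : ∀ᶠ q : B × ℝ in 𝓝 (b, H (b, t)), q.2 < H (q.1, t + ε) :=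
      (isOpen_lt continuous_snd (hc.comp (continuous_fst.prodMk continuous_const))).mem_nhds
        (hm b (lt_add_of_pos_right t hε))
    have hb : ∀ᶠ q : B × ℝ in 𝓝 (b, H (b, t)), q.1 ∈ O₁ := continuous_fst.continuousAt h₁
    filter_upwards [hl, hr, hb] with q hl hr hb
    obtain ⟨s, hs, e⟩ := intermediate_value_Icc (by linarith : t - ε ≤ t + ε)
      (hc.comp (continuous_const.prodMk continuous_id) : Continuous fun s => H (q.1, s)).continuousOn
      ⟨hl.le, hr.le⟩
    have := hO (show ((q.1, s) : B × ℝ) ∈ O₁ ×ˢ O₂ from ⟨hb, h₂ (by rwa [Real.closedBall_eq_Icc])⟩)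
    rwa [Set.mem_preimage, show (q.1, H (q.1, s)) = q from Prod.ext rfl e] at this

/-- The coordinate on the trivial line bundle. -/
def OBundle.coord (hG : G.NumerablyProper) (v : (OBundle.line F hG).tot) : ℝ :=
  (GBundle.toLine _ v).2

/-- The coordinate of the trivial line bundle can be deformed along a strictly increasing
function. -/
theorem NNMap.exists_deform (hG : G.NumerablyProper) (f : NNMap F X Y) {σ : ℝ → ℝ}
    (hc : Continuous σ) (hm : StrictMono σ) : ∃ (f' : NNMap F X Y)
      (β : OBundle.Map f'.E (f.E.add (.line F hG)) (GMap.id _)), f'.Equivalent f ∧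
      ∀ v, ∃ t, OBundle.coord hG ((f.E.addSum (.line F hG)).snd (β.toGMap (f'.toFib v))) = σ t := by
  let L := OBundle.line F hG
  have hL : L.BoundedRank := ⟨1, fun z => (GBundle.rank_line _ z).le⟩
  let l := f.lift L hL
  let s := f.V.isSum L X.anchorMap
  have c := s.cart.comp (GBundle.cart_toLine (unitSpace G))
  have c' := GSpace.cart_line (X.anchorMap.comp f.V.proj)
  let κ : GMap l.V.tot f.V.tot.line := c'.lift s.fst ((GBundle.toLine _).comp s.snd) c.comm
  have hκ : IsHomeomorph κ := c.isHomeomorph c' (c'.fst_lift _ _ _) (c'.snd_lift _ _ _)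
  have κs : ∀ v, (κ v).2 = OBundle.coord hG (s.snd v) := fun v =>
    congrArg Prod.snd (c'.snd_lift s.fst ((GBundle.toLine _).comp s.snd) c.comm v)
  let H : ℝ × unitInterval → ℝ := fun p => (1 - (p.2 : ℝ)) * p.1 + p.2 * σ p.1
  have hH : Continuous H := by fun_prop
  have mH : ∀ r, StrictMono fun t => H (t, r) := by
    rintro ⟨r, h0, h1⟩ x y h
    have h2 := hm h
    change (1 - r) * x + r * σ x < (1 - r) * y + r * σ y
    rcases h0.eq_or_lt with rfl | h0
    · simpa using h
    · nlinarith
  let A₀ : GMap f.V.tot.line.prodI f.V.tot.line :=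
    ⟨fun p => (p.1.1, H (p.1.2, p.2)), by
      have : Continuous fun p : (f.V.tot × ℝ) × unitInterval => (p.1.1, H (p.1.2, p.2)) := by fun_prop
      exact this, fun _ => rfl, fun _ _ _ => rfl⟩
  let A : GMap l.V.tot.prodI l.V.tot :=
    ⟨fun p => κ.symm hκ (A₀ (κ p.1, p.2)), by
      have h1 : Continuous fun p : l.V.tot × unitInterval => ((κ p.1, p.2) : f.V.tot.line × unitInterval) :=
        (κ.continuous_toFun.comp continuous_fst).prodMk continuous_snd
      exact (κ.symm hκ).continuous_toFun.comp (A₀.continuous_toFun.comp h1),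
      fun p => ((κ.symm hκ).anchor_map _).trans ((A₀.anchor_map _).trans (κ.anchor_map p.1)),
      fun g p h => by
        have h1 : G.src g = f.V.tot.line.anchor (κ p.1) := h.trans (κ.anchor_map p.1).symm
        have h2 : A₀ (κ (l.V.tot.act g p.1 h), p.2) = f.V.tot.line.act g (A₀ (κ p.1, p.2)) h1 :=
          congrArg (fun x : f.V.tot.line => A₀ (x, p.2)) (κ.map_act g p.1 h)
        exact (congrArg (κ.symm hκ) h2).trans ((κ.symm hκ).map_act g (A₀ (κ p.1, p.2)) h1)⟩
  have κA : ∀ v r, κ (A (v, r)) = ((κ v).1, H ((κ v).2, r)) := fun v r => κ.apply_symm hκ _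
  let a : GMap l.V.tot l.V.tot := A.comp (l.V.tot.slice 1)
  have κi := (κ.isHomeomorph_symm hκ).isOpenEmbedding
  have ha : IsOpenEmbedding a :=
    κi.comp ((isOpenEmbedding_of_strictMono (H := fun p : f.V.tot × ℝ => H (p.2, 1)) (by fun_prop)
      fun _ => mH 1).comp hκ.isOpenEmbedding)
  have hA : IsOpenEmbedding fun p : l.V.tot × unitInterval => (A p, p.2) := by
    let e : (f.V.tot × ℝ) × unitInterval ≃ₜ (f.V.tot × unitInterval) × ℝ :=
      { toFun := fun p => ((p.1.1, p.2), p.1.2)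
        invFun := fun p => ((p.1.1, p.2), p.1.2)
        left_inv := fun _ => rfl
        right_inv := fun _ => rfl }
    exact (κi.prodMap .id).comp (e.symm.isOpenEmbedding.comp
      ((isOpenEmbedding_of_strictMono (H := fun p : (f.V.tot × unitInterval) × ℝ => H (p.2, p.1.2))
        (by fun_prop) fun b => mH b.2).comp
        (e.isOpenEmbedding.comp (hκ.isOpenEmbedding.prodMap .id))))
  have h0 : ∀ v, A (v, 0) = v := fun v => hκ.injective
    ((κA v 0).trans (Prod.ext rfl (by simp [H])))
  refine ⟨l.precomp l.V l.subtrivial l.boundedV a ha, .refl _,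
    .trans _ _ _ (.symm _ _ (.rel _ _ (.inr (.inl (l.isotopic_precomp A hA h0 ha fun _ => rfl)))))
      (.rel _ _ (.inr (.inr (f.isLifting_lift L hL)))), fun v => ⟨(κ v).2, ?_⟩⟩
  refine (congrArg (OBundle.coord hG) (f.snd_liftFib L (a v))).trans
    ((κs (a v)).symm.trans ((congrArg Prod.snd (κA v 1)).trans ?_))
  simp [H]

theorem Corr.IsSum.isValue {Ψ Ψ₁ Ψ₂ : Corr F (unitSpace G) Y} (h : IsSum Ψ Ψ₁ Ψ₂)
    {η₁ η₂ : F.Supp Y.anchorMap} (hη₁ : Ψ₁.IsValue η₁) (hη₂ : Ψ₂.IsValue η₂) :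
    Ψ.IsValue (η₁ + η₂) := by
  obtain ⟨i₁, i₂, h₁, h₂, b₁, b₂, hc, ⟨f₁, ⟨α₁, β₁, hf₁⟩, e₁⟩, ⟨f₂, ⟨α₂, β₂, hf₂⟩, e₂⟩, hξ₁, hξ₂⟩ := h
  have hi : IsDisjointUnion i₁ i₂ := ⟨h₁, h₂, hc⟩
  have hα : IsDisjointUnion α₁.toGMap α₂.toGMap := hi.of_cart α₁.cart α₂.cart
  let x := Supp.mul Ψ.f.V.proj (Ψ.b.comp Ψ.f.V.proj) (fun _ => rfl) Ψ.ξ Ψ.f.V.τ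
  have key : ∀ (Φ : Corr F (unitSpace G) Y) {i : GMap Φ.M Ψ.M} (hi : IsClosedEmbedding i)
      (_ : IsOpenEmbedding i) {bb : ∀ m, Φ.b m = Ψ.b (i m)} (α : OBundle.Map Φ.f.V Ψ.f.V i)
      (a : IsClosedEmbedding α.toGMap)
      (β : OBundle.Map Φ.f.E Ψ.f.E (GMap.id _)) (_ : ∀ v, Φ.f.toBase v = Ψ.f.toBase (α.toGMap v) ∧
        β.toGMap (Φ.f.toFib v) = Ψ.f.toFib (α.toGMap v))
      (_ : Φ.ξ = Supp.restr i hi.isProperMap bb Ψ.ξ)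
      {η : F.Supp Y.anchorMap} (_ : Φ.IsValue η), ∃ y : F.Supp (Ψ.b.comp Ψ.f.V.proj),
        Supp.IsExtension α.toGMap (Supp.restr α.toGMap a.isProperMap (fun t => GMap.toUnit_congr
          (Ψ.b.comp Ψ.f.V.proj) (Φ.b.comp Φ.f.V.proj) α.toGMap t) x) y ∧
        Supp.IsExtension Ψ.f.hat y (Supp.mul Ψ.f.EY.proj (Y.anchorMap.comp Ψ.f.EY.proj) (fun _ => rfl)
          η Ψ.f.EY.τ) := by
    intro Φ i hi ho bb α a β hf hξ η hη
    have hx : Supp.restr α.toGMap a.isProperMap (fun t => GMap.toUnit_congr _ _ α.toGMap t) x =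
        Supp.mul Φ.f.V.proj (Φ.b.comp Φ.f.V.proj) (fun _ => rfl) Φ.ξ Φ.f.V.τ := by
      rw [hξ]
      exact mul_τ_restr α a.isProperMap Ψ.ξ
    obtain ⟨y, hy⟩ := Supp.exists_isExtension (F := F) α.toGMap (α.cart.isOpenEmbedding ho)
      (p := Ψ.b.comp Ψ.f.V.proj) (fun t => GMap.toUnit_congr _ (Φ.b.comp Φ.f.V.proj) α.toGMap t)
      (Supp.mul Φ.f.V.proj (Φ.b.comp Φ.f.V.proj) (fun _ => rfl) Φ.ξ Φ.f.V.τ)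
    refine ⟨y, Eq.mpr (congrArg (Supp.IsExtension _ · y) hx) hy,
      hη.push Ψ.f (j := GMap.id Y) .id ho α β (fun v => (hf v).1.symm) (fun v => (hf v).2.symm) hy ?_⟩
    have := Supp.IsExtension.of_homeomorph (F := F) (p := Y.anchorMap) (p' := Y.anchorMap)
      (j := GMap.id Y) .id (fun _ => rfl) η
    rwa [Supp.restr, Supp.pull_eq_self (fun _ => rfl)] at this
  obtain ⟨y₁, k₁, l₁⟩ := key ⟨Ψ₁.M, Ψ₁.b, f₁, Ψ₁.ξ⟩ h₁ hi.isOpenEmbedding α₁ hα.left β₁ hf₁ hξ₁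
    ((isValue_iff_of_equivalent e₁ η₁).2 hη₁)
  obtain ⟨y₂, k₂, l₂⟩ := key ⟨Ψ₂.M, Ψ₂.b, f₂, Ψ₂.ξ⟩ h₂ hi.symm.isOpenEmbedding α₂ hα.right β₂ hf₂ hξ₂
    ((isValue_iff_of_equivalent e₂ η₂).2 hη₂)
  have := l₁.add Ψ.f.isOpenEmbedding_hat (fun t => GMap.toUnit_congr _ _ Ψ.f.hat t) l₂
  rwa [← Supp.eq_add_of_pieces hα.left hα.right hα.compl _ _ x y₁ y₂ k₁ k₂, ← Supp.add_mul] at this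

/-- Any two correspondences have a sum. -/
theorem Corr.exists_isSum (hG : G.NumerablyProper) (Ψ₁ Ψ₂ : Corr F X Y) :
    ∃ Ψ, IsSum Ψ Ψ₁ Ψ₂ := by
  let A := Ψ₁.f.E
  let B := Ψ₂.f.E
  let L := OBundle.line F hG
  have hL : L.BoundedRank := ⟨1, fun z => (GBundle.rank_line _ z).le⟩
  have hA : A.BoundedRank := Ψ₁.f.boundedE
  have hB : B.BoundedRank := Ψ₂.f.boundedE
  have hAA := OBundle.boundedRank_add hA hA
  have hBB := OBundle.boundedRank_add hB hB
  have key : ∀ {M : GSpace G} (f : NNMap F M Y) {D C : OBundle F (unitSpace G)} (_ : D.BoundedRank)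
      (γ : OBundle.Map (f.E.add D) C (GMap.id _)) {σ : ℝ → ℝ} (_ : Continuous σ) (_ : StrictMono σ),
      ∃ (f' : NNMap F M Y) (β : OBundle.Map f'.E (C.add L) (GMap.id _)), f'.Equivalent f ∧
        ∀ v, ∃ t, OBundle.coord hG ((C.addSum L).snd (β.toGMap (f'.toFib v))) = σ t := by
    intro M f D C hD γ σ hc hm
    obtain ⟨f', β, h, hσ⟩ := (f.lift D hD).exists_deform hG hc hm
    let γ' : OBundle.Map ((f.lift D hD).E.add L) (C.add L) (GMap.id _) := OBundle.addCongr γ (.refl L)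
    refine ⟨f', γ'.comp β, h.trans _ _ _ (.rel _ _ (.inr (.inr (f.isLifting_lift D hD)))), fun v => ?_⟩
    obtain ⟨t, ht⟩ := hσ v
    exact ⟨t, (congrArg (OBundle.coord hG) (OBundle.Sum.snd_map (((f.lift D hD).E).addSum L)
      (C.addSum L) γ (.refl L) (fun _ => rfl) _)).trans ht⟩
  obtain ⟨f₁, β₁, e₁, p₁⟩ := key Ψ₁.f (D := A.add (B.add B)) (OBundle.boundedRank_add hA hBB)
    (OBundle.doubleInl A B) Real.continuous_exp Real.exp_strictMono
  obtain ⟨f₂, β₂, e₂, p₂⟩ := key Ψ₂.f (D := B.add (A.add A)) (OBundle.boundedRank_add hB hAA)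
    (OBundle.doubleInr hA B) (σ := fun t => -Real.exp (-t)) (by fun_prop)
    fun x y h => neg_lt_neg (Real.exp_strictMono (neg_lt_neg h))
  obtain ⟨f, h₁, h₂⟩ := f₁.exists_glue f₂
    (OBundle.boundedRank_add (OBundle.boundedRank_add hAA hBB) hL) β₁ β₂ fun v w e => by
      obtain ⟨t, ht⟩ := p₁ v
      obtain ⟨s, hs⟩ := p₂ w
      rw [e, hs] at ht
      have := Real.exp_pos t
      have := Real.exp_pos (-s)
      linarith
  have h := Ψ₁.M.isDisjointUnion_sum Ψ₂.M
  obtain ⟨b, b₁, b₂⟩ := h.exists_gmap Ψ₁.b Ψ₂.b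
  obtain ⟨ξ, x₁, x₂⟩ := h.exists_supp (p := b) (fun m => (b₁ m).symm) (fun m => (b₂ m).symm) Ψ₁.ξ Ψ₂.ξ
  exact ⟨⟨_, b, f, ξ⟩, _, _, h.left, h.right, fun m => (b₁ m).symm, fun m => (b₂ m).symm, h.compl,
    ⟨f₁, h₁, e₁⟩, ⟨f₂, h₂, e₂⟩, x₁.symm, x₂.symm⟩

end

theorem mainTheorem4 (G : TopGroupoid.{u}) (hG : G.NumerablyProper) (F : CohTheory.{u, v} G) :
    ∃ (_ : ∀ Y : GSpace G, AddCommGroup (FHat F (unitSpace G) Y))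
      (Φ : ∀ Y : GSpace G, FHat F (unitSpace G) Y ≃+ F.Supp Y.anchorMap),
      -- the group structure is given by the sum of correspondences
      (∀ (Y : GSpace G) (Ψ₁ Ψ₂ : Corr F (unitSpace G) Y), ∃ Ψ, Corr.IsSum Ψ Ψ₁ Ψ₂) ∧
      (∀ (Y : GSpace G) (Ψ Ψ₁ Ψ₂ : Corr F (unitSpace G) Y), Corr.IsSum Ψ Ψ₁ Ψ₂ →
        Ψ.cls = Ψ₁.cls + Ψ₂.cls) ∧
      -- the isomorphism preserves the grading
      (∀ (Y : GSpace G) (a : FHat F (unitSpace G) Y) (n : ℤ),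
        (∃ Ψ : Corr F (unitSpace G) Y, Ψ.HasDegree n ∧ Ψ.cls = a) ↔ (Φ Y a).HasDegree n) ∧
      -- its inverse maps `η` to the class of the correspondence `(Y, ϱ, id, η)`
      (∀ (Y : GSpace G) (η : F.Supp Y.anchorMap),
        ∃ Ψ : Corr F (unitSpace G) Y, Ψ.IsCanonical η) ∧
      (∀ (Y : GSpace G) (η : F.Supp Y.anchorMap) (Ψ : Corr F (unitSpace G) Y),
        Ψ.IsCanonical η → Φ Y Ψ.cls = η) ∧
      -- it is natural for proper maps and for open embeddings
      (∀ (Y Y' : GSpace G) (h : GMap Y' Y) (hh : IsProperMap h) (Ψ : Corr F (unitSpace G) Y)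
        (Ψ' : Corr F (unitSpace G) Y'), Ψ'.IsPullback Ψ h →
        Φ Y' Ψ'.cls = CohTheory.Supp.restr h hh (fun y => (h.anchor_map y).symm) (Φ Y Ψ.cls)) ∧
      (∀ (Y Y' : GSpace G) (j : GMap Y Y') (_ : IsOpenEmbedding j) (Ψ : Corr F (unitSpace G) Y)
        (Ψ' : Corr F (unitSpace G) Y'), Ψ'.IsPushforward Ψ j →
        CohTheory.Supp.IsExtension j (Φ Y Ψ.cls) (Φ Y' Ψ'.cls)) := by
  let inst : ∀ Y : GSpace G, AddCommGroup (FHat F (unitSpace G) Y) := fun Y =>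
    (FHat.equiv F hG Y).addCommGroup
  refine ⟨inst, fun Y => (FHat.equiv F hG Y).addEquiv, fun Y Ψ₁ Ψ₂ => Corr.exists_isSum hG Ψ₁ Ψ₂,
    fun Y Ψ Ψ₁ Ψ₂ h => ?_, fun Y a n => ⟨?_, fun h => ?_⟩,
    fun Y η => ⟨_, Corr.isCanonical_canonical η⟩, fun Y η Ψ h => h.isValue.value_eq,
    fun Y Y' h hh Ψ Ψ' hp => (hp.isValue hh Ψ.isValue_value).value_eq,
    fun Y Y' j hj Ψ Ψ' hp => hp.isExtension hj Ψ.isValue_value Ψ'.isValue_value⟩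
  · refine (FHat.equiv F hG Y).addEquiv.injective ?_
    rw [map_add]
    exact (h.isValue Ψ₁.isValue_value Ψ₂.isValue_value).value_eq
  · rintro ⟨Ψ, hΨ, rfl⟩
    exact hΨ.isValue Ψ.isValue_value
  · exact ⟨Corr.canonical (FHat.equiv F hG Y a), Corr.hasDegree_canonical h,
      (FHat.equiv F hG Y).symm_apply_apply a⟩
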